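/- Let $n\ge 1$, $s\in(0,1)$, $\alpha\ge 1$ and $\phi(x)=|x|^{\alpha}$. Write $\mathbb R^{n+1}_+=\{x\in\mathbb R^{n+1}: x_{n+1}>0\}$ and $B_r^+=\{x\in\mathbb R^{n+1}_+:|x|\le r\}$, and let $H^1(\mathbb R^{n+1}_+,x_{n+1}^{1-2s})$ be the space of (complex-valued) functions $v$ with weak gradient $\nabla v$ and $\int_{\mathbb R^{n+1}_+}x_{n+1}^{1-2s}(|v|^2+|\nabla v|^2)\,dx<\infty$. For $R>1$ consider any $\tilde u\in H^{1}(\mathbb R^{n+1}_+,x_{n+1}^{1-2s})$ with $\operatorname{supp}(\tilde u)\subset B_R^+\setminus B_1^+$, any $f$ with $\int_{\mathbb R^{n+1}_+}x_{n+1}^{2s-1}|f|^2\,dx<\infty$ vanishing almost everywhere outside a bounded set, and any $V\in L^\infty(\mathbb R^n)$ such that $$\nabla\cdot x_{n+1}^{1-2s}\nabla\tilde u=f\ \text{ in }\mathbb R^{n+1}_+,\qquad \lim_{x_{n+1}\to0}x_{n+1}^{1-2s}\partial_{n+1}\tilde u=V\tilde u\ \text{ on }\mathbb R^n\times\{0\}$$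 in the weak sense: for all real $\eta\in C_c^\infty(\mathbb R^{n+1})$, $$\int_{\mathbb R^{n+1}_+}x_{n+1}^{1-2s}\nabla\eta\cdot\nabla\tilde u\,dx=-\int_{\mathbb R^{n+1}_+}\eta f\,dx-\int_{\mathbb R^n\times\{0\}}\eta V\tilde u\,dx',$$ where on $\mathbb R^n\times\{0\}$ the function $\tilde u$ is understood as its trace. For $\tau>0$ put $$\mathcal L_\tau(\tilde u)=\tau^{3}\big\|e^{\tau\phi}|x|^{\frac{3\alpha}{2}-1}x_{n+1}^{\frac{1-2s}{2}}\tilde u\big\|_{L^2(\mathbb R^{n+1}_+)}^2+\tau\big\|e^{\tau\phi}|x|^{\frac{\alpha}{2}}x_{n+1}^{\frac{1-2s}{2}}\nabla\tilde u\big\|_{L^2(\mathbb R^{n+1}_+)}^2 .$$ Then there is a constant $\tau_0=\tau_0(n,s,\alpha)>1$ such that the following two statements hold. (i) For every $R>1$ there is a constant $C=C(n,s,\alpha,R)>1$ such that for all such $\tilde u,f,V$ and all $\tau\ge\tau_0$ $$\mathcal L_\tau(\tilde u)\le C\Big(\big\|e^{\tau\phi}x_{n+1}^{\frac{2s-1}{2}}|x|f\big\|_{L^2(\mathbb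 R^{n+1}_+)}^2+\tau^{2-2s}\big\|e^{\tau\phi}V|x|^{(1-\alpha)s}\tilde u\big\|_{L^2(\mathbb R^n\times\{0\})}^2\Big).$$ (ii) There is a constant $C=C(n,s,\alpha)>1$, independent of $R$, such that for all $R>1$, all such $\tilde u,f,V$ and all $\tau\ge\tau_0$ $$\mathcal L_\tau(\tilde u)\le C\Big(\big\|e^{\tau\phi}x_{n+1}^{\frac{2s-1}{2}}|x|f\big\|_{L^2(\mathbb R^{n+1}_+)}^2+\tau^{2-2s}\big\|e^{\tau\phi}V|x|^{\alpha+(1-\alpha)s}\tilde u\big\|_{L^2(\mathbb R^n\times\{0\})}^2\Big).$$ -/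

import Mathlib

open MeasureTheory
open scoped ContDiff ENNReal

/-- The open upper half-space `ℝ^{n+1}_+ = {x ∈ ℝ^{n+1} : x_{n+1} > 0}`. -/
def upperHalf (n : ℕ) : Set (EuclideanSpace ℝ (Fin (n + 1))) :=
  {x | 0 < x (Fin.last n)}

/-- The embedding `x' ↦ (x', 0)` of `ℝⁿ` onto the boundary `ℝⁿ × {0}`. -/
def bdryPt {n : ℕ} (x' : EuclideanSpace ℝ (Fin n)) : EuclideanSpace ℝ (Fin (n + 1)) :=
  WithLp.toLp 2 (Fin.snoc (fun i => x' i) 0)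

/-- Lebesgue measure on the open upper half-space. -/
noncomputable def halfMeasure (n : ℕ) : Measure (EuclideanSpace ℝ (Fin (n + 1))) :=
  volume.restrict (upperHalf n)

/-- The classical `i`-th partial derivative of a (test) function. -/
noncomputable def pderiv {m : ℕ} (i : Fin m) (η : EuclideanSpace ℝ (Fin m) → ℝ)
    (x : EuclideanSpace ℝ (Fin m)) : ℝ :=
  fderiv ℝ η x (EuclideanSpace.single i 1)

/-- `G` is the weak (distributional) gradient of `u` in the open half-space. -/
def IsWeakGradient {n : ℕ} (u : EuclideanSpace ℝ (Fin (n + 1)) → ℂ)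
    (G : EuclideanSpace ℝ (Fin (n + 1)) → EuclideanSpace ℂ (Fin (n + 1))) : Prop :=
  ∀ η : EuclideanSpace ℝ (Fin (n + 1)) → ℝ, ContDiff ℝ ∞ η → HasCompactSupport η →
    tsupport η ⊆ upperHalf n → ∀ i : Fin (n + 1),
      ∫ x, pderiv i η x • u x ∂(halfMeasure n) = -∫ x, η x • G x i ∂(halfMeasure n)

/-- `u ∈ H¹(ℝ^{n+1}_+, x_{n+1}^{1-2s})` with weak gradient `G`. -/
structure IsWeightedH1 {n : ℕ} (s : ℝ) (u : EuclideanSpace ℝ (Fin (n + 1)) → ℂ)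
    (G : EuclideanSpace ℝ (Fin (n + 1)) → EuclideanSpace ℂ (Fin (n + 1))) : Prop where
  memLp : MemLp (fun x => (x (Fin.last n)) ^ ((1 - 2 * s) / 2) • u x) 2 (halfMeasure n)
  memLp_grad : MemLp (fun x => (x (Fin.last n)) ^ ((1 - 2 * s) / 2) • G x) 2 (halfMeasure n)
  weakGradient : IsWeakGradient u G

/-- `g` is the trace on `ℝⁿ × {0}` of the function `u` with weak gradient `G`: the Gauss-Green
formula in the direction `e_{n+1}` holds against all smooth functions with compact support in
`ℝ^{n+1}` (these need not vanish on the boundary). This determines `g` almost everywhere. -/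
structure IsTrace {n : ℕ} (u : EuclideanSpace ℝ (Fin (n + 1)) → ℂ)
    (G : EuclideanSpace ℝ (Fin (n + 1)) → EuclideanSpace ℂ (Fin (n + 1)))
    (g : EuclideanSpace ℝ (Fin n) → ℂ) : Prop where
  locallyIntegrable : LocallyIntegrable g volume
  green : ∀ η : EuclideanSpace ℝ (Fin (n + 1)) → ℝ, ContDiff ℝ ∞ η → HasCompactSupport η →
    ∫ x, (η x • G x (Fin.last n) + pderiv (Fin.last n) η x • u x) ∂(halfMeasure n)
      = -∫ x', η (bdryPt x') • g x'

/-- Weak (energy) form of the Neumann-type problem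
`∇ · x_{n+1}^{1-2s} ∇u = f` in `ℝ^{n+1}_+`,
`lim_{x_{n+1} → 0} x_{n+1}^{1-2s} ∂_{n+1} u = h` on `ℝⁿ × {0}`,
for a function with weak gradient `G`. -/
def IsWeakNeumannSolution {n : ℕ} (s : ℝ)
    (G : EuclideanSpace ℝ (Fin (n + 1)) → EuclideanSpace ℂ (Fin (n + 1)))
    (f : EuclideanSpace ℝ (Fin (n + 1)) → ℂ) (h : EuclideanSpace ℝ (Fin n) → ℂ) : Prop :=
  ∀ η : EuclideanSpace ℝ (Fin (n + 1)) → ℝ, ContDiff ℝ ∞ η → HasCompactSupport η →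
    ∫ x, (x (Fin.last n)) ^ (1 - 2 * s) • ∑ i, pderiv i η x • G x i ∂(halfMeasure n)
      = -(∫ x, η x • f x ∂(halfMeasure n)) - ∫ x', η (bdryPt x') • h x'

/-- The data to which the Carleman estimate applies: `u ∈ H¹(ℝ^{n+1}_+, x_{n+1}^{1-2s})` with weak
gradient `G`, trace `g` and support in `B_R^+ \ B_1^+`, which solves the extension problem with
right-hand side `f ∈ L²(ℝ^{n+1}_+, x_{n+1}^{2s-1})` of bounded support and boundary flux `V g`,
`V ∈ L^∞(ℝⁿ)`. -/
structure IsAnnularSolution {n : ℕ} (s R : ℝ) (u : EuclideanSpace ℝ (Fin (n + 1)) → ℂ)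
    (G : EuclideanSpace ℝ (Fin (n + 1)) → EuclideanSpace ℂ (Fin (n + 1)))
    (g : EuclideanSpace ℝ (Fin n) → ℂ) (f : EuclideanSpace ℝ (Fin (n + 1)) → ℂ)
    (V : EuclideanSpace ℝ (Fin n) → ℂ) : Prop where
  weightedH1 : IsWeightedH1 s u G
  trace : IsTrace u G g
  support : ∀ᵐ x ∂(halfMeasure n), u x ≠ 0 → 1 < ‖x‖ ∧ ‖x‖ ≤ R
  rhs_memLp : MemLp (fun x => (x (Fin.last n)) ^ ((2 * s - 1) / 2) • f x) 2 (halfMeasure n)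
  rhs_support : ∃ ρ : ℝ, ∀ᵐ x ∂(halfMeasure n), f x ≠ 0 → ‖x‖ ≤ ρ
  potential : MemLp V ∞ volume
  equation : IsWeakNeumannSolution s G f (fun x' => V x' * g x')

/-- `τ³ ‖e^{τ|x|^α} |x|^{3α/2-1} x_{n+1}^{(1-2s)/2} u‖² + τ ‖e^{τ|x|^α} |x|^{α/2} x_{n+1}^{(1-2s)/2} ∇u‖²`
with norms in `L²(ℝ^{n+1}_+)`. -/
noncomputable def carlemanLHS {n : ℕ} (s α τ : ℝ) (u : EuclideanSpace ℝ (Fin (n + 1)) → ℂ)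
    (G : EuclideanSpace ℝ (Fin (n + 1)) → EuclideanSpace ℂ (Fin (n + 1))) : ℝ≥0∞ :=
  ENNReal.ofReal (τ ^ 3) *
      eLpNorm (fun x => (Real.exp (τ * ‖x‖ ^ α) * ‖x‖ ^ (3 * α / 2 - 1)
        * (x (Fin.last n)) ^ ((1 - 2 * s) / 2)) • u x) 2 (halfMeasure n) ^ 2
    + ENNReal.ofReal τ *
      eLpNorm (fun x => (Real.exp (τ * ‖x‖ ^ α) * ‖x‖ ^ (α / 2)
        * (x (Fin.last n)) ^ ((1 - 2 * s) / 2)) • G x) 2 (halfMeasure n) ^ 2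

/-- `‖e^{τ|x|^α} x_{n+1}^{(2s-1)/2} |x| f‖²` with the norm in `L²(ℝ^{n+1}_+)`. -/
noncomputable def carlemanBulk {n : ℕ} (s α τ : ℝ)
    (f : EuclideanSpace ℝ (Fin (n + 1)) → ℂ) : ℝ≥0∞ :=
  eLpNorm (fun x => (Real.exp (τ * ‖x‖ ^ α) * (x (Fin.last n)) ^ ((2 * s - 1) / 2) * ‖x‖) • f x)
    2 (halfMeasure n) ^ 2

/-- `τ^{2-2s} ‖e^{τ|x|^α} V |x|^κ g‖²` with the norm in `L²(ℝⁿ)`. -/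
noncomputable def carlemanBdry {n : ℕ} (s α τ κ : ℝ)
    (V g : EuclideanSpace ℝ (Fin n) → ℂ) : ℝ≥0∞ :=
  ENNReal.ofReal (τ ^ (2 - 2 * s)) *
    eLpNorm (fun x' => (Real.exp (τ * ‖x'‖ ^ α) * ‖x'‖ ^ κ) • (V x' * g x')) 2 volume ^ 2

/-! Put a = 1 - 2s and t = log |x|. The measure |x|^{-(n+1+a)} x_{n+1}^a dx on the half-space is
invariant under dilations, the radial derivative x·∇ is their generator and plays the role of ∂_t,
and the scale invariant gradient |x|∇ commutes with them. In these terms the problem is translation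
invariant in t, and no polar coordinates are needed. With c = (n-1+a)/2 the function v = e^{τ|x|^α}
|x|^c u solves a weak equation whose skew-symmetric part is exactly 2τα e^{αt} ∂_t + τα² e^{αt}
(`conjugated_equation`).

Zero flux (`SupportedInShell.carleman`). The equation is paired with its own skew part. The Rellich
identity has multiplier e^{αt} ∂_t v, the energy identity has multiplier e^{αt} v; taken with the
factors 2τα and τα² they lose the Dirichlet energy and leave 2α⁴τ³ ∫ e^{3αt} v², positive by
convexity of e^{αt}, together with the square of the skew part, which absorbs the product with the
right-hand side. What remains is of lower order once τ ≥ e^α. The gradient term is then read off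
from the energy identity. A weak solution has no second derivatives to spare, so ∂_t v is not an
admissible test function; symmetric difference quotients along dilations replace it. After a change
of variables the quotient falls on the radial multiplier alone, and the limit exists
(`InEnergySpace.tendsto_integral_grad_quotient`, `InEnergySpace.rellich_identity`).

General flux (`flux_carleman`). The Riesz theorem gives a function p with flux -α e^{αt} b for an
elliptic problem with zeroth order coefficient λ², λ = 1 + τ|x|^α. The weighted `trace_inequality`
bounds its energy, and the weight λ^{1-a} there produces the gain τ^{-(1-a)} = τ^{-2s}. If ψ equals
1/(α e^{αt}) on the shell, then w = ψp carries the same boundary term as v, so v - w falls under the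
first case. Putting e^{αt} into the flux and taking it out again through ψ makes the remainder at
most a constant times τ(λ|p| + |x||∇p|), uniformly in the length of the shell. This is why the
constant of (ii) does not see R.

To reach this setting one needs that a function of the weighted Sobolev space supported in an
annulus is a limit of test functions which avoid the origin but not the boundary
(`inEnergySpace_of_weakGradient`). Averaging over small balls lying above the point avoids any
extension across the boundary, and is bounded in L²(x_{n+1}^a) because the weight is almost
invariant under it (`exists_lintegral_shiftKernel_le`). The boundary product Vu enters only as a
datum, so real and imaginary parts can be treated separately. Finally (i) follows from (ii), since
|x|^α ≤ R^α on the support. -/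

open Filter Topology in
/-- Convergence in `L²(μ)` of functions along a filter. -/
def L2Tendsto {X ι F : Type*} [MeasurableSpace X] [NormedAddCommGroup F] (μ : Measure X)
    (l : Filter ι) (f : ι → X → F) (g : X → F) : Prop :=
  Tendsto (fun i => eLpNorm (fun x => f i x - g x) 2 μ) l (𝓝 0)

/-! ### Strong L² convergence of functions -/

section L2

open Filter Topology

variable {X ι F F' F'' : Type*} [MeasurableSpace X] {μ : Measure X} {l : Filter ι}
  [NormedAddCommGroup F] [NormedAddCommGroup F'] [NormedAddCommGroup F'']

theorem L2Tendsto.of_norm_le {f : ι → X → F} {g : X → F} {f' : ι → X → F'} {g' : X → F'}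
    (h : L2Tendsto μ l f g) (C : ℝ)
    (hC : ∀ᶠ i in l, ∀ᵐ x ∂μ, ‖f' i x - g' x‖ ≤ C * ‖f i x - g x‖) : L2Tendsto μ l f' g' := by
  have h1 : Tendsto (fun i => ENNReal.ofReal C * eLpNorm (fun x => f i x - g x) 2 μ) l (𝓝 0) := by
    simpa using ENNReal.Tendsto.const_mul h (Or.inr ENNReal.ofReal_ne_top)
  refine tendsto_of_tendsto_of_tendsto_of_le_of_le' tendsto_const_nhds h1
    (Eventually.of_forall fun _ => zero_le) ?_
  filter_upwards [hC] with i hi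
  exact eLpNorm_le_mul_eLpNorm_of_ae_le_mul hi 2

/-- Serves product rules, where the error of a gradient is dominated by the errors of a function and
of its gradient together. -/
theorem L2Tendsto.of_norm_le_add {f : ι → X → F} {g : X → F} {f₂ : ι → X → F'} {g₂ : X → F'}
    {f' : ι → X → F''} {g' : X → F''} (h : L2Tendsto μ l f g) (h₂ : L2Tendsto μ l f₂ g₂)
    (hm : ∀ i, AEStronglyMeasurable (fun x => f i x - g x) μ)
    (hm₂ : ∀ i, AEStronglyMeasurable (fun x => f₂ i x - g₂ x) μ) (C : ℝ)
    (hC : ∀ᶠ i in l, ∀ᵐ x ∂μ, ‖f' i x - g' x‖ ≤ C * (‖f i x - g x‖ + ‖f₂ i x - g₂ x‖)) :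
    L2Tendsto μ l f' g' := by
  have hs : L2Tendsto μ l (fun i x => ‖f i x - g x‖ + ‖f₂ i x - g₂ x‖) (fun _ => (0 : ℝ)) := by
    have h1 := h.add h₂
    rw [add_zero] at h1
    refine tendsto_of_tendsto_of_tendsto_of_le_of_le tendsto_const_nhds h1
      (fun _ => zero_le) fun i => ?_
    simp only [sub_zero]
    calc _ ≤ eLpNorm (fun x => ‖f i x - g x‖) 2 μ + eLpNorm (fun x => ‖f₂ i x - g₂ x‖) 2 μ :=
          eLpNorm_add_le (hm i).norm (hm₂ i).norm (by norm_num)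
      _ = _ := by rw [eLpNorm_norm, eLpNorm_norm]
  refine hs.of_norm_le C ?_
  filter_upwards [hC] with i hi
  filter_upwards [hi] with x hx
  rw [sub_zero, Real.norm_of_nonneg (by positivity)]
  exact hx

theorem L2Tendsto.add {f f₂ : ι → X → F} {g g₂ : X → F}
    (h : L2Tendsto μ l f g) (h₂ : L2Tendsto μ l f₂ g₂)
    (hm : ∀ i, AEStronglyMeasurable (fun x => f i x - g x) μ)
    (hm₂ : ∀ i, AEStronglyMeasurable (fun x => f₂ i x - g₂ x) μ) :
    L2Tendsto μ l (fun i x => f i x + f₂ i x) (fun x => g x + g₂ x) := by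
  refine h.of_norm_le_add h₂ hm hm₂ 1 (Eventually.of_forall fun i => Eventually.of_forall fun x => ?_)
  rw [one_mul, add_sub_add_comm]
  exact norm_add_le _ _

variable {H : Type*} [NormedAddCommGroup H] [InnerProductSpace ℝ H]

theorem L2Tendsto.toLp {f : ι → X → F} {g : X → F} (h : L2Tendsto μ l f g)
    (hf : ∀ i, MemLp (f i) 2 μ) (hg : MemLp g 2 μ) :
    Tendsto (fun i => (hf i).toLp (f i)) l (𝓝 (hg.toLp g)) :=
  (Lp.tendsto_Lp_iff_tendsto_eLpNorm'' _ hf _ hg).2 h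

theorem integral_inner_toLp {f g : X → H} (hf : MemLp f 2 μ) (hg : MemLp g 2 μ) :
    inner ℝ (hf.toLp f) (hg.toLp g) = ∫ x, inner ℝ (f x) (g x) ∂μ := by
  rw [L2.inner_def]
  apply integral_congr_ae
  filter_upwards [hf.coeFn_toLp, hg.coeFn_toLp] with x hx hy
  rw [hx, hy]

theorem L2Tendsto.integral_inner {f f₂ : ι → X → H} {g g₂ : X → H}
    (h : L2Tendsto μ l f g) (h₂ : L2Tendsto μ l f₂ g₂)
    (hf : ∀ i, MemLp (f i) 2 μ) (hg : MemLp g 2 μ)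
    (hf₂ : ∀ i, MemLp (f₂ i) 2 μ) (hg₂ : MemLp g₂ 2 μ) :
    Tendsto (fun i => ∫ x, inner ℝ (f i x) (f₂ i x) ∂μ) l (𝓝 (∫ x, inner ℝ (g x) (g₂ x) ∂μ)) := by
  have := (h.toLp hf hg).inner (𝕜 := ℝ) (h₂.toLp hf₂ hg₂)
  simpa only [integral_inner_toLp] using this

theorem L2Tendsto.integral_mul {f f₂ : ι → X → ℝ} {g g₂ : X → ℝ}
    (h : L2Tendsto μ l f g) (h₂ : L2Tendsto μ l f₂ g₂)
    (hf : ∀ i, MemLp (f i) 2 μ) (hg : MemLp g 2 μ)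
    (hf₂ : ∀ i, MemLp (f₂ i) 2 μ) (hg₂ : MemLp g₂ 2 μ) :
    Tendsto (fun i => ∫ x, f i x * f₂ i x ∂μ) l (𝓝 (∫ x, g x * g₂ x ∂μ)) := by
  have := h₂.integral_inner h hf₂ hg₂ hf hg
  simpa using this

theorem L2Tendsto.const (g : X → F) : L2Tendsto μ l (fun _ => g) g := by
  simpa [L2Tendsto] using tendsto_const_nhds

theorem MemLp.integrable_inner_real {f g : X → H} (hf : MemLp f 2 μ) (hg : MemLp g 2 μ) :
    Integrable (fun x => inner ℝ (f x) (g x)) μ := by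
  have := L2.integrable_inner (𝕜 := ℝ) (hf.toLp f) (hg.toLp g)
  refine this.congr ?_
  filter_upwards [hf.coeFn_toLp, hg.coeFn_toLp] with x hx hy
  rw [hx, hy]

theorem MemLp.integrable_mul_real {f g : X → ℝ} (hf : MemLp f 2 μ) (hg : MemLp g 2 μ) :
    Integrable (fun x => f x * g x) μ := by
  simpa using MemLp.integrable_inner_real hg hf

theorem L2Tendsto.of_tendsto_sq_integral {f : ι → X → F} {g : X → F}
    (hm : ∀ i, MemLp (fun x => f i x - g x) 2 μ)
    (h : Tendsto (fun i => ∫ x, ‖f i x - g x‖ ^ 2 ∂μ) l (𝓝 0)) : L2Tendsto μ l f g := by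
  have h1 : ∀ i, eLpNorm (fun x => f i x - g x) 2 μ
      = ENNReal.ofReal ((∫ x, ‖f i x - g x‖ ^ 2 ∂μ) ^ (2⁻¹ : ℝ)) := by
    intro i
    rw [(hm i).eLpNorm_eq_integral_rpow_norm (by norm_num) (by norm_num)]
    simp
  have h2 : Tendsto (fun i => ENNReal.ofReal ((∫ x, ‖f i x - g x‖ ^ 2 ∂μ) ^ (2⁻¹ : ℝ))) l
      (𝓝 (ENNReal.ofReal ((0 : ℝ) ^ (2⁻¹ : ℝ)))) :=
    ENNReal.tendsto_ofReal (h.rpow_const (Or.inr (by norm_num)))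
  rw [Real.zero_rpow (by norm_num), ENNReal.ofReal_zero] at h2
  unfold L2Tendsto
  simpa only [h1] using h2

/-- Two-parameter approximation: if `f' i j` approximates `f i` uniformly well in terms of the
distance of `p j` to `p₀`, and each `f' · j` converges to `g' j`, then `f` converges. -/
theorem L2Tendsto.of_approx {f : ι → X → F} {g : X → F} {f' : ℕ → ι → X → F} {g' : ℕ → X → F}
    (hf : ∀ j, L2Tendsto μ l (f' j) (g' j)) (ε : ℕ → ℝ≥0∞) (hε : Tendsto ε atTop (𝓝 0))
    (h₁ : ∀ j, ∀ᶠ i in l, eLpNorm (fun x => f i x - f' j i x) 2 μ ≤ ε j)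
    (h₂ : ∀ j, eLpNorm (fun x => g' j x - g x) 2 μ ≤ ε j)
    (hm₁ : ∀ i j, AEStronglyMeasurable (fun x => f i x - f' j i x) μ)
    (hm₂ : ∀ i j, AEStronglyMeasurable (fun x => f' j i x - g' j x) μ)
    (hm₃ : ∀ j, AEStronglyMeasurable (fun x => g' j x - g x) μ) : L2Tendsto μ l f g := by
  rw [L2Tendsto, ENNReal.tendsto_nhds_zero]
  intro δ hδ
  have hδ3 : 0 < δ / 3 := ENNReal.div_pos hδ.ne' (by norm_num)
  obtain ⟨j, hj⟩ := ((ENNReal.tendsto_nhds_zero.1 hε) (δ / 3) hδ3).exists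
  filter_upwards [(ENNReal.tendsto_nhds_zero.1 (hf j)) (δ / 3) hδ3, h₁ j] with i hi hij
  calc eLpNorm (fun x => f i x - g x) 2 μ
      = eLpNorm ((fun x => f i x - f' j i x) + ((fun x => f' j i x - g' j x)
          + fun x => g' j x - g x)) 2 μ := by
        congr 1; ext x; simp
    _ ≤ δ / 3 + (δ / 3 + δ / 3) := by
        refine (eLpNorm_add_le (hm₁ i j) ((hm₂ i j).add (hm₃ j)) (by norm_num)).trans ?_
        refine add_le_add (hij.trans hj) ?_
        exact (eLpNorm_add_le (hm₂ i j) (hm₃ j) (by norm_num)).trans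
          (add_le_add hi ((h₂ j).trans hj))
    _ = δ := by rw [← add_assoc]; exact ENNReal.add_thirds δ

end L2

/-! ### Riesz representation inside the closure of a range -/

section Riesz

variable {T H : Type*} [AddCommGroup T] [Module ℝ T] [NormedAddCommGroup H]
  [InnerProductSpace ℝ H] [CompleteSpace H]

/-- Riesz representation on the closure of the range of a linear map, for a functional that is
bounded in terms of that map. -/
theorem exists_mem_closure_range_inner_eq (J : T →ₗ[ℝ] H) (ℓ : T →ₗ[ℝ] ℝ) (M : ℝ) (hM : 0 ≤ M)
    (h : ∀ η, |ℓ η| ≤ M * ‖J η‖) :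
    ∃ p ∈ closure (Set.range J), ‖p‖ ≤ M ∧ ∀ η, inner ℝ p (J η) = ℓ η := by
  obtain ⟨r, hr⟩ := J.rangeRestrict.exists_rightInverse_of_surjective J.range_rangeRestrict
  have hJr : ∀ z : LinearMap.range J, J (r z) = z := fun z =>
    congrArg Subtype.val (LinearMap.congr_fun hr z)
  -- The bound forces ℓ to vanish on the kernel of J, so ℓ ∘ r does not depend on the chosen section
  -- r.
  have hℓ : ∀ η, ℓ (r (J.rangeRestrict η)) = ℓ η := by
    intro η
    have h1 := h (r (J.rangeRestrict η) - η)
    rw [map_sub, map_sub, hJr] at h1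
    simp only [LinearMap.codRestrict_apply, LinearMap.rangeRestrict, sub_self, norm_zero,
      mul_zero] at h1
    exact sub_eq_zero.1 (abs_eq_zero.1 (le_antisymm h1 (abs_nonneg _)))
  let f₀ : StrongDual ℝ (LinearMap.range J) :=
    LinearMap.mkContinuous (ℓ.comp r) M fun z => by
      have := h (r z)
      rw [hJr] at this
      exact this
  obtain ⟨g, hg, hgn⟩ := exists_extension_norm_eq (LinearMap.range J) f₀
  set q := (InnerProductSpace.toDual ℝ H).symm g with hq
  -- Projecting the representing vector onto the closure of the range keeps its pairings with every
  -- J η. It also makes the solution a limit of elements J η, hence later a member of the energy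
  -- space.
  set K := (LinearMap.range J).topologicalClosure
  have hKc : IsClosed (K : Set H) := Submodule.isClosed_topologicalClosure _
  have : CompleteSpace K := hKc.completeSpace_coe
  refine ⟨K.orthogonalProjectionOnto q, ?_, ?_, fun η => ?_⟩
  · have := (K.orthogonalProjectionOnto q).2
    rwa [← SetLike.mem_coe, Submodule.topologicalClosure_coe, LinearMap.coe_range] at this
  · refine (K.norm_orthogonalProjectionOnto_apply_le q).trans ?_
    rw [hq, LinearIsometryEquiv.norm_map, hgn]
    exact LinearMap.mkContinuous_norm_le _ hM _
  · have hmem : J η ∈ K := Submodule.le_topologicalClosure _ (LinearMap.mem_range_self J η)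
    have h1 := K.inner_orthogonalProjectionOnto_eq_of_mem_left ⟨J η, hmem⟩ q
    rw [real_inner_comm]
    have h2 : inner ℝ (J η) ((K.orthogonalProjectionOnto q : K) : H) = inner ℝ (J η) q := h1
    rw [h2, real_inner_comm, hq, InnerProductSpace.toDual_symm_apply]
    have h3 := hg (J.rangeRestrict η)
    have h4 : f₀ (J.rangeRestrict η) = ℓ (r (J.rangeRestrict η)) := rfl
    rw [h4, hℓ] at h3
    exact h3

end Riesz

/-- The ambient space `ℝ^{n+1}`. -/
abbrev Eu (n : ℕ) : Type := EuclideanSpace ℝ (Fin (n + 1))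

/-! ### Splitting off the last coordinate -/

section Coordinates

/-- `(x', y) ↦ x' + y e_{n+1}`. -/
def joinLast {n : ℕ} (p : EuclideanSpace ℝ (Fin n) × ℝ) : Eu n :=
  WithLp.toLp 2 (Fin.snoc (fun i => p.1 i) p.2)

variable {n : ℕ}

@[simp] theorem joinLast_last (p : EuclideanSpace ℝ (Fin n) × ℝ) :
    joinLast p (Fin.last n) = p.2 := by simp [joinLast]

@[simp] theorem joinLast_castSucc (p : EuclideanSpace ℝ (Fin n) × ℝ) (i : Fin n) :
    joinLast p i.castSucc = p.1 i := by simp [joinLast]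

theorem bdryPt_eq_joinLast (x' : EuclideanSpace ℝ (Fin n)) : bdryPt x' = joinLast (x', 0) := rfl

theorem norm_joinLast_sq (p : EuclideanSpace ℝ (Fin n) × ℝ) :
    ‖joinLast p‖ ^ 2 = ‖p.1‖ ^ 2 + p.2 ^ 2 := by
  rw [EuclideanSpace.norm_sq_eq, EuclideanSpace.norm_sq_eq, Fin.sum_univ_castSucc]
  simp

@[simp] theorem norm_bdryPt (x' : EuclideanSpace ℝ (Fin n)) : ‖bdryPt x'‖ = ‖x'‖ := by
  have h := norm_joinLast_sq (x', (0 : ℝ))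
  rw [← bdryPt_eq_joinLast] at h
  simpa using (sq_eq_sq₀ (norm_nonneg _) (norm_nonneg _)).1 (by simpa using h)

theorem measurePreserving_joinLast :
    MeasurePreserving (joinLast (n := n)) (volume.prod volume) volume := by
  have h1 : MeasurePreserving (Prod.map (WithLp.ofLp : EuclideanSpace ℝ (Fin n) → (Fin n → ℝ))
      (id : ℝ → ℝ)) (volume.prod volume) (volume.prod volume) :=
    (PiLp.volume_preserving_ofLp (Fin n)).prod (MeasurePreserving.id _)
  have h2 := (volume_preserving_piFinSuccAbove (fun _ : Fin (n + 1) => ℝ) (Fin.last n)).symm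
  have h3 := (PiLp.volume_preserving_toLp (Fin (n + 1))).comp (h2.comp
    (Measure.measurePreserving_swap.comp h1))
  have h4 : joinLast (n := n) = WithLp.toLp 2 ∘ (MeasurableEquiv.piFinSuccAbove
      (fun _ : Fin (n + 1) => ℝ) (Fin.last n)).symm ∘ Prod.swap ∘ Prod.map WithLp.ofLp id := by
    ext p i
    refine Fin.lastCases ?_ (fun j => ?_) i
    · simp [MeasurableEquiv.piFinSuccAbove, Fin.insertNthEquiv]
    · simp [MeasurableEquiv.piFinSuccAbove, Fin.insertNthEquiv]
  rw [h4]
  exact h3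

theorem continuous_joinLast : Continuous (joinLast (n := n)) := by
  refine (PiLp.continuous_toLp 2 _).comp (continuous_pi fun i => ?_)
  refine Fin.lastCases ?_ (fun j => ?_) i
  · simpa using continuous_snd
  · simpa using (by fun_prop : Continuous fun p : EuclideanSpace ℝ (Fin n) × ℝ => p.1 j)

theorem continuous_bdryPt : Continuous (bdryPt (n := n)) :=
  continuous_joinLast.comp (by fun_prop : Continuous fun x' : EuclideanSpace ℝ (Fin n) => (x', (0 : ℝ)))

theorem measurableEmbedding_joinLast : MeasurableEmbedding (joinLast (n := n)) := by
  refine continuous_joinLast.measurableEmbedding fun p q h => ?_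
  ext i
  · simpa using congrArg (fun z : Eu n => z i.castSucc) h
  · simpa using congrArg (fun z : Eu n => z (Fin.last n)) h

theorem measurableSet_upperHalf : MeasurableSet (upperHalf n) :=
  measurableSet_lt measurable_const (by fun_prop)

theorem isOpen_upperHalf : IsOpen (upperHalf n) :=
  isOpen_lt continuous_const (by fun_prop)

theorem abs_last_le_norm (x : Eu n) : |x (Fin.last n)| ≤ ‖x‖ := by
  simpa using PiLp.norm_apply_le x (Fin.last n)

theorem ne_zero_of_mem_upperHalf {x : Eu n} (hx : x ∈ upperHalf n) : x ≠ 0 := by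
  rintro rfl
  simp [upperHalf] at hx

theorem ae_mem_upperHalf : ∀ᵐ x ∂(halfMeasure n), x ∈ upperHalf n :=
  ae_restrict_mem measurableSet_upperHalf

/-- Powers `x_{n+1}^b` with `b > -1` are integrable on half-balls. -/
theorem integrableOn_rpow_last {b : ℝ} (hb : -1 < b) (ρ : ℝ) :
    IntegrableOn (fun x : Eu n => x (Fin.last n) ^ b)
      (upperHalf n ∩ Metric.closedBall 0 ρ) := by
  have hsub : joinLast ⁻¹' (upperHalf n ∩ Metric.closedBall 0 ρ) ⊆
      Metric.closedBall (0 : EuclideanSpace ℝ (Fin n)) ρ ×ˢ Set.Ioc (0 : ℝ) ρ := by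
    rintro p ⟨hp1, hp2⟩
    have h0 : 0 < p.2 := by simpa [upperHalf] using hp1
    have hρ : ‖joinLast p‖ ≤ ρ := by simpa using hp2
    have hsq := norm_joinLast_sq p
    refine ⟨?_, h0, ?_⟩
    · rw [mem_closedBall_zero_iff]
      refine le_trans ?_ hρ
      exact abs_le_of_sq_le_sq' (by nlinarith [sq_nonneg p.2]) (norm_nonneg _) |>.2
    · refine le_trans ?_ hρ
      simpa using (le_abs_self _).trans (abs_last_le_norm (joinLast p))
  rw [← measurePreserving_joinLast.integrableOn_comp_preimage measurableEmbedding_joinLast]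
  refine IntegrableOn.mono_set ?_ hsub
  have h1 : IntegrableOn (fun y : ℝ => y ^ b) (Set.Ioc 0 ρ) := by
    rcases le_or_gt ρ 0 with h | h
    · rw [Set.Ioc_eq_empty (not_lt.2 h)]; exact integrableOn_empty
    · exact (intervalIntegrable_iff_integrableOn_Ioc_of_le h.le).1
        (intervalIntegral.intervalIntegrable_rpow' hb)
  have h2 : IntegrableOn (fun _ : EuclideanSpace ℝ (Fin n) => (1 : ℝ)) (Metric.closedBall 0 ρ) :=
    integrableOn_const (measure_closedBall_lt_top.ne)
  have h3 : Integrable (fun z : EuclideanSpace ℝ (Fin n) × ℝ => (1 : ℝ) * z.2 ^ b)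
      ((volume.restrict (Metric.closedBall 0 ρ)).prod (volume.restrict (Set.Ioc 0 ρ))) :=
    Integrable.mul_prod h2 h1
  rw [Measure.prod_restrict] at h3
  simpa [IntegrableOn, Function.comp_def] using h3

end Coordinates

/-! ### The dilation invariant measure -/

section InvMeasure

/-- The density `|x|^{-(n+1+a)} x_{n+1}^a` of the dilation invariant measure. -/
noncomputable def coneWeight (n : ℕ) (a : ℝ) (x : Eu n) : ℝ :=
  ‖x‖ ^ (-(n + 1 + a)) * x (Fin.last n) ^ a

/-- The dilation invariant measure `|x|^{-(n+1+a)} x_{n+1}^a dx` on the half-space. -/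
noncomputable def invMeasure (n : ℕ) (a : ℝ) : Measure (Eu n) :=
  (halfMeasure n).withDensity fun x => ENNReal.ofReal (coneWeight n a x)

variable {n : ℕ} {a : ℝ}

theorem measurable_last : Measurable fun x : Eu n => x (Fin.last n) := by fun_prop

theorem measurable_coneWeight : Measurable (coneWeight n a) :=
  (measurable_norm.pow_const _).mul (measurable_last.pow_const _)

theorem coneWeight_pos {x : Eu n} (hx : x ∈ upperHalf n) : 0 < coneWeight n a x := by
  have h1 := norm_pos_iff.2 (ne_zero_of_mem_upperHalf hx)
  have h2 : 0 < x (Fin.last n) := hx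
  unfold coneWeight
  positivity

/-- The density is strictly positive on the half-space, so the two measures have the same null sets.
-/
theorem ae_invMeasure_iff {p : Eu n → Prop} :
    (∀ᵐ x ∂(invMeasure n a), p x) ↔ ∀ᵐ x ∂(halfMeasure n), p x := by
  rw [invMeasure, ae_withDensity_iff measurable_coneWeight.ennreal_ofReal]
  constructor
  · intro h
    filter_upwards [h, ae_mem_upperHalf] with x hx hu
    exact hx (ENNReal.ofReal_pos.2 (coneWeight_pos hu)).ne'
  · intro h
    filter_upwards [h] with x hx _ using hx

theorem ae_invMeasure_mem_upperHalf : ∀ᵐ x ∂(invMeasure n a), x ∈ upperHalf n :=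
  ae_invMeasure_iff.2 ae_mem_upperHalf

theorem integral_invMeasure {F : Type*} [NormedAddCommGroup F] [NormedSpace ℝ F] (f : Eu n → F) :
    ∫ x, f x ∂(invMeasure n a) = ∫ x, coneWeight n a x • f x ∂(halfMeasure n) := by
  rw [invMeasure, integral_withDensity_eq_integral_toReal_smul
    measurable_coneWeight.ennreal_ofReal (by simp)]
  apply integral_congr_ae
  filter_upwards [ae_mem_upperHalf] with x hx
  rw [ENNReal.toReal_ofReal (coneWeight_pos hx).le]

theorem integrable_invMeasure_iff {F : Type*} [NormedAddCommGroup F] [NormedSpace ℝ F]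
    {f : Eu n → F} : Integrable f (invMeasure n a) ↔
      Integrable (fun x => coneWeight n a x • f x) (halfMeasure n) := by
  rw [invMeasure, integrable_withDensity_iff_integrable_smul'
    measurable_coneWeight.ennreal_ofReal (by simp)]
  apply integrable_congr
  filter_upwards [ae_mem_upperHalf] with x hx
  rw [ENNReal.toReal_ofReal (coneWeight_pos hx).le]

theorem aestronglyMeasurable_invMeasure_iff {F : Type*} [NormedAddCommGroup F] [NormedSpace ℝ F]
    {f : Eu n → F} : AEStronglyMeasurable f (invMeasure n a) ↔
      AEStronglyMeasurable f (halfMeasure n) := by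
  constructor
  · rintro ⟨g, hg, h⟩
    exact ⟨g, hg, ae_invMeasure_iff.1 h⟩
  · rintro ⟨g, hg, h⟩
    exact ⟨g, hg, ae_invMeasure_iff.2 h⟩

theorem eLpNorm_two_sq {X F : Type*} [MeasurableSpace X] [NormedAddCommGroup F] (μ : Measure X)
    (f : X → F) : eLpNorm f 2 μ ^ 2 = ∫⁻ x, ‖f x‖ₑ ^ 2 ∂μ := by
  have := eLpNorm_nnreal_pow_eq_lintegral (f := f) (μ := μ) (p := 2) (by norm_num)
  simpa using this

theorem eLpNorm_invMeasure {F : Type*} [NormedAddCommGroup F] [NormedSpace ℝ F] (f : Eu n → F) :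
    eLpNorm f 2 (invMeasure n a)
      = eLpNorm (fun x => Real.sqrt (coneWeight n a x) • f x) 2 (halfMeasure n) := by
  have h : eLpNorm f 2 (invMeasure n a) ^ 2
      = eLpNorm (fun x => Real.sqrt (coneWeight n a x) • f x) 2 (halfMeasure n) ^ 2 := by
    rw [eLpNorm_two_sq, eLpNorm_two_sq, invMeasure, lintegral_withDensity_eq_lintegral_mul_non_measurable _
      measurable_coneWeight.ennreal_ofReal (by simp)]
    apply lintegral_congr_ae
    filter_upwards [ae_mem_upperHalf] with x hx
    rw [enorm_smul, mul_pow, Pi.mul_apply, Real.enorm_of_nonneg (Real.sqrt_nonneg _),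
      ← ENNReal.ofReal_pow (Real.sqrt_nonneg _), Real.sq_sqrt (coneWeight_pos hx).le]
  exact (ENNReal.pow_right_strictMono (by norm_num : (2 : ℕ) ≠ 0)).injective h

theorem memLp_invMeasure_iff {F : Type*} [NormedAddCommGroup F] [NormedSpace ℝ F] {f : Eu n → F} :
    MemLp f 2 (invMeasure n a)
      ↔ MemLp (fun x => Real.sqrt (coneWeight n a x) • f x) 2 (halfMeasure n) := by
  have hm : Measurable fun x : Eu n => Real.sqrt (coneWeight n a x) := measurable_coneWeight.sqrt
  constructor
  · rintro ⟨h1, h2⟩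
    exact ⟨hm.aestronglyMeasurable.smul (aestronglyMeasurable_invMeasure_iff.1 h1),
      by rwa [← eLpNorm_invMeasure]⟩
  · rintro ⟨h1, h2⟩
    refine ⟨aestronglyMeasurable_invMeasure_iff.2 ?_, by rwa [eLpNorm_invMeasure]⟩
    refine (hm.inv.aestronglyMeasurable.smul h1).congr ?_
    filter_upwards [ae_mem_upperHalf] with x hx
    have := (Real.sqrt_pos.2 (coneWeight_pos (a := a) hx)).ne'
    simp [smul_smul, this]

theorem coneWeight_smul {r : ℝ} (hr : 0 < r) {x : Eu n} (hx : x ∈ upperHalf n) :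
    coneWeight n a (r • x) = r ^ (-(n + 1 : ℝ)) * coneWeight n a x := by
  have h2 : 0 < x (Fin.last n) := hx
  unfold coneWeight
  rw [norm_smul, Real.norm_of_nonneg hr.le, PiLp.smul_apply, smul_eq_mul,
    Real.mul_rpow hr.le (norm_nonneg _), Real.mul_rpow hr.le h2.le, neg_add (n + 1 : ℝ),
    Real.rpow_add hr, Real.rpow_neg hr.le a]
  have : r ^ a ≠ 0 := (Real.rpow_pos_of_pos hr _).ne'
  field_simp

/-- The density is homogeneous of degree -(n+1), which cancels the Jacobian e^{(n+1)σ}. This is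
translation invariance in log |x|, the symmetry on which all radial integrations by parts rest. -/
theorem measurePreserving_dilation (σ : ℝ) :
    MeasurePreserving (fun x : Eu n => Real.exp σ • x) (invMeasure n a) (invMeasure n a) := by
  have hr : 0 < Real.exp σ := Real.exp_pos σ
  have hmeas : Measurable fun x : Eu n => Real.exp σ • x := measurable_const_smul _
  refine ⟨hmeas, ?_⟩
  ext A hA
  rw [Measure.map_apply hmeas hA, invMeasure, withDensity_apply _ hA, withDensity_apply _ (hmeas hA),
    halfMeasure, ← lintegral_indicator hA, ← lintegral_indicator (hmeas hA),
    ← lintegral_indicator measurableSet_upperHalf, ← lintegral_indicator measurableSet_upperHalf]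
  have hmap := Measure.map_addHaar_smul (volume : Measure (Eu n)) hr.ne'
  have hfin : Module.finrank ℝ (Eu n) = n + 1 := by simp
  have habs : |(Real.exp σ ^ (n + 1))⁻¹| = (Real.exp σ ^ (n + 1))⁻¹ := abs_of_pos (by positivity)
  rw [hfin, habs] at hmap
  set h : Eu n → ℝ≥0∞ := (upperHalf n).indicator
    (A.indicator fun x => ENNReal.ofReal (coneWeight n a x)) with hh
  have hhm : Measurable h :=
    (measurable_coneWeight.ennreal_ofReal.indicator hA).indicator measurableSet_upperHalf
  have key : ∀ x, (upperHalf n).indicator (((fun x => Real.exp σ • x) ⁻¹' A).indicator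
      fun x => ENNReal.ofReal (coneWeight n a x)) x
      = ENNReal.ofReal (Real.exp σ ^ (n + 1)) * h (Real.exp σ • x) := by
    intro x
    by_cases hx : x ∈ upperHalf n
    · have hx2 : Real.exp σ • x ∈ upperHalf n := by
        have : 0 < x (Fin.last n) := hx
        simp only [upperHalf, Set.mem_ofPred_eq, PiLp.smul_apply, smul_eq_mul]
        positivity
      rw [hh, Set.indicator_of_mem hx, Set.indicator_of_mem hx2]
      by_cases hxA : Real.exp σ • x ∈ A
      · rw [Set.indicator_of_mem hxA, Set.indicator_of_mem (by exact hxA), coneWeight_smul hr hx,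
          ← ENNReal.ofReal_mul (by positivity), ← mul_assoc, Real.rpow_neg hr.le,
          show (n + 1 : ℝ) = ((n + 1 : ℕ) : ℝ) by push_cast; ring, Real.rpow_natCast,
          mul_inv_cancel₀ (by positivity), one_mul]
      · rw [Set.indicator_of_notMem hxA, Set.indicator_of_notMem (by exact hxA), mul_zero]
    · have hx2 : Real.exp σ • x ∉ upperHalf n := by
        have : ¬ 0 < x (Fin.last n) := hx
        simp only [upperHalf, Set.mem_ofPred_eq, PiLp.smul_apply, smul_eq_mul]
        intro h
        exact this ((mul_pos_iff_of_pos_left hr).1 h)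
      rw [hh, Set.indicator_of_notMem hx, Set.indicator_of_notMem hx2, mul_zero]
  have hhc : Measurable fun x => h (Real.exp σ • x) := hhm.comp hmeas
  rw [lintegral_congr key, lintegral_const_mul _ hhc, ← lintegral_map hhm hmeas, hmap,
    lintegral_smul_measure, smul_eq_mul, ← mul_assoc, ← ENNReal.ofReal_mul (by positivity),
    mul_inv_cancel₀ (by positivity), ENNReal.ofReal_one, one_mul]

/-- Closed annuli have finite invariant measure. -/
theorem invMeasure_annulus_lt_top (ha : -1 < a) {r₁ : ℝ} (h₁ : 0 < r₁) (r₂ : ℝ) :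
    invMeasure n a {x | r₁ ≤ ‖x‖ ∧ ‖x‖ ≤ r₂} < ⊤ := by
  have hA : MeasurableSet {x : Eu n | r₁ ≤ ‖x‖ ∧ ‖x‖ ≤ r₂} :=
    (measurableSet_le measurable_const measurable_norm).inter
      (measurableSet_le measurable_norm measurable_const)
  rw [invMeasure, withDensity_apply _ hA, halfMeasure, Measure.restrict_restrict hA]
  set S := {x : Eu n | r₁ ≤ ‖x‖ ∧ ‖x‖ ≤ r₂} ∩ upperHalf n with hS
  have hSm : MeasurableSet S := hA.inter measurableSet_upperHalf
  have hsub : S ⊆ upperHalf n ∩ Metric.closedBall 0 r₂ := fun x hx =>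
    ⟨hx.2, by simpa using hx.1.2⟩
  have hint := (integrableOn_rpow_last (n := n) ha r₂).mono_set hsub
  rw [← setLIntegral_congr_fun hSm (fun x _ => rfl)]
  refine lt_of_le_of_lt (setLIntegral_mono_ae (g := fun x => ENNReal.ofReal
    (max (r₁ ^ (-(n + 1 + a))) (r₂ ^ (-(n + 1 + a)))) * ENNReal.ofReal (x (Fin.last n) ^ a)) ?_ ?_) ?_
  · exact ((measurable_last.pow_const a).ennreal_ofReal.const_mul _).aemeasurable
  · refine Filter.Eventually.of_forall fun x hx => ?_
    rw [← ENNReal.ofReal_mul (le_max_of_le_left (by positivity))]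
    apply ENNReal.ofReal_le_ofReal
    have h2 : 0 < x (Fin.last n) := hx.2
    refine mul_le_mul_of_nonneg_right ?_ (by positivity)
    have hx0 : 0 < ‖x‖ := h₁.trans_le hx.1.1
    rcases le_total 0 (-(n + 1 + a)) with h | h
    · exact le_max_of_le_right (Real.rpow_le_rpow hx0.le hx.1.2 h)
    · exact le_max_of_le_left (Real.rpow_le_rpow_of_nonpos h₁ hx.1.1 h)
  · rw [lintegral_const_mul _ (measurable_last.pow_const a).ennreal_ofReal]
    refine ENNReal.mul_lt_top ENNReal.ofReal_lt_top ?_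
    exact hint.lintegral_lt_top

end InvMeasure

/-! ### Test functions, scale invariant gradient and radial derivative -/

section TestFunctions

variable {n : ℕ} {a : ℝ}

/-- The closed annulus `r₁ ≤ |x| ≤ r₂`. -/
def annulus (n : ℕ) (r₁ r₂ : ℝ) : Set (Eu n) := {x | r₁ ≤ ‖x‖ ∧ ‖x‖ ≤ r₂}

theorem measurableSet_annulus (r₁ r₂ : ℝ) : MeasurableSet (annulus n r₁ r₂) :=
  (measurableSet_le measurable_const measurable_norm).inter
      (measurableSet_le measurable_norm measurable_const)

theorem memLp_of_bound_annulus {F : Type*} [NormedAddCommGroup F] (ha : -1 < a) {f : Eu n → F}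
    (hf : AEStronglyMeasurable f (invMeasure n a)) {r₁ r₂ C : ℝ} (h₁ : 0 < r₁)
    (hC : ∀ x, ‖f x‖ ≤ C) (h0 : ∀ x, x ∉ annulus n r₁ r₂ → f x = 0) (p : ℝ≥0∞) :
    MemLp f p (invMeasure n a) := by
  refine (memLp_indicator_const p (measurableSet_annulus r₁ r₂) C
    (Or.inr (invMeasure_annulus_lt_top ha h₁ r₂).ne)).mono hf (Filter.Eventually.of_forall fun x => ?_)
  by_cases hx : x ∈ annulus n r₁ r₂
  · rw [Set.indicator_of_mem hx]
    exact (hC x).trans (le_abs_self C)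
  · rw [h0 x hx]; simp

/-- Smooth functions on `ℝ^{n+1}` with compact support in `ℝ^{n+1} \ {0}`. -/
structure IsTest (η : Eu n → ℝ) : Prop where
  contDiff : ContDiff ℝ ∞ η
  compact : HasCompactSupport η
  zero_notMem : (0 : Eu n) ∉ tsupport η

theorem exists_annulus_of_isCompact {K : Set (Eu n)} (hK : IsCompact K) (h0 : (0 : Eu n) ∉ K) :
    ∃ r₁ r₂ : ℝ, 0 < r₁ ∧ K ⊆ annulus n r₁ r₂ := by
  obtain ⟨ε, hε, h1⟩ := Metric.isOpen_iff.1 hK.isClosed.isOpen_compl 0 h0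
  obtain ⟨r₂, h2⟩ := hK.isBounded.subset_closedBall 0
  refine ⟨ε, r₂, hε, fun x hx => ⟨?_, by simpa using h2 hx⟩⟩
  by_contra h
  exact h1 (by simpa using h) hx

theorem IsTest.differentiable {η : Eu n → ℝ} (h : IsTest η) : Differentiable ℝ η :=
  h.contDiff.differentiable (by simp)

theorem IsTest.add {η ξ : Eu n → ℝ} (h : IsTest η) (h' : IsTest ξ) :
    IsTest fun x => η x + ξ x := by
  refine ⟨h.contDiff.add h'.contDiff, h.compact.add h'.compact, fun h0 => ?_⟩
  rcases tsupport_add η ξ h0 with h0 | h0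
  exacts [h.zero_notMem h0, h'.zero_notMem h0]

theorem IsTest.const_mul {η : Eu n → ℝ} (h : IsTest η) (c : ℝ) : IsTest fun x => c * η x :=
  ⟨contDiff_const.mul h.contDiff, h.compact.mul_left,
    fun h0 => h.zero_notMem (tsupport_mul_subset_right (f := fun _ => c) h0)⟩

theorem isTest_zero : IsTest fun _ : Eu n => (0 : ℝ) :=
  ⟨contDiff_const, HasCompactSupport.zero, by simp [tsupport]⟩

/-- The radial function `k (log |x|)`. -/
noncomputable def radial (k : ℝ → ℝ) (x : Eu n) : ℝ := k (Real.log ‖x‖)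

theorem contDiffAt_radial {k : ℝ → ℝ} (hk : ContDiff ℝ ∞ k) {x : Eu n} (hx : x ≠ 0) :
    ContDiffAt ℝ ∞ (radial k) x :=
  hk.contDiffAt.comp x ((contDiffAt_norm ℝ hx).log (norm_ne_zero_iff.2 hx))

theorem measurable_radial {k : ℝ → ℝ} (hk : Continuous k) : Measurable (radial (n := n) k) :=
  hk.measurable.comp (Real.measurable_log.comp measurable_norm)

/-- A singularity of the factor at the origin is harmless, because test functions vanish near it.
This admits every smooth function of log |x| as a multiplier. -/
theorem contDiff_mul_of_notMem {f η : Eu n → ℝ} (hf : ∀ x ≠ 0, ContDiffAt ℝ ∞ f x)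
    (hη : IsTest η) : IsTest fun x => f x * η x := by
  refine ⟨contDiff_iff_contDiffAt.2 fun x => ?_, hη.compact.mul_left,
    fun h0 => hη.zero_notMem (tsupport_mul_subset_right (f := f) h0)⟩
  by_cases hx : x = 0
  · have h1 : (fun x => f x * η x) =ᶠ[nhds x] fun _ => 0 := by
      filter_upwards [(isClosed_tsupport η).isOpen_compl.mem_nhds (hx ▸ hη.zero_notMem)] with y hy
      rw [image_eq_zero_of_notMem_tsupport hy, mul_zero]
    exact contDiffAt_const.congr_of_eventuallyEq h1
  · exact (hf x hx).mul hη.contDiff.contDiffAt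

theorem IsTest.radial_mul {η : Eu n → ℝ} (h : IsTest η) {k : ℝ → ℝ} (hk : ContDiff ℝ ∞ k) :
    IsTest fun x => radial k x * η x :=
  contDiff_mul_of_notMem (fun _ hx => contDiffAt_radial hk hx) h

theorem IsTest.dilation {η : Eu n → ℝ} (h : IsTest η) (σ : ℝ) :
    IsTest fun x => η (Real.exp σ • x) := by
  have hσ : Real.exp σ ≠ 0 := (Real.exp_pos σ).ne'
  let φ : Eu n ≃ₜ Eu n := Homeomorph.smulOfNeZero (Real.exp σ) hσ
  refine ⟨h.contDiff.comp (contDiff_const_smul _), h.compact.comp_homeomorph φ, fun h0 => ?_⟩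
  have h1 := tsupport_comp_subset_preimage η φ.continuous h0
  have h2 : φ 0 = 0 := smul_zero (Real.exp σ)
  rw [Set.mem_preimage, h2] at h1
  exact h.zero_notMem h1

/-- The scale invariant gradient `|x| ∇η(x)`. -/
noncomputable def sgrad (η : Eu n → ℝ) (x : Eu n) : Eu n := ‖x‖ • gradient η x

/-- The radial direction `x / |x|`. -/
noncomputable def rdir (x : Eu n) : Eu n := ‖x‖⁻¹ • x

theorem measurable_rdir : Measurable (rdir (n := n)) := by
  unfold rdir
  exact measurable_norm.inv.smul measurable_id

theorem norm_rdir_le (x : Eu n) : ‖rdir x‖ ≤ 1 := by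
  rw [rdir, norm_smul, norm_inv, norm_norm]
  exact inv_mul_le_one

theorem norm_rdir {x : Eu n} (hx : x ≠ 0) : ‖rdir x‖ = 1 := by
  rw [rdir, norm_smul, norm_inv, norm_norm, inv_mul_cancel₀ (norm_ne_zero_iff.2 hx)]

theorem inner_gradient (η : Eu n → ℝ) (x y : Eu n) :
    inner ℝ (gradient η x) y = fderiv ℝ η x y := by
  rw [gradient, InnerProductSpace.toDual_symm_apply]

theorem inner_sgrad (η : Eu n → ℝ) (x y : Eu n) :
    inner ℝ (sgrad η x) y = ‖x‖ * fderiv ℝ η x y := by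
  rw [sgrad, real_inner_smul_left, inner_gradient]

theorem inner_sgrad_rdir (η : Eu n → ℝ) (x : Eu n) :
    inner ℝ (sgrad η x) (rdir x) = fderiv ℝ η x x := by
  rw [inner_sgrad, rdir, map_smul, smul_eq_mul]
  by_cases hx : x = 0
  · simp [hx]
  · rw [← mul_assoc, mul_inv_cancel₀ (norm_ne_zero_iff.2 hx), one_mul]

theorem sgrad_add {η ξ : Eu n → ℝ} {x : Eu n} (h : DifferentiableAt ℝ η x)
    (h' : DifferentiableAt ℝ ξ x) : sgrad (fun x => η x + ξ x) x = sgrad η x + sgrad ξ x := by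
  refine ext_inner_right ℝ fun y => ?_
  rw [inner_add_left, inner_sgrad, inner_sgrad, inner_sgrad, fderiv_fun_add h h']
  simp [mul_add]

theorem sgrad_mul {η ξ : Eu n → ℝ} {x : Eu n} (h : DifferentiableAt ℝ η x)
    (h' : DifferentiableAt ℝ ξ x) :
    sgrad (fun x => η x * ξ x) x = η x • sgrad ξ x + ξ x • sgrad η x := by
  refine ext_inner_right ℝ fun y => ?_
  rw [inner_add_left, real_inner_smul_left, real_inner_smul_left, inner_sgrad, inner_sgrad,
    inner_sgrad, fderiv_fun_mul h h']
  simp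
  ring

theorem sgrad_const_mul {η : Eu n → ℝ} {x : Eu n} (h : DifferentiableAt ℝ η x) (c : ℝ) :
    sgrad (fun x => c * η x) x = c • sgrad η x := by
  refine ext_inner_right ℝ fun y => ?_
  rw [real_inner_smul_left, inner_sgrad, inner_sgrad, fderiv_const_mul h]
  simp
  ring

theorem hasFDerivAt_log_norm {x : Eu n} (hx : x ≠ 0) :
    HasFDerivAt (fun x : Eu n => Real.log ‖x‖) ((‖x‖ ^ 2)⁻¹ • innerSL ℝ x) x := by
  have h1 : HasFDerivAt (fun x : Eu n => ‖x‖ ^ 2) (2 • innerSL ℝ x) x :=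
    (hasStrictFDerivAt_norm_sq x).hasFDerivAt
  have h2 := (h1.log (pow_ne_zero 2 (norm_ne_zero_iff.2 hx))).const_mul (1 / 2 : ℝ)
  have h3 : (fun x : Eu n => 1 / 2 * Real.log (‖x‖ ^ 2)) = fun x => Real.log ‖x‖ := by
    ext y; rw [Real.log_pow]; push_cast; ring
  rw [h3] at h2
  refine h2.congr_fderiv ?_
  rw [smul_smul, ← Nat.cast_smul_eq_nsmul ℝ, smul_smul]
  congr 1
  push_cast
  ring

/-- Since |x|∇ log |x| = x/|x|, the chain rule leaves no power of |x| behind: for radial functions,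
differentiation is d/dt in t = log |x|. -/
theorem sgrad_radial {k : ℝ → ℝ} {x : Eu n} (hk : DifferentiableAt ℝ k (Real.log ‖x‖)) (hx : x ≠ 0) :
    sgrad (radial k) x = radial (deriv k) x • rdir x := by
  have h : HasFDerivAt (radial k) (deriv k (Real.log ‖x‖) • ((‖x‖ ^ 2)⁻¹ • innerSL ℝ x)) x :=
    hk.hasDerivAt.comp_hasFDerivAt x (hasFDerivAt_log_norm hx)
  refine ext_inner_right ℝ fun y => ?_
  rw [inner_sgrad, h.fderiv, real_inner_smul_left, rdir, real_inner_smul_left]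
  have := norm_ne_zero_iff.2 hx
  simp [radial]
  field_simp

theorem sgrad_radial_mul {k : ℝ → ℝ} (hk : Differentiable ℝ k) {η : Eu n → ℝ}
    (hη : Differentiable ℝ η) (x : Eu n) :
    sgrad (fun x => radial k x * η x) x
      = radial k x • sgrad η x + (radial (deriv k) x * η x) • rdir x := by
  by_cases hx : x = 0
  · simp [sgrad, hx, rdir]
  · have h : HasFDerivAt (radial k) (deriv k (Real.log ‖x‖) • ((‖x‖ ^ 2)⁻¹ • innerSL ℝ x)) x :=
      (hk _).hasDerivAt.comp_hasFDerivAt x (hasFDerivAt_log_norm hx)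
    rw [sgrad_mul h.differentiableAt (hη x), sgrad_radial (hk _) hx, smul_smul, mul_comm (η x)]

/-- The factor |x| in the gradient swallows the e^σ of the chain rule, so the gradient commutes with
dilations. -/
theorem sgrad_dilation {η : Eu n → ℝ} (hη : Differentiable ℝ η) (σ : ℝ) (x : Eu n) :
    sgrad (fun x => η (Real.exp σ • x)) x = sgrad η (Real.exp σ • x) := by
  have h : HasFDerivAt (fun x => η (Real.exp σ • x))
      ((fderiv ℝ η (Real.exp σ • x)).comp (Real.exp σ • ContinuousLinearMap.id ℝ (Eu n))) x :=
    (hη _).hasFDerivAt.comp x ((hasFDerivAt_id x).const_smul (Real.exp σ))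
  refine ext_inner_right ℝ fun y => ?_
  rw [inner_sgrad, inner_sgrad, h.fderiv, norm_smul, Real.norm_of_nonneg (Real.exp_pos σ).le]
  simp
  ring

theorem IsTest.continuous_gradient {η : Eu n → ℝ} (h : IsTest η) : Continuous (gradient η) :=
  (LinearIsometryEquiv.continuous _).comp (h.contDiff.continuous_fderiv (by simp))

theorem IsTest.continuous_sgrad {η : Eu n → ℝ} (h : IsTest η) : Continuous (sgrad η) :=
  continuous_norm.smul h.continuous_gradient

theorem sgrad_eq_zero_of_notMem {η : Eu n → ℝ} {x : Eu n} (hx : x ∉ tsupport η) :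
    sgrad η x = 0 := by
  have h1 : fderiv ℝ η x = 0 := image_eq_zero_of_notMem_tsupport
    (fun h => hx (tsupport_fderiv_subset ℝ h))
  rw [sgrad, gradient, h1, map_zero, smul_zero]

theorem IsTest.exists_bound {η : Eu n → ℝ} (h : IsTest η) : ∃ r₁ r₂ C : ℝ, 0 < r₁ ∧
    (∀ x, |η x| ≤ C) ∧ (∀ x, ‖sgrad η x‖ ≤ C) ∧
    (∀ x, x ∉ annulus n r₁ r₂ → η x = 0) ∧ (∀ x, x ∉ annulus n r₁ r₂ → sgrad η x = 0) := by
  obtain ⟨r₁, r₂, h1, hsub⟩ := exists_annulus_of_isCompact h.compact h.zero_notMem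
  obtain ⟨C₁, hC₁⟩ := h.compact.exists_bound_of_continuous h.contDiff.continuous
  have hs : HasCompactSupport (sgrad η) := HasCompactSupport.intro h.compact
    fun x hx => sgrad_eq_zero_of_notMem hx
  obtain ⟨C₂, hC₂⟩ := hs.exists_bound_of_continuous h.continuous_sgrad
  exact ⟨r₁, r₂, max C₁ C₂, h1, fun x => le_max_of_le_left (hC₁ x),
    fun x => le_max_of_le_right (hC₂ x),
    fun x hx => image_eq_zero_of_notMem_tsupport fun h' => hx (hsub h'),
    fun x hx => sgrad_eq_zero_of_notMem fun h' => hx (hsub h')⟩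

theorem IsTest.memLp (ha : -1 < a) {η : Eu n → ℝ} (h : IsTest η) (p : ℝ≥0∞) :
    MemLp η p (invMeasure n a) := by
  obtain ⟨r₁, r₂, C, h1, h2, -, h4, -⟩ := h.exists_bound
  exact memLp_of_bound_annulus ha h.contDiff.continuous.aestronglyMeasurable h1 h2 h4 p

theorem IsTest.memLp_sgrad (ha : -1 < a) {η : Eu n → ℝ} (h : IsTest η) (p : ℝ≥0∞) :
    MemLp (sgrad η) p (invMeasure n a) := by
  obtain ⟨r₁, r₂, C, h1, -, h3, -, h5⟩ := h.exists_bound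
  exact memLp_of_bound_annulus ha h.continuous_sgrad.aestronglyMeasurable h1 h3 h5 p

/-- The radial derivative `x · ∇η(x)`. -/
noncomputable def euler (η : Eu n → ℝ) (x : Eu n) : ℝ := inner ℝ (sgrad η x) (rdir x)

theorem euler_eq (η : Eu n → ℝ) (x : Eu n) : euler η x = fderiv ℝ η x x := inner_sgrad_rdir η x

theorem abs_euler_le (η : Eu n → ℝ) (x : Eu n) : |euler η x| ≤ ‖sgrad η x‖ :=
  (abs_real_inner_le_norm _ _).trans
    (mul_le_of_le_one_right (norm_nonneg _) (norm_rdir_le x))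

theorem IsTest.continuous_euler {η : Eu n → ℝ} (h : IsTest η) : Continuous (euler η) := by
  have : euler η = fun x => fderiv ℝ η x x := funext (euler_eq η)
  rw [this]
  exact (h.contDiff.continuous_fderiv (by simp)).clm_apply continuous_id

/-- The radial derivative generates the dilation flow, which is what makes it a limit of difference
quotients along that flow. -/
theorem hasDerivAt_dilation {η : Eu n → ℝ} (h : Differentiable ℝ η) (x : Eu n) (σ : ℝ) :
    HasDerivAt (fun σ => η (Real.exp σ • x)) (euler η (Real.exp σ • x)) σ := by
  rw [euler_eq]
  exact (h _).hasFDerivAt.comp_hasDerivAt σ ((Real.hasDerivAt_exp σ).smul_const x)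

/-- Supplies one enlarged annulus carrying all dilates with bounded parameter, as needed for a
dominating function. -/
theorem dilation_mem_annulus {r₁ r₂ σ δ : ℝ} {x : Eu n} (hσ : |σ| ≤ δ) (h₁ : 0 < r₁)
    (h : Real.exp σ • x ∈ annulus n r₁ r₂) :
    x ∈ annulus n (Real.exp (-δ) * r₁) (Real.exp δ * r₂) := by
  obtain ⟨h2, h3⟩ := h
  rw [norm_smul, Real.norm_of_nonneg (Real.exp_pos σ).le] at h2 h3
  have hx : ‖x‖ = Real.exp (-σ) * (Real.exp σ * ‖x‖) := by
    rw [← mul_assoc, ← Real.exp_add]; simp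
  have h4 : Real.exp (-δ) ≤ Real.exp (-σ) := Real.exp_le_exp.2 (by linarith [(abs_le.1 hσ).2])
  have h5 : Real.exp (-σ) ≤ Real.exp δ := Real.exp_le_exp.2 (by linarith [(abs_le.1 hσ).1])
  constructor
  · rw [hx]
    exact mul_le_mul h4 h2 h₁.le (Real.exp_pos _).le
  · rw [hx]
    exact mul_le_mul h5 h3 (by positivity) (Real.exp_pos _).le

theorem IsTest.integrable (ha : -1 < a) {η : Eu n → ℝ} (h : IsTest η) :
    Integrable η (invMeasure n a) := memLp_one_iff_integrable.1 (h.memLp ha 1)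

/-- The radial derivative of a test function has vanishing integral. -/
theorem integral_euler (ha : -1 < a) {η : Eu n → ℝ} (h : IsTest η) :
    ∫ x, euler η x ∂(invMeasure n a) = 0 := by
  obtain ⟨r₁, r₂, C, h1, -, h3, -, h5⟩ := h.exists_bound
  set A := annulus n (Real.exp (-1) * r₁) (Real.exp 1 * r₂) with hA
  have hAm : MeasurableSet A := measurableSet_annulus _ _
  have hbound : Integrable (A.indicator fun _ => C) (invMeasure n a) :=
    (integrable_indicator_iff hAm).2 (integrableOn_const
      (invMeasure_annulus_lt_top ha (by positivity) _).ne)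
  -- By invariance ∫ η(e^σ x) is constant in σ; differentiating under the integral at σ = 0 produces
  -- the integral of the radial derivative, which is therefore zero.
  have hd := hasDerivAt_integral_of_dominated_loc_of_deriv_le (μ := invMeasure n a)
    (F := fun σ x => η (Real.exp σ • x)) (F' := fun σ x => euler η (Real.exp σ • x)) (x₀ := (0 : ℝ))
    (s := Metric.ball 0 1) (bound := A.indicator fun _ => C) (Metric.ball_mem_nhds _ one_pos)
    (Filter.Eventually.of_forall fun σ => (h.dilation σ).contDiff.continuous.aestronglyMeasurable)
    ((h.dilation 0).integrable ha)
    ((h.continuous_euler.comp (continuous_const_smul _)).aestronglyMeasurable)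
    (Filter.Eventually.of_forall fun x σ hσ => by
      have hσ' : |σ| ≤ 1 := by simpa using (mem_ball_zero_iff.1 hσ).le
      by_cases hx : Real.exp σ • x ∈ annulus n r₁ r₂
      · rw [Set.indicator_of_mem (dilation_mem_annulus hσ' h1 hx)]
        exact (abs_euler_le _ _).trans (h3 _)
      · have : euler η (Real.exp σ • x) = 0 := by simp [euler, h5 _ hx]
        rw [this, norm_zero]
        refine Set.indicator_nonneg (fun _ _ => ?_) x
        exact (norm_nonneg _).trans (h3 0))
    hbound (Filter.Eventually.of_forall fun x σ _ => hasDerivAt_dilation h.differentiable x σ)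
  have hc : (fun σ => ∫ x, η (Real.exp σ • x) ∂(invMeasure n a))
      = fun _ => ∫ x, η x ∂(invMeasure n a) := by
    ext σ
    exact (measurePreserving_dilation σ).integral_comp
      (Homeomorph.smulOfNeZero (Real.exp σ) (Real.exp_pos σ).ne').measurableEmbedding η
  have h0 := hd.2
  rw [hc] at h0
  have := h0.unique (hasDerivAt_const _ _)
  simpa using this

instance : SFinite (invMeasure n a) := by
  unfold invMeasure halfMeasure
  infer_instance

/-- Dilations move a test function in `L²` with speed at most the norm of its radial derivative. -/
theorem IsTest.eLpNorm_dilation_sub_le {η : Eu n → ℝ} (h : IsTest η) (σ : ℝ) :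
    eLpNorm (fun x => η (Real.exp σ • x) - η x) 2 (invMeasure n a)
      ≤ ENNReal.ofReal |σ| * eLpNorm (euler η) 2 (invMeasure n a) := by
  have hcont : Continuous fun z : Eu n × ℝ => euler η (Real.exp z.2 • z.1) :=
    h.continuous_euler.comp (by fun_prop)
  have hpt : ∀ x, ‖η (Real.exp σ • x) - η x‖ₑ ^ 2
      ≤ ENNReal.ofReal |σ| * ∫⁻ ρ in Set.uIoc 0 σ, ‖euler η (Real.exp ρ • x)‖ₑ ^ 2 := by
    intro x
    have h1 : η (Real.exp σ • x) - η x = ∫ ρ in (0 : ℝ)..σ, euler η (Real.exp ρ • x) := by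
      rw [intervalIntegral.integral_eq_sub_of_hasDerivAt
        (fun ρ _ => hasDerivAt_dilation h.differentiable x ρ)
        ((hcont.comp (by fun_prop : Continuous fun ρ : ℝ => (x, ρ))).intervalIntegrable _ _)]
      simp
    have h2 : ‖η (Real.exp σ • x) - η x‖ₑ ≤ ∫⁻ ρ in Set.uIoc 0 σ, ‖euler η (Real.exp ρ • x)‖ₑ := by
      rw [h1, intervalIntegral.intervalIntegral_eq_integral_uIoc]
      rw [enorm_smul]
      have : ‖(if (0 : ℝ) ≤ σ then (1 : ℝ) else -1)‖ₑ = 1 := by split_ifs <;> simp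
      rw [this, one_mul]
      exact enorm_integral_le_lintegral_enorm _
    have hm : AEMeasurable (fun ρ => ‖euler η (Real.exp ρ • x)‖ₑ)
        (volume.restrict (Set.uIoc 0 σ)) :=
      ((hcont.comp (by fun_prop : Continuous fun ρ : ℝ => (x, ρ))).measurable.enorm).aemeasurable
    -- Cauchy–Schwarz on an interval of length |σ| gives one factor |σ|. The other comes from
    -- integrating in ρ, once invariance has made the integral over x independent of ρ.
    have h3 := ENNReal.lintegral_mul_le_Lp_mul_Lq (volume.restrict (Set.uIoc 0 σ))
      Real.HolderConjugate.two_two (f := fun _ => (1 : ℝ≥0∞)) aemeasurable_const hm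
    simp only [Pi.mul_apply, one_mul, ENNReal.one_rpow, lintegral_const, Measure.restrict_apply_univ,
      Real.volume_uIoc, sub_zero] at h3
    calc ‖η (Real.exp σ • x) - η x‖ₑ ^ 2 ≤ _ := pow_le_pow_left' (h2.trans h3) 2
      _ = _ := by
        rw [mul_pow, ← ENNReal.rpow_natCast, ← ENNReal.rpow_mul, ← ENNReal.rpow_natCast,
          ← ENNReal.rpow_mul]
        norm_num
  have hsq : eLpNorm (fun x => η (Real.exp σ • x) - η x) 2 (invMeasure n a) ^ 2
      ≤ (ENNReal.ofReal |σ| * eLpNorm (euler η) 2 (invMeasure n a)) ^ 2 := by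
    rw [eLpNorm_two_sq, mul_pow, eLpNorm_two_sq]
    calc _ ≤ ∫⁻ x, (ENNReal.ofReal |σ| * ∫⁻ ρ in Set.uIoc 0 σ, ‖euler η (Real.exp ρ • x)‖ₑ ^ 2)
            ∂(invMeasure n a) := lintegral_mono hpt
      _ = ENNReal.ofReal |σ| * ∫⁻ ρ in Set.uIoc 0 σ, ∫⁻ x, ‖euler η (Real.exp ρ • x)‖ₑ ^ 2
            ∂(invMeasure n a) := by
          rw [lintegral_const_mul' _ _ ENNReal.ofReal_ne_top, lintegral_lintegral_swap]
          exact (hcont.measurable.enorm.pow_const 2).aemeasurable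
      _ = ENNReal.ofReal |σ| * ∫⁻ ρ in Set.uIoc 0 σ, ∫⁻ x, ‖euler η x‖ₑ ^ 2 ∂(invMeasure n a) := by
          congr 2
          ext ρ
          exact (measurePreserving_dilation ρ).lintegral_comp
            (f := fun x => ‖euler η x‖ₑ ^ 2) (h.continuous_euler.measurable.enorm.pow_const 2)
      _ = _ := by
          rw [lintegral_const, Measure.restrict_apply_univ, Real.volume_uIoc, sub_zero]
          ring
  exact (ENNReal.pow_right_strictMono (by norm_num : (2 : ℕ) ≠ 0)).le_iff_le.1 hsq

end TestFunctions

/-! ### The energy space as closure of the test functions -/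

section EnergySpace

open Filter Topology

variable {n : ℕ} {a : ℝ}

/-- `(v, P)` is a limit in `L²` for the invariant measure of test functions and their scale
invariant gradients. -/
structure InEnergySpace (a : ℝ) (v : Eu n → ℝ) (P : Eu n → Eu n) : Prop where
  memLp : MemLp v 2 (invMeasure n a)
  memLp_grad : MemLp P 2 (invMeasure n a)
  approx : ∃ η : ℕ → Eu n → ℝ, (∀ j, IsTest (η j)) ∧ L2Tendsto (invMeasure n a) atTop η v ∧
    L2Tendsto (invMeasure n a) atTop (fun j => sgrad (η j)) P

theorem IsTest.inEnergySpace (ha : -1 < a) {η : Eu n → ℝ} (h : IsTest η) :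
    InEnergySpace a η (sgrad η) :=
  ⟨h.memLp ha 2, h.memLp_sgrad ha 2, fun _ => η, fun _ => h, L2Tendsto.const _, L2Tendsto.const _⟩

theorem InEnergySpace.add (ha : -1 < a) {v w : Eu n → ℝ} {P Q : Eu n → Eu n}
    (h : InEnergySpace a v P) (h' : InEnergySpace a w Q) :
    InEnergySpace a (fun x => v x + w x) (fun x => P x + Q x) := by
  obtain ⟨η, h1, h2, h3⟩ := h.approx
  obtain ⟨ξ, h4, h5, h6⟩ := h'.approx
  refine ⟨h.memLp.add h'.memLp, h.memLp_grad.add h'.memLp_grad, fun j x => η j x + ξ j x,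
    fun j => (h1 j).add (h4 j), ?_, ?_⟩
  · exact h2.add h5 (fun j => (((h1 j).memLp ha 2).sub h.memLp).1)
      (fun j => (((h4 j).memLp ha 2).sub h'.memLp).1)
  · have := h3.add h6 (fun j => (((h1 j).memLp_sgrad ha 2).sub h.memLp_grad).1)
      (fun j => (((h4 j).memLp_sgrad ha 2).sub h'.memLp_grad).1)
    refine this.of_norm_le 1 (Eventually.of_forall fun j => Eventually.of_forall fun x => ?_)
    rw [sgrad_add ((h1 j).differentiable x) ((h4 j).differentiable x), one_mul]

theorem InEnergySpace.const_mul {v : Eu n → ℝ} {P : Eu n → Eu n}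
    (h : InEnergySpace a v P) (c : ℝ) :
    InEnergySpace a (fun x => c * v x) (fun x => c • P x) := by
  obtain ⟨η, h1, h2, h3⟩ := h.approx
  refine ⟨h.memLp.const_mul c, h.memLp_grad.const_smul c, fun j x => c * η j x,
    fun j => (h1 j).const_mul c, ?_, ?_⟩
  · refine h2.of_norm_le |c| (Eventually.of_forall fun j => Eventually.of_forall fun x => ?_)
    rw [← mul_sub, norm_mul, Real.norm_eq_abs]
  · refine h3.of_norm_le |c| (Eventually.of_forall fun j => Eventually.of_forall fun x => ?_)
    rw [sgrad_const_mul ((h1 j).differentiable x), ← smul_sub, norm_smul, Real.norm_eq_abs]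

theorem InEnergySpace.sub (ha : -1 < a) {v w : Eu n → ℝ} {P Q : Eu n → Eu n}
    (h : InEnergySpace a v P) (h' : InEnergySpace a w Q) :
    InEnergySpace a (fun x => v x - w x) (fun x => P x - Q x) := by
  have := h.add ha (h'.const_mul (-1))
  simpa [← sub_eq_add_neg] using this

theorem InEnergySpace.congr {v w : Eu n → ℝ} {P Q : Eu n → Eu n} (h : InEnergySpace a v P)
    (hv : ∀ᵐ x ∂(invMeasure n a), v x = w x) (hP : ∀ᵐ x ∂(invMeasure n a), P x = Q x) :
    InEnergySpace a w Q := by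
  obtain ⟨η, h1, h2, h3⟩ := h.approx
  refine ⟨(memLp_congr_ae hv).1 h.memLp, (memLp_congr_ae hP).1 h.memLp_grad, η, h1, ?_, ?_⟩
  · refine h2.of_norm_le 1 (Eventually.of_forall fun j => ?_)
    filter_upwards [hv] with x hx
    rw [hx, one_mul]
  · refine h3.of_norm_le 1 (Eventually.of_forall fun j => ?_)
    filter_upwards [hP] with x hx
    rw [hx, one_mul]

theorem MemLp.radial_smul {F : Type*} [NormedAddCommGroup F] [NormedSpace ℝ F] {f : Eu n → F}
    {p : ℝ≥0∞} (hf : MemLp f p (invMeasure n a)) {k : ℝ → ℝ} (hk : Continuous k) {C : ℝ}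
    (hC : ∀ t, |k t| ≤ C) : MemLp (fun x => radial k x • f x) p (invMeasure n a) := by
  refine hf.of_le_mul (c := C) ((measurable_radial hk).aestronglyMeasurable.smul hf.1)
    (Eventually.of_forall fun x => ?_)
  rw [norm_smul]
  exact mul_le_mul_of_nonneg_right (hC _) (norm_nonneg _)

theorem MemLp.radial_mul {f : Eu n → ℝ} {p : ℝ≥0∞} (hf : MemLp f p (invMeasure n a)) {k : ℝ → ℝ}
    (hk : Continuous k) {C : ℝ} (hC : ∀ t, |k t| ≤ C) :
    MemLp (fun x => radial k x * f x) p (invMeasure n a) := MemLp.radial_smul hf hk hC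

theorem MemLp.smul_rdir {f : Eu n → ℝ} {p : ℝ≥0∞} (hf : MemLp f p (invMeasure n a)) :
    MemLp (fun x => f x • rdir x) p (invMeasure n a) := by
  refine hf.of_le (hf.1.smul measurable_rdir.aestronglyMeasurable) (Eventually.of_forall fun x => ?_)
  rw [norm_smul]
  exact mul_le_of_le_one_right (norm_nonneg _) (norm_rdir_le x)

theorem MemLp.inner_rdir {P : Eu n → Eu n} {p : ℝ≥0∞} (hP : MemLp P p (invMeasure n a)) :
    MemLp (fun x => inner ℝ (P x) (rdir x)) p (invMeasure n a) := by
  refine hP.of_le (hP.1.inner measurable_rdir.aestronglyMeasurable)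
    (Eventually.of_forall fun x => ?_)
  exact (norm_inner_le_norm _ _).trans (mul_le_of_le_one_right (norm_nonneg _) (norm_rdir_le x))

/-- Multiplication by a radial function preserves the energy space. -/
theorem InEnergySpace.radial_mul (ha : -1 < a) {v : Eu n → ℝ} {P : Eu n → Eu n}
    (h : InEnergySpace a v P) {k : ℝ → ℝ} (hk : ContDiff ℝ ∞ k) {C : ℝ}
    (hC : ∀ t, |k t| ≤ C) (hC' : ∀ t, |deriv k t| ≤ C) :
    InEnergySpace a (fun x => radial k x * v x)
      (fun x => radial k x • P x + (radial (deriv k) x * v x) • rdir x) := by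
  have hk' : Continuous (deriv k) := hk.continuous_deriv (by simp)
  obtain ⟨η, h1, h2, h3⟩ := h.approx
  refine ⟨MemLp.radial_mul h.memLp hk.continuous hC,
    (MemLp.radial_smul h.memLp_grad hk.continuous hC).add
      (MemLp.smul_rdir (MemLp.radial_mul h.memLp hk' hC')),
    fun j x => radial k x * η j x, fun j => (h1 j).radial_mul hk, ?_, ?_⟩
  · refine h2.of_norm_le C (Eventually.of_forall fun j => Eventually.of_forall fun x => ?_)
    rw [← mul_sub, norm_mul]
    exact mul_le_mul_of_nonneg_right (hC _) (norm_nonneg _)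
  · refine h3.of_norm_le_add h2 (fun j => (((h1 j).memLp_sgrad ha 2).sub h.memLp_grad).1)
      (fun j => (((h1 j).memLp ha 2).sub h.memLp).1) C
      (Eventually.of_forall fun j => Eventually.of_forall fun x => ?_)
    rw [sgrad_radial_mul (hk.differentiable (by simp)) (h1 j).differentiable, add_sub_add_comm,
      ← smul_sub, ← sub_smul, ← mul_sub, mul_add]
    refine (norm_add_le _ _).trans (add_le_add ?_ ?_)
    · rw [norm_smul]
      exact mul_le_mul_of_nonneg_right (hC _) (norm_nonneg _)
    · rw [norm_smul, norm_mul]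
      refine (mul_le_of_le_one_right (by positivity) (norm_rdir_le x)).trans ?_
      exact mul_le_mul_of_nonneg_right (hC' _) (norm_nonneg _)

theorem exists_bound_of_contDiff_compact {k : ℝ → ℝ} (hk : ContDiff ℝ ∞ k)
    (hc : HasCompactSupport k) : ∃ C, (∀ t, |k t| ≤ C) ∧ (∀ t, |deriv k t| ≤ C) ∧
      ∀ t, |deriv (deriv k) t| ≤ C := by
  have hk' : ContDiff ℝ ∞ (deriv k) := (contDiff_infty_iff_deriv.1 hk).2
  have hk'' : ContDiff ℝ ∞ (deriv (deriv k)) := (contDiff_infty_iff_deriv.1 hk').2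
  obtain ⟨C₁, h1⟩ := hc.exists_bound_of_continuous hk.continuous
  obtain ⟨C₂, h2⟩ := hc.deriv.exists_bound_of_continuous hk'.continuous
  obtain ⟨C₃, h3⟩ := hc.deriv.deriv.exists_bound_of_continuous hk''.continuous
  exact ⟨max C₁ (max C₂ C₃), fun t => le_max_of_le_left (h1 t),
    fun t => le_max_of_le_right (le_max_of_le_left (h2 t)),
    fun t => le_max_of_le_right (le_max_of_le_right (h3 t))⟩

theorem eLpNorm_dilation {F : Type*} [NormedAddCommGroup F] {f : Eu n → F}
    (hf : AEStronglyMeasurable f (invMeasure n a)) (σ : ℝ) (p : ℝ≥0∞) :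
    eLpNorm (fun x => f (Real.exp σ • x)) p (invMeasure n a) = eLpNorm f p (invMeasure n a) :=
  eLpNorm_comp_measurePreserving hf (measurePreserving_dilation σ)

theorem MemLp.dilation {F : Type*} [NormedAddCommGroup F] {f : Eu n → F} {p : ℝ≥0∞}
    (hf : MemLp f p (invMeasure n a)) (σ : ℝ) :
    MemLp (fun x => f (Real.exp σ • x)) p (invMeasure n a) :=
  hf.comp_measurePreserving (measurePreserving_dilation σ)

theorem L2Tendsto.dilation {ι F : Type*} {l : Filter ι} [NormedAddCommGroup F]
    {f : ι → Eu n → F} {g : Eu n → F} (h : L2Tendsto (invMeasure n a) l f g)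
    (hm : ∀ i, AEStronglyMeasurable (fun x => f i x - g x) (invMeasure n a)) (σ : ℝ) :
    L2Tendsto (invMeasure n a) l (fun i x => f i (Real.exp σ • x))
      (fun x => g (Real.exp σ • x)) := by
  unfold L2Tendsto at h ⊢
  simpa only [← eLpNorm_dilation (hm _) σ 2] using h

theorem InEnergySpace.dilation (ha : -1 < a) {v : Eu n → ℝ} {P : Eu n → Eu n}
    (h : InEnergySpace a v P) (σ : ℝ) :
    InEnergySpace a (fun x => v (Real.exp σ • x)) (fun x => P (Real.exp σ • x)) := by
  obtain ⟨η, h1, h2, h3⟩ := h.approx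
  refine ⟨MemLp.dilation h.memLp σ, MemLp.dilation h.memLp_grad σ, fun j x => η j (Real.exp σ • x),
    fun j => (h1 j).dilation σ,
    h2.dilation (fun j => (((h1 j).memLp ha 2).sub h.memLp).1) σ, ?_⟩
  have := h3.dilation (fun j => (((h1 j).memLp_sgrad ha 2).sub h.memLp_grad).1) σ
  refine this.of_norm_le 1 (Eventually.of_forall fun j => Eventually.of_forall fun x => ?_)
  rw [sgrad_dilation (h1 j).differentiable, one_mul]

theorem L2Tendsto.tendsto_eLpNorm {X ι F : Type*} [MeasurableSpace X] {μ : Measure X} {l : Filter ι}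
    [NormedAddCommGroup F] {f : ι → X → F} {g : X → F} (h : L2Tendsto μ l f g)
    (hf : ∀ i, MemLp (f i) 2 μ) (hg : MemLp g 2 μ) :
    Tendsto (fun i => eLpNorm (f i) 2 μ) l (𝓝 (eLpNorm g 2 μ)) := by
  have h1 := ((h.toLp hf hg).nnnorm)
  have h2 := (ENNReal.continuous_coe.tendsto _).comp h1
  have h3 : ∀ {f : X → F} (hf : MemLp f 2 μ), ((‖hf.toLp f‖₊ : NNReal) : ℝ≥0∞) = eLpNorm f 2 μ := by
    intro f hf
    rw [← enorm_eq_nnnorm, Lp.enorm_toLp]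
  simpa only [Function.comp_def, h3] using h2

theorem L2Tendsto.inner_rdir {ι : Type*} {l : Filter ι} {f : ι → Eu n → Eu n} {g : Eu n → Eu n}
    (h : L2Tendsto (invMeasure n a) l f g) :
    L2Tendsto (invMeasure n a) l (fun i x => inner ℝ (f i x) (rdir x))
      (fun x => inner ℝ (g x) (rdir x)) := by
  refine h.of_norm_le 1 (Eventually.of_forall fun j => Eventually.of_forall fun x => ?_)
  rw [← inner_sub_left, one_mul]
  exact (norm_inner_le_norm _ _).trans (mul_le_of_le_one_right (norm_nonneg _) (norm_rdir_le x))

/-- Both sides converge along an approximating sequence, so the estimate for test functions passes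
to the limit. -/
theorem InEnergySpace.eLpNorm_dilation_sub_le (ha : -1 < a) {v : Eu n → ℝ} {P : Eu n → Eu n}
    (h : InEnergySpace a v P) (σ : ℝ) :
    eLpNorm (fun x => v (Real.exp σ • x) - v x) 2 (invMeasure n a)
      ≤ ENNReal.ofReal |σ| * eLpNorm (fun x => inner ℝ (P x) (rdir x)) 2 (invMeasure n a) := by
  obtain ⟨η, h1, h2, h3⟩ := h.approx
  have hm := fun j => (((h1 j).memLp ha 2).sub h.memLp).1
  have h4 : L2Tendsto (invMeasure n a) atTop (fun j x => η j (Real.exp σ • x) - η j x)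
      (fun x => v (Real.exp σ • x) - v x) := by
    refine (h2.dilation hm σ).of_norm_le_add h2
      (fun j => (((MemLp.dilation ((h1 j).memLp ha 2) σ)).sub (MemLp.dilation h.memLp σ)).1) hm 1
      (Eventually.of_forall fun j => Eventually.of_forall fun x => ?_)
    rw [one_mul, sub_sub_sub_comm]
    exact norm_sub_le _ _
  have h5 := h4.tendsto_eLpNorm (fun j => (MemLp.dilation ((h1 j).memLp ha 2) σ).sub ((h1 j).memLp ha 2))
    ((MemLp.dilation h.memLp σ).sub h.memLp)
  have h6 := (h3.inner_rdir).tendsto_eLpNorm (fun j => MemLp.inner_rdir ((h1 j).memLp_sgrad ha 2))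
    (MemLp.inner_rdir h.memLp_grad)
  exact le_of_tendsto_of_tendsto' h5
    (ENNReal.Tendsto.const_mul h6 (Or.inr ENNReal.ofReal_ne_top))
    fun j => (h1 j).eLpNorm_dilation_sub_le σ

theorem IsTest.mul {η ξ : Eu n → ℝ} (h : IsTest η) (h' : IsTest ξ) :
    IsTest fun x => η x * ξ x :=
  contDiff_mul_of_notMem (fun _ _ => h.contDiff.contDiffAt) h'

/-- The function k(log |x|) η² is again a test function, so its radial derivative 2kη x·∇η + k'η²
integrates to zero. -/
theorem IsTest.integral_radial_mul_euler (ha : -1 < a) {η : Eu n → ℝ} (h : IsTest η) {k : ℝ → ℝ}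
    (hk : ContDiff ℝ ∞ k) :
    ∫ x, radial k x * η x * euler η x ∂(invMeasure n a)
      = -(1 / 2) * ∫ x, radial (deriv k) x * η x ^ 2 ∂(invMeasure n a) := by
  have hk' : ContDiff ℝ ∞ (deriv k) := (contDiff_infty_iff_deriv.1 hk).2
  have h1 := integral_euler ha ((h.mul h).radial_mul hk)
  have h2 : ∀ x ≠ 0, euler (fun x => radial k x * (η x * η x)) x
      = 2 * (radial k x * η x * euler η x) + radial (deriv k) x * η x ^ 2 := by
    intro x hx
    rw [euler, sgrad_radial_mul (hk.differentiable (by simp)) (h.mul h).differentiable,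
      sgrad_mul (h.differentiable x) (h.differentiable x), inner_add_left, real_inner_smul_left,
      real_inner_smul_left, real_inner_self_eq_norm_sq, norm_rdir hx, inner_add_left,
      real_inner_smul_left, euler]
    ring
  have i1 : Integrable (fun x => radial k x * η x * euler η x) (invMeasure n a) :=
    MemLp.integrable_mul_real ((h.radial_mul hk).memLp ha 2) (MemLp.inner_rdir (h.memLp_sgrad ha 2))
  have i2 : Integrable (fun x => radial (deriv k) x * η x ^ 2) (invMeasure n a) := by
    refine (MemLp.integrable_mul_real ((h.radial_mul hk').memLp ha 2) (h.memLp ha 2)).congr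
      (Eventually.of_forall fun x => ?_)
    simp only; ring
  have h3 : ∫ x, euler (fun x => radial k x * (η x * η x)) x ∂(invMeasure n a)
      = ∫ x, (2 * (radial k x * η x * euler η x) + radial (deriv k) x * η x ^ 2)
        ∂(invMeasure n a) := by
    apply integral_congr_ae
    filter_upwards [ae_invMeasure_mem_upperHalf] with x hx using h2 x (ne_zero_of_mem_upperHalf hx)
  rw [h1, integral_add (i1.const_mul 2) i2, integral_const_mul] at h3
  linarith

/-- Integration by parts in the radial direction. -/
theorem InEnergySpace.integral_radial_mul (ha : -1 < a) {v : Eu n → ℝ} {P : Eu n → Eu n}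
    (h : InEnergySpace a v P) {k : ℝ → ℝ} (hk : ContDiff ℝ ∞ k) (hc : HasCompactSupport k) :
    ∫ x, radial k x * v x * inner ℝ (P x) (rdir x) ∂(invMeasure n a)
      = -(1 / 2) * ∫ x, radial (deriv k) x * v x ^ 2 ∂(invMeasure n a) := by
  obtain ⟨C, hC, hC', -⟩ := exists_bound_of_contDiff_compact hk hc
  have hk' : ContDiff ℝ ∞ (deriv k) := (contDiff_infty_iff_deriv.1 hk).2
  obtain ⟨η, h1, h2, h3⟩ := h.approx
  have hmul : ∀ k : ℝ → ℝ, (∀ t, |k t| ≤ C) →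
      L2Tendsto (invMeasure n a) atTop (fun j x => radial k x * η j x) (fun x => radial k x * v x) := by
    intro k hC
    refine h2.of_norm_le C (Eventually.of_forall fun j => Eventually.of_forall fun x => ?_)
    rw [← mul_sub, norm_mul]
    exact mul_le_mul_of_nonneg_right (hC _) (norm_nonneg _)
  have l1 := (hmul k hC).integral_mul h3.inner_rdir (fun j => ((h1 j).radial_mul hk).memLp ha 2)
    (MemLp.radial_mul h.memLp hk.continuous hC) (fun j => MemLp.inner_rdir ((h1 j).memLp_sgrad ha 2))
    (MemLp.inner_rdir h.memLp_grad)
  have l2 := (hmul _ hC').integral_mul h2 (fun j => ((h1 j).radial_mul hk').memLp ha 2)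
    (MemLp.radial_mul h.memLp hk'.continuous hC') (fun j => (h1 j).memLp ha 2) h.memLp
  have l3 := l2.const_mul (-(1 / 2))
  have e : ∀ j, ∫ x, radial k x * η j x * inner ℝ (sgrad (η j) x) (rdir x) ∂(invMeasure n a)
      = -(1 / 2) * ∫ x, radial (deriv k) x * η j x * η j x ∂(invMeasure n a) := by
    intro j
    have := (h1 j).integral_radial_mul_euler ha hk
    simp only [pow_two, ← mul_assoc] at this
    exact this
  simp only [e] at l1
  have := tendsto_nhds_unique l1 l3
  simp only [pow_two, ← mul_assoc] at this ⊢
  exact this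

end EnergySpace

/-! ### Difference quotients along dilations and the Rellich identity -/

section DifferenceQuotients

open Filter Topology

variable {n : ℕ} {a : ℝ}

theorem L2Tendsto.of_dominated {X ι F : Type*} [MeasurableSpace X] {μ : Measure X} {l : Filter ι}
    [l.IsCountablyGenerated] [NormedAddCommGroup F] {f : ι → X → F} {g : X → F} {b : X → ℝ}
    (hm : ∀ i, MemLp (fun x => f i x - g x) 2 μ) (hb : MemLp b 2 μ)
    (hle : ∀ᶠ i in l, ∀ᵐ x ∂μ, ‖f i x - g x‖ ≤ b x)
    (hlim : ∀ᵐ x ∂μ, Tendsto (fun i => f i x) l (𝓝 (g x))) : L2Tendsto μ l f g := by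
  refine L2Tendsto.of_tendsto_sq_integral hm ?_
  have h := tendsto_integral_filter_of_dominated_convergence (μ := μ) (l := l)
    (F := fun i x => ‖f i x - g x‖ ^ 2) (f := fun _ => (0 : ℝ)) (fun x => b x ^ 2)
    (Eventually.of_forall fun i => (hm i).1.norm.pow 2) ?_ hb.integrable_sq ?_
  · simpa using h
  · filter_upwards [hle] with i hi
    filter_upwards [hi] with x hx
    rw [Real.norm_of_nonneg (by positivity)]
    exact pow_le_pow_left₀ (norm_nonneg _) hx 2
  · filter_upwards [hlim] with x hx
    have := ((hx.sub_const (g x)).norm).pow 2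
    simpa using this

/-- The symmetric difference quotient along dilations. -/
noncomputable def dilQuot (σ : ℝ) (f : Eu n → ℝ) (x : Eu n) : ℝ :=
  (2 * σ)⁻¹ * (f (Real.exp σ • x) - f (Real.exp (-σ) • x))

theorem tendsto_symm_quotient {g : ℝ → ℝ} {g' : ℝ} (h : HasDerivAt g g' 0) :
    Tendsto (fun σ => (2 * σ)⁻¹ * (g σ - g (-σ))) (𝓝[≠] 0) (𝓝 g') := by
  have h1 : HasDerivAt (fun σ => g σ - g (-σ)) (g' - -g') 0 := by
    have h2 : HasDerivAt (fun σ => g (-σ)) (-g') 0 := by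
      have h3 : HasDerivAt g g' (-(0 : ℝ)) := by simpa using h
      have h4 := h3.comp (0 : ℝ) (hasDerivAt_neg (0 : ℝ))
      rw [mul_neg_one] at h4
      exact h4
    exact h.sub h2
  have h2 := (hasDerivAt_iff_tendsto_slope_zero.1 h1).const_mul (1 / 2)
  refine (h2.congr fun σ => ?_).trans (le_of_eq (by ring_nf))
  simp
  ring

/-- Pointwise this is differentiation along the flow. The mean value inequality bounds the quotients
with |σ| ≤ 1 by a multiple of the indicator of one annulus, which has finite invariant measure, so
dominated convergence applies. -/
theorem IsTest.tendsto_dilQuot (ha : -1 < a) {η : Eu n → ℝ} (h : IsTest η) :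
    L2Tendsto (invMeasure n a) (𝓝[≠] 0) (fun σ => dilQuot σ η) (euler η) := by
  obtain ⟨r₁, r₂, C, h1, -, h3, -, h5⟩ := h.exists_bound
  set A := annulus n (Real.exp (-1) * r₁) (Real.exp 1 * r₂) with hA
  have hAm : MeasurableSet A := measurableSet_annulus _ _
  have hC0 : 0 ≤ C := (norm_nonneg _).trans (h3 0)
  have hbd : ∀ σ : ℝ, |σ| ≤ 1 → ∀ x, |euler η (Real.exp σ • x)| ≤ A.indicator (fun _ => C) x := by
    intro σ hσ x
    by_cases hx : Real.exp σ • x ∈ annulus n r₁ r₂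
    · rw [Set.indicator_of_mem (dilation_mem_annulus hσ h1 hx)]
      exact (abs_euler_le _ _).trans (h3 _)
    · have : euler η (Real.exp σ • x) = 0 := by simp [euler, h5 _ hx]
      rw [this, abs_zero]
      exact Set.indicator_nonneg (fun _ _ => hC0) x
  have hb : MemLp (A.indicator fun _ => C) 2 (invMeasure n a) :=
    memLp_indicator_const 2 hAm C (Or.inr (invMeasure_annulus_lt_top ha (by positivity) _).ne)
  refine L2Tendsto.of_dominated (fun σ => ?_) (hb.const_mul 2) ?_ ?_
  · refine MemLp.sub ?_ (MemLp.inner_rdir (h.memLp_sgrad ha 2))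
    exact (((h.dilation σ).memLp ha 2).sub ((h.dilation (-σ)).memLp ha 2)).const_mul _
  · have h01 : ∀ᶠ σ : ℝ in 𝓝[≠] 0, |σ| ≤ 1 := by
      refine eventually_nhdsWithin_of_eventually_nhds ?_
      filter_upwards [Metric.ball_mem_nhds (0 : ℝ) one_pos] with σ hσ
      simpa using (mem_ball_zero_iff.1 hσ).le
    filter_upwards [h01, self_mem_nhdsWithin] with σ hσ hσ0
    have hσ0 : σ ≠ 0 := hσ0
    refine Eventually.of_forall fun x => ?_
    have h6 : |η (Real.exp σ • x) - η (Real.exp (-σ) • x)|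
        ≤ A.indicator (fun _ => C) x * |σ - -σ| := by
      refine Convex.norm_image_sub_le_of_norm_hasDerivWithin_le (s := Set.Icc (-|σ|) |σ|)
        (f := fun ρ => η (Real.exp ρ • x))
        (fun ρ _ => (hasDerivAt_dilation h.differentiable x ρ).hasDerivWithinAt)
        (fun ρ hρ => hbd ρ ((abs_le.2 hρ).trans hσ) x) (convex_Icc _ _) ?_ ?_
      · exact abs_le.1 (by simp)
      · exact abs_le.1 (by simp)
    have h7 : |dilQuot σ η x| ≤ A.indicator (fun _ => C) x := by
      rw [dilQuot, abs_mul, abs_inv, inv_mul_le_iff₀ (by positivity)]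
      refine h6.trans (le_of_eq ?_)
      rw [sub_neg_eq_add, ← two_mul, mul_comm]
    have h8 : |euler η x| ≤ A.indicator (fun _ => C) x := by
      simpa using hbd 0 (by simp) x
    rw [two_mul, Real.norm_eq_abs]
    exact (abs_sub _ _).trans (add_le_add h7 h8)
  · refine Eventually.of_forall fun x => ?_
    have := hasDerivAt_dilation h.differentiable x 0
    simp only [Real.exp_zero, one_smul] at this
    exact tendsto_symm_quotient this

theorem IsTest.tendsto_sgrad_dilation (ha : -1 < a) {η : Eu n → ℝ} (h : IsTest η) :
    L2Tendsto (invMeasure n a) (𝓝 0) (fun (σ : ℝ) x => sgrad η (Real.exp σ • x)) (sgrad η) := by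
  obtain ⟨r₁, r₂, C, h1, -, h3, -, h5⟩ := h.exists_bound
  set A := annulus n (Real.exp (-1) * r₁) (Real.exp 1 * r₂) with hA
  have hAm : MeasurableSet A := measurableSet_annulus _ _
  have hC0 : 0 ≤ C := (norm_nonneg _).trans (h3 0)
  have hbd : ∀ σ : ℝ, |σ| ≤ 1 → ∀ x, ‖sgrad η (Real.exp σ • x)‖ ≤ A.indicator (fun _ => C) x := by
    intro σ hσ x
    by_cases hx : Real.exp σ • x ∈ annulus n r₁ r₂
    · rw [Set.indicator_of_mem (dilation_mem_annulus hσ h1 hx)]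
      exact h3 _
    · rw [h5 _ hx, norm_zero]
      exact Set.indicator_nonneg (fun _ _ => hC0) x
  have hb : MemLp (A.indicator fun _ => C) 2 (invMeasure n a) :=
    memLp_indicator_const 2 hAm C (Or.inr (invMeasure_annulus_lt_top ha (by positivity) _).ne)
  refine L2Tendsto.of_dominated (fun σ => ?_) (hb.const_mul 2) ?_ ?_
  · exact (MemLp.dilation (h.memLp_sgrad ha 2) σ).sub (h.memLp_sgrad ha 2)
  · filter_upwards [Metric.ball_mem_nhds (0 : ℝ) one_pos] with σ hσ
    refine Eventually.of_forall fun x => ?_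
    have h8 := hbd 0 (by simp) x
    rw [Real.exp_zero, one_smul] at h8
    rw [two_mul]
    exact (norm_sub_le _ _).trans (add_le_add (hbd σ (by simpa using (mem_ball_zero_iff.1 hσ).le) x) h8)
  · refine Eventually.of_forall fun x => ?_
    have : Continuous fun σ : ℝ => sgrad η (Real.exp σ • x) := h.continuous_sgrad.comp (by fun_prop)
    simpa using this.tendsto 0

/-- Dilations are L² isometries, so the approximation error by test functions is the same for all σ,
and strong continuity extends to the closure. -/
theorem InEnergySpace.tendsto_grad_dilation (ha : -1 < a) {v : Eu n → ℝ} {P : Eu n → Eu n}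
    (h : InEnergySpace a v P) :
    L2Tendsto (invMeasure n a) (𝓝 0) (fun (σ : ℝ) x => P (Real.exp σ • x)) P := by
  obtain ⟨η, h1, h2, h3⟩ := h.approx
  have hm := fun j => (((h1 j).memLp_sgrad ha 2).sub h.memLp_grad).1
  refine L2Tendsto.of_approx (fun j => (h1 j).tendsto_sgrad_dilation ha) _ h3
    (fun j => Eventually.of_forall fun σ => ?_) (fun j => le_rfl)
    (fun σ j => ((MemLp.dilation h.memLp_grad σ).sub
      (MemLp.dilation ((h1 j).memLp_sgrad ha 2) σ)).1)
    (fun σ j => ((MemLp.dilation ((h1 j).memLp_sgrad ha 2) σ).sub ((h1 j).memLp_sgrad ha 2)).1) hm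
  refine le_trans ?_ (eLpNorm_dilation (hm j) σ 2).le
  exact (eLpNorm_sub_comm (fun x => P (Real.exp σ • x)) (fun x => sgrad (η j) (Real.exp σ • x)) _ _).le

theorem dilQuot_sub (σ : ℝ) (f g : Eu n → ℝ) (x : Eu n) :
    dilQuot σ f x - dilQuot σ g x = dilQuot σ (fun x => f x - g x) x := by
  simp only [dilQuot]; ring

theorem MemLp.dilQuot {v : Eu n → ℝ} (h : MemLp v 2 (invMeasure n a)) (σ : ℝ) :
    MemLp (dilQuot σ v) 2 (invMeasure n a) :=
  ((MemLp.dilation h σ).sub (MemLp.dilation h (-σ))).const_mul _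

/-- Inserting v(x) splits the symmetric difference into two increments, each of norm at most |σ|
times that of the radial derivative, which exactly cancels the denominator 2|σ|. -/
theorem InEnergySpace.eLpNorm_dilQuot_le (ha : -1 < a) {v : Eu n → ℝ} {P : Eu n → Eu n}
    (h : InEnergySpace a v P) {σ : ℝ} (hσ : σ ≠ 0) :
    eLpNorm (dilQuot σ v) 2 (invMeasure n a)
      ≤ eLpNorm (fun x => inner ℝ (P x) (rdir x)) 2 (invMeasure n a) := by
  have h1 := h.eLpNorm_dilation_sub_le ha σ
  have h2 := h.eLpNorm_dilation_sub_le ha (-σ)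
  set N := eLpNorm (fun x => inner ℝ (P x) (rdir x)) 2 (invMeasure n a)
  have e : dilQuot σ v = (2 * σ)⁻¹ • ((fun x => v (Real.exp σ • x) - v x)
      - fun x => v (Real.exp (-σ) • x) - v x) := by
    ext x; simp [dilQuot]
  rw [e, eLpNorm_const_smul]
  calc _ ≤ ‖(2 * σ)⁻¹‖ₑ * (ENNReal.ofReal |σ| * N + ENNReal.ofReal |σ| * N) := by
        gcongr
        refine (eLpNorm_sub_le ((MemLp.dilation h.memLp σ).sub h.memLp).1
          ((MemLp.dilation h.memLp (-σ)).sub h.memLp).1 (by norm_num)).trans (add_le_add h1 ?_)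
        rw [abs_neg] at h2
        exact h2
    _ = N := by
        rw [← two_mul, ← mul_assoc, ← mul_assoc, Real.enorm_eq_ofReal_abs,
          ← ENNReal.ofReal_ofNat, ← ENNReal.ofReal_mul (by positivity),
          ← ENNReal.ofReal_mul (by positivity)]
        have : |(2 * σ)⁻¹| * 2 * |σ| = 1 := by
          rw [abs_inv, abs_mul, abs_two]
          have := abs_pos.2 hσ
          field_simp
        rw [this, ENNReal.ofReal_one, one_mul]

/-- The quotient of v - η_j is bounded by the radial derivative of v - η_j uniformly in σ, so
convergence for test functions extends to the energy space. -/
theorem InEnergySpace.tendsto_dilQuot (ha : -1 < a) {v : Eu n → ℝ} {P : Eu n → Eu n}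
    (h : InEnergySpace a v P) :
    L2Tendsto (invMeasure n a) (𝓝[≠] 0) (fun σ => dilQuot σ v)
      (fun x => inner ℝ (P x) (rdir x)) := by
  obtain ⟨η, h1, h2, h3⟩ := h.approx
  have hm := fun j => ((MemLp.inner_rdir ((h1 j).memLp_sgrad ha 2)).sub
    (MemLp.inner_rdir h.memLp_grad)).1
  refine L2Tendsto.of_approx (fun j => (h1 j).tendsto_dilQuot ha) _ h3.inner_rdir
    (fun j => ?_) (fun j => le_rfl)
    (fun σ j => ((MemLp.dilQuot h.memLp σ).sub (MemLp.dilQuot ((h1 j).memLp ha 2) σ)).1)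
    (fun σ j => ((MemLp.dilQuot ((h1 j).memLp ha 2) σ).sub
      (MemLp.inner_rdir ((h1 j).memLp_sgrad ha 2))).1) hm
  filter_upwards [self_mem_nhdsWithin] with σ hσ
  have hw := h.sub ha ((h1 j).inEnergySpace ha)
  have h4 := hw.eLpNorm_dilQuot_le ha hσ
  simp only [dilQuot_sub]
  refine h4.trans (le_of_eq ?_)
  rw [← eLpNorm_neg]
  congr 1
  ext x
  simp [inner_sub_left]

/-- A weak equation against test functions extends to the energy space. -/
theorem InEnergySpace.weak_eq (ha : -1 < a) {P : Eu n → Eu n} {f : Eu n → ℝ}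
    (hP : MemLp P 2 (invMeasure n a)) (hf : MemLp f 2 (invMeasure n a))
    (heq : ∀ ξ : Eu n → ℝ, IsTest ξ →
      ∫ x, inner ℝ (P x) (sgrad ξ x) ∂(invMeasure n a) = ∫ x, f x * ξ x ∂(invMeasure n a))
    {w : Eu n → ℝ} {Q : Eu n → Eu n} (hw : InEnergySpace a w Q) :
    ∫ x, inner ℝ (P x) (Q x) ∂(invMeasure n a) = ∫ x, f x * w x ∂(invMeasure n a) := by
  obtain ⟨η, h1, h2, h3⟩ := hw.approx
  have l1 := (L2Tendsto.const (l := atTop) P).integral_inner h3 (fun _ => hP) hP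
    (fun j => (h1 j).memLp_sgrad ha 2) hw.memLp_grad
  have l2 := (L2Tendsto.const (l := atTop) f).integral_mul h2 (fun _ => hf) hf
    (fun j => (h1 j).memLp ha 2) hw.memLp
  simp only [heq _ (h1 _)] at l1
  exact tendsto_nhds_unique l1 l2

/-- The energy identity. -/
theorem InEnergySpace.energy_identity (ha : -1 < a) {v : Eu n → ℝ} {P : Eu n → Eu n}
    (h : InEnergySpace a v P) {f : Eu n → ℝ} (hf : MemLp f 2 (invMeasure n a))
    (heq : ∀ ξ : Eu n → ℝ, IsTest ξ →
      ∫ x, inner ℝ (P x) (sgrad ξ x) ∂(invMeasure n a) = ∫ x, f x * ξ x ∂(invMeasure n a))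
    {k : ℝ → ℝ} (hk : ContDiff ℝ ∞ k) (hc : HasCompactSupport k) :
    ∫ x, radial k x * ‖P x‖ ^ 2 ∂(invMeasure n a)
        + ∫ x, radial (deriv k) x * v x * inner ℝ (P x) (rdir x) ∂(invMeasure n a)
      = ∫ x, f x * (radial k x * v x) ∂(invMeasure n a) := by
  obtain ⟨C, hC, hC', -⟩ := exists_bound_of_contDiff_compact hk hc
  have hk' : ContDiff ℝ ∞ (deriv k) := (contDiff_infty_iff_deriv.1 hk).2
  rw [← InEnergySpace.weak_eq ha h.memLp_grad hf heq (h.radial_mul ha hk hC hC'), ← integral_add]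
  · congr 1
    ext x
    rw [inner_add_right, real_inner_smul_right, real_inner_smul_right, real_inner_self_eq_norm_sq]
  · refine (MemLp.integrable_inner_real h.memLp_grad
      (MemLp.radial_smul h.memLp_grad hk.continuous hC)).congr (Eventually.of_forall fun x => ?_)
    simp only [real_inner_smul_right, real_inner_self_eq_norm_sq]
  · exact MemLp.integrable_mul_real (MemLp.radial_mul h.memLp hk'.continuous hC')
      (MemLp.inner_rdir h.memLp_grad)

/-- A quantitative Taylor bound: s ↦ k(t - s) + s k'(t) has derivative at most C|s|. The limit is
-k'/2 because the increment is one-sided while the denominator is that of a symmetric quotient. -/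
theorem abs_shift_quotient_le {k : ℝ → ℝ} (hk : ContDiff ℝ ∞ k) {C : ℝ}
    (hC : ∀ t, |deriv (deriv k) t| ≤ C) {σ : ℝ} (hσ : σ ≠ 0) (t : ℝ) :
    |(2 * σ)⁻¹ * (k (t - σ) - k t) - -(1 / 2) * deriv k t| ≤ C * |σ| := by
  have hk' : ContDiff ℝ ∞ (deriv k) := (contDiff_infty_iff_deriv.1 hk).2
  have hd := hk.differentiable (by simp)
  have hd' := hk'.differentiable (by simp)
  have hC0 : 0 ≤ C := (abs_nonneg _).trans (hC 0)
  have h1 : ∀ s : ℝ, |deriv k t - deriv k (t - s)| ≤ C * |s| := fun s => by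
    have := Convex.norm_image_sub_le_of_norm_deriv_le (f := deriv k) (s := Set.univ)
      (x := t - s) (y := t) (fun x _ => hd' x) (fun x _ => hC x) convex_univ trivial trivial
    simpa using this
  have h2 : ∀ s, HasDerivAt (fun s => k (t - s) + s * deriv k t) (deriv k t - deriv k (t - s)) s := by
    intro s
    have h3 := ((hd (t - s)).hasDerivAt.comp s ((hasDerivAt_const s t).sub (hasDerivAt_id s))).add
      ((hasDerivAt_id s).mul_const (deriv k t))
    refine (h3.congr_deriv ?_)
    simp; ring
  have h3 := Convex.norm_image_sub_le_of_norm_hasDerivWithin_le (s := Set.Icc (-|σ|) |σ|)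
    (x := 0) (y := σ) (C := C * |σ|) (fun s _ => (h2 s).hasDerivWithinAt)
    (fun s hs => (h1 s).trans (mul_le_mul_of_nonneg_left (abs_le.2 hs) hC0)) (convex_Icc _ _)
    (abs_le.1 (by simp)) (abs_le.1 le_rfl)
  simp only [sub_zero, zero_mul, add_zero, Real.norm_eq_abs] at h3
  have h4 : (2 * σ)⁻¹ * (k (t - σ) - k t) - -(1 / 2) * deriv k t
      = (2 * σ)⁻¹ * (k (t - σ) + σ * deriv k t - k t) := by
    field_simp; ring
  rw [h4, abs_mul, abs_inv, abs_mul, abs_two, inv_mul_le_iff₀ (by positivity)]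
  nlinarith [mul_nonneg hC0 (mul_nonneg (abs_nonneg σ) (abs_nonneg σ))]

theorem norm_dilation_eq (σ : ℝ) (x : Eu n) : ‖Real.exp σ • x‖ = Real.exp σ * ‖x‖ := by
  rw [norm_smul, Real.norm_of_nonneg (Real.exp_pos σ).le]

theorem radial_dilation (k : ℝ → ℝ) (σ : ℝ) {x : Eu n} (hx : x ≠ 0) :
    radial k (Real.exp σ • x) = radial (fun t => k (t + σ)) x := by
  rw [radial, radial, norm_dilation_eq, Real.log_mul (Real.exp_pos σ).ne' (norm_ne_zero_iff.2 hx),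
    Real.log_exp, add_comm]

/-- Passing to the limit in the gradient part of the difference quotient of a weak solution. -/
theorem InEnergySpace.tendsto_integral_grad_quotient (ha : -1 < a) {v : Eu n → ℝ} {P : Eu n → Eu n}
    (h : InEnergySpace a v P) {k : ℝ → ℝ} (hk : ContDiff ℝ ∞ k) (hc : HasCompactSupport k) :
    Tendsto (fun σ : ℝ => ∫ x, inner ℝ (P x)
        (radial k x • ((2 * σ)⁻¹ • (P (Real.exp σ • x) - P (Real.exp (-σ) • x)))) ∂(invMeasure n a))
      (𝓝[≠] 0) (𝓝 (-(1 / 2) * ∫ x, radial (deriv k) x * ‖P x‖ ^ 2 ∂(invMeasure n a))) := by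
  obtain ⟨C, hC, hC', hC''⟩ := exists_bound_of_contDiff_compact hk hc
  have hC0 : 0 ≤ C := (abs_nonneg _).trans (hC 0)
  have hk' : ContDiff ℝ ∞ (deriv k) := (contDiff_infty_iff_deriv.1 hk).2
  set ν := invMeasure n a with hν
  set D : ℝ → ℝ → ℝ := fun σ t => (2 * σ)⁻¹ * (k (t - σ) - k t) with hD
  have hDc : ∀ σ, Continuous (D σ) := fun σ => by
    have := hk.continuous
    fun_prop
  have hDb : ∀ σ t, |D σ t| ≤ |(2 * σ)⁻¹| * (C + C) := fun σ t => by
    rw [hD, abs_mul]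
    exact mul_le_mul_of_nonneg_left ((abs_sub _ _).trans (add_le_add (hC _) (hC _))) (abs_nonneg _)
  have hPd : ∀ σ : ℝ, MemLp (fun x => P (Real.exp σ • x)) 2 ν := fun σ => MemLp.dilation h.memLp_grad σ
  -- Substituting e^{-σ} x for x in the term with P(e^σ x) turns both terms into pairings of
  -- P(e^{-σ} x) with P(x). The difference then falls on the cutoff, so no derivative of P is ever
  -- needed.
  have key : ∀ σ : ℝ, ∫ x, inner ℝ (P x)
      (radial k x • ((2 * σ)⁻¹ • (P (Real.exp σ • x) - P (Real.exp (-σ) • x)))) ∂ν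
      = ∫ x, inner ℝ (radial (D σ) x • P (Real.exp (-σ) • x)) (P x) ∂ν := by
    intro σ
    have i1 : ∀ σ : ℝ, Integrable (fun x => inner ℝ (P x) (radial k x • P (Real.exp σ • x))) ν :=
      fun σ => MemLp.integrable_inner_real h.memLp_grad
        (MemLp.radial_smul (hPd σ) hk.continuous hC)
    have hkc : Continuous fun t => k (t + -σ) := by
      have := hk.continuous
      fun_prop
    have i2 : Integrable (fun x => inner ℝ (P (Real.exp (-σ) • x))
        (radial (fun t => k (t + -σ)) x • P x)) ν :=
      MemLp.integrable_inner_real (hPd _) (MemLp.radial_smul h.memLp_grad hkc fun t => hC _)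
    have e1 : ∫ x, inner ℝ (P x) (radial k x • P (Real.exp σ • x)) ∂ν
        = ∫ x, inner ℝ (P (Real.exp (-σ) • x)) (radial (fun t => k (t + -σ)) x • P x) ∂ν := by
      rw [← (measurePreserving_dilation (a := a) (-σ)).integral_comp
        (Homeomorph.smulOfNeZero (Real.exp (-σ)) (Real.exp_pos (-σ)).ne').measurableEmbedding
        (fun x => inner ℝ (P x) (radial k x • P (Real.exp σ • x)))]
      apply integral_congr_ae
      filter_upwards [ae_invMeasure_mem_upperHalf] with x hx
      rw [radial_dilation k _ (ne_zero_of_mem_upperHalf hx), smul_smul, ← Real.exp_add]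
      simp
    have e2 : ∀ x, inner ℝ (P x)
        (radial k x • ((2 * σ)⁻¹ • (P (Real.exp σ • x) - P (Real.exp (-σ) • x))))
        = (2 * σ)⁻¹ * (inner ℝ (P x) (radial k x • P (Real.exp σ • x))
          - inner ℝ (P x) (radial k x • P (Real.exp (-σ) • x))) := by
      intro x
      simp only [real_inner_smul_right, inner_sub_right]
      ring
    simp only [e2]
    rw [integral_const_mul, integral_sub (i1 _) (i1 _), e1, ← integral_sub i2 (i1 _),
      ← integral_const_mul]
    congr 1
    ext x
    simp only [hD, radial, real_inner_smul_right, real_inner_smul_left, ← sub_eq_add_neg]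
    rw [real_inner_comm (P x)]
    ring
  simp only [key]
  have hneg : Tendsto (fun σ : ℝ => -σ) (𝓝[≠] 0) (𝓝 0) :=
    (by simpa using (continuous_neg.tendsto (0 : ℝ)) : Tendsto (fun σ : ℝ => -σ) (𝓝 0) (𝓝 0)).mono_left
      nhdsWithin_le_nhds
  have hconv : L2Tendsto ν (𝓝[≠] 0) (fun (σ : ℝ) x => P (Real.exp (-σ) • x)) P :=
    (h.tendsto_grad_dilation ha).comp hneg
  have hsmall : L2Tendsto ν (𝓝[≠] 0) (fun (σ : ℝ) x => σ • P (Real.exp (-σ) • x)) (fun _ => 0) := by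
    have e : ∀ σ : ℝ, eLpNorm (fun x => σ • P (Real.exp (-σ) • x) - 0) 2 ν
        = ‖σ‖ₑ * eLpNorm P 2 ν := by
      intro σ
      simp only [sub_zero]
      rw [← eLpNorm_dilation h.memLp_grad.1 (-σ) 2]
      exact eLpNorm_const_smul σ _ _ _
    have h0 : Tendsto (fun σ : ℝ => ‖σ‖ₑ * eLpNorm P 2 ν) (𝓝[≠] 0) (𝓝 0) := by
      have h1 : Tendsto (fun σ : ℝ => ‖σ‖ₑ) (𝓝[≠] 0) (𝓝 0) := by
        have := (continuous_enorm.tendsto (0 : ℝ))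
        rw [enorm_zero] at this
        exact this.mono_left nhdsWithin_le_nhds
      simpa using ENNReal.Tendsto.mul_const h1 (Or.inr h.memLp_grad.2.ne)
    unfold L2Tendsto
    simpa only [e] using h0
  -- The error splits into the Taylor error of the cutoff, of size |σ| |P(e^{-σ} x)|, and the
  -- continuity error P(e^{-σ} x) - P(x).
  have hmain : L2Tendsto ν (𝓝[≠] 0) (fun σ x => radial (D σ) x • P (Real.exp (-σ) • x))
      (fun x => (-(1 / 2) * radial (deriv k) x) • P x) := by
    refine hsmall.of_norm_le_add hconv (fun σ => ((hPd (-σ)).const_smul σ |>.sub MemLp.zero).1)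
      (fun σ => ((hPd (-σ)).sub h.memLp_grad).1) C ?_
    filter_upwards [self_mem_nhdsWithin] with σ hσ
    refine Eventually.of_forall fun x => ?_
    have e : radial (D σ) x • P (Real.exp (-σ) • x) - (-(1 / 2) * radial (deriv k) x) • P x
        = (radial (D σ) x - -(1 / 2) * radial (deriv k) x) • P (Real.exp (-σ) • x)
          + (-(1 / 2) * radial (deriv k) x) • (P (Real.exp (-σ) • x) - P x) := by
      rw [sub_smul, smul_sub]; abel
    rw [e, mul_add, sub_zero]
    refine (norm_add_le _ _).trans (add_le_add ?_ ?_)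
    · rw [norm_smul, norm_smul, ← mul_assoc]
      exact mul_le_mul_of_nonneg_right (abs_shift_quotient_le hk hC'' hσ _) (norm_nonneg _)
    · rw [norm_smul]
      refine mul_le_mul_of_nonneg_right ?_ (norm_nonneg _)
      rw [norm_mul]
      have h5 := hC' (Real.log ‖x‖)
      have h6 : ‖(-(1 / 2) : ℝ)‖ = 1 / 2 := by norm_num
      rw [h6, Real.norm_eq_abs, radial]
      linarith [abs_nonneg (deriv k (Real.log ‖x‖))]
  have hmem : MemLp (fun x => (-(1 / 2) * radial (deriv k) x) • P x) 2 ν := by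
    have := (MemLp.radial_smul h.memLp_grad hk'.continuous hC').const_smul (-(1 / 2) : ℝ)
    simpa only [smul_smul, Pi.smul_def] using this
  have hfin := hmain.integral_inner (L2Tendsto.const P)
    (fun σ => MemLp.radial_smul (hPd (-σ)) (hDc σ) (hDb σ)) hmem (fun _ => h.memLp_grad) h.memLp_grad
  refine hfin.trans (le_of_eq ?_)
  rw [← integral_const_mul]
  congr 2
  ext x
  rw [real_inner_smul_left, real_inner_self_eq_norm_sq]
  ring

/-- The Rellich type identity: a weak solution tested with its own radial derivative. -/
theorem InEnergySpace.rellich_identity (ha : -1 < a) {v : Eu n → ℝ} {P : Eu n → Eu n}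
    (h : InEnergySpace a v P) {f : Eu n → ℝ} (hf : MemLp f 2 (invMeasure n a))
    (heq : ∀ ξ : Eu n → ℝ, IsTest ξ →
      ∫ x, inner ℝ (P x) (sgrad ξ x) ∂(invMeasure n a) = ∫ x, f x * ξ x ∂(invMeasure n a))
    {k : ℝ → ℝ} (hk : ContDiff ℝ ∞ k) (hc : HasCompactSupport k) :
    ∫ x, radial (deriv k) x * inner ℝ (P x) (rdir x) ^ 2 ∂(invMeasure n a)
        - 1 / 2 * ∫ x, radial (deriv k) x * ‖P x‖ ^ 2 ∂(invMeasure n a)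
      = ∫ x, f x * (radial k x * inner ℝ (P x) (rdir x)) ∂(invMeasure n a) := by
  obtain ⟨C, hC, hC', -⟩ := exists_bound_of_contDiff_compact hk hc
  have hk' : ContDiff ℝ ∞ (deriv k) := (contDiff_infty_iff_deriv.1 hk).2
  -- The radial derivative of v need not belong to the energy space; its difference quotients do,
  -- being combinations of dilates of v. The weak equation is tested with these and σ is sent to
  -- zero.
  have hw : ∀ σ : ℝ, InEnergySpace a (dilQuot σ v)
      (fun x => (2 * σ)⁻¹ • (P (Real.exp σ • x) - P (Real.exp (-σ) • x))) := fun σ =>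
    ((h.dilation ha σ).sub ha (h.dilation ha (-σ))).const_mul _
  have hdr := MemLp.inner_rdir h.memLp_grad
  have hq := h.tendsto_dilQuot ha
  have hqm : ∀ k : ℝ → ℝ, (∀ t, |k t| ≤ C) → L2Tendsto (invMeasure n a) (𝓝[≠] 0)
      (fun σ x => radial k x * dilQuot σ v x) (fun x => radial k x * inner ℝ (P x) (rdir x)) := by
    intro k hC
    refine hq.of_norm_le C (Eventually.of_forall fun j => Eventually.of_forall fun x => ?_)
    rw [← mul_sub, norm_mul]
    exact mul_le_mul_of_nonneg_right (hC _) (norm_nonneg _)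
  have hqL := fun σ => MemLp.dilQuot h.memLp σ
  have l1 := (L2Tendsto.const f).integral_mul (hqm k hC) (fun _ => hf) hf
    (fun σ => MemLp.radial_mul (hqL σ) hk.continuous hC) (MemLp.radial_mul hdr hk.continuous hC)
  have l2 := (hqm _ hC').integral_mul (L2Tendsto.const fun x => inner ℝ (P x) (rdir x))
    (fun σ => MemLp.radial_mul (hqL σ) hk'.continuous hC') (MemLp.radial_mul hdr hk'.continuous hC')
    (fun _ => hdr) hdr
  have l3 := h.tendsto_integral_grad_quotient ha hk hc
  have e : ∀ σ : ℝ, ∫ x, f x * (radial k x * dilQuot σ v x) ∂(invMeasure n a)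
      = ∫ x, inner ℝ (P x)
        (radial k x • ((2 * σ)⁻¹ • (P (Real.exp σ • x) - P (Real.exp (-σ) • x)))) ∂(invMeasure n a)
        + ∫ x, radial (deriv k) x * dilQuot σ v x * inner ℝ (P x) (rdir x) ∂(invMeasure n a) := by
    intro σ
    rw [← InEnergySpace.weak_eq ha h.memLp_grad hf heq ((hw σ).radial_mul ha hk hC hC'),
      ← integral_add]
    · congr 1
      ext x
      rw [inner_add_right, real_inner_smul_right _ (rdir x)]
    · exact MemLp.integrable_inner_real h.memLp_grad
        (MemLp.radial_smul (hw σ).memLp_grad hk.continuous hC)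
    · exact MemLp.integrable_mul_real (MemLp.radial_mul (hqL σ) hk'.continuous hC') hdr
  simp only [e] at l1
  have := tendsto_nhds_unique l1 (l3.add l2)
  rw [this]
  have h2 : ∫ x, radial (deriv k) x * inner ℝ (P x) (rdir x) ^ 2 ∂(invMeasure n a)
      = ∫ x, radial (deriv k) x * inner ℝ (P x) (rdir x) * inner ℝ (P x) (rdir x)
        ∂(invMeasure n a) := by
    congr 1; ext x; ring
  rw [h2]
  ring

end DifferenceQuotients

/-! ### The Carleman estimate with zero flux -/

section Carleman

open Filter Topology

variable {n : ℕ} {a : ℝ}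

theorem exists_cutoff_one (t₀ t₁ : ℝ) : ∃ χ : ℝ → ℝ, ContDiff ℝ ∞ χ ∧ HasCompactSupport χ ∧
    (∀ t, |χ t| ≤ 1) ∧ ∀ t ∈ Set.Icc t₀ t₁, χ =ᶠ[𝓝 t] fun _ => 1 := by
  let b : ContDiffBump (0 : ℝ) := ⟨|t₀| + |t₁| + 1, |t₀| + |t₁| + 2, by positivity, by linarith⟩
  refine ⟨b, b.contDiff, b.hasCompactSupport, fun t => ?_, fun t ht => ?_⟩
  · rw [abs_of_nonneg b.nonneg]; exact b.le_one
  · refine b.eventuallyEq_one_of_mem_ball ?_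
    have h1 : |t| ≤ |t₀| + |t₁| := by
      refine abs_le.2 ⟨?_, ?_⟩
      · linarith [neg_abs_le t₀, abs_nonneg t₁, ht.1]
      · linarith [le_abs_self t₁, abs_nonneg t₀, ht.2]
    rw [mem_ball_zero_iff, Real.norm_eq_abs]
    change |t| < |t₀| + |t₁| + 1
    linarith

/-- For functions living in a shell, an exponential multiplier may be cut off outside without
changing any integral. This transfers the identities for compactly supported multipliers to the
powers e^{βt}. -/
theorem exists_compact_eq_exp (β t₀ t₁ : ℝ) : ∃ k : ℝ → ℝ, ContDiff ℝ ∞ k ∧ HasCompactSupport k ∧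
    ∀ t ∈ Set.Icc t₀ t₁, k t = Real.exp (β * t) ∧ deriv k t = β * Real.exp (β * t) := by
  obtain ⟨χ, h1, h2, -, h3⟩ := exists_cutoff_one t₀ t₁
  refine ⟨fun t => χ t * Real.exp (β * t), h1.mul (by fun_prop), h2.mul_right, fun t ht => ⟨?_, ?_⟩⟩
  · simp [(h3 t ht).eq_of_nhds]
  · have h4 : (fun t => χ t * Real.exp (β * t)) =ᶠ[𝓝 t] fun t => Real.exp (β * t) := by
      filter_upwards [h3 t ht] with s hs
      rw [hs, one_mul]
    rw [h4.deriv_eq]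
    have h5 := ((hasDerivAt_id t).const_mul β).exp
    simp only [id, mul_one] at h5
    rw [h5.deriv, mul_comm]

/-- The radial power `|x|^β`, written as an exponential of `log |x|`. -/
noncomputable def rexp (β : ℝ) (x : Eu n) : ℝ := Real.exp (β * Real.log ‖x‖)

theorem rexp_pos (β : ℝ) (x : Eu n) : 0 < rexp β x := Real.exp_pos _

theorem rexp_mul (β γ : ℝ) (x : Eu n) : rexp β x * rexp γ x = rexp (β + γ) x := by
  rw [rexp, rexp, rexp, ← Real.exp_add, add_mul]

theorem measurable_rexp (β : ℝ) : Measurable (rexp (n := n) β) :=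
  measurable_radial (k := fun t => Real.exp (β * t)) (by fun_prop)

/-- The function `f` vanishes almost everywhere off the shell `t₀ ≤ log |x| ≤ t₁`. -/
def SupportedInShell {F : Type*} [Zero F] (n : ℕ) (a t₀ t₁ : ℝ) (f : Eu n → F) : Prop :=
  ∀ᵐ x ∂(invMeasure n a), f x ≠ 0 → Real.log ‖x‖ ∈ Set.Icc t₀ t₁

theorem SupportedInShell.memLp_rexp_smul {F : Type*} [NormedAddCommGroup F] [NormedSpace ℝ F]
    {f : Eu n → F} {t₀ t₁ : ℝ} (h : SupportedInShell n a t₀ t₁ f) (hf : MemLp f 2 (invMeasure n a))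
    (β : ℝ) : MemLp (fun x => rexp β x • f x) 2 (invMeasure n a) := by
  obtain ⟨k, h1, h2, h3⟩ := exists_compact_eq_exp β t₀ t₁
  obtain ⟨C, hC, -, -⟩ := exists_bound_of_contDiff_compact h1 h2
  refine (memLp_congr_ae ?_).1 (MemLp.radial_smul hf h1.continuous hC)
  filter_upwards [h] with x hx
  by_cases h0 : f x = 0
  · simp [h0]
  · rw [radial, (h3 _ (hx h0)).1, rexp]

theorem SupportedInShell.integral_ibp (ha : -1 < a) {v : Eu n → ℝ} {P : Eu n → Eu n} {t₀ t₁ : ℝ}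
    (hs : SupportedInShell n a t₀ t₁ v) (h : InEnergySpace a v P) (β : ℝ) :
    ∫ x, rexp β x * v x * inner ℝ (P x) (rdir x) ∂(invMeasure n a)
      = -(β / 2) * ∫ x, rexp β x * v x ^ 2 ∂(invMeasure n a) := by
  obtain ⟨k, h1, h2, h3⟩ := exists_compact_eq_exp β t₀ t₁
  have e1 : ∫ x, rexp β x * v x * inner ℝ (P x) (rdir x) ∂(invMeasure n a)
      = ∫ x, radial k x * v x * inner ℝ (P x) (rdir x) ∂(invMeasure n a) := by
    apply integral_congr_ae
    filter_upwards [hs] with x hx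
    by_cases h0 : v x = 0
    · simp [h0]
    · rw [radial, (h3 _ (hx h0)).1, rexp]
  have e2 : ∫ x, radial (deriv k) x * v x ^ 2 ∂(invMeasure n a)
      = β * ∫ x, rexp β x * v x ^ 2 ∂(invMeasure n a) := by
    rw [← integral_const_mul]
    apply integral_congr_ae
    filter_upwards [hs] with x hx
    by_cases h0 : v x = 0
    · simp [h0]
    · rw [radial, (h3 _ (hx h0)).2, rexp]; ring
  rw [e1, h.integral_radial_mul ha h1 h2, e2]
  ring

theorem SupportedInShell.energy_identity (ha : -1 < a) {v : Eu n → ℝ} {P : Eu n → Eu n} {t₀ t₁ : ℝ}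
    (hs : SupportedInShell n a t₀ t₁ v) (hsP : SupportedInShell n a t₀ t₁ P)
    (h : InEnergySpace a v P) {f : Eu n → ℝ} (hf : MemLp f 2 (invMeasure n a))
    (heq : ∀ ξ : Eu n → ℝ, IsTest ξ →
      ∫ x, inner ℝ (P x) (sgrad ξ x) ∂(invMeasure n a) = ∫ x, f x * ξ x ∂(invMeasure n a)) (β : ℝ) :
    ∫ x, rexp β x * ‖P x‖ ^ 2 ∂(invMeasure n a)
        + β * ∫ x, rexp β x * v x * inner ℝ (P x) (rdir x) ∂(invMeasure n a)
      = ∫ x, f x * (rexp β x * v x) ∂(invMeasure n a) := by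
  obtain ⟨k, h1, h2, h3⟩ := exists_compact_eq_exp β t₀ t₁
  have key := h.energy_identity ha hf heq h1 h2
  have e1 : ∫ x, rexp β x * ‖P x‖ ^ 2 ∂(invMeasure n a)
      = ∫ x, radial k x * ‖P x‖ ^ 2 ∂(invMeasure n a) := by
    apply integral_congr_ae
    filter_upwards [hsP] with x hx
    by_cases h0 : P x = 0
    · simp [h0]
    · rw [radial, (h3 _ (hx h0)).1, rexp]
  have e2 : β * ∫ x, rexp β x * v x * inner ℝ (P x) (rdir x) ∂(invMeasure n a)
      = ∫ x, radial (deriv k) x * v x * inner ℝ (P x) (rdir x) ∂(invMeasure n a) := by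
    rw [← integral_const_mul]
    apply integral_congr_ae
    filter_upwards [hs] with x hx
    by_cases h0 : v x = 0
    · simp [h0]
    · rw [radial, (h3 _ (hx h0)).2, rexp]; ring
  have e3 : ∫ x, f x * (rexp β x * v x) ∂(invMeasure n a)
      = ∫ x, f x * (radial k x * v x) ∂(invMeasure n a) := by
    apply integral_congr_ae
    filter_upwards [hs] with x hx
    by_cases h0 : v x = 0
    · simp [h0]
    · rw [radial, (h3 _ (hx h0)).1, rexp]
  rw [e1, e2, e3, key]

theorem SupportedInShell.rellich_identity (ha : -1 < a) {v : Eu n → ℝ} {P : Eu n → Eu n} {t₀ t₁ : ℝ}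
    (hsP : SupportedInShell n a t₀ t₁ P)
    (h : InEnergySpace a v P) {f : Eu n → ℝ} (hf : MemLp f 2 (invMeasure n a))
    (heq : ∀ ξ : Eu n → ℝ, IsTest ξ →
      ∫ x, inner ℝ (P x) (sgrad ξ x) ∂(invMeasure n a) = ∫ x, f x * ξ x ∂(invMeasure n a)) (β : ℝ) :
    β * ∫ x, rexp β x * inner ℝ (P x) (rdir x) ^ 2 ∂(invMeasure n a)
        - β / 2 * ∫ x, rexp β x * ‖P x‖ ^ 2 ∂(invMeasure n a)
      = ∫ x, f x * (rexp β x * inner ℝ (P x) (rdir x)) ∂(invMeasure n a) := by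
  obtain ⟨k, h1, h2, h3⟩ := exists_compact_eq_exp β t₀ t₁
  have key := h.rellich_identity ha hf heq h1 h2
  have e1 : ∫ x, radial (deriv k) x * inner ℝ (P x) (rdir x) ^ 2 ∂(invMeasure n a)
      = β * ∫ x, rexp β x * inner ℝ (P x) (rdir x) ^ 2 ∂(invMeasure n a) := by
    rw [← integral_const_mul]
    apply integral_congr_ae
    filter_upwards [hsP] with x hx
    by_cases h0 : P x = 0
    · simp [h0]
    · rw [radial, (h3 _ (hx h0)).2, rexp]; ring
  have e2 : ∫ x, radial (deriv k) x * ‖P x‖ ^ 2 ∂(invMeasure n a)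
      = β * ∫ x, rexp β x * ‖P x‖ ^ 2 ∂(invMeasure n a) := by
    rw [← integral_const_mul]
    apply integral_congr_ae
    filter_upwards [hsP] with x hx
    by_cases h0 : P x = 0
    · simp [h0]
    · rw [radial, (h3 _ (hx h0)).2, rexp]; ring
  have e3 : ∫ x, f x * (radial k x * inner ℝ (P x) (rdir x)) ∂(invMeasure n a)
      = ∫ x, f x * (rexp β x * inner ℝ (P x) (rdir x)) ∂(invMeasure n a) := by
    apply integral_congr_ae
    filter_upwards [hsP] with x hx
    by_cases h0 : P x = 0
    · simp [h0]
    · rw [radial, (h3 _ (hx h0)).1, rexp]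
  rw [e1, e2, e3] at key
  rw [← key]
  ring

/-- Linearity for the longest expansion that occurs; shorter ones are padded with zero coefficients.
-/
theorem integral_lincomb₅ {X : Type*} [MeasurableSpace X] {μ : Measure X} {g₁ g₂ g₃ g₄ g₅ : X → ℝ}
    (h₁ : Integrable g₁ μ) (h₂ : Integrable g₂ μ) (h₃ : Integrable g₃ μ) (h₄ : Integrable g₄ μ)
    (h₅ : Integrable g₅ μ) (c₁ c₂ c₃ c₄ c₅ : ℝ) :
    ∫ x, (c₁ * g₁ x + c₂ * g₂ x + c₃ * g₃ x + c₄ * g₄ x + c₅ * g₅ x) ∂μ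
      = c₁ * ∫ x, g₁ x ∂μ + c₂ * ∫ x, g₂ x ∂μ + c₃ * ∫ x, g₃ x ∂μ + c₄ * ∫ x, g₄ x ∂μ
        + c₅ * ∫ x, g₅ x ∂μ := by
  have k₁ := h₁.const_mul c₁
  have k₂ := h₂.const_mul c₂
  have k₃ := h₃.const_mul c₃
  have k₄ := h₄.const_mul c₄
  rw [integral_add (f := fun x => c₁ * g₁ x + c₂ * g₂ x + c₃ * g₃ x + c₄ * g₄ x)
      (((k₁.add k₂).add k₃).add k₄) (h₅.const_mul c₅),
    integral_add (f := fun x => c₁ * g₁ x + c₂ * g₂ x + c₃ * g₃ x) ((k₁.add k₂).add k₃) k₄,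
    integral_add (f := fun x => c₁ * g₁ x + c₂ * g₂ x) (k₁.add k₂) k₃, integral_add k₁ k₂]
  simp only [integral_const_mul]

/-- The algebra that turns the Rellich and the energy identity into the Carleman estimate. -/
theorem carleman_arithmetic {α τ c A₁ B₂ V₁ V₂ V₃ J S N h₁ h₂ : ℝ} (hα : 1 ≤ α)
    (hτ : Real.exp α ≤ τ)
    (hA₁ : 0 ≤ A₁) (hV₁ : 0 ≤ V₁) (hV₂ : 0 ≤ V₂) (hN : 0 ≤ N)
    (hV₁₃ : V₁ ≤ Real.exp α ^ 2 * V₃) (hV₂₃ : V₂ ≤ Real.exp α * V₃)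
    (hS : S = 4 * τ ^ 2 * α ^ 2 * B₂ - 3 * τ ^ 2 * α ^ 4 * V₂)
    (hSN : 0 ≤ S + (2 * τ * α * h₁ + τ * α ^ 2 * h₂) + N / 4)
    (hh : 0 ≤ N + 2 * τ * h₂ + τ ^ 2 * V₂)
    (hR : α * A₁ - α / 2 * J = -(c ^ 2 * (-(α / 2) * V₁) - τ ^ 2 * α ^ 2 * (-(3 * α / 2) * V₃)
      + 2 * τ * α * B₂ + τ * α ^ 2 * (-α * V₂) + h₁))
    (hE : J + α * (-(α / 2) * V₁) = -(c ^ 2 * V₁ - τ ^ 2 * α ^ 2 * V₃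
      + 2 * τ * α * (-α * V₂) + τ * α ^ 2 * V₂ + h₂)) :
    τ ^ 3 * V₃ + τ * J ≤ 4 * α ^ 2 * N := by
  have hex : 1 ≤ Real.exp α := Real.one_le_exp (by linarith)
  have hτ1 : 1 ≤ τ := hex.trans hτ
  have hV₃ : 0 ≤ V₃ := by
    by_contra h
    have : Real.exp α * V₃ < 0 := mul_neg_of_pos_of_neg (by linarith) (by linarith)
    linarith
  -- Here and in the next bound the size of τ enters: it compensates for e^{αt} being as small as
  -- e^{-α}, so that lower powers of the weight are absorbed by the cubic term.
  have h1 : τ * V₁ ≤ τ ^ 3 * V₃ := by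
    have : Real.exp α ^ 2 * V₃ ≤ τ ^ 2 * V₃ :=
      mul_le_mul_of_nonneg_right (pow_le_pow_left₀ (by linarith) hτ 2) hV₃
    calc τ * V₁ ≤ τ * (τ ^ 2 * V₃) := mul_le_mul_of_nonneg_left (hV₁₃.trans this) (by linarith)
      _ = _ := by ring
  have h2 : τ ^ 2 * V₂ ≤ τ ^ 3 * V₃ := by
    have : Real.exp α * V₃ ≤ τ * V₃ := mul_le_mul_of_nonneg_right hτ hV₃
    calc τ ^ 2 * V₂ ≤ τ ^ 2 * (τ * V₃) := mul_le_mul_of_nonneg_left (hV₂₃.trans this) (by positivity)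
      _ = _ := by ring
  -- These factors rebuild the skew part as multiplier and make J cancel. The Rellich identity
  -- contributes 3α⁴τ³V₃ and the energy identity takes α⁴τ³V₃ away, hence the coefficient 2; the
  -- first order terms in D and v assemble into the square S.
  have key : 2 * τ * α ^ 2 * A₁ - α ^ 4 / 2 * (τ * V₁) + 2 * α ^ 4 * (τ ^ 3 * V₃) + S
      + (2 * τ * α * h₁ + τ * α ^ 2 * h₂) = 0 := by
    linear_combination 2 * τ * α * hR + τ * α ^ 2 * hE + hS
  have hα2 : 1 ≤ α ^ 2 := one_le_pow₀ hα
  have hα4 : 1 ≤ α ^ 4 := one_le_pow₀ hα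
  have h3V : 0 ≤ τ ^ 3 * V₃ := by positivity
  -- Completing the square, S together with its product with the right-hand side is at least -N/4,
  -- and the V₁ term costs a quarter of the cubic term.
  have h4 : 3 / 2 * (α ^ 4 * (τ ^ 3 * V₃)) ≤ N / 4 := by
    have : 0 ≤ 2 * τ * α ^ 2 * A₁ := by positivity
    have h5 : α ^ 4 / 2 * (τ * V₁) ≤ α ^ 4 / 2 * (τ ^ 3 * V₃) :=
      mul_le_mul_of_nonneg_left h1 (by positivity)
    linarith
  have h6 : τ ^ 3 * V₃ ≤ N / 6 := by
    have : τ ^ 3 * V₃ ≤ α ^ 4 * (τ ^ 3 * V₃) := le_mul_of_one_le_left h3V hα4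
    linarith
  -- The gradient term comes from the energy identity alone, now that the cubic term controls
  -- everything else in it. The c² term has a good sign and is dropped, so the bound does not depend
  -- on c.
  have h7 : τ * J = α ^ 2 / 2 * (τ * V₁) - c ^ 2 * (τ * V₁) + α ^ 2 * (τ ^ 3 * V₃)
      + α ^ 2 * (τ ^ 2 * V₂) - τ * h₂ := by
    linear_combination τ * hE
  have h8 : 0 ≤ c ^ 2 * (τ * V₁) := by positivity
  have h9 : α ^ 2 / 2 * (τ * V₁) ≤ α ^ 2 / 2 * (N / 6) :=
    mul_le_mul_of_nonneg_left (h1.trans h6) (by positivity)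
  have h10 : α ^ 2 * (τ ^ 3 * V₃) ≤ α ^ 2 * (N / 6) := mul_le_mul_of_nonneg_left h6 (by positivity)
  have h11 : α ^ 2 * (τ ^ 2 * V₂) ≤ α ^ 2 * (N / 6) :=
    mul_le_mul_of_nonneg_left (h2.trans h6) (by positivity)
  have h12 : N ≤ α ^ 2 * N := le_mul_of_one_le_left hN hα2
  have h13 : τ ^ 2 * V₂ ≤ N / 6 := h2.trans h6
  nlinarith

/-- The Carleman estimate for weak solutions with vanishing Neumann data, in the scale invariant
form. -/
theorem SupportedInShell.carleman (ha : -1 < a) {v : Eu n → ℝ} {P : Eu n → Eu n} {t₁ : ℝ}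
    (hs : SupportedInShell n a (-1) t₁ v) (hsP : SupportedInShell n a (-1) t₁ P)
    (h : InEnergySpace a v P) {H : Eu n → ℝ} (hH : MemLp H 2 (invMeasure n a)) {α τ : ℝ} (c : ℝ)
    (hα : 1 ≤ α) (hτ : Real.exp α ≤ τ)
    (heq : ∀ ξ : Eu n → ℝ, IsTest ξ → ∫ x, inner ℝ (P x) (sgrad ξ x) ∂(invMeasure n a)
      = ∫ x, -((c ^ 2 - τ ^ 2 * α ^ 2 * rexp (2 * α) x) * v x
        + 2 * τ * α * rexp α x * inner ℝ (P x) (rdir x) + τ * α ^ 2 * rexp α x * v x + H x) * ξ x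
        ∂(invMeasure n a)) :
    τ ^ 3 * ∫ x, rexp (3 * α) x * v x ^ 2 ∂(invMeasure n a)
        + τ * ∫ x, rexp α x * ‖P x‖ ^ 2 ∂(invMeasure n a)
      ≤ 4 * α ^ 2 * ∫ x, H x ^ 2 ∂(invMeasure n a) := by
  set ν := invMeasure n a with hν
  set D : Eu n → ℝ := fun x => inner ℝ (P x) (rdir x) with hD
  have hDL : MemLp D 2 ν := MemLp.inner_rdir h.memLp_grad
  have hsD : SupportedInShell n a (-1) t₁ D := by
    filter_upwards [hsP] with x hx h0
    refine hx fun h1 => h0 ?_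
    simp [hD, h1]
  have hv : ∀ β, MemLp (fun x => rexp β x * v x) 2 ν := fun β => hs.memLp_rexp_smul h.memLp β
  have hd : ∀ β, MemLp (fun x => rexp β x * D x) 2 ν := fun β => hsD.memLp_rexp_smul hDL β
  have hα2 : ∀ x : Eu n, rexp (2 * α) x = rexp α x * rexp α x := fun x => by
    rw [rexp_mul]; congr 1; ring
  have hα3 : ∀ x : Eu n, rexp (3 * α) x = rexp α x * rexp (2 * α) x := fun x => by
    rw [rexp_mul]; congr 1; ring
  set f : Eu n → ℝ := fun x => -((c ^ 2 - τ ^ 2 * α ^ 2 * rexp (2 * α) x) * v x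
        + 2 * τ * α * rexp α x * D x + τ * α ^ 2 * rexp α x * v x + H x) with hf
  have hfL : MemLp f 2 ν := by
    have := ((((h.memLp.const_mul (c ^ 2)).sub ((hv (2 * α)).const_mul (τ ^ 2 * α ^ 2))).add
      ((hd α).const_mul (2 * τ * α))).add ((hv α).const_mul (τ * α ^ 2))).add hH |>.neg
    refine (memLp_congr_ae (Eventually.of_forall fun x => ?_)).1 this
    simp only [hf, Pi.neg_apply, Pi.add_apply, Pi.sub_apply]
    ring
  have iVV : ∀ β, Integrable (fun x => rexp β x * v x ^ 2) ν := fun β =>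
    (MemLp.integrable_mul_real (hv β) h.memLp).congr (Eventually.of_forall fun x => by
      simp only; ring)
  have iVD : ∀ β, Integrable (fun x => rexp β x * v x * D x) ν := fun β =>
    MemLp.integrable_mul_real (hv β) hDL
  have iDD : ∀ β, Integrable (fun x => rexp β x * D x ^ 2) ν := fun β =>
    (MemLp.integrable_mul_real (hd β) hDL).congr (Eventually.of_forall fun x => by
      simp only; ring)
  have iHD : Integrable (fun x => H x * (rexp α x * D x)) ν := MemLp.integrable_mul_real hH (hd α)
  have iHV : Integrable (fun x => H x * (rexp α x * v x)) ν := MemLp.integrable_mul_real hH (hv α)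
  have iHH : Integrable (fun x => H x ^ 2) ν := hH.integrable_sq
  have p1 := hs.integral_ibp ha h α
  have p2 := hs.integral_ibp ha h (2 * α)
  have p3 := hs.integral_ibp ha h (3 * α)
  have R := hsP.rellich_identity ha h hfL heq α
  have E := hs.energy_identity ha hsP h hfL heq α
  rw [p1] at E
  have eR : ∫ x, f x * (rexp α x * D x) ∂ν = -(c ^ 2 * (-(α / 2) * ∫ x, rexp α x * v x ^ 2 ∂ν)
      - τ ^ 2 * α ^ 2 * (-(3 * α / 2) * ∫ x, rexp (3 * α) x * v x ^ 2 ∂ν)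
      + 2 * τ * α * ∫ x, rexp (2 * α) x * D x ^ 2 ∂ν
      + τ * α ^ 2 * (-α * ∫ x, rexp (2 * α) x * v x ^ 2 ∂ν)
      + ∫ x, H x * (rexp α x * D x) ∂ν) := by
    rw [show -α = -(2 * α / 2) by ring, ← p1, ← p2, ← p3]
    have := integral_lincomb₅ (iVD α) (iVD (3 * α)) (iDD (2 * α)) (iVD (2 * α)) iHD
      (-c ^ 2) (τ ^ 2 * α ^ 2) (-(2 * τ * α)) (-(τ * α ^ 2)) (-1)
    calc _ = ∫ x, (-c ^ 2 * (rexp α x * v x * D x) + τ ^ 2 * α ^ 2 * (rexp (3 * α) x * v x * D x)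
          + -(2 * τ * α) * (rexp (2 * α) x * D x ^ 2) + -(τ * α ^ 2) * (rexp (2 * α) x * v x * D x)
          + -1 * (H x * (rexp α x * D x))) ∂ν := by
          congr 1; ext x; simp only [hf, hα3, hα2]; ring
      _ = _ := by rw [this]; ring
  have eE : ∫ x, f x * (rexp α x * v x) ∂ν = -(c ^ 2 * ∫ x, rexp α x * v x ^ 2 ∂ν
      - τ ^ 2 * α ^ 2 * ∫ x, rexp (3 * α) x * v x ^ 2 ∂ν
      + 2 * τ * α * (-α * ∫ x, rexp (2 * α) x * v x ^ 2 ∂ν)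
      + τ * α ^ 2 * ∫ x, rexp (2 * α) x * v x ^ 2 ∂ν
      + ∫ x, H x * (rexp α x * v x) ∂ν) := by
    rw [show -α = -(2 * α / 2) by ring, ← p2]
    have := integral_lincomb₅ (iVV α) (iVV (3 * α)) (iVD (2 * α)) (iVV (2 * α)) iHV
      (-c ^ 2) (τ ^ 2 * α ^ 2) (-(2 * τ * α)) (-(τ * α ^ 2)) (-1)
    calc _ = ∫ x, (-c ^ 2 * (rexp α x * v x ^ 2) + τ ^ 2 * α ^ 2 * (rexp (3 * α) x * v x ^ 2)
          + -(2 * τ * α) * (rexp (2 * α) x * v x * D x) + -(τ * α ^ 2) * (rexp (2 * α) x * v x ^ 2)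
          + -1 * (H x * (rexp α x * v x))) ∂ν := by
          congr 1; ext x; simp only [hf, hα3, hα2]; ring
      _ = _ := by rw [this]; ring
  -- The shell is allowed to begin at t = -1, not 0, to leave room for the cutoff of the boundary
  -- correction.
  have hlog : ∀ᵐ x ∂ν, v x ≠ 0 → Real.exp (-α) ≤ rexp α x := by
    filter_upwards [hs] with x hx h0
    exact Real.exp_le_exp.2 (by nlinarith [(hx h0).1])
  have hcancel : Real.exp α * Real.exp (-α) = 1 := by rw [← Real.exp_add]; simp
  have hmono : ∀ᵐ x ∂ν, v x ≠ 0 → 1 ≤ Real.exp α * rexp α x := by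
    filter_upwards [hlog] with x hx h0
    rw [← hcancel]
    exact mul_le_mul_of_nonneg_left (hx h0) (Real.exp_pos α).le
  refine carleman_arithmetic (c := c) (A₁ := ∫ x, rexp α x * D x ^ 2 ∂ν)
    (B₂ := ∫ x, rexp (2 * α) x * D x ^ 2 ∂ν) (V₁ := ∫ x, rexp α x * v x ^ 2 ∂ν)
    (V₂ := ∫ x, rexp (2 * α) x * v x ^ 2 ∂ν)
    (S := ∫ x, (2 * τ * α * (rexp α x * D x) + τ * α ^ 2 * (rexp α x * v x)) ^ 2 ∂ν)
    (h₁ := ∫ x, H x * (rexp α x * D x) ∂ν) (h₂ := ∫ x, H x * (rexp α x * v x) ∂ν)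
    hα hτ ?_ ?_ ?_ ?_ ?_ ?_ ?_ ?_ ?_ (R.trans eR) (E.trans eE)
  · exact integral_nonneg fun x => mul_nonneg (rexp_pos _ _).le (sq_nonneg _)
  · exact integral_nonneg fun x => mul_nonneg (rexp_pos _ _).le (sq_nonneg _)
  · exact integral_nonneg fun x => mul_nonneg (rexp_pos _ _).le (sq_nonneg _)
  · exact integral_nonneg fun x => sq_nonneg _
  · rw [← integral_const_mul]
    refine integral_mono_ae (iVV _) ((iVV _).const_mul _) ?_
    filter_upwards [hmono] with x hx
    by_cases h0 : v x = 0
    · simp [h0]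
    · have h1 := hx h0
      have h2 : 1 ≤ (Real.exp α * rexp α x) ^ 2 := one_le_pow₀ h1
      have h3 : 0 ≤ rexp α x * v x ^ 2 := mul_nonneg (rexp_pos _ _).le (sq_nonneg _)
      calc rexp α x * v x ^ 2 ≤ (Real.exp α * rexp α x) ^ 2 * (rexp α x * v x ^ 2) :=
            le_mul_of_one_le_left h3 h2
        _ = _ := by rw [hα3, hα2]; ring
  · rw [← integral_const_mul]
    refine integral_mono_ae (iVV _) ((iVV _).const_mul _) ?_
    filter_upwards [hmono] with x hx
    by_cases h0 : v x = 0
    · simp [h0]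
    · have h3 : 0 ≤ rexp (2 * α) x * v x ^ 2 := mul_nonneg (rexp_pos _ _).le (sq_nonneg _)
      calc rexp (2 * α) x * v x ^ 2 ≤ (Real.exp α * rexp α x) * (rexp (2 * α) x * v x ^ 2) :=
            le_mul_of_one_le_left h3 (hx h0)
        _ = _ := by rw [hα3]; ring
  · have := integral_lincomb₅ (iDD (2 * α)) (iVD (2 * α)) (iVV (2 * α)) iHD iHD
      (4 * τ ^ 2 * α ^ 2) (4 * τ ^ 2 * α ^ 3) (τ ^ 2 * α ^ 4) 0 0
    rw [p2] at this
    calc _ = _ := by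
          refine integral_congr_ae (Eventually.of_forall fun x => ?_)
          simp only [hα2]; ring
      _ = _ := this
      _ = _ := by ring
  -- Nonnegativity of the square of the skew part plus H/2.
  · have iS : Integrable
        (fun x => (2 * τ * α * (rexp α x * D x) + τ * α ^ 2 * (rexp α x * v x)) ^ 2) ν :=
      (((hd α).const_mul (2 * τ * α)).add ((hv α).const_mul (τ * α ^ 2))).integrable_sq
    have := integral_lincomb₅ iS iHD iHV iHH iHH 1 (2 * τ * α) (τ * α ^ 2) (1 / 4) 0
    calc (0 : ℝ) ≤ ∫ x, ((2 * τ * α * (rexp α x * D x) + τ * α ^ 2 * (rexp α x * v x))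
          + 1 / 2 * H x) ^ 2 ∂ν := integral_nonneg fun x => sq_nonneg _
      _ = _ := by
          refine integral_congr_ae (Eventually.of_forall fun x => ?_)
          simp only; ring
      _ = _ := this
      _ = _ := by ring
  -- Nonnegativity of (H + τ e^{αt} v)², which bounds the pairing of H with e^{αt} v from below.
  · have := integral_lincomb₅ iHH iHV (iVV (2 * α)) iHH iHH 1 (2 * τ) (τ ^ 2) 0 0
    calc (0 : ℝ) ≤ ∫ x, (H x + τ * (rexp α x * v x)) ^ 2 ∂ν := integral_nonneg fun x => sq_nonneg _
      _ = _ := by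
          refine integral_congr_ae (Eventually.of_forall fun x => ?_)
          simp only [hα2]; ring
      _ = _ := this
      _ = _ := by ring

end Carleman

/-! ### A trace inequality with a large parameter -/

section TraceInequality

open Filter Topology

theorem sq_integral_mul_le {X : Type*} [MeasurableSpace X] {μ : Measure X} {f g : X → ℝ}
    (hf : MemLp f 2 μ) (hg : MemLp g 2 μ) :
    (∫ x, f x * g x ∂μ) ^ 2 ≤ (∫ x, f x ^ 2 ∂μ) * ∫ x, g x ^ 2 ∂μ := by
  have h := real_inner_mul_inner_self_le (hf.toLp f) (hg.toLp g)
  rw [integral_inner_toLp, integral_inner_toLp, integral_inner_toLp] at h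
  simp only [real_inner_self_eq_norm_sq, Real.norm_eq_abs, sq_abs] at h
  simp only [RCLike.inner_apply, conj_trivial, mul_comm (g _) (f _)] at h
  rw [pow_two]
  exact h

/-- A weighted one-dimensional trace inequality. -/
theorem sq_le_weighted_integral {a δ : ℝ} (ha : -1 < a) (ha' : a < 1) (hδ : 0 < δ) {g g' : ℝ → ℝ}
    (hg : ∀ t, HasDerivAt g (g' t) t) (hg' : Continuous g') :
    g 0 ^ 2 * (δ ^ (1 + a) / (1 + a)) ≤ 2 * (∫ y in Set.Ioc 0 δ, y ^ a * g y ^ 2)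
      + δ ^ 2 / (1 - a) * ∫ y in Set.Ioc 0 δ, y ^ a * g' y ^ 2 := by
  have hgc : Continuous g := continuous_iff_continuousAt.2 fun t => (hg t).continuousAt
  have hint : ∀ b : ℝ, -1 < b → IntegrableOn (fun y : ℝ => y ^ b) (Set.Ioc 0 δ) := fun b hb =>
    (intervalIntegrable_iff_integrableOn_Ioc_of_le hδ.le).1
      (intervalIntegral.intervalIntegrable_rpow' hb)
  have hval : ∀ b : ℝ, -1 < b → ∀ y : ℝ, 0 ≤ y →
      ∫ t in Set.Ioc 0 y, t ^ b = y ^ (b + 1) / (b + 1) := by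
    intro b hb y hy
    rw [← intervalIntegral.integral_of_le hy, integral_rpow (Or.inl hb),
      Real.zero_rpow (by linarith), sub_zero]
  have hmulint : ∀ b : ℝ, -1 < b → ∀ φ : ℝ → ℝ, Continuous φ →
      IntegrableOn (fun y : ℝ => y ^ b * φ y) (Set.Ioc 0 δ) := by
    intro b hb φ hφ
    have h1 : IntegrableOn (fun y : ℝ => y ^ b * φ y) (Set.Icc 0 δ) :=
      ((integrableOn_Icc_iff_integrableOn_Ioc).2 (hint b hb)).mul_continuousOn hφ.continuousOn
        isCompact_Icc
    exact h1.mono_set Set.Ioc_subset_Icc_self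
  set B := ∫ y in Set.Ioc 0 δ, y ^ a * g' y ^ 2 with hB
  -- The increment of g is estimated by Cauchy–Schwarz, splitting g' as t^{-a/2} times t^{a/2} g';
  -- the first factor is square integrable near 0 because a < 1.
  have hpt : ∀ y ∈ Set.Ioc 0 δ, g 0 ^ 2 ≤ 2 * g y ^ 2 + 2 * (y ^ (1 - a) / (1 - a) * B) := by
    intro y hy
    have h1 : g y - g 0 = ∫ t in Set.Ioc 0 y, g' t := by
      rw [← intervalIntegral.integral_of_le hy.1.le, intervalIntegral.integral_eq_sub_of_hasDerivAt
        (fun t _ => hg t) (hg'.intervalIntegrable _ _)]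
    have hsub : Set.Ioc 0 y ⊆ Set.Ioc 0 δ := Set.Ioc_subset_Ioc_right hy.2
    have hsq : ∀ b : ℝ, ∀ t ∈ Set.Ioc (0 : ℝ) y, (t ^ (b / 2)) ^ 2 = t ^ b := by
      intro b t ht
      rw [← Real.rpow_natCast, ← Real.rpow_mul ht.1.le]
      congr 1; push_cast; ring
    have m1 : MemLp (fun t : ℝ => t ^ (-a / 2)) 2 (volume.restrict (Set.Ioc 0 y)) := by
      rw [memLp_two_iff_integrable_sq (by fun_prop)]
      refine (integrableOn_congr_fun (fun t ht => hsq (-a) t ht) measurableSet_Ioc).2 ?_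
      exact (hint (-a) (by linarith)).mono_set hsub
    have m2 : MemLp (fun t : ℝ => t ^ (a / 2) * g' t) 2 (volume.restrict (Set.Ioc 0 y)) := by
      have := hg'.measurable
      rw [memLp_two_iff_integrable_sq (by fun_prop)]
      refine (integrableOn_congr_fun (g := fun t => t ^ a * g' t ^ 2) (fun t ht => ?_)
        measurableSet_Ioc).2 ?_
      · simp only [mul_pow]; rw [hsq a t ht]
      · exact (hmulint a ha (fun t => g' t ^ 2) (by fun_prop)).mono_set hsub
    have h2 := sq_integral_mul_le m1 m2
    have e1 : ∫ t in Set.Ioc 0 y, t ^ (-a / 2) * (t ^ (a / 2) * g' t) = g y - g 0 := by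
      rw [h1]
      refine setIntegral_congr_fun measurableSet_Ioc fun t ht => ?_
      rw [← mul_assoc, ← Real.rpow_add ht.1]
      simp [neg_div]
    have e2 : ∫ t in Set.Ioc 0 y, (t ^ (-a / 2)) ^ 2 = y ^ (1 - a) / (1 - a) := by
      rw [setIntegral_congr_fun measurableSet_Ioc fun t ht => hsq (-a) t ht,
        hval (-a) (by linarith) y hy.1.le, neg_add_eq_sub]
    have e3 : ∫ t in Set.Ioc 0 y, (t ^ (a / 2) * g' t) ^ 2 ≤ B := by
      rw [setIntegral_congr_fun (g := fun t => t ^ a * g' t ^ 2) measurableSet_Ioc fun t ht => by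
        simp only [mul_pow]; rw [hsq a t ht]]
      refine setIntegral_mono_set (hmulint a ha (fun t => g' t ^ 2) (by fun_prop)) ?_
        hsub.eventuallyLE
      refine (ae_restrict_mem measurableSet_Ioc).mono fun t ht => ?_
      have : 0 < t := ht.1
      simp only [Pi.zero_apply]; positivity
    rw [e1, e2] at h2
    have h3 : (g y - g 0) ^ 2 ≤ y ^ (1 - a) / (1 - a) * B := by
      refine h2.trans (mul_le_mul_of_nonneg_left e3 ?_)
      have := hy.1
      have : 0 < 1 - a := by linarith
      positivity
    nlinarith [sq_nonneg (g y - (g y - g 0)), sq_nonneg (g y + (g y - g 0))]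
  have hi1 : IntegrableOn (fun y : ℝ => y ^ a * g 0 ^ 2) (Set.Ioc 0 δ) := (hint a ha).mul_const _
  have hi2 := (hmulint a ha (fun y => g y ^ 2) (by fun_prop)).const_mul 2
  have hi3 : IntegrableOn (fun y : ℝ => 2 * B / (1 - a) * y) (Set.Ioc 0 δ) :=
    (Continuous.integrableOn_Ioc (by fun_prop))
  -- Multiplying by y^a and integrating over the interval: y^a y^{1-a} = y is the source of the
  -- factor δ².
  have hmono := setIntegral_mono_on hi1 (hi2.add hi3) measurableSet_Ioc (fun y hy => by
    have h1 := mul_le_mul_of_nonneg_left (hpt y hy) (Real.rpow_nonneg hy.1.le a)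
    refine h1.trans (le_of_eq ?_)
    have h2 : y ^ a * y ^ (1 - a) = y := by
      rw [← Real.rpow_add hy.1]; simp
    have : (1 - a) ≠ 0 := by linarith
    simp only [Pi.add_apply]
    linear_combination 2 * B / (1 - a) * h2)
  rw [integral_mul_const, hval a ha δ hδ.le] at hmono
  have e4 : ∫ y in Set.Ioc 0 δ, ((fun y : ℝ => 2 * (y ^ a * g y ^ 2)) +
      (fun y : ℝ => 2 * B / (1 - a) * y) : ℝ → ℝ) y
      = 2 * (∫ y in Set.Ioc 0 δ, y ^ a * g y ^ 2) + δ ^ 2 / (1 - a) * B := by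
    simp only [Pi.add_apply]
    rw [integral_add hi2 hi3, integral_const_mul, integral_const_mul]
    have := hval 1 (by norm_num) δ hδ.le
    simp only [Real.rpow_one] at this
    rw [this]
    norm_num
    ring
  rw [e4] at hmono
  rw [mul_comm, add_comm 1 a]
  exact hmono

variable {n : ℕ} {a : ℝ}

theorem halfMeasure_eq_map : halfMeasure n
    = Measure.map joinLast ((volume : Measure (EuclideanSpace ℝ (Fin n))).prod
      (volume.restrict (Set.Ioi 0))) := by
  have h1 := (measurePreserving_joinLast (n := n)).restrict_preimage
    (measurableSet_upperHalf (n := n))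
  have h2 : joinLast ⁻¹' upperHalf n
      = (Set.univ : Set (EuclideanSpace ℝ (Fin n))) ×ˢ Set.Ioi (0 : ℝ) := by
    ext p; simp [upperHalf]
  rw [h2, ← Measure.prod_restrict, Measure.restrict_univ] at h1
  exact h1.map_eq.symm

theorem integrable_joinLast {F : Type*} [NormedAddCommGroup F] {f : Eu n → F}
    (hf : Integrable f (halfMeasure n)) : Integrable (fun p => f (joinLast p))
      ((volume : Measure (EuclideanSpace ℝ (Fin n))).prod (volume.restrict (Set.Ioi 0))) := by
  rw [halfMeasure_eq_map] at hf
  exact (measurableEmbedding_joinLast.integrable_map_iff).1 hf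

theorem integral_halfMeasure {f : Eu n → ℝ} (hf : Integrable f (halfMeasure n)) :
    ∫ x, f x ∂(halfMeasure n) = ∫ x', ∫ y in Set.Ioi 0, f (joinLast (x', y)) := by
  have h := integrable_joinLast hf
  rw [halfMeasure_eq_map, measurableEmbedding_joinLast.integral_map]
  exact integral_prod _ h

theorem hasDerivAt_joinLast (x' : EuclideanSpace ℝ (Fin n)) (y : ℝ) :
    HasDerivAt (fun y => joinLast (x', y)) (EuclideanSpace.single (Fin.last n) 1) y := by
  have h : (fun y => joinLast (x', y))
      = fun y => joinLast (x', 0) + y • EuclideanSpace.single (Fin.last n) (1 : ℝ) := by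
    ext y i
    refine Fin.lastCases ?_ (fun j => ?_) i
    · simp
    · simp
  rw [h]
  have := ((hasDerivAt_id y).smul_const (EuclideanSpace.single (Fin.last n) (1 : ℝ))).const_add
    (joinLast (x', 0))
  simpa using this

theorem norm_sq_gradient_ge (η : Eu n → ℝ) (x : Eu n) :
    ‖x‖ ^ 2 * (fderiv ℝ η x (EuclideanSpace.single (Fin.last n) 1)) ^ 2 ≤ ‖sgrad η x‖ ^ 2 := by
  have h := abs_real_inner_le_norm (sgrad η x) (EuclideanSpace.single (Fin.last n) (1 : ℝ))
  rw [inner_sgrad] at h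
  have h1 : ‖EuclideanSpace.single (Fin.last n) (1 : ℝ)‖ = 1 := by simp
  rw [h1, mul_one] at h
  rw [← mul_pow, ← sq_abs]
  exact pow_le_pow_left₀ (abs_nonneg _) h 2

/-- The radial weight `1 + τ |x|^α`. -/
noncomputable def lamW (τ α : ℝ) (x : Eu n) : ℝ := 1 + τ * rexp α x

theorem one_le_lamW {τ : ℝ} (hτ : 0 ≤ τ) (α : ℝ) (x : Eu n) : 1 ≤ lamW τ α x := by
  have := mul_nonneg hτ (rexp_pos α x).le
  unfold lamW; linarith

theorem IsTest.integrable_trace_density (ha : -1 < a) {η : Eu n → ℝ} (h : IsTest η) (τ α : ℝ) :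
    Integrable (fun x => ‖sgrad η x‖ ^ 2 + (lamW τ α x * η x) ^ 2) (invMeasure n a) := by
  refine (h.memLp_sgrad ha 2).norm.integrable_sq.add ?_
  have h1 : IsTest fun x => lamW τ α x * η x :=
    h.radial_mul (k := fun t => 1 + τ * Real.exp (α * t)) (by fun_prop)
  exact (h1.memLp ha 2).integrable_sq

/-- The trace inequality with the weight `1 + τ |x|^α`. -/
theorem trace_inequality (ha : -1 < a) (ha' : a < 1) : ∃ C : ℝ, 0 < C ∧ ∀ τ α : ℝ, 0 ≤ τ → 0 ≤ α →
    ∀ η : Eu n → ℝ, IsTest η →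
      ∫ x', lamW τ α (bdryPt x') ^ (1 - a) * ‖x'‖ ^ (-(n : ℝ)) * η (bdryPt x') ^ 2
        ≤ C * ∫ x, (‖sgrad η x‖ ^ 2 + (lamW τ α x * η x) ^ 2) ∂(invMeasure n a) := by
  set C₀ : ℝ := (1 + a) * (2 + 1 / (1 - a)) with hC₀
  set Q : ℝ := n + 1 + a with hQ
  have hQ0 : 0 < Q := by have : (0 : ℝ) ≤ n := Nat.cast_nonneg n; linarith
  have h1a : 0 < 1 + a := by linarith
  have h1a' : 0 < 1 - a := by linarith
  have hC₀p : 0 < C₀ := by positivity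
  refine ⟨C₀ * 2 ^ Q, by positivity, fun τ α hτ hα η hη => ?_⟩
  have hint := hη.integrable_trace_density ha τ α
  rw [integrable_invMeasure_iff] at hint
  rw [integral_invMeasure, integral_halfMeasure hint, ← integral_const_mul]
  have hprod := integrable_joinLast hint
  refine integral_mono_of_nonneg (Eventually.of_forall fun x' => ?_)
    (hprod.integral_prod_left.const_mul _) ?_
  · have := one_le_lamW hτ α (bdryPt x')
    simp only [Pi.zero_apply]; positivity
  filter_upwards [hprod.prod_right_ae] with x' hx'
  by_cases h0 : x' = 0
  · have : η (bdryPt x') = 0 := by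
      have : bdryPt x' = 0 := by rw [← norm_eq_zero, norm_bdryPt, h0, norm_zero]
      rw [this]; exact image_eq_zero_of_notMem_tsupport hη.zero_notMem
    rw [this]
    simp only [ne_eq, OfNat.ofNat_ne_zero, not_false_eq_true, zero_pow, mul_zero]
    refine mul_nonneg (by positivity) (setIntegral_nonneg measurableSet_Ioi fun y hy => ?_)
    have : joinLast (x', y) ∈ upperHalf n := by simpa [upperHalf] using hy
    exact mul_nonneg (coneWeight_pos this).le (by positivity)
  set r := ‖x'‖ with hr
  have hr0 : 0 < r := norm_pos_iff.2 h0
  set L := lamW τ α (bdryPt x') with hL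
  have hL1 : 1 ≤ L := one_le_lamW hτ α _
  have hL0 : 0 < L := by linarith
  -- This height balances the two terms of the one-dimensional inequality, since δ²L² = r². As L ≥ 1
  -- it is at most r, so |x| stays between r and 2r on the vertical segment, which costs the factor
  -- 2^Q.
  set δ := r / L with hδ
  have hδ0 : 0 < δ := by positivity
  have hδr : δ ≤ r := div_le_self hr0.le hL1
  set g : ℝ → ℝ := fun y => η (joinLast (x', y)) with hg
  set g' : ℝ → ℝ := fun y => fderiv ℝ η (joinLast (x', y)) (EuclideanSpace.single (Fin.last n) 1)
    with hg'
  have hcj : Continuous fun y : ℝ => joinLast (x', y) := continuous_joinLast.comp (by fun_prop)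
  have hgd : ∀ y, HasDerivAt g (g' y) y := fun y =>
    (hη.differentiable _).hasFDerivAt.comp_hasDerivAt y (hasDerivAt_joinLast x' y)
  have hg'c : Continuous g' :=
    ((hη.contDiff.continuous_fderiv (by simp)).comp hcj).clm_apply continuous_const
  have hgc : Continuous g := continuous_iff_continuousAt.2 fun t => (hgd t).continuousAt
  have h1d := sq_le_weighted_integral ha ha' hδ0 hgd hg'c
  have hint1 : ∀ φ : ℝ → ℝ, Continuous φ → IntegrableOn (fun y : ℝ => y ^ a * φ y) (Set.Ioc 0 δ) := by
    intro φ hφ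
    have h2 : IntegrableOn (fun y : ℝ => y ^ a) (Set.Icc 0 δ) :=
      (integrableOn_Icc_iff_integrableOn_Ioc).2
        ((intervalIntegrable_iff_integrableOn_Ioc_of_le hδ0.le).1
          (intervalIntegral.intervalIntegrable_rpow' ha))
    exact (h2.mul_continuousOn hφ.continuousOn isCompact_Icc).mono_set Set.Ioc_subset_Icc_self
  have i1 := hint1 (fun y => g y ^ 2) (by fun_prop)
  have i2 := hint1 (fun y => g' y ^ 2) (by fun_prop)
  have hpt : ∀ y ∈ Set.Ioc 0 δ, r ^ (-Q) * (L ^ 2 * (y ^ a * g y ^ 2) + r ^ 2 * (y ^ a * g' y ^ 2))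
      ≤ 2 ^ Q * (coneWeight n a (joinLast (x', y)) •
        (‖sgrad η (joinLast (x', y))‖ ^ 2 + (lamW τ α (joinLast (x', y)) * η (joinLast (x', y))) ^ 2)) := by
    intro y hy
    set x := joinLast (x', y) with hx
    have hnx := norm_joinLast_sq (x', y)
    rw [← hx] at hnx
    have hy0 : 0 < y := hy.1
    have hyr : y ≤ r := hy.2.trans hδr
    simp only [← hr] at hnx
    have hrx : r ≤ ‖x‖ := abs_le_of_sq_le_sq' (by nlinarith) (norm_nonneg _) |>.2
    have hxr : ‖x‖ ≤ 2 * r := abs_le_of_sq_le_sq' (by nlinarith) (by positivity) |>.2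
    have hx0 : 0 < ‖x‖ := hr0.trans_le hrx
    have hlam : L ≤ lamW τ α x := by
      rw [hL, lamW, lamW, rexp, rexp, norm_bdryPt]
      gcongr
    have hpow : r ^ (-Q) ≤ 2 ^ Q * ‖x‖ ^ (-Q) := by
      have h1 : (2 * r) ^ (-Q) ≤ ‖x‖ ^ (-Q) :=
        Real.rpow_le_rpow_of_nonpos hx0 hxr (by linarith)
      rw [Real.mul_rpow (by norm_num) hr0.le] at h1
      calc r ^ (-Q) = 2 ^ Q * (2 ^ (-Q) * r ^ (-Q)) := by
            rw [← mul_assoc, ← Real.rpow_add (by norm_num)]; simp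
        _ ≤ _ := mul_le_mul_of_nonneg_left h1 (by positivity)
    have hsum : L ^ 2 * (y ^ a * g y ^ 2) + r ^ 2 * (y ^ a * g' y ^ 2)
        ≤ y ^ a * (‖sgrad η x‖ ^ 2 + (lamW τ α x * η x) ^ 2) := by
      have e1 : L ^ 2 * g y ^ 2 ≤ (lamW τ α x * η x) ^ 2 := by
        rw [mul_pow]
        exact mul_le_mul_of_nonneg_right (pow_le_pow_left₀ hL0.le hlam 2) (sq_nonneg _)
      have e2 : r ^ 2 * g' y ^ 2 ≤ ‖sgrad η x‖ ^ 2 :=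
        (mul_le_mul_of_nonneg_right (pow_le_pow_left₀ hr0.le hrx 2) (sq_nonneg _)).trans
          (norm_sq_gradient_ge η x)
      have := mul_le_mul_of_nonneg_left (add_le_add e2 e1) (Real.rpow_nonneg hy0.le a)
      refine le_trans (le_of_eq ?_) this
      ring
    have hlast : x (Fin.last n) = y := by rw [hx]; simp
    calc _ ≤ (2 ^ Q * ‖x‖ ^ (-Q)) * (y ^ a * (‖sgrad η x‖ ^ 2 + (lamW τ α x * η x) ^ 2)) := by
          refine mul_le_mul hpow hsum ?_ (by positivity)
          positivity
      _ = _ := by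
          rw [smul_eq_mul, coneWeight, hlast, hQ]; ring
  have hstep : ∫ y in Set.Ioc 0 δ,
        r ^ (-Q) * (L ^ 2 * (y ^ a * g y ^ 2) + r ^ 2 * (y ^ a * g' y ^ 2))
      ≤ 2 ^ Q * ∫ y in Set.Ioi 0, coneWeight n a (joinLast (x', y)) •
        (‖sgrad η (joinLast (x', y))‖ ^ 2
          + (lamW τ α (joinLast (x', y)) * η (joinLast (x', y))) ^ 2) := by
    have hx'2 : IntegrableOn (fun y => coneWeight n a (joinLast (x', y)) •
        (‖sgrad η (joinLast (x', y))‖ ^ 2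
          + (lamW τ α (joinLast (x', y)) * η (joinLast (x', y))) ^ 2)) (Set.Ioi 0) := hx'
    refine (setIntegral_mono_on (((i1.const_mul _).add (i2.const_mul _)).const_mul _)
      ((hx'2.mono_set Set.Ioc_subset_Ioi_self).const_mul (2 ^ Q)) measurableSet_Ioc hpt).trans ?_
    rw [integral_const_mul]
    refine mul_le_mul_of_nonneg_left ?_ (by positivity)
    refine setIntegral_mono_set hx'2 ?_ Set.Ioc_subset_Ioi_self.eventuallyLE
    refine (ae_restrict_mem measurableSet_Ioi).mono fun y hy => ?_
    have : joinLast (x', y) ∈ upperHalf n := by simpa [upperHalf] using hy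
    exact mul_nonneg (coneWeight_pos this).le (by positivity)
  have hstep' := mul_le_mul_of_nonneg_left hstep hC₀p.le
  rw [← mul_assoc] at hstep'
  refine le_trans ?_ hstep'
  rw [integral_const_mul, integral_add (i1.const_mul _) (i2.const_mul _), integral_const_mul,
    integral_const_mul]
  set G := ∫ y in Set.Ioc 0 δ, y ^ a * g y ^ 2 with hG
  set B := ∫ y in Set.Ioc 0 δ, y ^ a * g' y ^ 2 with hB
  have hG0 : 0 ≤ G := setIntegral_nonneg measurableSet_Ioc fun y hy => by
    have : 0 < y := hy.1
    positivity
  have hB0 : 0 ≤ B := setIntegral_nonneg measurableSet_Ioc fun y hy => by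
    have : 0 < y := hy.1
    positivity
  have hg0 : η (bdryPt x') = g 0 := rfl
  have hδp : δ ^ (1 + a) = r ^ (1 + a) * L ^ (-(1 + a)) := by
    rw [hδ, Real.div_rpow hr0.le hL0.le, Real.rpow_neg hL0.le, div_eq_mul_inv]
  have hr1 : r ^ (-(n : ℝ)) = r ^ (-Q) * r ^ (1 + a) := by
    rw [← Real.rpow_add hr0]; congr 1; rw [hQ]; ring
  have hL2 : L ^ (1 - a) = L ^ 2 * L ^ (-(1 + a)) := by
    rw [← Real.rpow_natCast L 2, ← Real.rpow_add hL0]; congr 1; push_cast; ring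
  have hδ2 : δ ^ 2 * L ^ 2 = r ^ 2 := by rw [hδ]; field_simp
  have hrQ : 0 < r ^ (-Q) := by positivity
  calc L ^ (1 - a) * r ^ (-(n : ℝ)) * η (bdryPt x') ^ 2
      = (1 + a) * (r ^ (-Q) * L ^ 2) * (g 0 ^ 2 * (δ ^ (1 + a) / (1 + a))) := by
        rw [hg0, hr1, hL2, hδp]; field_simp
    _ ≤ (1 + a) * (r ^ (-Q) * L ^ 2) * (2 * G + δ ^ 2 / (1 - a) * B) :=
        mul_le_mul_of_nonneg_left h1d (by positivity)
    _ = (1 + a) * r ^ (-Q) * (2 * (L ^ 2 * G) + 1 / (1 - a) * (r ^ 2 * B)) := by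
        rw [← hδ2]; field_simp
    _ ≤ C₀ * (r ^ (-Q) * (L ^ 2 * G + r ^ 2 * B)) := by
        rw [hC₀]
        have e1 : 0 ≤ L ^ 2 * G := by positivity
        have e2 : 0 ≤ r ^ 2 * B := by positivity
        have e3 : 0 < 1 / (1 - a) := by positivity
        have e4 : 2 * (L ^ 2 * G) + 1 / (1 - a) * (r ^ 2 * B)
            ≤ (2 + 1 / (1 - a)) * (L ^ 2 * G + r ^ 2 * B) := by
          nlinarith [mul_nonneg e3.le e1]
        have := mul_le_mul_of_nonneg_left e4 (by positivity : 0 ≤ (1 + a) * r ^ (-Q))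
        refine this.trans (le_of_eq ?_)
        ring

end TraceInequality

/-! ### An averaging kernel looking upwards, and the weight x_{n+1}^a -/

section Kernel

open Filter Topology

variable {n : ℕ} {a : ℝ}

/-- The weighted measure `x_{n+1}^a dx` on the half-space. -/
noncomputable def powMeasure (n : ℕ) (a : ℝ) : Measure (Eu n) :=
  (halfMeasure n).withDensity fun x => ENNReal.ofReal (x (Fin.last n) ^ a)

theorem lintegral_powMeasure {f : Eu n → ℝ≥0∞} (hf : Measurable f) :
    ∫⁻ x, f x ∂(powMeasure n a)
      = ∫⁻ x, (upperHalf n).indicator (fun x => ENNReal.ofReal (x (Fin.last n) ^ a)) x * f x := by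
  rw [powMeasure, lintegral_withDensity_eq_lintegral_mul _
    (measurable_last.pow_const a).ennreal_ofReal hf, halfMeasure,
    ← lintegral_indicator measurableSet_upperHalf]
  congr 1
  ext x
  by_cases hx : x ∈ upperHalf n
  · rw [Set.indicator_of_mem hx, Set.indicator_of_mem hx]; rfl
  · rw [Set.indicator_of_notMem hx, Set.indicator_of_notMem hx, zero_mul]

theorem powMeasure_closedBall_lt_top (ha : -1 < a) (ρ : ℝ) :
    powMeasure n a (Metric.closedBall 0 ρ) < ⊤ := by
  rw [powMeasure, withDensity_apply _ measurableSet_closedBall, halfMeasure,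
    Measure.restrict_restrict measurableSet_closedBall, Set.inter_comm]
  exact (integrableOn_rpow_last (n := n) ha ρ).lintegral_lt_top

theorem isLocallyFiniteMeasure_powMeasure (ha : -1 < a) :
    IsLocallyFiniteMeasure (powMeasure n a) := by
  refine ⟨fun x => ⟨Metric.closedBall 0 (‖x‖ + 1), ?_, powMeasure_closedBall_lt_top ha _⟩⟩
  refine Filter.mem_of_superset (Metric.ball_mem_nhds x one_pos) fun y hy => ?_
  rw [mem_closedBall_zero_iff]
  have h1 : ‖y - x‖ < 1 := by simpa [dist_eq_norm] using hy
  have h2 := norm_le_norm_add_norm_sub x y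
  linarith [norm_sub_rev x y]

/-- The kernel of unit scale: a smooth bump around `-3 e_{n+1}`. -/
noncomputable def unitKernel (n : ℕ) : Eu n → ℝ :=
  (⟨1 / 2, 1, by norm_num, by norm_num⟩ :
    ContDiffBump (-(3 : ℝ) • EuclideanSpace.single (Fin.last n) (1 : ℝ) : Eu n)).normed volume

/-- The rescaled kernel. -/
noncomputable def shiftKernel (n : ℕ) (ε : ℝ) (t : Eu n) : ℝ :=
  (ε ^ (n + 1))⁻¹ * unitKernel n (ε⁻¹ • t)

theorem contDiff_shiftKernel (ε : ℝ) : ContDiff ℝ ∞ (shiftKernel n ε) :=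
  contDiff_const.mul ((ContDiffBump.contDiff_normed _).comp (contDiff_const_smul _))

theorem shiftKernel_nonneg {ε : ℝ} (hε : 0 < ε) (t : Eu n) : 0 ≤ shiftKernel n ε t :=
  mul_nonneg (by positivity) (ContDiffBump.nonneg_normed _ _)

theorem tsupport_shiftKernel_subset {ε : ℝ} (hε : 0 < ε) : tsupport (shiftKernel n ε) ⊆
    Metric.closedBall (-(3 * ε) • EuclideanSpace.single (Fin.last n) (1 : ℝ)) ε := by
  refine closure_minimal (fun t ht => ?_) Metric.isClosed_closedBall
  have h1 : unitKernel n (ε⁻¹ • t) ≠ 0 := fun h => ht (by simp [shiftKernel, h])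
  have h2 : ε⁻¹ • t ∈ Function.support (unitKernel n) := h1
  rw [unitKernel, ContDiffBump.support_normed_eq, mem_ball_iff_norm] at h2
  rw [mem_closedBall_iff_norm]
  have h3 : t - -(3 * ε) • EuclideanSpace.single (Fin.last n) (1 : ℝ)
      = ε • (ε⁻¹ • t - -(3 : ℝ) • EuclideanSpace.single (Fin.last n) (1 : ℝ)) := by
    rw [smul_sub, smul_smul, smul_smul, mul_inv_cancel₀ hε.ne', one_smul]
    congr 2; ring
  rw [h3, norm_smul, Real.norm_of_nonneg hε.le]
  exact mul_le_of_le_one_right hε.le h2.le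

theorem hasCompactSupport_shiftKernel {ε : ℝ} (hε : 0 < ε) :
    HasCompactSupport (shiftKernel n ε) :=
  HasCompactSupport.of_support_subset_isCompact (isCompact_closedBall _ _)
    ((subset_tsupport _).trans (tsupport_shiftKernel_subset hε))

/-- Convolution evaluates at x - t, so negative heights of t mean that only points at heights 2ε to
4ε above x are used; the average at a point of the half-space never leaves it. -/
theorem mem_tsupport_shiftKernel {ε : ℝ} (hε : 0 < ε) {t : Eu n}
    (ht : t ∈ tsupport (shiftKernel n ε)) :
    -(4 * ε) ≤ t (Fin.last n) ∧ t (Fin.last n) ≤ -(2 * ε) ∧ ‖t‖ ≤ 4 * ε := by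
  have h1 := tsupport_shiftKernel_subset hε ht
  rw [mem_closedBall_iff_norm] at h1
  have h2 := (abs_last_le_norm (t - -(3 * ε) • EuclideanSpace.single (Fin.last n) (1 : ℝ))).trans h1
  simp only [PiLp.sub_apply, PiLp.smul_apply, PiLp.single_apply, if_true, smul_eq_mul,
    mul_one] at h2
  obtain ⟨h3, h4⟩ := abs_le.1 h2
  refine ⟨by linarith, by linarith, ?_⟩
  have h5 := norm_le_norm_sub_add t (-(3 * ε) • EuclideanSpace.single (Fin.last n) (1 : ℝ))
  have h6 : ‖-(3 * ε) • EuclideanSpace.single (Fin.last n) (1 : ℝ)‖ = 3 * ε := by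
    rw [norm_smul]; simp [hε.le]
  linarith

theorem integral_shiftKernel {ε : ℝ} (hε : 0 < ε) : ∫ t, shiftKernel n ε t = 1 := by
  simp only [shiftKernel]
  rw [integral_const_mul, Measure.integral_comp_smul, unitKernel, ContDiffBump.integral_normed]
  have : Module.finrank ℝ (Eu n) = n + 1 := by simp
  rw [this, smul_eq_mul, mul_one, inv_pow, inv_inv, abs_of_pos (by positivity)]
  exact inv_mul_cancel₀ (by positivity)

theorem lintegral_shiftKernel {ε : ℝ} (hε : 0 < ε) :
    ∫⁻ t, ENNReal.ofReal (shiftKernel n ε t) = 1 := by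
  rw [← ofReal_integral_eq_lintegral_ofReal, integral_shiftKernel hε, ENNReal.ofReal_one]
  · exact (contDiff_shiftKernel ε).continuous.integrable_of_hasCompactSupport
      (hasCompactSupport_shiftKernel hε)
  · exact Eventually.of_forall fun t => shiftKernel_nonneg hε t

theorem exists_unitKernel_le (n : ℕ) : ∃ C : ℝ, 0 < C ∧ ∀ t, unitKernel n t ≤ C := by
  obtain ⟨C, hC⟩ := (ContDiffBump.hasCompactSupport_normed (μ := volume) (⟨1 / 2, 1, by norm_num, by norm_num⟩ :
    ContDiffBump (-(3 : ℝ) • EuclideanSpace.single (Fin.last n) (1 : ℝ) : Eu n))).exists_bound_of_continuous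
    (ContDiffBump.continuous_normed _)
  exact ⟨max C 1, by positivity, fun t => le_max_of_le_left ((le_abs_self _).trans (hC t))⟩

/-- The weight `x_{n+1}^a` on the half-space, extended by zero. -/
noncomputable def halfWeight (n : ℕ) (a : ℝ) : Eu n → ℝ≥0∞ :=
  (upperHalf n).indicator fun x => ENNReal.ofReal (x (Fin.last n) ^ a)

theorem measurable_halfWeight : Measurable (halfWeight n a) :=
  (measurable_last.pow_const a).ennreal_ofReal.indicator measurableSet_upperHalf

/-- For a ≥ 0 this is monotonicity; for a < 0 the loss is k^{-a}, which is at most k because a > -1.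
-/
theorem rpow_le_of_comparable {x z k : ℝ} (ha : -1 < a) (hz : 0 < z) (hx : 0 < x)
    (hk : 1 ≤ k) (h1 : z ≤ k * x) (h2 : x ≤ z) : x ^ a ≤ k * z ^ a := by
  rcases le_total 0 a with h | h
  · calc x ^ a ≤ z ^ a := Real.rpow_le_rpow hx.le h2 h
      _ ≤ k * z ^ a := le_mul_of_one_le_left (by positivity) hk
  · have h3 : z / k ≤ x := by rw [div_le_iff₀ (by linarith)]; linarith
    calc x ^ a ≤ (z / k) ^ a := Real.rpow_le_rpow_of_nonpos (by positivity) h3 h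
      _ = k ^ (-a) * z ^ a := by
        rw [Real.div_rpow hz.le (by linarith), Real.rpow_neg (by linarith)]; field_simp
      _ ≤ k * z ^ a := by
        refine mul_le_mul_of_nonneg_right ?_ (by positivity)
        calc k ^ (-a) ≤ k ^ (1 : ℝ) := Real.rpow_le_rpow_of_exponent_le hk (by linarith)
          _ = k := Real.rpow_one k

/-- The ball is enclosed in a cylinder over a ball of radius 4ε. The height z_{n+1} + t_{n+1} is at
most 8ε + 4ε = 12ε, and y^a is integrable at 0. -/
theorem lintegral_halfWeight_ball (ha : -1 < a) {ε : ℝ} (hε : 0 < ε) {z : Eu n}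
    (hz : z (Fin.last n) ≤ 8 * ε) :
    ∫⁻ t in Metric.closedBall 0 (4 * ε), halfWeight n a (z + t)
      ≤ volume (Metric.closedBall (0 : EuclideanSpace ℝ (Fin n)) (4 * ε))
        * ENNReal.ofReal ((12 * ε) ^ (a + 1) / (a + 1)) := by
  set w : ℝ → ℝ≥0∞ := (Set.Ioc 0 (12 * ε)).indicator fun y => ENNReal.ofReal (y ^ a) with hw
  have hwm : Measurable w := (by fun_prop : Measurable fun y : ℝ => ENNReal.ofReal (y ^ a)).indicator
    measurableSet_Ioc
  set B := Metric.closedBall (0 : EuclideanSpace ℝ (Fin n)) (4 * ε) with hB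
  rw [← lintegral_indicator measurableSet_closedBall,
    ← measurePreserving_joinLast.lintegral_comp_emb measurableEmbedding_joinLast]
  have hle : ∀ p : EuclideanSpace ℝ (Fin n) × ℝ,
      (Metric.closedBall (0 : Eu n) (4 * ε)).indicator (fun t => halfWeight n a (z + t)) (joinLast p)
      ≤ B.indicator (fun _ => (1 : ℝ≥0∞)) p.1 * w (z (Fin.last n) + p.2) := by
    intro p
    by_cases hp : joinLast p ∈ Metric.closedBall (0 : Eu n) (4 * ε)
    · rw [Set.indicator_of_mem hp]
      rw [mem_closedBall_zero_iff] at hp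
      have h1 := norm_joinLast_sq p
      have h2 : ‖p.1‖ ≤ 4 * ε := le_trans
        (abs_le_of_sq_le_sq' (by nlinarith [sq_nonneg p.2]) (norm_nonneg _) |>.2) hp
      have h3 : p.2 ≤ 4 * ε := by
        simpa using ((le_abs_self _).trans (abs_last_le_norm (joinLast p))).trans hp
      have h2' : p.1 ∈ B := by simpa [hB] using h2
      rw [Set.indicator_of_mem h2', one_mul]
      by_cases h4 : z + joinLast p ∈ upperHalf n
      · have h5 : 0 < z (Fin.last n) + p.2 := by simpa [upperHalf] using h4
        have h6 : z (Fin.last n) + p.2 ∈ Set.Ioc 0 (12 * ε) := ⟨h5, by linarith⟩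
        rw [halfWeight, Set.indicator_of_mem h4, hw, Set.indicator_of_mem h6]
        simp
      · rw [halfWeight, Set.indicator_of_notMem h4]; exact zero_le
    · rw [Set.indicator_of_notMem hp]; exact zero_le
  refine (lintegral_mono hle).trans (le_of_eq ?_)
  have hwm2 : Measurable fun y => w (z (Fin.last n) + y) := hwm.comp (measurable_const_add _)
  rw [lintegral_prod_mul ((measurable_const.indicator measurableSet_closedBall).aemeasurable)
    hwm2.aemeasurable, lintegral_indicator measurableSet_closedBall,
    lintegral_add_left_eq_self w, hw, lintegral_indicator measurableSet_Ioc]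
  congr 1
  · simp [hB]
  · have h12 : 0 ≤ 12 * ε := by positivity
    rw [← ofReal_integral_eq_lintegral_ofReal]
    · rw [← intervalIntegral.integral_of_le h12, integral_rpow (Or.inl ha),
        Real.zero_rpow (by linarith), sub_zero]
    · exact (intervalIntegrable_iff_integrableOn_Ioc_of_le h12).1
        (intervalIntegral.intervalIntegrable_rpow' ha)
    · refine (ae_restrict_mem measurableSet_Ioc).mono fun y hy => ?_
      exact Real.rpow_nonneg hy.1.le a

/-- The weight is almost invariant under the averaging with the shifted kernel. -/
theorem exists_lintegral_shiftKernel_le (n : ℕ) (ha : -1 < a) :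
    ∃ K : ℝ, 0 < K ∧ ∀ ε : ℝ, 0 < ε → ∀ z : Eu n,
      ∫⁻ t, ENNReal.ofReal (shiftKernel n ε t) * halfWeight n a (z + t)
        ≤ ENNReal.ofReal K * halfWeight n a z := by
  obtain ⟨Ck, hCk, hk⟩ := exists_unitKernel_le n
  set vn := (volume (Metric.closedBall (0 : EuclideanSpace ℝ (Fin n)) 1)).toReal with hvn
  have ha1 : 0 < a + 1 := by linarith
  set K₀ := Ck * 4 ^ n * vn * (12 ^ (a + 1) / (a + 1)) * 8 with hK₀
  have hK₀0 : 0 ≤ K₀ := by positivity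
  refine ⟨K₀ + 2, by positivity, fun ε hε z => ?_⟩
  -- Three regimes in the height of z. At height at most 2ε, the shift by at least 2ε downwards
  -- leaves the half-space and the average is zero.
  by_cases hz2 : z (Fin.last n) ≤ 2 * ε
  · have : ∀ t, ENNReal.ofReal (shiftKernel n ε t) * halfWeight n a (z + t) = 0 := by
      intro t
      by_cases ht : t ∈ tsupport (shiftKernel n ε)
      · have h1 := (mem_tsupport_shiftKernel hε ht).2.1
        have h2 : z + t ∉ upperHalf n := by
          simp only [upperHalf, Set.mem_ofPred_eq, PiLp.add_apply, not_lt]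
          linarith
        rw [halfWeight, Set.indicator_of_notMem h2, mul_zero]
      · rw [image_eq_zero_of_notMem_tsupport ht, ENNReal.ofReal_zero, zero_mul]
    simp [this]
  push Not at hz2
  set y := z (Fin.last n) with hy
  have hy0 : 0 < y := by linarith
  have hzu : z ∈ upperHalf n := hy0
  have hWz : halfWeight n a z = ENNReal.ofReal (y ^ a) := by
    rw [halfWeight, Set.indicator_of_mem hzu]
  have hya : 0 < y ^ a := by positivity
  -- High above the boundary the shift, at most 4ε, changes the height by at most a factor 2, and
  -- the kernel has mass one.
  by_cases hz8 : 8 * ε ≤ y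
  · have hle : ∀ t, ENNReal.ofReal (shiftKernel n ε t) * halfWeight n a (z + t)
        ≤ ENNReal.ofReal (shiftKernel n ε t) * ENNReal.ofReal (2 * y ^ a) := by
      intro t
      by_cases ht : t ∈ tsupport (shiftKernel n ε)
      · obtain ⟨h1, h2, -⟩ := mem_tsupport_shiftKernel hε ht
        refine mul_le_mul_right ?_ _
        have h3 : (z + t) (Fin.last n) = y + t (Fin.last n) := rfl
        have h4 : z + t ∈ upperHalf n := by
          change 0 < (z + t) (Fin.last n)
          rw [h3]; linarith
        rw [halfWeight, Set.indicator_of_mem h4, h3]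
        apply ENNReal.ofReal_le_ofReal
        exact rpow_le_of_comparable ha hy0 (by linarith) (by norm_num) (by linarith) (by linarith)
      · rw [image_eq_zero_of_notMem_tsupport ht, ENNReal.ofReal_zero, zero_mul, zero_mul]
    refine (lintegral_mono hle).trans ?_
    rw [lintegral_mul_const _ (contDiff_shiftKernel ε).continuous.measurable.ennreal_ofReal,
      lintegral_shiftKernel hε, one_mul, hWz, ← ENNReal.ofReal_mul (by positivity)]
    apply ENNReal.ofReal_le_ofReal
    nlinarith
  -- In between, the kernel is replaced by its maximum, of order ε^{-(n+1)}, on a ball of radius 4ε.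
  -- The result is of order ε^a, and ε is comparable to y up to the factor 8.
  · push Not at hz8
    have hle : ∀ t, ENNReal.ofReal (shiftKernel n ε t) * halfWeight n a (z + t)
        ≤ (Metric.closedBall (0 : Eu n) (4 * ε)).indicator (fun t =>
          ENNReal.ofReal ((ε ^ (n + 1))⁻¹ * Ck) * halfWeight n a (z + t)) t := by
      intro t
      by_cases ht : t ∈ tsupport (shiftKernel n ε)
      · have h1 : t ∈ Metric.closedBall (0 : Eu n) (4 * ε) := by
          simpa using (mem_tsupport_shiftKernel hε ht).2.2
        rw [Set.indicator_of_mem h1]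
        refine mul_le_mul_left (ENNReal.ofReal_le_ofReal ?_) _
        exact mul_le_mul_of_nonneg_left (hk _) (by positivity)
      · rw [image_eq_zero_of_notMem_tsupport ht, ENNReal.ofReal_zero, zero_mul]; exact zero_le
    refine (lintegral_mono hle).trans ?_
    have hm : Measurable fun t => halfWeight n a (z + t) :=
      measurable_halfWeight.comp (measurable_const_add z)
    rw [lintegral_indicator measurableSet_closedBall, lintegral_const_mul _ hm]
    refine (mul_le_mul_right (lintegral_halfWeight_ball ha hε hz8.le) _).trans ?_
    have hvol : volume (Metric.closedBall (0 : EuclideanSpace ℝ (Fin n)) (4 * ε))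
        = ENNReal.ofReal ((4 * ε) ^ n * vn) := by
      rw [Measure.addHaar_closedBall' _ _ (by positivity), ENNReal.ofReal_mul (by positivity),
        hvn, ENNReal.ofReal_toReal measure_closedBall_lt_top.ne]
      simp
    rw [hvol, hWz, ← ENNReal.ofReal_mul (by positivity), ← ENNReal.ofReal_mul (by positivity),
      ← ENNReal.ofReal_mul (by positivity)]
    apply ENNReal.ofReal_le_ofReal
    have hεa : ε ^ a ≤ 8 * y ^ a :=
      rpow_le_of_comparable ha hy0 hε (by norm_num) hz8.le (by linarith)
    calc (ε ^ (n + 1))⁻¹ * Ck * ((4 * ε) ^ n * vn * ((12 * ε) ^ (a + 1) / (a + 1)))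
        = Ck * 4 ^ n * vn * (12 ^ (a + 1) / (a + 1)) * ε ^ a := by
          rw [Real.mul_rpow (by norm_num) hε.le, Real.rpow_add hε, Real.rpow_one, mul_pow]
          field_simp
          ring
      _ ≤ Ck * 4 ^ n * vn * (12 ^ (a + 1) / (a + 1)) * (8 * y ^ a) :=
          mul_le_mul_of_nonneg_left hεa (by positivity)
      _ = K₀ * y ^ a := by rw [hK₀]; ring
      _ ≤ (K₀ + 2) * y ^ a := by nlinarith

end Kernel

/-! ### Approximation by shifted averages in L²(x_{n+1}^a) -/

section ShiftAverage

open Filter Topology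

variable {n : ℕ} {a : ℝ}

/-- The average of `f` over a small ball above the point. -/
noncomputable def shiftAvg (ε : ℝ) (f : Eu n → ℝ) (x : Eu n) : ℝ :=
  ∫ t, shiftKernel n ε t * f (x - t)

theorem shiftAvg_eq_convolution (ε : ℝ) (f : Eu n → ℝ) :
    shiftAvg ε f = convolution (shiftKernel n ε) f (ContinuousLinearMap.lsmul ℝ ℝ) volume := rfl

theorem contDiff_shiftAvg {ε : ℝ} (hε : 0 < ε) {f : Eu n → ℝ} (hf : LocallyIntegrable f) :
    ContDiff ℝ ∞ (shiftAvg ε f) := by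
  rw [shiftAvg_eq_convolution]
  exact (hasCompactSupport_shiftKernel hε).contDiff_convolution_left _ (contDiff_shiftKernel ε) hf

theorem integrable_shiftKernel_mul {ε : ℝ} (hε : 0 < ε) {f : Eu n → ℝ} (hf : LocallyIntegrable f)
    (x : Eu n) : Integrable fun t => shiftKernel n ε t * f (x - t) :=
  (hasCompactSupport_shiftKernel hε).convolutionExists_left (ContinuousLinearMap.lsmul ℝ ℝ)
    (contDiff_shiftKernel ε).continuous hf x

theorem shiftAvg_sub {ε : ℝ} (hε : 0 < ε) {f g : Eu n → ℝ} (hf : LocallyIntegrable f)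
    (hg : LocallyIntegrable g) (x : Eu n) :
    shiftAvg ε (fun x => f x - g x) x = shiftAvg ε f x - shiftAvg ε g x := by
  rw [shiftAvg, shiftAvg, shiftAvg, ← integral_sub (integrable_shiftKernel_mul hε hf x)
    (integrable_shiftKernel_mul hε hg x)]
  simp only [mul_sub]

/-- Jensen's inequality for the square, obtained by Cauchy–Schwarz since the kernel is a probability
density. -/
theorem enorm_shiftAvg_sq_le {ε : ℝ} (hε : 0 < ε) {f : Eu n → ℝ} (hf : Measurable f) (x : Eu n) :
    ‖shiftAvg ε f x‖ₑ ^ 2 ≤ ∫⁻ t, ENNReal.ofReal (shiftKernel n ε t) * ‖f (x - t)‖ₑ ^ 2 := by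
  have hκm : Measurable fun t => ENNReal.ofReal (shiftKernel n ε t) :=
    (contDiff_shiftKernel ε).continuous.measurable.ennreal_ofReal
  have hfm : Measurable fun t => ‖f (x - t)‖ₑ := (hf.comp (measurable_const_sub x)).enorm
  set μ := (volume : Measure (Eu n)).withDensity fun t => ENNReal.ofReal (shiftKernel n ε t) with hμ
  have h1 : ‖shiftAvg ε f x‖ₑ ≤ ∫⁻ t, ‖f (x - t)‖ₑ ∂μ := by
    rw [hμ, lintegral_withDensity_eq_lintegral_mul _ hκm hfm]
    refine (enorm_integral_le_lintegral_enorm _).trans (le_of_eq (lintegral_congr fun t => ?_))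
    rw [enorm_mul, Real.enorm_of_nonneg (shiftKernel_nonneg hε t)]; rfl
  have hμ1 : μ Set.univ = 1 := by
    rw [hμ, withDensity_apply _ MeasurableSet.univ, Measure.restrict_univ, lintegral_shiftKernel hε]
  have h2 := ENNReal.lintegral_mul_le_Lp_mul_Lq μ Real.HolderConjugate.two_two
    (f := fun _ => (1 : ℝ≥0∞)) aemeasurable_const hfm.aemeasurable
  simp only [Pi.mul_apply, one_mul, ENNReal.one_rpow, lintegral_const, hμ1] at h2
  calc ‖shiftAvg ε f x‖ₑ ^ 2 ≤ _ := pow_le_pow_left' (h1.trans h2) 2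
    _ = ∫⁻ t, ‖f (x - t)‖ₑ ^ 2 ∂μ := by
      rw [← ENNReal.rpow_natCast, ← ENNReal.rpow_mul]
      norm_num
    _ = _ := by
      rw [hμ, lintegral_withDensity_eq_lintegral_mul _ hκm (hfm.pow_const 2)]
      rfl

/-- After Jensen, Fubini and a translation move the average from f onto the weight, where it is
controlled by a constant multiple of the weight itself. The bound is uniform in ε. -/
theorem eLpNorm_shiftAvg_le (n : ℕ) (ha : -1 < a) : ∃ K : ℝ, 0 < K ∧
    ∀ ε : ℝ, 0 < ε → ∀ f : Eu n → ℝ, Measurable f → LocallyIntegrable f →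
      eLpNorm (shiftAvg ε f) 2 (powMeasure n a) ≤ ENNReal.ofReal K * eLpNorm f 2 (powMeasure n a) := by
  obtain ⟨K, hK, hb⟩ := exists_lintegral_shiftKernel_le n ha
  refine ⟨Real.sqrt K, Real.sqrt_pos.2 hK, fun ε hε f hf hfl => ?_⟩
  rw [← (ENNReal.pow_right_strictMono (by norm_num : (2 : ℕ) ≠ 0)).le_iff_le]
  have hκm : Measurable fun t => ENNReal.ofReal (shiftKernel n ε t) :=
    (contDiff_shiftKernel ε).continuous.measurable.ennreal_ofReal
  rw [mul_pow, ← ENNReal.ofReal_pow (Real.sqrt_nonneg _), Real.sq_sqrt hK.le, eLpNorm_two_sq,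
    eLpNorm_two_sq, lintegral_powMeasure
      ((contDiff_shiftAvg hε hfl).continuous.measurable.enorm.pow_const 2),
    lintegral_powMeasure (hf.enorm.pow_const 2)]
  change ∫⁻ x, halfWeight n a x * _ ≤ ENNReal.ofReal K * ∫⁻ x, halfWeight n a x * _
  have hW := measurable_halfWeight (n := n) (a := a)
  calc ∫⁻ x, halfWeight n a x * ‖shiftAvg ε f x‖ₑ ^ 2
      ≤ ∫⁻ x, ∫⁻ t, halfWeight n a x * (ENNReal.ofReal (shiftKernel n ε t) * ‖f (x - t)‖ₑ ^ 2) := by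
        refine lintegral_mono fun x => ?_
        have h1 : Measurable fun t => f (x - t) := hf.comp (measurable_const_sub x)
        have h2 : Measurable fun t => ENNReal.ofReal (shiftKernel n ε t) * ‖f (x - t)‖ₑ ^ 2 :=
          hκm.mul (h1.enorm.pow_const 2)
        rw [lintegral_const_mul _ h2]
        exact mul_le_mul_right (enorm_shiftAvg_sq_le hε hf x) _
    _ = ∫⁻ t, ∫⁻ x, halfWeight n a x * (ENNReal.ofReal (shiftKernel n ε t) * ‖f (x - t)‖ₑ ^ 2) := by
        refine lintegral_lintegral_swap (Measurable.aemeasurable ?_)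
        have h1 : Measurable fun p : Eu n × Eu n => f (p.1 - p.2) :=
          hf.comp (measurable_fst.sub measurable_snd)
        exact (hW.comp measurable_fst).mul ((hκm.comp measurable_snd).mul (h1.enorm.pow_const 2))
    _ = ∫⁻ t, ∫⁻ z, halfWeight n a (z + t) * (ENNReal.ofReal (shiftKernel n ε t) * ‖f z‖ₑ ^ 2) := by
        refine lintegral_congr fun t => ?_
        rw [← lintegral_add_right_eq_self _ t]
        simp
    _ = ∫⁻ z, ∫⁻ t, halfWeight n a (z + t) * (ENNReal.ofReal (shiftKernel n ε t) * ‖f z‖ₑ ^ 2) := by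
        refine lintegral_lintegral_swap (Measurable.aemeasurable ?_)
        exact (hW.comp (measurable_snd.add measurable_fst)).mul
          ((hκm.comp measurable_fst).mul ((hf.comp measurable_snd).enorm.pow_const 2))
    _ = ∫⁻ z, (∫⁻ t, ENNReal.ofReal (shiftKernel n ε t) * halfWeight n a (z + t)) * ‖f z‖ₑ ^ 2 := by
        refine lintegral_congr fun z => ?_
        have h1 : Measurable fun t => ENNReal.ofReal (shiftKernel n ε t) * halfWeight n a (z + t) :=
          hκm.mul (hW.comp (measurable_const_add z))
        rw [← lintegral_mul_const _ h1]
        refine lintegral_congr fun t => ?_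
        ring
    _ ≤ ∫⁻ z, (ENNReal.ofReal K * halfWeight n a z) * ‖f z‖ₑ ^ 2 :=
        lintegral_mono fun z => mul_le_mul_left (hb ε hε z) _
    _ = _ := by
        have h1 : Measurable fun z => halfWeight n a z * ‖f z‖ₑ ^ 2 := hW.mul (hf.enorm.pow_const 2)
        rw [← lintegral_const_mul _ h1]
        refine lintegral_congr fun z => ?_
        ring

/-- Averages of a bounded, compactly supported function share one bound and one ball; with pointwise
convergence from continuity this is dominated convergence. -/
theorem tendsto_shiftAvg_of_continuous (ha : -1 < a) {g : Eu n → ℝ} (hg : Continuous g)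
    (hgc : HasCompactSupport g) {ε : ℕ → ℝ} (hε : ∀ j, 0 < ε j) (hε0 : Tendsto ε atTop (𝓝 0)) :
    L2Tendsto (powMeasure n a) atTop (fun j => shiftAvg (ε j) g) g := by
  obtain ⟨C, hC⟩ := hgc.exists_bound_of_continuous hg
  have hC0 : 0 ≤ C := (norm_nonneg _).trans (hC 0)
  obtain ⟨ρ, hρ⟩ := hgc.isCompact.isBounded.subset_closedBall 0
  obtain ⟨N, hN⟩ : ∃ N, ∀ j, 4 * ε j ≤ N := by
    obtain ⟨N, hN⟩ := hε0.bddAbove_range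
    exact ⟨4 * N, fun j => by linarith [hN ⟨j, rfl⟩]⟩
  have hgl : LocallyIntegrable g := hg.locallyIntegrable
  have hsh : ∀ j x, |shiftAvg (ε j) g x| ≤ C := by
    intro j x
    calc |shiftAvg (ε j) g x| ≤ ∫ t, shiftKernel n (ε j) t * C := by
          have hκ : Integrable (shiftKernel n (ε j)) :=
            (contDiff_shiftKernel (ε j)).continuous.integrable_of_hasCompactSupport
              (hasCompactSupport_shiftKernel (hε j))
          refine norm_integral_le_of_norm_le (f := fun t => shiftKernel n (ε j) t * g (x - t))
            (hκ.mul_const C) (Eventually.of_forall fun t => ?_)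
          rw [norm_mul, Real.norm_of_nonneg (shiftKernel_nonneg (hε j) t)]
          exact mul_le_mul_of_nonneg_left (hC _) (shiftKernel_nonneg (hε j) t)
      _ = C := by rw [integral_mul_const, integral_shiftKernel (hε j), one_mul]
  have hzero : ∀ j x, x ∉ Metric.closedBall (0 : Eu n) (ρ + N) → shiftAvg (ε j) g x = 0 ∧ g x = 0 := by
    intro j x hx
    rw [mem_closedBall_zero_iff, not_le] at hx
    have h0 : ∀ y : Eu n, ρ < ‖y‖ → g y = 0 := fun y hy => by
      refine image_eq_zero_of_notMem_tsupport fun h => ?_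
      have := hρ h
      rw [mem_closedBall_zero_iff] at this
      linarith
    constructor
    · rw [shiftAvg]
      refine (integral_congr_ae (Eventually.of_forall fun t => ?_)).trans (integral_zero _ _)
      by_cases ht : t ∈ tsupport (shiftKernel n (ε j))
      · have h1 := (mem_tsupport_shiftKernel (hε j) ht).2.2
        have h2 := norm_le_norm_sub_add x t
        rw [h0 (x - t) (by linarith [hN j]), mul_zero]
      · rw [image_eq_zero_of_notMem_tsupport ht, zero_mul]
    · exact h0 x (by linarith [hN 0, hε 0])
  have hmem : ∀ f : Eu n → ℝ, Continuous f → (∀ x, |f x| ≤ C) →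
      (∀ x, x ∉ Metric.closedBall (0 : Eu n) (ρ + N) → f x = 0) → MemLp f 2 (powMeasure n a) := by
    intro f hf h1 h2
    refine (memLp_indicator_const 2 (measurableSet_closedBall (x := (0 : Eu n)) (ε := ρ + N)) C
      (Or.inr (powMeasure_closedBall_lt_top ha _).ne)).mono hf.aestronglyMeasurable
      (Eventually.of_forall fun x => ?_)
    by_cases hx : x ∈ Metric.closedBall (0 : Eu n) (ρ + N)
    · rw [Set.indicator_of_mem hx]
      exact (h1 x).trans (le_abs_self C)
    · rw [h2 x hx]; simp
  have hb : MemLp ((Metric.closedBall (0 : Eu n) (ρ + N)).indicator fun _ => 2 * C) 2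
      (powMeasure n a) := memLp_indicator_const 2 measurableSet_closedBall _
        (Or.inr (powMeasure_closedBall_lt_top ha _).ne)
  refine L2Tendsto.of_dominated (fun j => (hmem _ (contDiff_shiftAvg (hε j) hgl).continuous (hsh j)
    fun x hx => (hzero j x hx).1).sub (hmem g hg hC fun x hx => (hzero 0 x hx).2)) hb
    (Eventually.of_forall fun j => Eventually.of_forall fun x => ?_)
    (Eventually.of_forall fun x => ?_)
  · by_cases hx : x ∈ Metric.closedBall (0 : Eu n) (ρ + N)
    · rw [Set.indicator_of_mem hx, two_mul]
      exact (norm_sub_le _ _).trans (add_le_add (hsh j x) (hC x))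
    · rw [Set.indicator_of_notMem hx, (hzero j x hx).1, (hzero j x hx).2]; simp
  · rw [Metric.tendsto_atTop]
    intro δ hδ
    obtain ⟨r, hr, hcont⟩ := Metric.continuousAt_iff.1 hg.continuousAt (δ / 2) (half_pos hδ)
    obtain ⟨J, hJ⟩ := Metric.tendsto_atTop.1 hε0 (r / 4) (by linarith)
    refine ⟨J, fun j hj => ?_⟩
    have h4 : 4 * ε j < r := by
      have := hJ j hj
      rw [Real.dist_eq, sub_zero, abs_of_pos (hε j)] at this
      linarith
    have hdist : dist (shiftAvg (ε j) g x) (g x) ≤ δ / 2 := by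
      rw [shiftAvg_eq_convolution]
      refine dist_convolution_le (R := r) (half_pos hδ).le (fun t ht => ?_)
        (fun t => shiftKernel_nonneg (hε j) t)
        (integral_shiftKernel (hε j)) hg.aestronglyMeasurable
        fun y hy => (hcont hy).le
      have := (mem_tsupport_shiftKernel (hε j) (subset_tsupport _ ht)).2.2
      rw [mem_ball_zero_iff]
      linarith
    linarith

/-- Density of continuous compactly supported functions together with the uniform operator bound. -/
theorem tendsto_shiftAvg (ha : -1 < a) {f : Eu n → ℝ} (hf : Measurable f)
    (hfl : LocallyIntegrable f) (hfm : MemLp f 2 (powMeasure n a)) {ε : ℕ → ℝ} (hε : ∀ j, 0 < ε j)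
    (hε0 : Tendsto ε atTop (𝓝 0)) :
    L2Tendsto (powMeasure n a) atTop (fun j => shiftAvg (ε j) f) f := by
  have := isLocallyFiniteMeasure_powMeasure (n := n) ha
  obtain ⟨K, hK, hKb⟩ := eLpNorm_shiftAvg_le n ha
  have happ : ∀ i : ℕ, ∃ g : Eu n → ℝ, HasCompactSupport g ∧
      eLpNorm (fun x => f x - g x) 2 (powMeasure n a) ≤ ENNReal.ofReal (1 / (i + 1)) ∧
      Continuous g ∧ MemLp g 2 (powMeasure n a) := fun i =>
    hfm.exists_hasCompactSupport_eLpNorm_sub_le (by norm_num)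
      (by simpa using (by positivity : (0 : ℝ) < i + 1))
  choose g hgc hgε hg hgm using happ
  have hsm : ∀ j, AEStronglyMeasurable (shiftAvg (ε j) f) (powMeasure n a) := fun j =>
    (contDiff_shiftAvg (hε j) hfl).continuous.aestronglyMeasurable
  have hsg : ∀ j i, AEStronglyMeasurable (shiftAvg (ε j) (g i)) (powMeasure n a) := fun j i =>
    (contDiff_shiftAvg (hε j) (hg i).locallyIntegrable).continuous.aestronglyMeasurable
  refine L2Tendsto.of_approx
    (fun i => tendsto_shiftAvg_of_continuous ha (hg i) (hgc i) hε hε0)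
    (fun i => ENNReal.ofReal ((K + 1) * (1 / ((i : ℝ) + 1)))) ?_ (fun i => Eventually.of_forall fun j => ?_)
    (fun i => ?_) (fun j i => (hsm j).sub (hsg j i))
    (fun j i => (hsg j i).sub (hgm i).1) (fun i => (hgm i).1.sub hfm.1)
  · have := ENNReal.tendsto_ofReal ((tendsto_one_div_add_atTop_nhds_zero_nat (𝕜 := ℝ)).const_mul (K + 1))
    simpa using this
  · have h1 : (fun x => shiftAvg (ε j) f x - shiftAvg (ε j) (g i) x)
        = shiftAvg (ε j) fun x => f x - g i x := by
      ext x; rw [shiftAvg_sub (hε j) hfl (hg i).locallyIntegrable]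
    rw [h1]
    refine (hKb (ε j) (hε j) _ (hf.sub (hg i).measurable)
      (hfl.sub (hg i).locallyIntegrable)).trans ?_
    refine (mul_le_mul_right (hgε i) _).trans ?_
    rw [← ENNReal.ofReal_mul hK.le]
    apply ENNReal.ofReal_le_ofReal
    refine mul_le_mul_of_nonneg_right (by linarith) (by positivity)
  · rw [← eLpNorm_neg]
    have h1 : -(fun x => g i x - f x) = fun x => f x - g i x := by ext x; simp
    rw [h1]
    refine (hgε i).trans (ENNReal.ofReal_le_ofReal ?_)
    refine le_mul_of_one_le_left (by positivity) (by linarith)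

end ShiftAverage

/-! ### Weighted Sobolev functions on annuli lie in the energy space -/

section Density

open Filter Topology

variable {n : ℕ} {a : ℝ}

/-- Real version of the weak gradient in the half-space. -/
def IsRealWeakGradient (u : Eu n → ℝ) (G : Eu n → Eu n) : Prop :=
  ∀ η : Eu n → ℝ, ContDiff ℝ ∞ η → HasCompactSupport η → tsupport η ⊆ upperHalf n →
    ∀ i : Fin (n + 1),
      ∫ x, pderiv i η x * u x ∂(halfMeasure n) = -∫ x, η x * G x i ∂(halfMeasure n)

theorem integral_halfMeasure_eq {f : Eu n → ℝ} (hf : ∀ x, x ∉ upperHalf n → f x = 0) :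
    ∫ x, f x ∂(halfMeasure n) = ∫ x, f x :=
  setIntegral_eq_integral_of_forall_compl_eq_zero hf

theorem shiftAvg_eq_flip (ε : ℝ) (f : Eu n → ℝ) :
    shiftAvg ε f = convolution f (shiftKernel n ε) (ContinuousLinearMap.mul ℝ ℝ) volume := by
  ext x
  rw [shiftAvg, convolution_def, ← integral_sub_left_eq_self _ volume x]
  congr 1
  ext t
  simp [mul_comm]

/-- For x in the half-space the kernel z ↦ κ_ε(x - z) is compactly supported in the open half-space,
hence admissible in the definition of the weak gradient. Below the boundary the identity would pick
up the jump of u. -/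
theorem fderiv_shiftAvg {ε : ℝ} (hε : 0 < ε) {u : Eu n → ℝ} {G : Eu n → Eu n}
    (hu : LocallyIntegrable u) (hu0 : ∀ x, x ∉ upperHalf n → u x = 0)
    (hG0 : ∀ x, x ∉ upperHalf n → G x = 0) (hw : IsRealWeakGradient u G) {x : Eu n}
    (hx : x ∈ upperHalf n) (i : Fin (n + 1)) :
    fderiv ℝ (shiftAvg ε u) x (EuclideanSpace.single i 1) = shiftAvg ε (fun z => G z i) x := by
  have hκ := contDiff_shiftKernel (n := n) ε
  have hκc := hasCompactSupport_shiftKernel (n := n) hε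
  have h1 := hκc.hasFDerivAt_convolution_right (ContinuousLinearMap.mul ℝ ℝ) hu
    (hκ.of_le (by simp)) x
  rw [shiftAvg_eq_flip ε u, h1.fderiv, convolution_precompR_apply _ hu (hκc.fderiv ℝ)
    (hκ.continuous_fderiv (by simp)), shiftAvg_eq_flip, convolution_def, convolution_def]
  set ζ : Eu n → ℝ := fun z => shiftKernel n ε (x - z) with hζ
  have hζs : ContDiff ℝ ∞ ζ := hκ.comp (contDiff_const.sub contDiff_id)
  let φ : Eu n ≃ₜ Eu n := Homeomorph.subLeft x
  have hζc : HasCompactSupport ζ := hκc.comp_homeomorph φ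
  have hζt : tsupport ζ ⊆ upperHalf n := by
    intro z hz
    have h2 : x - z ∈ tsupport (shiftKernel n ε) :=
      tsupport_comp_subset_preimage (shiftKernel n ε) φ.continuous hz
    have h3 := (mem_tsupport_shiftKernel hε h2).2.1
    have h4 : (x - z) (Fin.last n) = x (Fin.last n) - z (Fin.last n) := rfl
    have h5 : 0 < x (Fin.last n) := hx
    change 0 < z (Fin.last n)
    linarith
  have hpd : ∀ z, pderiv i ζ z = -fderiv ℝ (shiftKernel n ε) (x - z) (EuclideanSpace.single i 1) := by
    intro z
    have h2 : HasFDerivAt ζ ((fderiv ℝ (shiftKernel n ε) (x - z)).comp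
        (-ContinuousLinearMap.id ℝ (Eu n))) z :=
      (hκ.differentiable (by simp) _).hasFDerivAt.comp z ((hasFDerivAt_id z).const_sub x)
    rw [pderiv, h2.fderiv]
    simp
  have h6 := hw ζ hζs hζc hζt i
  rw [integral_halfMeasure_eq fun z hz => by rw [hu0 z hz, mul_zero],
    integral_halfMeasure_eq fun z hz => by rw [hG0 z hz]; simp] at h6
  simp only [hpd, neg_mul, integral_neg, neg_inj] at h6
  simp only [ContinuousLinearMap.mul_apply', mul_comm (u _), mul_comm (G _ _)]
  exact h6

theorem norm_le_sum_abs (v : Eu n) : ‖v‖ ≤ ∑ i, |v i| := by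
  refine abs_le_of_sq_le_sq' ?_ (Finset.sum_nonneg fun i _ => abs_nonneg _) |>.2
  rw [EuclideanSpace.norm_sq_eq]
  exact Finset.sum_sq_le_sq_sum_of_nonneg fun i _ => abs_nonneg _

theorem measurable_coord (i : Fin (n + 1)) : Measurable fun x : Eu n => x i := by fun_prop

theorem ae_powMeasure_iff {p : Eu n → Prop} :
    (∀ᵐ x ∂(powMeasure n a), p x) ↔ ∀ᵐ x ∂(halfMeasure n), p x := by
  rw [powMeasure, ae_withDensity_iff (measurable_last.pow_const a).ennreal_ofReal]
  constructor
  · intro h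
    filter_upwards [h, ae_mem_upperHalf] with x hx hu
    exact hx (ENNReal.ofReal_pos.2 (Real.rpow_pos_of_pos hu a)).ne'
  · intro h
    filter_upwards [h] with x hx _ using hx

theorem eLpNorm_powMeasure {F : Type*} [NormedAddCommGroup F] [NormedSpace ℝ F] (f : Eu n → F) :
    eLpNorm f 2 (powMeasure n a)
      = eLpNorm (fun x => (x (Fin.last n) ^ (a / 2)) • f x) 2 (halfMeasure n) := by
  refine (ENNReal.pow_right_strictMono (by norm_num : (2 : ℕ) ≠ 0)).injective ?_
  rw [eLpNorm_two_sq, eLpNorm_two_sq, powMeasure,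
    lintegral_withDensity_eq_lintegral_mul_non_measurable _
      (measurable_last.pow_const a).ennreal_ofReal (by simp)]
  apply lintegral_congr_ae
  filter_upwards [ae_mem_upperHalf] with x hx
  have hx0 : 0 < x (Fin.last n) := hx
  rw [enorm_smul, mul_pow, Pi.mul_apply, Real.enorm_of_nonneg (by positivity),
    ← ENNReal.ofReal_pow (by positivity), ← Real.rpow_natCast, ← Real.rpow_mul hx0.le]
  norm_num

theorem memLp_powMeasure {F : Type*} [NormedAddCommGroup F] [NormedSpace ℝ F] {f : Eu n → F}
    (hf : MemLp (fun x => (x (Fin.last n) ^ (a / 2)) • f x) 2 (halfMeasure n)) :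
    MemLp f 2 (powMeasure n a) := by
  refine ⟨?_, by rw [eLpNorm_powMeasure]; exact hf.2⟩
  have h1 : AEStronglyMeasurable f (halfMeasure n) := by
    refine ((measurable_last.pow_const (a / 2)).inv.aestronglyMeasurable.smul hf.1).congr ?_
    filter_upwards [ae_mem_upperHalf] with x hx
    have : (x (Fin.last n) ^ (a / 2)) ≠ 0 := (Real.rpow_pos_of_pos hx _).ne'
    simp [smul_smul, this]
  obtain ⟨g, hg, h⟩ := h1
  exact ⟨g, hg, ae_powMeasure_iff.2 h⟩

/-- Young's inequality 2|f| ≤ x_{n+1}^a f² + x_{n+1}^{-a}, where the last power is integrable on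
half-balls because a < 1. -/
theorem integrable_of_memLp_powMeasure (ha' : a < 1) {f : Eu n → ℝ} (hf : Measurable f)
    (hm : MemLp f 2 (powMeasure n a)) {ρ : ℝ}
    (h0 : ∀ x, x ∉ upperHalf n ∩ Metric.closedBall 0 ρ → f x = 0) : Integrable f := by
  set S := upperHalf n ∩ Metric.closedBall (0 : Eu n) ρ with hS
  have hSm : MeasurableSet S := measurableSet_upperHalf.inter measurableSet_closedBall
  have h1 : Integrable (fun x => f x ^ 2) (powMeasure n a) := hm.integrable_sq
  rw [powMeasure, integrable_withDensity_iff_integrable_smul'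
    (measurable_last.pow_const a).ennreal_ofReal (by simp)] at h1
  have h2 : IntegrableOn (fun x : Eu n => x (Fin.last n) ^ a * f x ^ 2) S := by
    have h3 : IntegrableOn (fun x : Eu n => (ENNReal.ofReal (x (Fin.last n) ^ a)).toReal • f x ^ 2) S :=
      IntegrableOn.mono_set (s := S) (t := upperHalf n) h1 Set.inter_subset_left
    refine h3.congr ?_
    refine (ae_restrict_mem hSm).mono fun x hx => ?_
    have : 0 < x (Fin.last n) := hx.1
    simp only
    rw [ENNReal.toReal_ofReal (by positivity), smul_eq_mul]
  have h3 : IntegrableOn f S := by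
    refine (h2.add (integrableOn_rpow_last (b := -a) (by linarith) ρ)).mono' hf.aestronglyMeasurable ?_
    refine (ae_restrict_mem hSm).mono fun x hx => ?_
    have hx0 : 0 < x (Fin.last n) := hx.1
    have h4 : x (Fin.last n) ^ a * x (Fin.last n) ^ (-a) = 1 := by
      rw [← Real.rpow_add hx0]; simp
    simp only [Pi.add_apply]
    set p := x (Fin.last n) ^ a with hp
    set q := x (Fin.last n) ^ (-a) with hq
    have hp0 : 0 < p := by positivity
    have hq0 : 0 < q := by positivity
    have h5 : (2 * |f x|) ^ 2 ≤ (p * f x ^ 2 + q) ^ 2 := by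
      have : (p * f x ^ 2 + q) ^ 2 = (p * f x ^ 2 - q) ^ 2 + 4 * (p * q) * f x ^ 2 := by ring
      rw [this, h4, mul_pow, sq_abs]
      nlinarith [sq_nonneg (p * f x ^ 2 - q)]
    have h6 := abs_le_of_sq_le_sq' h5 (by positivity) |>.2
    rw [Real.norm_eq_abs]
    linarith [abs_nonneg (f x)]
  exact (integrableOn_iff_integrable_of_support_subset fun x hx => by
    by_contra h; exact hx (h0 x h)).1 h3

/-- On an annulus off the origin the two densities differ only by the bounded factor |x|^{-(n+1+a)}.
-/
theorem exists_eLpNorm_invMeasure_le (n : ℕ) (a : ℝ) {r₁ : ℝ} (h₁ : 0 < r₁) (r₂ : ℝ) :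
    ∃ C : ℝ, 0 < C ∧ ∀ {F : Type} [NormedAddCommGroup F] [NormedSpace ℝ F] (f : Eu n → F),
      (∀ x ∈ upperHalf n, x ∉ annulus n r₁ r₂ → f x = 0) →
        eLpNorm f 2 (invMeasure n a) ≤ ENNReal.ofReal C * eLpNorm f 2 (powMeasure n a) := by
  set K := max (r₁ ^ (-(n + 1 + a))) (r₂ ^ (-(n + 1 + a))) with hK
  have hK0 : 0 < K := lt_max_of_lt_left (by positivity)
  refine ⟨Real.sqrt K, Real.sqrt_pos.2 hK0, fun f hf => ?_⟩
  rw [← (ENNReal.pow_right_strictMono (by norm_num : (2 : ℕ) ≠ 0)).le_iff_le]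
  rw [mul_pow, ← ENNReal.ofReal_pow (Real.sqrt_nonneg _), Real.sq_sqrt hK0.le, eLpNorm_two_sq,
    eLpNorm_two_sq, invMeasure, powMeasure, lintegral_withDensity_eq_lintegral_mul_non_measurable _
      measurable_coneWeight.ennreal_ofReal (by simp),
    lintegral_withDensity_eq_lintegral_mul_non_measurable _
      (measurable_last.pow_const a).ennreal_ofReal (by simp),
    ← lintegral_const_mul' _ _ ENNReal.ofReal_ne_top]
  refine lintegral_mono_ae ?_
  filter_upwards [ae_mem_upperHalf] with x hx
  simp only [Pi.mul_apply]
  by_cases hxA : x ∈ annulus n r₁ r₂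
  · rw [← mul_assoc, ← ENNReal.ofReal_mul hK0.le]
    refine mul_le_mul_left (ENNReal.ofReal_le_ofReal ?_) _
    have h2 : 0 < x (Fin.last n) := hx
    refine mul_le_mul_of_nonneg_right ?_ (by positivity)
    have hx0 : 0 < ‖x‖ := h₁.trans_le hxA.1
    rcases le_total 0 (-(n + 1 + a)) with h | h
    · exact le_max_of_le_right (Real.rpow_le_rpow hx0.le hxA.2 h)
    · exact le_max_of_le_left (Real.rpow_le_rpow_of_nonpos h₁ hxA.1 h)
  · rw [hf x hx hxA]; simp

theorem isClosed_annulus (r₁ r₂ : ℝ) : IsClosed (annulus n r₁ r₂) :=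
  (isClosed_le continuous_const continuous_norm).inter (isClosed_le continuous_norm continuous_const)

theorem shiftAvg_eq_zero {ε r₁ r₂ : ℝ} (hε : 0 < ε) {f : Eu n → ℝ}
    (hf : ∀ x, x ∉ annulus n r₁ r₂ → f x = 0) {x : Eu n}
    (hx : x ∉ annulus n (r₁ - 4 * ε) (r₂ + 4 * ε)) : shiftAvg ε f x = 0 := by
  rw [shiftAvg]
  refine (integral_congr_ae (Eventually.of_forall fun t => ?_)).trans (integral_zero _ _)
  by_cases ht : t ∈ tsupport (shiftKernel n ε)
  · have h1 := (mem_tsupport_shiftKernel hε ht).2.2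
    rw [hf (x - t), mul_zero]
    rintro ⟨h2, h3⟩
    refine hx ⟨?_, ?_⟩
    · linarith [norm_sub_le x t]
    · linarith [norm_le_norm_sub_add x t]
  · rw [image_eq_zero_of_notMem_tsupport ht, zero_mul]

theorem L2Tendsto.sum_abs {X ι κ : Type*} [MeasurableSpace X] {μ : Measure X} {l : Filter ι}
    [Fintype κ] {f : κ → ι → X → ℝ} {g : κ → X → ℝ} (h : ∀ i, L2Tendsto μ l (f i) (g i))
    (hm : ∀ i j, AEStronglyMeasurable (fun x => f i j x - g i x) μ) :
    L2Tendsto μ l (fun j x => ∑ i, |f i j x - g i x|) (fun _ => 0) := by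
  have h2 := tendsto_finsetSum (Finset.univ : Finset κ) fun i _ => h i
  rw [Finset.sum_const_zero] at h2
  refine tendsto_of_tendsto_of_tendsto_of_le_of_le tendsto_const_nhds h2 (fun _ => zero_le)
    fun j => ?_
  have h3 := eLpNorm_sum_le (μ := μ) (p := 2) (s := (Finset.univ : Finset κ))
    (f := fun i x => |f i j x - g i x|) (fun i _ => (hm i j).norm) (by norm_num)
  have e1 : (∑ i, fun x => |f i j x - g i x|) = fun x => ∑ i, |f i j x - g i x| - 0 := by
    ext x
    simp [Finset.sum_apply]
  rw [e1] at h3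
  exact h3.trans (Finset.sum_le_sum fun i _ => (eLpNorm_norm fun x => f i j x - g i x).le)

/-- The shifted averages of u are the approximating test functions: they are smooth on the whole
space, and in the half-space their gradients are the shifted averages of G. -/
theorem inEnergySpace_of_measurable (ha : -1 < a) (ha' : a < 1) {u : Eu n → ℝ} {G : Eu n → Eu n}
    {r₁ r₂ : ℝ} (h₁ : 0 < r₁) (hum : Measurable u) (hGm : Measurable G)
    (hu : MemLp u 2 (powMeasure n a)) (hG : MemLp G 2 (powMeasure n a))
    (hu0 : ∀ x, x ∉ upperHalf n ∩ annulus n r₁ r₂ → u x = 0)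
    (hG0 : ∀ x, x ∉ upperHalf n ∩ annulus n r₁ r₂ → G x = 0) (hw : IsRealWeakGradient u G) :
    InEnergySpace a u fun x => ‖x‖ • G x := by
  -- The kernel reaches at most 4ε ≤ 4δ, so all averages live in the annulus from r₁/2 to r₂ + 1,
  -- away from the origin.
  set δ := min r₁ 1 / 8 with hδ
  have hδ0 : 0 < δ := by positivity
  have hδ1 : 4 * δ ≤ r₁ / 2 := by
    have := min_le_left r₁ 1
    rw [hδ]; linarith
  have hδ2 : 4 * δ ≤ 1 := by
    have := min_le_right r₁ 1
    rw [hδ]; linarith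
  set ε : ℕ → ℝ := fun j => δ * (1 / ((j : ℝ) + 1)) with hε
  have hεp : ∀ j, 0 < ε j := fun j => by simp only [hε]; positivity
  have hεle : ∀ j, ε j ≤ δ := fun j => by
    have h2 : 1 / ((j : ℝ) + 1) ≤ 1 := by
      rw [div_le_one (by positivity)]
      have : (0 : ℝ) ≤ j := Nat.cast_nonneg j
      linarith
    exact mul_le_of_le_one_right hδ0.le h2
  have hε0 : Tendsto ε atTop (𝓝 0) := by
    have := (tendsto_one_div_add_atTop_nhds_zero_nat (𝕜 := ℝ)).const_mul δ
    simpa [hε] using this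
  have hball : ∀ {x : Eu n}, x ∉ upperHalf n ∩ Metric.closedBall 0 r₂ →
      x ∉ upperHalf n ∩ annulus n r₁ r₂ := fun hx h =>
    hx ⟨h.1, by simpa using h.2.2⟩
  have hGi : ∀ i, MemLp (fun x => G x i) 2 (powMeasure n a) := fun i =>
    hG.of_le ((measurable_coord i).comp hGm).aestronglyMeasurable
      (Eventually.of_forall fun x => PiLp.norm_apply_le (G x) i)
  have hul : LocallyIntegrable u := (integrable_of_memLp_powMeasure ha' hum hu
    fun x hx => hu0 x (hball hx)).locallyIntegrable
  have hGl : ∀ i, LocallyIntegrable fun x => G x i := fun i =>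
    (integrable_of_memLp_powMeasure (ρ := r₂) ha' ((measurable_coord i).comp hGm) (hGi i)
      fun x hx => by simp [hG0 x (hball hx)]).locallyIntegrable
  have hu0' : ∀ x, x ∉ annulus n r₁ r₂ → u x = 0 := fun x hx => hu0 x fun h => hx h.2
  have hG0' : ∀ x, x ∉ annulus n r₁ r₂ → G x = 0 := fun x hx => hG0 x fun h => hx h.2
  have hsub : ∀ j {x : Eu n}, x ∉ annulus n (r₁ / 2) (r₂ + 1) →
      x ∉ annulus n (r₁ - 4 * ε j) (r₂ + 4 * ε j) := fun j x hx h =>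
    hx ⟨by linarith [h.1, hεle j], by linarith [h.2, hεle j]⟩
  have hsub' : ∀ {x : Eu n}, x ∉ annulus n (r₁ / 2) (r₂ + 1) → x ∉ annulus n r₁ r₂ := fun hx h =>
    hx ⟨by linarith [h.1], by linarith [h.2]⟩
  have hsupp : ∀ j, tsupport (shiftAvg (ε j) u) ⊆ annulus n (r₁ / 2) (r₂ + 1) := fun j => by
    refine closure_minimal (fun x hx => ?_) (isClosed_annulus _ _)
    by_contra h
    exact hx (shiftAvg_eq_zero (hεp j) hu0' (hsub j h))
  have htest : ∀ j, IsTest (shiftAvg (ε j) u) := fun j => by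
    refine ⟨contDiff_shiftAvg (hεp j) hul, ?_, fun h => ?_⟩
    · refine HasCompactSupport.of_support_subset_isCompact
        (isCompact_closedBall (0 : Eu n) (r₂ + 1)) fun x hx => ?_
      simpa using (hsupp j (subset_tsupport _ hx)).2
    · have := (hsupp j h).1
      rw [norm_zero] at this
      linarith
  obtain ⟨C, hC, hCb⟩ := exists_eLpNorm_invMeasure_le n a (half_pos h₁) (r₂ + 1)
  have htrans : ∀ f : Eu n → ℝ, Measurable f → LocallyIntegrable f → MemLp f 2 (powMeasure n a) →
      (∀ x, x ∉ annulus n r₁ r₂ → f x = 0) →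
      L2Tendsto (invMeasure n a) atTop (fun j => shiftAvg (ε j) f) f := by
    intro f hfm hfl hf hf0
    have h2 := tendsto_shiftAvg ha hfm hfl hf hεp hε0
    have h3 := ENNReal.Tendsto.const_mul (a := ENNReal.ofReal C) h2 (Or.inr ENNReal.ofReal_ne_top)
    rw [mul_zero] at h3
    refine tendsto_of_tendsto_of_tendsto_of_le_of_le tendsto_const_nhds h3 (fun _ => zero_le)
      fun j => hCb _ fun x _ hx => ?_
    change shiftAvg (ε j) f x - f x = 0
    rw [shiftAvg_eq_zero (hεp j) hf0 (hsub j hx), hf0 x (hsub' hx), sub_zero]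
  have hLu : MemLp u 2 (invMeasure n a) := ⟨hum.aestronglyMeasurable,
    (hCb u fun x _ hx => hu0' x (hsub' hx)).trans_lt (ENNReal.mul_lt_top ENNReal.ofReal_lt_top hu.2)⟩
  have hLG : MemLp G 2 (invMeasure n a) := ⟨hGm.aestronglyMeasurable,
    (hCb G fun x _ hx => hG0' x (hsub' hx)).trans_lt (ENNReal.mul_lt_top ENNReal.ofReal_lt_top hG.2)⟩
  have hr2 : ∀ x, ‖(‖x‖ • G x)‖ ≤ |r₂| * ‖G x‖ := fun x => by
    by_cases hx : x ∈ annulus n r₁ r₂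
    · rw [norm_smul, norm_norm]
      exact mul_le_mul_of_nonneg_right (hx.2.trans (le_abs_self _)) (norm_nonneg _)
    · rw [hG0' x hx]; simp
  refine ⟨hLu, hLG.of_le_mul (measurable_norm.smul hGm).aestronglyMeasurable
    (Eventually.of_forall hr2), fun j => shiftAvg (ε j) u, htest, htrans u hum hul hu hu0', ?_⟩
  have hGt : ∀ i, L2Tendsto (invMeasure n a) atTop (fun j => shiftAvg (ε j) fun x => G x i)
      fun x => G x i := fun i =>
    htrans _ ((measurable_coord i).comp hGm) (hGl i) (hGi i) fun x hx => by simp [hG0' x hx]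
  have hsum : L2Tendsto (invMeasure n a) atTop
      (fun j x => ∑ i, |shiftAvg (ε j) (fun x => G x i) x - G x i|) (fun _ => 0) :=
    L2Tendsto.sum_abs hGt fun i j => ((contDiff_shiftAvg (hεp j) (hGl i)).continuous.measurable.sub
        ((measurable_coord i).comp hGm)).aestronglyMeasurable
  refine hsum.of_norm_le (|r₂ + 1|) (Eventually.of_forall fun j => ?_)
  filter_upwards [ae_invMeasure_mem_upperHalf] with x hx
  rw [sub_zero]
  by_cases hxA : x ∈ annulus n (r₁ / 2) (r₂ + 1)
  · have h2 : sgrad (shiftAvg (ε j) u) x - ‖x‖ • G x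
        = ‖x‖ • (gradient (shiftAvg (ε j) u) x - G x) := by rw [sgrad, smul_sub]
    rw [h2, norm_smul, norm_norm]
    refine mul_le_mul (hxA.2.trans (le_abs_self _)) ?_ (norm_nonneg _) (abs_nonneg _)
    refine (norm_le_sum_abs _).trans (le_trans (le_of_eq ?_) (le_abs_self _))
    refine Finset.sum_congr rfl fun i _ => ?_
    have h3 : gradient (shiftAvg (ε j) u) x i = shiftAvg (ε j) (fun x => G x i) x := by
      rw [← fderiv_shiftAvg (hεp j) hul (fun x hx => hu0 x fun h => hx h.1)
        (fun x hx => hG0 x fun h => hx h.1) hw hx i, ← inner_gradient, EuclideanSpace.inner_single_right]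
      simp
    rw [PiLp.sub_apply, h3]
  · rw [sgrad_eq_zero_of_notMem fun h => hxA (hsupp j h), hG0' x (hsub' hxA)]
    simp only [smul_zero, sub_zero, norm_zero]
    positivity

/-- Functions of the weighted Sobolev space with support in an annulus belong to the energy
space. -/
theorem inEnergySpace_of_weakGradient (ha : -1 < a) (ha' : a < 1) {u : Eu n → ℝ} {G : Eu n → Eu n}
    {r₁ r₂ : ℝ} (h₁ : 0 < r₁)
    (hu : MemLp (fun x => (x (Fin.last n) ^ (a / 2)) • u x) 2 (halfMeasure n))
    (hG : MemLp (fun x => (x (Fin.last n) ^ (a / 2)) • G x) 2 (halfMeasure n))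
    (hu0 : ∀ᵐ x ∂(halfMeasure n), u x ≠ 0 → x ∈ annulus n r₁ r₂)
    (hG0 : ∀ᵐ x ∂(halfMeasure n), G x ≠ 0 → x ∈ annulus n r₁ r₂) (hw : IsRealWeakGradient u G) :
    InEnergySpace a u fun x => ‖x‖ • G x := by
  have hu2 := memLp_powMeasure hu
  have hG2 := memLp_powMeasure hG
  set S := upperHalf n ∩ annulus n r₁ r₂ with hS
  have hSm : MeasurableSet S := measurableSet_upperHalf.inter (measurableSet_annulus _ _)
  -- Cutting measurable representatives to S changes u and G only on null sets and makes the support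
  -- conditions hold everywhere.
  set u' : Eu n → ℝ := S.indicator (hu2.1.mk u) with hu'
  set G' : Eu n → Eu n := S.indicator (hG2.1.mk G) with hG'
  have eu : ∀ᵐ x ∂(halfMeasure n), u' x = u x := by
    filter_upwards [ae_powMeasure_iff.1 hu2.1.ae_eq_mk, hu0, ae_mem_upperHalf] with x h1 h2 h3
    by_cases hx : x ∈ S
    · rw [hu', Set.indicator_of_mem hx, ← h1]
    · rw [hu', Set.indicator_of_notMem hx]
      by_contra h
      exact hx ⟨h3, h2 fun h0 => h h0.symm⟩
  have eG : ∀ᵐ x ∂(halfMeasure n), G' x = G x := by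
    filter_upwards [ae_powMeasure_iff.1 hG2.1.ae_eq_mk, hG0, ae_mem_upperHalf] with x h1 h2 h3
    by_cases hx : x ∈ S
    · rw [hG', Set.indicator_of_mem hx, ← h1]
    · rw [hG', Set.indicator_of_notMem hx]
      by_contra h
      exact hx ⟨h3, h2 fun h0 => h h0.symm⟩
  have hw' : IsRealWeakGradient u' G' := by
    intro η h1 h2 h3 i
    have h4 := hw η h1 h2 h3 i
    rw [integral_congr_ae (g := fun x => pderiv i η x * u x) (by
        filter_upwards [eu] with x hx; rw [hx]),
      integral_congr_ae (f := fun x => η x * G' x i) (g := fun x => η x * G x i) (by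
        filter_upwards [eG] with x hx; rw [hx])]
    exact h4
  refine (inEnergySpace_of_measurable ha ha' h₁ (hu2.1.stronglyMeasurable_mk.measurable.indicator hSm)
    (hG2.1.stronglyMeasurable_mk.measurable.indicator hSm)
    ((memLp_congr_ae (ae_powMeasure_iff.2 eu)).2 hu2) ((memLp_congr_ae (ae_powMeasure_iff.2 eG)).2 hG2)
    (fun x hx => Set.indicator_of_notMem hx _) (fun x hx => Set.indicator_of_notMem hx _) hw').congr
    (ae_invMeasure_iff.2 eu) ?_
  filter_upwards [ae_invMeasure_iff.2 eG] with x hx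
  exact congrArg (fun z => ‖x‖ • z) hx

end Density

/-! ### Lifting a boundary flux by a variational problem -/

section BoundaryLift

open Filter Topology

variable {n : ℕ} {a : ℝ}

/-- The weight of the trace inequality on the boundary. -/
noncomputable def traceW (a τ α : ℝ) (x : Eu n) : ℝ :=
  lamW τ α x ^ ((1 - a) / 2) * rexp (-(n / 2)) x

theorem lamW_pos {τ : ℝ} (hτ : 0 ≤ τ) (α : ℝ) (x : Eu n) : 0 < lamW τ α x :=
  zero_lt_one.trans_le (one_le_lamW hτ α x)

theorem traceW_pos {τ : ℝ} (hτ : 0 ≤ τ) (α : ℝ) (x : Eu n) : 0 < traceW a τ α x :=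
  mul_pos (Real.rpow_pos_of_pos (lamW_pos hτ α x) _) (rexp_pos _ _)

theorem traceW_sq {τ : ℝ} (hτ : 0 ≤ τ) (α : ℝ) (x : Eu n) :
    traceW a τ α x ^ 2 = lamW τ α x ^ (1 - a) * rexp (-n) x := by
  rw [traceW, mul_pow, ← Real.rpow_natCast, ← Real.rpow_mul (lamW_pos hτ α x).le, pow_two,
    rexp_mul]
  congr 2
  · push_cast; ring
  · ring

theorem IsTest.lamW_mul {η : Eu n → ℝ} (h : IsTest η) (τ α : ℝ) :
    IsTest fun x => lamW τ α x * η x :=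
  h.radial_mul (k := fun t => 1 + τ * Real.exp (α * t)) (by fun_prop)

theorem IsTest.traceW_mul {η : Eu n → ℝ} (h : IsTest η) {τ : ℝ} (hτ : 0 ≤ τ) (α : ℝ) :
    IsTest fun x => traceW a τ α x * η x := by
  refine h.radial_mul (k := fun t => (1 + τ * Real.exp (α * t)) ^ ((1 - a) / 2)
    * Real.exp (-(n / 2) * t)) (ContDiff.mul ?_ (by fun_prop))
  refine ContDiff.rpow_const_of_ne (by fun_prop) fun t => ?_
  have := mul_nonneg hτ (Real.exp_pos (α * t)).le
  linarith

theorem IsTest.memLp_bdryPt {η : Eu n → ℝ} (h : IsTest η) (p : ℝ≥0∞) :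
    MemLp (fun x' : EuclideanSpace ℝ (Fin n) => η (bdryPt x')) p volume := by
  obtain ⟨r, hr⟩ := h.compact.isCompact.isBounded.subset_closedBall 0
  refine (h.contDiff.continuous.comp continuous_bdryPt).memLp_of_hasCompactSupport
    (HasCompactSupport.of_support_subset_isCompact
      (isCompact_closedBall (0 : EuclideanSpace ℝ (Fin n)) r) fun x' hx' => ?_)
  have := hr (subset_tsupport _ (show η (bdryPt x') ≠ 0 from hx'))
  simpa [norm_bdryPt] using this

theorem IsTest.apply_zero {η : Eu n → ℝ} (h : IsTest η) : η 0 = 0 :=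
  image_eq_zero_of_notMem_tsupport h.zero_notMem

/-- The test functions as a vector space. -/
def testSpace (n : ℕ) : Submodule ℝ (Eu n → ℝ) where
  carrier := {η | IsTest η}
  add_mem' h h' := h.add h'
  zero_mem' := isTest_zero
  smul_mem' c _ h := h.const_mul c

/-- A function in the energy space with prescribed flux `b` on the boundary, which solves an
elliptic equation with zeroth order coefficient `λ²`, and the bound for its energy. -/
theorem exists_boundary_lift (ha : -1 < a) (ha' : a < 1) : ∃ C : ℝ, 0 < C ∧ ∀ τ α : ℝ, 0 ≤ τ →
    0 ≤ α → ∀ b : EuclideanSpace ℝ (Fin n) → ℝ,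
      MemLp (fun x' => b x' / traceW a τ α (bdryPt x')) 2 volume →
      ∃ (p : Eu n → ℝ) (P : Eu n → Eu n), InEnergySpace a p P ∧
        MemLp (fun x => lamW τ α x * p x) 2 (invMeasure n a) ∧
        (∀ ξ : Eu n → ℝ, IsTest ξ → ∫ x, inner ℝ (P x) (sgrad ξ x) ∂(invMeasure n a)
          + ∫ x, lamW τ α x ^ 2 * p x * ξ x ∂(invMeasure n a) = ∫ x', b x' * ξ (bdryPt x')) ∧
        ∫ x, ‖P x‖ ^ 2 ∂(invMeasure n a) + ∫ x, (lamW τ α x * p x) ^ 2 ∂(invMeasure n a)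
          ≤ C * ∫ x', (b x' / traceW a τ α (bdryPt x')) ^ 2 := by
  obtain ⟨C, hC, htr⟩ := trace_inequality (n := n) ha ha'
  refine ⟨C, hC, fun τ α hτ hα b hb => ?_⟩
  have hbξ : ∀ {ξ : Eu n → ℝ} (x' : EuclideanSpace ℝ (Fin n)), b x' * ξ (bdryPt x')
      = b x' / traceW a τ α (bdryPt x') * (traceW a τ α (bdryPt x') * ξ (bdryPt x')) := by
    intro ξ x'
    have := (traceW_pos (a := a) hτ α (bdryPt x')).ne'
    field_simp
  have hint : ∀ {ξ : Eu n → ℝ}, IsTest ξ → Integrable fun x' => b x' * ξ (bdryPt x') := by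
    intro ξ h
    simp only [hbξ]
    exact MemLp.integrable_mul_real hb ((h.traceW_mul hτ α).memLp_bdryPt 2)
  -- The norm of J η is the energy norm with zeroth order coefficient λ², so the Riesz theorem for J
  -- is the Lax–Milgram theorem for the elliptic problem.
  let J : testSpace n →ₗ[ℝ] WithLp 2 (Lp ℝ 2 (invMeasure n a) × Lp (Eu n) 2 (invMeasure n a)) :=
    { toFun := fun η => WithLp.toLp 2 (((η.2.lamW_mul τ α).memLp ha 2).toLp _,
        (η.2.memLp_sgrad ha 2).toLp _)
      map_add' := fun η ξ => by
        rw [← WithLp.toLp_add, Prod.mk_add_mk]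
        congr 2
        · rw [← MemLp.toLp_add]
          refine MemLp.toLp_congr _ _ (Eventually.of_forall fun x => ?_)
          exact mul_add _ _ _
        · rw [← MemLp.toLp_add]
          refine MemLp.toLp_congr _ _ (Eventually.of_forall fun x => ?_)
          exact sgrad_add (η.2.differentiable x) (ξ.2.differentiable x)
      map_smul' := fun c η => by
        rw [← WithLp.toLp_smul, Prod.smul_mk]
        congr 2
        · rw [← MemLp.toLp_const_smul]
          refine MemLp.toLp_congr _ _ (Eventually.of_forall fun x => ?_)
          exact mul_left_comm _ _ _
        · rw [← MemLp.toLp_const_smul]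
          refine MemLp.toLp_congr _ _ (Eventually.of_forall fun x => ?_)
          exact sgrad_const_mul (η.2.differentiable x) c }
  let ℓ : testSpace n →ₗ[ℝ] ℝ :=
    { toFun := fun η => ∫ x', b x' * η.1 (bdryPt x')
      map_add' := fun η ξ => by
        rw [← integral_add (hint η.2) (hint ξ.2)]
        simp [mul_add]
      map_smul' := fun c η => by
        rw [RingHom.id_apply, smul_eq_mul, ← integral_const_mul]
        simp [mul_left_comm] }
  set N : ℝ := ∫ x', (b x' / traceW a τ α (bdryPt x')) ^ 2 with hN
  have hN0 : 0 ≤ N := integral_nonneg fun _ => sq_nonneg _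
  have hJ : ∀ η : testSpace n, ‖J η‖ ^ 2
      = ∫ x, (‖sgrad η.1 x‖ ^ 2 + (lamW τ α x * η.1 x) ^ 2) ∂(invMeasure n a) := by
    intro η
    rw [integral_add (η.2.memLp_sgrad ha 2).norm.integrable_sq
      ((η.2.lamW_mul τ α).memLp ha 2).integrable_sq, ← real_inner_self_eq_norm_sq,
      WithLp.prod_inner_apply, add_comm]
    congr 1
    · refine (integral_inner_toLp (η.2.memLp_sgrad ha 2) (η.2.memLp_sgrad ha 2)).trans ?_
      simp only [real_inner_self_eq_norm_sq]
    · refine (integral_inner_toLp ((η.2.lamW_mul τ α).memLp ha 2) ((η.2.lamW_mul τ α).memLp ha 2)).trans ?_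
      simp only [real_inner_self_eq_norm_sq, Real.norm_eq_abs, sq_abs]
  -- Dividing and multiplying by the trace weight, Cauchy–Schwarz on the boundary leaves a weighted
  -- trace of η, which the trace inequality bounds by its energy.
  have hbound : ∀ η : testSpace n, |ℓ η| ≤ √(C * N) * ‖J η‖ := by
    intro η
    refine abs_le_of_sq_le_sq ?_ (by positivity)
    rw [mul_pow, Real.sq_sqrt (by positivity), hJ]
    have h1 := sq_integral_mul_le hb ((η.2.traceW_mul (a := a) hτ α).memLp_bdryPt 2)
    have h2 := htr τ α hτ hα η.1 η.2
    have h3 : ∫ x', (traceW a τ α (bdryPt x') * η.1 (bdryPt x')) ^ 2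
        = ∫ x', lamW τ α (bdryPt x') ^ (1 - a) * ‖x'‖ ^ (-(n : ℝ)) * η.1 (bdryPt x') ^ 2 := by
      congr 1
      ext x'
      rcases eq_or_ne x' 0 with rfl | hx
      · have : bdryPt (0 : EuclideanSpace ℝ (Fin n)) = 0 := by
          rw [← norm_eq_zero, norm_bdryPt, norm_zero]
        simp [this, η.2.apply_zero]
      · rw [mul_pow, traceW_sq hτ, rexp, norm_bdryPt, Real.rpow_def_of_pos (norm_pos_iff.2 hx)
          (-(n : ℝ)), mul_comm (-(n : ℝ))]
    rw [h3] at h1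
    simp only [← hbξ] at h1
    calc (∫ x', b x' * η.1 (bdryPt x')) ^ 2 ≤ _ := h1
      _ ≤ N * (C * _) := mul_le_mul_of_nonneg_left h2 hN0
      _ = _ := by ring
  obtain ⟨p, hp, hpn, hpe⟩ := exists_mem_closure_range_inner_eq J ℓ (√(C * N)) (Real.sqrt_nonneg _)
    hbound
  set p₁ := (WithLp.ofLp p).1 with hp₁
  set P := (WithLp.ofLp p).2 with hP
  have hlam : ∀ x, lamW τ α x * (p₁ x / lamW τ α x) = p₁ x := fun x =>
    mul_div_cancel₀ _ (lamW_pos hτ α x).ne'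
  have hml : Measurable fun x : Eu n => lamW τ α x := by
    have := measurable_rexp (n := n) α
    unfold lamW; fun_prop
  have hm : MemLp (fun x => p₁ x / lamW τ α x) 2 (invMeasure n a) := by
    refine (Lp.memLp p₁).of_le ((Lp.memLp p₁).1.div₀ hml.aestronglyMeasurable)
      (Eventually.of_forall fun x => ?_)
    rw [norm_div, Real.norm_of_nonneg (lamW_pos hτ α x).le]
    exact div_le_self (norm_nonneg _) (one_le_lamW hτ α x)
  -- Since the representing vector lies in the closure of the range, its two components are limits
  -- of λη and of the gradients of the same test functions η. So the second component is the
  -- gradient of the first divided by λ.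
  obtain ⟨q, hq, hqp⟩ := mem_closure_iff_seq_limit.1 hp
  choose η hη using hq
  have hη' : ∀ j, q j = J (η j) := fun j => (hη j).symm
  have hcont := (WithLp.prod_continuous_ofLp 2 (Lp ℝ 2 (invMeasure n a))
    (Lp (Eu n) 2 (invMeasure n a))).tendsto p
  have hl1 : L2Tendsto (invMeasure n a) atTop (fun j x => lamW τ α x * (η j).1 x) p₁ := by
    have h1 := ((continuous_fst.tendsto _).comp (hcont.comp hqp))
    refine (Lp.tendsto_Lp_iff_tendsto_eLpNorm'' _
      (fun j => (((η j).2.lamW_mul τ α).memLp ha 2)) _ (Lp.memLp p₁)).1 ?_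
    rw [Lp.toLp_coeFn]
    simp only [Function.comp_def, hη'] at h1
    exact h1
  have hl2 : L2Tendsto (invMeasure n a) atTop (fun j => sgrad (η j).1) P := by
    have h1 := ((continuous_snd.tendsto _).comp (hcont.comp hqp))
    refine (Lp.tendsto_Lp_iff_tendsto_eLpNorm'' _
      (fun j => ((η j).2.memLp_sgrad ha 2)) _ (Lp.memLp P)).1 ?_
    rw [Lp.toLp_coeFn]
    simp only [Function.comp_def, hη'] at h1
    exact h1
  refine ⟨fun x => p₁ x / lamW τ α x, P, ⟨hm, Lp.memLp P, fun j => (η j).1, fun j => (η j).2,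
    ?_, hl2⟩, ?_, fun ξ hξ => ?_, ?_⟩
  · refine hl1.of_norm_le 1 (Eventually.of_forall fun j => Eventually.of_forall fun x => ?_)
    have h1 := lamW_pos hτ α x
    have h2 : (η j).1 x - p₁ x / lamW τ α x
        = (lamW τ α x * (η j).1 x - p₁ x) / lamW τ α x := by field_simp
    rw [h2, norm_div, Real.norm_of_nonneg h1.le, one_mul]
    exact div_le_self (norm_nonneg _) (one_le_lamW hτ α x)
  · simp only [hlam]
    exact Lp.memLp p₁
  · have h1 := hpe ⟨ξ, hξ⟩
    rw [WithLp.prod_inner_apply, add_comm] at h1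
    refine Eq.trans ?_ h1
    congr 1
    · conv_rhs => rw [show (WithLp.ofLp p).2 = (Lp.memLp P).toLp P from (Lp.toLp_coeFn _ _).symm]
      exact (integral_inner_toLp (Lp.memLp P) (hξ.memLp_sgrad ha 2)).symm
    · conv_rhs => rw [show (WithLp.ofLp p).1 = (Lp.memLp p₁).toLp p₁ from (Lp.toLp_coeFn _ _).symm]
      refine Eq.trans ?_ (integral_inner_toLp (Lp.memLp p₁) ((hξ.lamW_mul τ α).memLp ha 2)).symm
      congr 1
      ext x
      rw [pow_two, mul_assoc (lamW τ α x), hlam]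
      simp only [RCLike.inner_apply, conj_trivial]
      ring
  · have h1 : ‖p‖ ^ 2 ≤ C * N := by
      rw [← Real.sq_sqrt (by positivity : 0 ≤ C * N)]
      exact pow_le_pow_left₀ (norm_nonneg _) hpn 2
    refine le_trans (le_of_eq ?_) h1
    rw [← real_inner_self_eq_norm_sq, WithLp.prod_inner_apply, add_comm]
    congr 1
    · simp only [hlam]
      rw [L2.inner_def]
      simp only [real_inner_self_eq_norm_sq, Real.norm_eq_abs, sq_abs, hp₁]
    · rw [L2.inner_def]
      simp only [real_inner_self_eq_norm_sq, hP]

end BoundaryLift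

/-! ### Radial cutoffs uniform in the length of the shell -/

section FluxCutoff

open Filter Topology

theorem deriv_eq_zero_of_forall_notMem {K : Set ℝ} (hK : IsClosed K) {f : ℝ → ℝ}
    (h : ∀ t ∉ K, f t = 0) : ∀ t ∉ K, deriv f t = 0 := fun t ht => by
  have h1 : f =ᶠ[𝓝 t] fun _ => 0 := by
    filter_upwards [hK.isOpen_compl.mem_nhds ht] with s hs using h s hs
  rw [h1.deriv_eq, deriv_const]

/-- Cutoff functions on intervals of arbitrary length with uniformly bounded derivatives. -/
theorem exists_uniform_cutoff : ∃ K : ℝ, 0 < K ∧ ∀ T : ℝ, 0 ≤ T → ∃ χ : ℝ → ℝ, ContDiff ℝ ∞ χ ∧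
    (∀ t ∉ Set.Icc (-1) (T + 1), χ t = 0) ∧ (∀ t ∈ Set.Icc 0 T, χ t = 1) ∧
    ∀ t, |χ t| ≤ K ∧ |deriv χ t| ≤ K ∧ |deriv (deriv χ) t| ≤ K := by
  set S : ℝ → ℝ := Real.smoothTransition with hS
  have h0 : ContDiff ℝ ∞ S := Real.smoothTransition.contDiff
  have h1 : ContDiff ℝ ∞ (deriv S) := (contDiff_infty_iff_deriv.1 h0).2
  have h2 : ContDiff ℝ ∞ (deriv (deriv S)) := (contDiff_infty_iff_deriv.1 h1).2
  have hc : HasCompactSupport (deriv S) := by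
    refine HasCompactSupport.intro (isCompact_Icc (a := (0 : ℝ)) (b := 1)) fun t ht => ?_
    rcases lt_or_ge t 0 with h | h
    · have : S =ᶠ[𝓝 t] fun _ => 0 := by
        filter_upwards [gt_mem_nhds h] with s hs
        exact Real.smoothTransition.zero_of_nonpos (le_of_lt hs)
      rw [this.deriv_eq, deriv_const]
    · have h' : 1 < t := by
        by_contra h''
        exact ht ⟨h, not_lt.1 h''⟩
      have : S =ᶠ[𝓝 t] fun _ => 1 := by
        filter_upwards [lt_mem_nhds h'] with s hs
        exact Real.smoothTransition.one_of_one_le (le_of_lt hs)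
      rw [this.deriv_eq, deriv_const]
  obtain ⟨C₁, hC₁⟩ := hc.exists_bound_of_continuous h1.continuous
  obtain ⟨C₂, hC₂⟩ := hc.deriv.exists_bound_of_continuous h2.continuous
  have hb0 : ∀ t, |S t| ≤ 1 := fun t => by
    rw [abs_of_nonneg (Real.smoothTransition.nonneg t)]
    exact Real.smoothTransition.le_one t
  simp only [Real.norm_eq_abs] at hC₁ hC₂
  have hC₁0 : 0 ≤ C₁ := (abs_nonneg _).trans (hC₁ 0)
  have hC₂0 : 0 ≤ C₂ := (abs_nonneg _).trans (hC₂ 0)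
  -- One fixed smooth transition at each end; changing T only moves the second one, so the
  -- derivative bounds do not depend on T.
  refine ⟨1 + 2 * C₁ + 2 * C₂ + 2 * C₁ * C₁, by positivity, fun T hT =>
    ⟨fun t => S (t + 1) * S (T + 1 - t), by fun_prop, fun t ht => ?_, fun t ht => ?_, fun t => ?_⟩⟩
  · rcases lt_or_ge t (-1) with h | h
    · simp only [hS]
      rw [Real.smoothTransition.zero_of_nonpos (x := t + 1) (by linarith), zero_mul]
    · have h' : T + 1 < t := by
        by_contra h''
        exact ht ⟨h, not_lt.1 h''⟩
      simp only [hS]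
      rw [Real.smoothTransition.zero_of_nonpos (x := T + 1 - t) (by linarith), mul_zero]
  · simp only [hS]
    rw [Real.smoothTransition.one_of_one_le (x := T + 1 - t) (by linarith [ht.2]),
      Real.smoothTransition.one_of_one_le (x := t + 1) (by linarith [ht.1]), mul_one]
  · have d0 : ∀ t, HasDerivAt S (deriv S t) t := fun t =>
      (h0.differentiable (by simp) t).hasDerivAt
    have d1 : ∀ t, HasDerivAt (deriv S) (deriv (deriv S) t) t := fun t =>
      (h1.differentiable (by simp) t).hasDerivAt
    have e1 : ∀ t, HasDerivAt (fun t => S (t + 1) * S (T + 1 - t))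
        (deriv S (t + 1) * S (T + 1 - t) + S (t + 1) * -deriv S (T + 1 - t)) t := fun t =>
      ((d0 _).comp_add_const t 1).mul ((d0 _).comp_const_sub (T + 1) t)
    have e1' : deriv (fun t => S (t + 1) * S (T + 1 - t)) = fun t =>
        deriv S (t + 1) * S (T + 1 - t) + S (t + 1) * -deriv S (T + 1 - t) :=
      funext fun t => (e1 t).deriv
    have e2 : HasDerivAt (fun t => deriv S (t + 1) * S (T + 1 - t) + S (t + 1) * -deriv S (T + 1 - t))
        ((deriv (deriv S) (t + 1) * S (T + 1 - t) + deriv S (t + 1) * -deriv S (T + 1 - t))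
          + (deriv S (t + 1) * -deriv S (T + 1 - t)
            + S (t + 1) * -(-deriv (deriv S) (T + 1 - t)))) t :=
      (((d1 _).comp_add_const t 1).mul ((d0 _).comp_const_sub (T + 1) t)).add
        (((d0 _).comp_add_const t 1).mul ((d1 _).comp_const_sub (T + 1) t).neg)
    have m : ∀ {x y p q : ℝ}, |x| ≤ p → |y| ≤ q → |x * y| ≤ p * q := fun {x y p q} hx hy => by
      rw [abs_mul]
      exact mul_le_mul hx hy (abs_nonneg _) ((abs_nonneg _).trans hx)
    have hn : ∀ {x p : ℝ}, |x| ≤ p → |-x| ≤ p := fun h => by rwa [abs_neg]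
    refine ⟨?_, ?_, ?_⟩
    · refine (m (hb0 _) (hb0 _)).trans ?_
      have : 0 ≤ C₁ * C₁ := by positivity
      linarith
    · rw [e1']
      refine (abs_add_le _ _).trans
        ((add_le_add (m (hC₁ _) (hb0 _)) (m (hb0 _) (hn (hC₁ _)))).trans ?_)
      have : 0 ≤ C₁ * C₁ := by positivity
      linarith
    · rw [e1', e2.deriv]
      refine (abs_add_le _ _).trans ((add_le_add
        ((abs_add_le _ _).trans (add_le_add (m (hC₂ _) (hb0 _)) (m (hC₁ _) (hn (hC₁ _)))))
        ((abs_add_le _ _).trans (add_le_add (m (hC₁ _) (hn (hC₁ _)))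
          (m (hb0 _) (hn (hn (hC₂ _))))))).trans ?_)
      linarith

/-- The choice is ψ = χ e^{-αt}/α with a uniform cutoff χ. Each derivative of ψ again carries
e^{-αt}, so after multiplication by e^{αt} only bounds on χ remain. Uniformity in T is what makes
the Carleman constant independent of the outer radius. -/
theorem exists_flux_cutoff {α : ℝ} (hα : 1 ≤ α) : ∃ K : ℝ, 0 < K ∧ ∀ T : ℝ, 0 ≤ T →
    ∃ ψ : ℝ → ℝ, ContDiff ℝ ∞ ψ ∧ (∀ t ∉ Set.Icc (-1) (T + 1), ψ t = 0) ∧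
      (∀ t ∈ Set.Icc 0 T, α * Real.exp (α * t) * ψ t = 1) ∧
      ∀ t, |ψ t| * Real.exp (α * t) ≤ K ∧ |deriv ψ t| * Real.exp (α * t) ≤ K ∧
        |deriv (deriv ψ) t| * Real.exp (α * t) ≤ K := by
  obtain ⟨K, hK, hχ⟩ := exists_uniform_cutoff
  refine ⟨K * (1 + 2 * α + α ^ 2), by positivity, fun T hT => ?_⟩
  obtain ⟨χ, h0, hz, h1, hb⟩ := hχ T hT
  have h0' : ContDiff ℝ ∞ (deriv χ) := (contDiff_infty_iff_deriv.1 h0).2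
  have dE : ∀ t, HasDerivAt (fun t => α⁻¹ * Real.exp (-(α * t))) (-Real.exp (-(α * t))) t := fun t => by
    have := ((((hasDerivAt_id t).const_mul α).fun_neg).exp).const_mul α⁻¹
    simp only [id, mul_one] at this
    refine this.congr_deriv ?_
    field_simp
  have dE' : ∀ t, HasDerivAt (fun t => -Real.exp (-(α * t))) (α * Real.exp (-(α * t))) t := fun t => by
    have := ((((hasDerivAt_id t).const_mul α).fun_neg).exp).fun_neg
    simp only [id, mul_one] at this
    refine this.congr_deriv ?_
    ring
  have d0 : ∀ t, HasDerivAt χ (deriv χ t) t := fun t => (h0.differentiable (by simp) t).hasDerivAt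
  have d1 : ∀ t, HasDerivAt (deriv χ) (deriv (deriv χ) t) t := fun t =>
    (h0'.differentiable (by simp) t).hasDerivAt
  have e1 : deriv (fun t => χ t * (α⁻¹ * Real.exp (-(α * t)))) = fun t =>
      deriv χ t * (α⁻¹ * Real.exp (-(α * t))) + χ t * -Real.exp (-(α * t)) :=
    funext fun t => ((d0 t).mul (dE t)).deriv
  have e2 : deriv (deriv (fun t => χ t * (α⁻¹ * Real.exp (-(α * t))))) = fun t =>
      (deriv (deriv χ) t * (α⁻¹ * Real.exp (-(α * t))) + deriv χ t * -Real.exp (-(α * t)))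
      + (deriv χ t * -Real.exp (-(α * t)) + χ t * (α * Real.exp (-(α * t)))) := by
    rw [e1]
    exact funext fun t => (((d1 t).mul (dE t)).add ((d0 t).mul (dE' t))).deriv
  have hexp : ∀ t, Real.exp (-(α * t)) * Real.exp (α * t) = 1 := fun t => by
    rw [← Real.exp_add]; simp
  have hi : α⁻¹ ≤ 1 := inv_le_one_of_one_le₀ hα
  have hi0 : 0 < α⁻¹ := by positivity
  have habs : ∀ x t : ℝ, |x * Real.exp (-(α * t))| * Real.exp (α * t) = |x| := fun x t => by
    rw [abs_mul, abs_of_pos (Real.exp_pos _), mul_assoc, hexp, mul_one]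
  have hK' : ∀ {x : ℝ}, |x| ≤ K → |x * α⁻¹| ≤ K := fun {x} h => by
    rw [abs_mul, abs_of_pos hi0]
    exact (mul_le_of_le_one_right (abs_nonneg _) hi).trans h
  have hK0 : 0 ≤ K * α := by positivity
  have hK1 : 0 ≤ K * α ^ 2 := by positivity
  have hKα : K ≤ K * α := le_mul_of_one_le_right hK.le hα
  refine ⟨fun t => χ t * (α⁻¹ * Real.exp (-(α * t))), by fun_prop, fun t ht => ?_, fun t ht => ?_,
    fun t => ?_⟩
  · simp [hz t ht]
  · simp only [h1 t ht]
    have := hexp t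
    field_simp
    linarith
  · obtain ⟨b0, b1, b2⟩ := hb t
    rw [e2, e1]
    refine ⟨?_, ?_, ?_⟩
    · simp only [← mul_assoc, habs]
      linarith [hK' b0]
    · have : deriv χ t * (α⁻¹ * Real.exp (-(α * t))) + χ t * -Real.exp (-(α * t))
          = (deriv χ t * α⁻¹ - χ t) * Real.exp (-(α * t)) := by ring
      simp only [this, habs]
      have := abs_sub (deriv χ t * α⁻¹) (χ t)
      linarith [hK' b1]
    · have : (deriv (deriv χ) t * (α⁻¹ * Real.exp (-(α * t))) + deriv χ t * -Real.exp (-(α * t)))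
          + (deriv χ t * -Real.exp (-(α * t)) + χ t * (α * Real.exp (-(α * t))))
          = (deriv (deriv χ) t * α⁻¹ + (-2 * deriv χ t + χ t * α)) * Real.exp (-(α * t)) := by ring
      simp only [this, habs]
      have i1 := abs_add_le (deriv (deriv χ) t * α⁻¹) (-2 * deriv χ t + χ t * α)
      have i2 := abs_add_le (-2 * deriv χ t) (χ t * α)
      have i3 : |-2 * deriv χ t| ≤ 2 * K := by
        rw [abs_mul]; norm_num; exact b1
      have i4 : |χ t * α| ≤ K * α := by
        rw [abs_mul, abs_of_pos (by linarith : 0 < α)]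
        exact mul_le_mul_of_nonneg_right b0 (by linarith)
      have := hK' b2
      nlinarith

end FluxCutoff

/-! ### Radial multipliers against the Dirichlet form -/

section FluxCorrection

open Filter Topology

variable {n : ℕ} {a : ℝ}

/-- Polarized integration by parts in the radial direction. -/
theorem InEnergySpace.integral_radial_mul_euler (ha : -1 < a) {p : Eu n → ℝ} {P : Eu n → Eu n}
    (h : InEnergySpace a p P) {k : ℝ → ℝ} (hk : ContDiff ℝ ∞ k) (hc : HasCompactSupport k)
    {ξ : Eu n → ℝ} (hξ : IsTest ξ) :
    ∫ x, radial k x * p x * inner ℝ (sgrad ξ x) (rdir x) ∂(invMeasure n a)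
      = -∫ x, (radial (deriv k) x * p x + radial k x * inner ℝ (P x) (rdir x)) * ξ x
        ∂(invMeasure n a) := by
  obtain ⟨C, hC, hC', -⟩ := exists_bound_of_contDiff_compact hk hc
  have hk' : Continuous (deriv k) := hk.continuous_deriv (by simp)
  have hξE := hξ.inEnergySpace ha
  -- Polarization: the quadratic identity for p + ξ, minus those for p and for ξ.
  have e1 := (h.add ha hξE).integral_radial_mul ha hk hc
  have e2 := h.integral_radial_mul ha hk hc
  have e3 := hξE.integral_radial_mul ha hk hc
  have mp := MemLp.radial_mul h.memLp hk.continuous hC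
  have mξ := MemLp.radial_mul hξE.memLp hk.continuous hC
  have mp' := MemLp.radial_mul h.memLp hk' hC'
  have mξ' := MemLp.radial_mul hξE.memLp hk' hC'
  have mP := MemLp.inner_rdir h.memLp_grad
  have mX := MemLp.inner_rdir hξE.memLp_grad
  have i1 := MemLp.integrable_mul_real mp mP
  have i2 := MemLp.integrable_mul_real mp mX
  have i3 := MemLp.integrable_mul_real mξ mP
  have i4 := MemLp.integrable_mul_real mξ mX
  have j1 := MemLp.integrable_mul_real mp' h.memLp
  have j2 := MemLp.integrable_mul_real mp' hξE.memLp
  have j4 := MemLp.integrable_mul_real mξ' hξE.memLp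
  have s1 : ∫ x, radial k x * (p x + ξ x) * inner ℝ (P x + sgrad ξ x) (rdir x) ∂(invMeasure n a)
      = ∫ x, radial k x * p x * inner ℝ (P x) (rdir x) ∂(invMeasure n a)
        + ∫ x, radial k x * p x * inner ℝ (sgrad ξ x) (rdir x) ∂(invMeasure n a)
        + (∫ x, radial k x * ξ x * inner ℝ (P x) (rdir x) ∂(invMeasure n a)
        + ∫ x, radial k x * ξ x * inner ℝ (sgrad ξ x) (rdir x) ∂(invMeasure n a)) := by
    refine Eq.trans ?_ ((integral_lincomb₅ i1 i2 i3 i4 i4 1 1 1 1 0).trans (by ring))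
    congr 1
    ext x
    rw [inner_add_left]
    ring
  have s2 : ∫ x, radial (deriv k) x * (p x + ξ x) ^ 2 ∂(invMeasure n a)
      = ∫ x, radial (deriv k) x * p x ^ 2 ∂(invMeasure n a)
        + 2 * ∫ x, radial (deriv k) x * p x * ξ x ∂(invMeasure n a)
        + ∫ x, radial (deriv k) x * ξ x ^ 2 ∂(invMeasure n a) := by
    simp only [pow_two, ← mul_assoc]
    refine Eq.trans ?_ ((integral_lincomb₅ j1 j2 j4 j4 j4 1 2 1 0 0).trans (by ring))
    congr 1
    ext x
    ring
  have s3 : ∫ x, (radial (deriv k) x * p x + radial k x * inner ℝ (P x) (rdir x)) * ξ x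
      ∂(invMeasure n a) = ∫ x, radial (deriv k) x * p x * ξ x ∂(invMeasure n a)
        + ∫ x, radial k x * ξ x * inner ℝ (P x) (rdir x) ∂(invMeasure n a) := by
    rw [← integral_add j2 i3]
    congr 1
    ext x
    ring
  rw [s1, s2] at e1
  rw [s3]
  linarith

/-- Multiplying the first argument of the Dirichlet form by a radial cutoff, up to lower order
terms, is multiplying the second. -/
theorem InEnergySpace.integral_inner_radial_mul (ha : -1 < a) {p : Eu n → ℝ} {P : Eu n → Eu n}
    (h : InEnergySpace a p P) {k : ℝ → ℝ} (hk : ContDiff ℝ ∞ k) (hc : HasCompactSupport k)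
    {ξ : Eu n → ℝ} (hξ : IsTest ξ) :
    ∫ x, inner ℝ (radial k x • P x + (radial (deriv k) x * p x) • rdir x) (sgrad ξ x)
        ∂(invMeasure n a)
      = ∫ x, inner ℝ (P x) (sgrad (fun x => radial k x * ξ x) x) ∂(invMeasure n a)
        - ∫ x, (radial (deriv (deriv k)) x * p x
          + 2 * (radial (deriv k) x * inner ℝ (P x) (rdir x))) * ξ x ∂(invMeasure n a) := by
  obtain ⟨C, hC, hC', hC''⟩ := exists_bound_of_contDiff_compact hk hc
  have hk' : ContDiff ℝ ∞ (deriv k) := (contDiff_infty_iff_deriv.1 hk).2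
  have hk'' : Continuous (deriv (deriv k)) := hk'.continuous_deriv (by simp)
  have hξE := hξ.inEnergySpace ha
  have ibp := h.integral_radial_mul_euler ha hk' hc.deriv hξ
  have i1 := MemLp.integrable_inner_real (MemLp.radial_smul h.memLp_grad hk.continuous hC)
    hξE.memLp_grad
  have i2 := MemLp.integrable_mul_real (MemLp.radial_mul h.memLp hk'.continuous hC')
    (MemLp.inner_rdir hξE.memLp_grad)
  have i3 := MemLp.integrable_mul_real (MemLp.radial_mul (MemLp.inner_rdir h.memLp_grad)
    hk'.continuous hC') hξE.memLp
  have i4 := MemLp.integrable_mul_real (MemLp.radial_mul h.memLp hk'' hC'') hξE.memLp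
  have e1 : ∫ x, inner ℝ (radial k x • P x + (radial (deriv k) x * p x) • rdir x) (sgrad ξ x)
        ∂(invMeasure n a)
      = ∫ x, inner ℝ (radial k x • P x) (sgrad ξ x) ∂(invMeasure n a)
        + ∫ x, radial (deriv k) x * p x * inner ℝ (sgrad ξ x) (rdir x) ∂(invMeasure n a) := by
    rw [← integral_add i1 i2]
    congr 1
    ext x
    rw [inner_add_left, real_inner_smul_left (rdir x), real_inner_comm (sgrad ξ x) (rdir x)]
  have e2 : ∫ x, inner ℝ (P x) (sgrad (fun x => radial k x * ξ x) x) ∂(invMeasure n a)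
      = ∫ x, inner ℝ (radial k x • P x) (sgrad ξ x) ∂(invMeasure n a)
        + ∫ x, radial (deriv k) x * inner ℝ (P x) (rdir x) * ξ x ∂(invMeasure n a) := by
    rw [← integral_add i1 i3]
    congr 1
    ext x
    rw [sgrad_radial_mul (hk.differentiable (by simp)) hξ.differentiable, inner_add_right,
      real_inner_smul_right, real_inner_smul_right, real_inner_smul_left]
    ring
  have e3 : ∫ x, (radial (deriv (deriv k)) x * p x
          + radial (deriv k) x * inner ℝ (P x) (rdir x)) * ξ x ∂(invMeasure n a)
      = ∫ x, radial (deriv (deriv k)) x * p x * ξ x ∂(invMeasure n a)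
        + ∫ x, radial (deriv k) x * inner ℝ (P x) (rdir x) * ξ x ∂(invMeasure n a) := by
    rw [← integral_add i4 i3]
    congr 1
    ext x
    ring
  have e4 : ∫ x, (radial (deriv (deriv k)) x * p x
          + 2 * (radial (deriv k) x * inner ℝ (P x) (rdir x))) * ξ x ∂(invMeasure n a)
      = ∫ x, radial (deriv (deriv k)) x * p x * ξ x ∂(invMeasure n a)
        + 2 * ∫ x, radial (deriv k) x * inner ℝ (P x) (rdir x) * ξ x ∂(invMeasure n a) := by
    rw [← integral_const_mul, ← integral_add i4 (i3.const_mul 2)]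
    congr 1
    ext x
    ring
  rw [e1, e2, e4, ibp, e3]
  ring

end FluxCorrection

/-! ### Size of the boundary correction and of its flux -/

section FluxCarleman

open Filter Topology

variable {n : ℕ} {a : ℝ}

theorem SupportedInShell.integrable_rexp_mul_sq {F : Type*} [NormedAddCommGroup F] [NormedSpace ℝ F]
    {f : Eu n → F} {t₀ t₁ : ℝ} (h : SupportedInShell n a t₀ t₁ f) (hf : MemLp f 2 (invMeasure n a))
    (β : ℝ) : Integrable (fun x => rexp β x * ‖f x‖ ^ 2) (invMeasure n a) := by
  refine (h.memLp_rexp_smul hf (β / 2)).norm.integrable_sq.congr (Eventually.of_forall fun x => ?_)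
  simp only [norm_smul, mul_pow, Real.norm_of_nonneg (rexp_pos _ x).le]
  rw [pow_two, rexp_mul, add_halves]

theorem SupportedInShell.mono {F : Type*} [Zero F] {f : Eu n → F} {t₀ t₁ s₀ s₁ : ℝ}
    (h : SupportedInShell n a t₀ t₁ f) (h₀ : s₀ ≤ t₀) (h₁ : t₁ ≤ s₁) :
    SupportedInShell n a s₀ s₁ f := by
  filter_upwards [h] with x hx h0
  exact ⟨h₀.trans (hx h0).1, (hx h0).2.trans h₁⟩

theorem SupportedInShell.sub {F : Type*} [AddGroup F] {f g : Eu n → F} {t₀ t₁ : ℝ}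
    (h : SupportedInShell n a t₀ t₁ f) (h' : SupportedInShell n a t₀ t₁ g) :
    SupportedInShell n a t₀ t₁ fun x => f x - g x := by
  filter_upwards [h, h'] with x hx hx' h0
  by_cases hf : f x = 0
  · refine hx' fun hg => h0 ?_
    rw [hf, hg, sub_self]
  · exact hx hf

/-- Pointwise bounds for the terms produced by the boundary correction. -/
theorem flux_correction_bounds {α τ c K e k₀ k₁ k₂ A B : ℝ} (hα : 1 ≤ α) (hτ : 1 ≤ τ) (he : 0 < e)
    (heτ : 1 ≤ e * τ) (hk₀ : 0 ≤ k₀) (hk₁ : 0 ≤ k₁) (hk₂ : 0 ≤ k₂) (h₀ : k₀ * e ≤ K)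
    (h₁ : k₁ * e ≤ K) (h₂ : k₂ * e ≤ K) (hA : 0 ≤ A) (hB : 0 ≤ B) :
    (c ^ 2 + τ ^ 2 * α ^ 2 * e ^ 2) * (k₀ * A) + 2 * τ * α * e * (k₀ * B + k₁ * A)
        + τ * α ^ 2 * e * (k₀ * A) + (1 + τ * e) ^ 2 * (k₀ * A) + (k₂ * A + 2 * (k₁ * B))
      ≤ K * (c ^ 2 + 2 * α ^ 2 + 2 * α + 3) * τ * ((1 + τ * e) * A + B) ∧
    τ ^ 3 * (e ^ 3 * (k₀ * A) ^ 2) ≤ K ^ 2 * τ ^ 2 * ((1 + τ * e) * A) ^ 2 ∧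
    τ * (e * (k₀ * B + k₁ * A) ^ 2) ≤ 2 * K ^ 2 * τ ^ 2 * (((1 + τ * e) * A) ^ 2 + B ^ 2) := by
  have hK : 0 ≤ K := (mul_nonneg hk₀ he.le).trans h₀
  -- A derivative of the cutoff not accompanied by e^{αt} is paid for with one power of τ, which the
  -- target bounds allow.
  have hb : ∀ {k : ℝ}, 0 ≤ k → k * e ≤ K → k ≤ K * τ := fun {k} hk h => by
    calc k ≤ k * (e * τ) := le_mul_of_one_le_right hk heτ
      _ = k * e * τ := by ring
      _ ≤ K * τ := mul_le_mul_of_nonneg_right h (by linarith)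
  have b₀ := hb hk₀ h₀
  have b₁ := hb hk₁ h₁
  have b₂ := hb hk₂ h₂
  have hτe : 0 ≤ τ * e := by positivity
  set L := (1 + τ * e) * A with hL
  have hAL : A ≤ L := le_mul_of_one_le_left hA (by linarith)
  have hτL : τ * e * A ≤ L := mul_le_mul_of_nonneg_right (by linarith) hA
  have hL0 : 0 ≤ L := hA.trans hAL
  have hKτ : 0 ≤ K * τ := by positivity
  have kA : ∀ {k : ℝ}, 0 ≤ k → k ≤ K * τ → k * A ≤ K * τ * L := fun hk h =>
    mul_le_mul h hAL hA hKτ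
  refine ⟨?_, ?_, ?_⟩
  · have t1 : c ^ 2 * (k₀ * A) ≤ c ^ 2 * (K * τ * L) :=
      mul_le_mul_of_nonneg_left (kA hk₀ b₀) (sq_nonneg _)
    have t2 : τ ^ 2 * α ^ 2 * e ^ 2 * (k₀ * A) ≤ α ^ 2 * τ * (K * L) := by
      calc τ ^ 2 * α ^ 2 * e ^ 2 * (k₀ * A) = α ^ 2 * τ * ((k₀ * e) * (τ * e * A)) := by ring
        _ ≤ α ^ 2 * τ * (K * L) := mul_le_mul_of_nonneg_left
          (mul_le_mul h₀ hτL (by positivity) hK) (by positivity)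
    have t3 : 2 * τ * α * e * (k₀ * B + k₁ * A) ≤ 2 * τ * α * (K * B + K * L) := by
      calc 2 * τ * α * e * (k₀ * B + k₁ * A) = 2 * τ * α * (k₀ * e * B + k₁ * e * A) := by ring
        _ ≤ _ := mul_le_mul_of_nonneg_left (add_le_add (mul_le_mul_of_nonneg_right h₀ hB)
          (mul_le_mul h₁ hAL hA hK)) (by positivity)
    have t4 : τ * α ^ 2 * e * (k₀ * A) ≤ τ * α ^ 2 * (K * L) := by
      calc τ * α ^ 2 * e * (k₀ * A) = τ * α ^ 2 * (k₀ * e * A) := by ring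
        _ ≤ _ := mul_le_mul_of_nonneg_left (mul_le_mul h₀ hAL hA hK) (by positivity)
    have t5 : (1 + τ * e) ^ 2 * (k₀ * A) ≤ 2 * (K * τ) * L := by
      calc (1 + τ * e) ^ 2 * (k₀ * A) = (k₀ + k₀ * e * τ) * L := by rw [hL]; ring
        _ ≤ (K * τ + K * τ) * L := mul_le_mul_of_nonneg_right
          (add_le_add b₀ (mul_le_mul_of_nonneg_right h₀ (by linarith))) hL0
        _ = _ := by ring
    have t6 := kA hk₂ b₂
    have t7 : k₁ * B ≤ K * τ * B := mul_le_mul_of_nonneg_right b₁ hB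
    have t8 : 0 ≤ K * τ * B * (c ^ 2 + 2 * α ^ 2 + 1) := by positivity
    linear_combination t1 + t2 + t3 + t4 + t5 + t6 + 2 * t7 + t8
  · have s1 : (k₀ * e) ^ 2 ≤ K ^ 2 := pow_le_pow_left₀ (by positivity) h₀ 2
    have s2 : (τ * e * A) ^ 2 ≤ L ^ 2 := pow_le_pow_left₀ (by positivity) hτL 2
    calc τ ^ 3 * (e ^ 3 * (k₀ * A) ^ 2) = (k₀ * e) ^ 2 * (τ ^ 3 * e * A ^ 2) := by ring
      _ ≤ K ^ 2 * (τ ^ 3 * e * A ^ 2) := mul_le_mul_of_nonneg_right s1 (by positivity)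
      _ ≤ K ^ 2 * (τ ^ 3 * e * A ^ 2 * (e * τ)) := mul_le_mul_of_nonneg_left
          (le_mul_of_one_le_right (by positivity) heτ) (by positivity)
      _ = K ^ 2 * τ ^ 2 * (τ * e * A) ^ 2 := by ring
      _ ≤ _ := mul_le_mul_of_nonneg_left s2 (by positivity)
  · have ek : ∀ {k : ℝ}, 0 ≤ k → k * e ≤ K → k ≤ K * τ → e * k ^ 2 ≤ K * (K * τ) := fun {k} hk h h' => by
      calc e * k ^ 2 = k * e * k := by ring
        _ ≤ _ := mul_le_mul h h' hk hK
    have s1 : (k₀ * B + k₁ * A) ^ 2 ≤ 2 * (k₀ ^ 2 * B ^ 2 + k₁ ^ 2 * A ^ 2) := by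
      nlinarith [sq_nonneg (k₀ * B - k₁ * A)]
    have s2 : A ^ 2 ≤ L ^ 2 := pow_le_pow_left₀ hA hAL 2
    calc τ * (e * (k₀ * B + k₁ * A) ^ 2)
        ≤ τ * (e * (2 * (k₀ ^ 2 * B ^ 2 + k₁ ^ 2 * A ^ 2))) := by gcongr
      _ = 2 * τ * (e * k₀ ^ 2 * B ^ 2 + e * k₁ ^ 2 * A ^ 2) := by ring
      _ ≤ 2 * τ * (K * (K * τ) * B ^ 2 + K * (K * τ) * L ^ 2) := mul_le_mul_of_nonneg_left
          (add_le_add (mul_le_mul_of_nonneg_right (ek hk₀ h₀ b₀) (sq_nonneg _))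
            (mul_le_mul (ek hk₁ h₁ b₁) s2 (sq_nonneg _) (by positivity))) (by positivity)
      _ = _ := by ring

theorem measurable_traceW (a τ α : ℝ) : Measurable (traceW (n := n) a τ α) := by
  have := measurable_rexp (n := n) α
  have h2 := measurable_rexp (n := n) (-(n / 2))
  unfold traceW lamW
  fun_prop

/-- The flux density after multiplication with the slope of the Carleman weight. -/
theorem memLp_flux {α τ : ℝ} (hα : 0 ≤ α) (hτ : 0 < τ) (ha' : a < 1)
    {b : EuclideanSpace ℝ (Fin n) → ℝ}
    (hb : MemLp (fun x' => rexp (α * (1 - (1 - a) / 2) + n / 2) (bdryPt x') * b x') 2 volume) :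
    MemLp (fun x' => -(α * rexp α (bdryPt x') * b x') / traceW a τ α (bdryPt x')) 2 volume ∧
    ∫ x', (-(α * rexp α (bdryPt x') * b x') / traceW a τ α (bdryPt x')) ^ 2
      ≤ α ^ 2 * τ ^ (-(1 - a))
        * ∫ x', (rexp (α * (1 - (1 - a) / 2) + n / 2) (bdryPt x') * b x') ^ 2 := by
  set γ := α * (1 - (1 - a) / 2) + n / 2 with hγ
  set β := (1 - a) / 2 with hβ
  have hβ0 : 0 ≤ β := by rw [hβ]; linarith
  have key : ∀ x' : EuclideanSpace ℝ (Fin n),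
      ‖-(α * rexp α (bdryPt x') * b x') / traceW a τ α (bdryPt x')‖
        ≤ α * τ ^ (-β) * ‖rexp γ (bdryPt x') * b x'‖ := by
    intro x'
    set z := bdryPt x' with hz
    -- From λ ≥ τ e^{αt}. Hence e^{αt} divided by the trace weight is at most τ^{-β} e^{(α(1-β) +
    -- n/2)t}; this yields both the gain in τ and the boundary exponent.
    have h1 : τ ^ β * rexp (α * β) z ≤ lamW τ α z ^ β := by
      have : rexp (α * β) z = rexp α z ^ β := by
        rw [rexp, rexp, ← Real.exp_mul]; ring_nf
      rw [this, ← Real.mul_rpow hτ.le (rexp_pos _ _).le]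
      refine Real.rpow_le_rpow (mul_nonneg hτ.le (rexp_pos _ _).le) ?_ hβ0
      rw [lamW]; linarith
    have h2 : τ ^ β * rexp (α * β - n / 2) z ≤ traceW a τ α z := by
      rw [traceW, ← hβ, sub_eq_add_neg, ← rexp_mul, ← mul_assoc]
      exact mul_le_mul_of_nonneg_right h1 (rexp_pos _ _).le
    have h3 : rexp α z ≤ τ ^ (-β) * rexp γ z * traceW a τ α z := by
      calc rexp α z = τ ^ (-β) * rexp γ z * (τ ^ β * rexp (α * β - n / 2) z) := by
            have e1 : τ ^ (-β) * τ ^ β = 1 := by rw [← Real.rpow_add hτ]; simp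
            have e2 : rexp γ z * rexp (α * β - n / 2) z = rexp α z := by
              rw [rexp_mul]; congr 1; rw [hγ]; ring
            rw [← e2]
            linear_combination -(rexp γ z * rexp (α * β - n / 2) z) * e1
        _ ≤ _ := mul_le_mul_of_nonneg_left h2
          (mul_nonneg (Real.rpow_nonneg hτ.le _) (rexp_pos _ _).le)
    have h4 := traceW_pos (a := a) hτ.le α z
    rw [norm_div, norm_neg, norm_mul, norm_mul, norm_mul, Real.norm_of_nonneg hα,
      Real.norm_of_nonneg (rexp_pos _ _).le, Real.norm_of_nonneg (rexp_pos _ _).le,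
      Real.norm_of_nonneg h4.le, div_le_iff₀ h4]
    calc α * rexp α z * ‖b x'‖ ≤ α * (τ ^ (-β) * rexp γ z * traceW a τ α z) * ‖b x'‖ := by gcongr
      _ = _ := by ring
  have hm : AEStronglyMeasurable
      (fun x' => -(α * rexp α (bdryPt x') * b x') / traceW a τ α (bdryPt x')) volume := by
    have h1 : Measurable fun x' : EuclideanSpace ℝ (Fin n) =>
        -(α * rexp α (bdryPt x')) * rexp (-γ) (bdryPt x') / traceW a τ α (bdryPt x') := by
      have m1 := (measurable_rexp α).comp (continuous_bdryPt (n := n)).measurable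
      have m2 := (measurable_rexp (-γ)).comp (continuous_bdryPt (n := n)).measurable
      have m3 := (measurable_traceW a τ α).comp (continuous_bdryPt (n := n)).measurable
      exact ((m1.const_mul α).neg.mul m2).div m3
    refine (h1.aestronglyMeasurable.mul hb.1).congr (Eventually.of_forall fun x' => ?_)
    have h2 : rexp (-γ) (bdryPt x') * rexp γ (bdryPt x') = 1 := by
      rw [rexp_mul]; simp [rexp]
    simp only [Pi.mul_apply]
    linear_combination (-(α * rexp α (bdryPt x') * b x') / traceW a τ α (bdryPt x')) * h2
  have hL := hb.of_le_mul hm (Eventually.of_forall key)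
  refine ⟨hL, ?_⟩
  rw [← integral_const_mul]
  refine integral_mono hL.integrable_sq (hb.integrable_sq.const_mul _) fun x' => ?_
  have h1 := pow_le_pow_left₀ (norm_nonneg _) (key x') 2
  rw [mul_pow, mul_pow, Real.norm_eq_abs, Real.norm_eq_abs, sq_abs, sq_abs, ← Real.rpow_natCast
    (τ ^ (-β)), ← Real.rpow_mul hτ.le] at h1
  have h2 : -β * ((2 : ℕ) : ℝ) = -(1 - a) := by rw [hβ]; push_cast; ring
  rw [h2] at h1
  exact h1

end FluxCarleman

/-! ### The Carleman estimate with prescribed flux -/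

section FluxCarlemanEstimate

open Filter Topology

variable {n : ℕ} {a : ℝ}

/-- The function `ψ p` built from a lift `p` of the boundary flux and a radial cutoff `ψ`: bounds for
it, its gradient and the remainder it leaves in the equation. -/
theorem flux_correction_estimates {α τ c K T : ℝ} (hα : 1 ≤ α) (hτ : Real.exp α ≤ τ)
    {ψ : ℝ → ℝ} (hz : ∀ t ∉ Set.Icc (-1) (T + 1), ψ t = 0)
    (hK : ∀ t, |ψ t| * Real.exp (α * t) ≤ K ∧ |deriv ψ t| * Real.exp (α * t) ≤ K ∧
        |deriv (deriv ψ) t| * Real.exp (α * t) ≤ K)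
    {p : Eu n → ℝ} {P : Eu n → Eu n} {x : Eu n} :
    let w := radial ψ x * p x
    let W := radial ψ x • P x + (radial (deriv ψ) x * p x) • rdir x
    |(c ^ 2 - τ ^ 2 * α ^ 2 * rexp (2 * α) x) * w + 2 * τ * α * rexp α x * inner ℝ W (rdir x)
        + τ * α ^ 2 * rexp α x * w - lamW τ α x ^ 2 * w
        - (radial (deriv (deriv ψ)) x * p x + 2 * (radial (deriv ψ) x * inner ℝ (P x) (rdir x)))|
      ≤ K * (c ^ 2 + 2 * α ^ 2 + 2 * α + 3) * τ * (|lamW τ α x * p x| + ‖P x‖) ∧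
    |lamW τ α x ^ 2 * w| ≤ K * (c ^ 2 + 2 * α ^ 2 + 2 * α + 3) * τ * (|lamW τ α x * p x| + ‖P x‖) ∧
    τ ^ 3 * (rexp (3 * α) x * w ^ 2) ≤ K ^ 2 * τ ^ 2 * (lamW τ α x * p x) ^ 2 ∧
    τ * (rexp α x * ‖W‖ ^ 2) ≤ 2 * K ^ 2 * τ ^ 2 * ((lamW τ α x * p x) ^ 2 + ‖P x‖ ^ 2) := by
  intro w W
  have hτ1 : 1 ≤ τ := (Real.one_le_exp (by linarith)).trans hτ
  have hτ0 : 0 < τ := by linarith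
  have hK0 : 0 ≤ K := (by positivity : 0 ≤ |ψ 0| * Real.exp (α * 0)).trans (hK 0).1
  by_cases ht : Real.log ‖x‖ ∈ Set.Icc (-1) (T + 1)
  · have he : 0 < rexp α x := rexp_pos α x
    -- On the enlarged shell t ≥ -1, so e^{αt} ≥ e^{-α} ≥ 1/τ.
    have heτ : 1 ≤ rexp α x * τ := by
      calc (1 : ℝ) ≤ rexp α x * Real.exp α := by
            rw [rexp, ← Real.exp_add]
            refine Real.one_le_exp ?_
            nlinarith [ht.1]
        _ ≤ _ := mul_le_mul_of_nonneg_left hτ he.le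
    obtain ⟨h₀, h₁, h₂⟩ := hK (Real.log ‖x‖)
    have key := flux_correction_bounds (c := c) hα hτ1 he heτ (abs_nonneg (radial ψ x))
      (abs_nonneg (radial (deriv ψ) x)) (abs_nonneg (radial (deriv (deriv ψ)) x)) h₀ h₁ h₂
      (abs_nonneg (p x)) (norm_nonneg (P x))
    have hl : |lamW τ α x * p x| = (1 + τ * rexp α x) * |p x| := by
      rw [abs_mul, abs_of_pos (lamW_pos hτ0.le α x), lamW]
    have hw : |w| = |radial ψ x| * |p x| := abs_mul _ _
    have hW : ‖W‖ ≤ |radial ψ x| * ‖P x‖ + |radial (deriv ψ) x| * |p x| := by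
      refine (norm_add_le _ _).trans (add_le_add (norm_smul _ _).le ?_)
      rw [norm_smul, norm_mul]
      exact mul_le_of_le_one_right (by positivity) (norm_rdir_le x)
    have hD : ∀ Q : Eu n, |inner ℝ Q (rdir x)| ≤ ‖Q‖ := fun Q =>
      (abs_real_inner_le_norm _ _).trans (mul_le_of_le_one_right (norm_nonneg _) (norm_rdir_le x))
    have hWD := (hD W).trans hW
    have hPD := hD (P x)
    have e2 : rexp (2 * α) x = rexp α x ^ 2 := by rw [pow_two, rexp_mul]; congr 1; ring
    have e3 : rexp (3 * α) x = rexp α x ^ 3 := by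
      rw [pow_succ, ← e2, rexp_mul]; congr 1; ring
    obtain ⟨k1, k2, k3⟩ := key
    rw [← hw] at k1 k2
    have hlw : lamW τ α x = 1 + τ * rexp α x := rfl
    rw [hlw] at hl ⊢
    rw [← sq_abs ((1 + τ * rexp α x) * p x), hl, e2, e3, ← sq_abs w]
    have q1 : 0 ≤ |radial (deriv (deriv ψ)) x| * |p x| := by positivity
    have q2 : 0 ≤ |radial (deriv ψ) x| * ‖P x‖ := by positivity
    have q3 : 0 ≤ (c ^ 2 + τ ^ 2 * α ^ 2 * rexp α x ^ 2) * |w| := by positivity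
    have q4 : 0 ≤ 2 * τ * α * rexp α x * (|radial ψ x| * ‖P x‖ + |radial (deriv ψ) x| * |p x|) := by
      positivity
    have q5 : 0 ≤ τ * α ^ 2 * rexp α x * |w| := by positivity
    have q6 : |(1 + τ * rexp α x) ^ 2 * w| = (1 + τ * rexp α x) ^ 2 * |w| := by
      rw [abs_mul, abs_of_nonneg (sq_nonneg _)]
    refine ⟨?_, ?_, k2, ?_⟩
    · refine le_trans ?_ k1
      refine (abs_sub _ _).trans (add_le_add ((abs_sub _ _).trans (add_le_add ((abs_add_le _ _).trans
        (add_le_add ((abs_add_le _ _).trans (add_le_add ?_ ?_)) ?_)) ?_)) ?_)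
      · rw [abs_mul]
        refine mul_le_mul_of_nonneg_right ((abs_sub _ _).trans (le_of_eq ?_)) (abs_nonneg _)
        rw [abs_of_nonneg (sq_nonneg c), abs_of_nonneg (by positivity)]
      · rw [abs_mul, abs_of_nonneg (by positivity)]
        exact mul_le_mul_of_nonneg_left hWD (by positivity)
      · rw [abs_mul, abs_of_nonneg (by positivity)]
      · exact q6.le
      · refine (abs_add_le _ _).trans (add_le_add (abs_mul _ _).le ?_)
        rw [abs_mul, abs_mul, abs_two]
        gcongr
    · rw [q6]
      linarith
    · refine le_trans ?_ k3
      gcongr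
  · have z1 := deriv_eq_zero_of_forall_notMem isClosed_Icc hz
    have z2 := deriv_eq_zero_of_forall_notMem isClosed_Icc z1
    have hw : w = 0 := by simp only [w, radial, hz _ ht, zero_mul]
    have hW : W = 0 := by simp only [W, radial, hz _ ht, z1 _ ht, zero_smul, zero_mul, add_zero]
    rw [hw, hW, radial, radial, z1 _ ht, z2 _ ht]
    simp only [inner_zero_left, mul_zero, zero_mul, add_zero, sub_zero, abs_zero, norm_zero, ne_eq,
      OfNat.ofNat_ne_zero, not_false_eq_true, zero_pow]
    refine ⟨?_, ?_, ?_, ?_⟩ <;> positivity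

set_option maxHeartbeats 1000000 in
/-- The Carleman estimate for weak solutions with a prescribed flux on the boundary, in the scale
invariant form. -/
theorem flux_carleman (ha : -1 < a) (ha' : a < 1) {α : ℝ} (hα : 1 ≤ α) (c : ℝ) :
    ∃ C : ℝ, 0 < C ∧ ∀ τ T : ℝ, Real.exp α ≤ τ → 0 ≤ T → ∀ (v : Eu n → ℝ) (P : Eu n → Eu n)
      (H : Eu n → ℝ) (b : EuclideanSpace ℝ (Fin n) → ℝ), InEnergySpace a v P →
      SupportedInShell n a 0 T v → SupportedInShell n a 0 T P → MemLp H 2 (invMeasure n a) →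
      MemLp (fun x' => rexp (α * (1 - (1 - a) / 2) + n / 2) (bdryPt x') * b x') 2 volume →
      (∀ᵐ x', b x' ≠ 0 → Real.log ‖x'‖ ∈ Set.Icc 0 T) →
      (∀ ξ : Eu n → ℝ, IsTest ξ → ∫ x, inner ℝ (P x) (sgrad ξ x) ∂(invMeasure n a)
        = ∫ x, -((c ^ 2 - τ ^ 2 * α ^ 2 * rexp (2 * α) x) * v x
          + 2 * τ * α * rexp α x * inner ℝ (P x) (rdir x) + τ * α ^ 2 * rexp α x * v x + H x) * ξ x
          ∂(invMeasure n a) - ∫ x', b x' * ξ (bdryPt x')) →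
      τ ^ 3 * ∫ x, rexp (3 * α) x * v x ^ 2 ∂(invMeasure n a)
          + τ * ∫ x, rexp α x * ‖P x‖ ^ 2 ∂(invMeasure n a)
        ≤ C * (∫ x, H x ^ 2 ∂(invMeasure n a) + τ ^ (2 - (1 - a))
          * ∫ x', (rexp (α * (1 - (1 - a) / 2) + n / 2) (bdryPt x') * b x') ^ 2) := by
  obtain ⟨C₀, hC₀, hlift⟩ := exists_boundary_lift (n := n) ha ha'
  obtain ⟨K, hK, hcut⟩ := exists_flux_cutoff hα
  set K' := K * (c ^ 2 + 2 * α ^ 2 + 2 * α + 3) with hK'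
  have hK'0 : 0 < K' := by positivity
  refine ⟨16 * α ^ 2 + (32 * α ^ 2 * K' ^ 2 + 8 * K ^ 2) * (C₀ * α ^ 2), by positivity,
    fun τ T hτ hT v P H b hv hsv hsP hH hb hbs heq => ?_⟩
  have hα0 : 0 ≤ α := by linarith
  have hτ1 : 1 ≤ τ := (Real.one_le_exp hα0).trans hτ
  have hτ0 : 0 < τ := by linarith
  obtain ⟨ψ, hψ, hz, h1, hψK⟩ := hcut T hT
  have hψc : HasCompactSupport ψ := HasCompactSupport.intro isCompact_Icc hz
  obtain ⟨M, hM, hM', hM''⟩ := exists_bound_of_contDiff_compact hψ hψc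
  have hψ' : ContDiff ℝ ∞ (deriv ψ) := (contDiff_infty_iff_deriv.1 hψ).2
  have hψ'' : Continuous (deriv (deriv ψ)) := hψ'.continuous_deriv (by simp)
  obtain ⟨hbL, hbN⟩ := memLp_flux (a := a) hα0 hτ0 ha' hb
  set B := ∫ x', (rexp (α * (1 - (1 - a) / 2) + n / 2) (bdryPt x') * b x') ^ 2 with hB
  -- The lifted flux is -α e^{αt} b rather than -b; the factor is undone by ψ. This makes τ²e^{2αt}ψ
  -- comparable to τλ on the shell, so the energy of p controls the remainder with a loss of τ only.
  obtain ⟨p, Q, hp, hlp, hpeq, hpE⟩ := hlift τ α hτ0.le hα0 _ hbL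
  set ν := invMeasure n a with hν
  have hw := hp.radial_mul ha hψ hM hM'
  set w : Eu n → ℝ := fun x => radial ψ x * p x with hwdef
  set W : Eu n → Eu n := fun x => radial ψ x • Q x + (radial (deriv ψ) x * p x) • rdir x with hWdef
  have est := fun x => flux_correction_estimates (n := n) (c := c) hα hτ hz hψK
    (p := p) (P := Q) (x := x)
  simp only at est
  have z1 := deriv_eq_zero_of_forall_notMem isClosed_Icc hz
  have hsw : SupportedInShell n a (-1) (T + 1) w := Eventually.of_forall fun x h0 => by
    by_contra ht
    exact h0 (by simp only [hwdef, radial, hz _ ht, zero_mul])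
  have hsW : SupportedInShell n a (-1) (T + 1) W := Eventually.of_forall fun x h0 => by
    by_contra ht
    exact h0 (by simp only [hWdef, radial, hz _ ht, z1 _ ht, zero_smul, zero_mul, add_zero])
  have hsv' : SupportedInShell n a (-1) (T + 1) v := hsv.mono (by norm_num) (by linarith)
  have hsP' : SupportedInShell n a (-1) (T + 1) P := hsP.mono (by norm_num) (by linarith)
  have hG : MemLp (fun x => |lamW τ α x * p x| + ‖Q x‖) 2 ν := hlp.norm.add hp.memLp_grad.norm
  set f₂ : Eu n → ℝ := fun x => lamW τ α x ^ 2 * w x with hf₂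
  set f₃ : Eu n → ℝ := fun x => radial (deriv (deriv ψ)) x * p x
    + 2 * (radial (deriv ψ) x * inner ℝ (Q x) (rdir x)) with hf₃
  set A : (Eu n → ℝ) → (Eu n → Eu n) → Eu n → ℝ := fun v P x =>
    (c ^ 2 - τ ^ 2 * α ^ 2 * rexp (2 * α) x) * v x
      + 2 * τ * α * rexp α x * inner ℝ (P x) (rdir x) + τ * α ^ 2 * rexp α x * v x with hA
  have hml : Measurable fun x : Eu n => lamW τ α x := by
    have := measurable_rexp (n := n) α
    unfold lamW; fun_prop
  have hAL : ∀ {v : Eu n → ℝ} {P : Eu n → Eu n}, InEnergySpace a v P →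
      SupportedInShell n a (-1) (T + 1) v → SupportedInShell n a (-1) (T + 1) P →
      MemLp (A v P) 2 ν := by
    intro v P hv hsv hsP
    have hsD : SupportedInShell n a (-1) (T + 1) fun x => inner ℝ (P x) (rdir x) := by
      filter_upwards [hsP] with x hx h0
      exact hx fun h1 => h0 (by rw [h1, inner_zero_left])
    have := (((hv.memLp.const_mul (c ^ 2)).sub
      ((hsv.memLp_rexp_smul hv.memLp (2 * α)).const_mul (τ ^ 2 * α ^ 2))).add
      ((hsD.memLp_rexp_smul (MemLp.inner_rdir hv.memLp_grad) α).const_mul (2 * τ * α))).add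
      ((hsv.memLp_rexp_smul hv.memLp α).const_mul (τ * α ^ 2))
    refine (memLp_congr_ae (Eventually.of_forall fun x => ?_)).1 this
    simp only [Pi.add_apply, Pi.sub_apply, smul_eq_mul, hA]
    ring
  have hf₂L : MemLp f₂ 2 ν := hG.of_le_mul (c := K' * τ)
    ((hml.pow_const 2).aestronglyMeasurable.mul hw.memLp.1) (Eventually.of_forall fun x => by
      rw [Real.norm_eq_abs, Real.norm_of_nonneg (by positivity)]
      exact (est x).2.1)
  have hf₃L : MemLp f₃ 2 ν := (MemLp.radial_mul hp.memLp hψ'' hM'').add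
    ((MemLp.radial_mul (MemLp.inner_rdir hp.memLp_grad) hψ'.continuous hM').const_mul 2)
  -- The defect of w in the equation: A w is the lower order part of the operator, f₂ comes from the
  -- zeroth order term of the lifting problem, f₃ from commuting ψ with the Dirichlet form. The
  -- boundary terms of v and w cancel, so v - w has zero flux and right-hand side H + Z.
  set Z : Eu n → ℝ := fun x => A w W x - f₂ x - f₃ x with hZ
  have hZL : MemLp Z 2 ν := ((hAL hw hsw hsW).sub hf₂L).sub hf₃L
  have hHZ : MemLp (fun x => H x + Z x) 2 ν := hH.add hZL
  have hAv := hAL hv hsv' hsP'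
  have hfin := (hsv'.sub hsw).carleman ha (hsP'.sub hsW) (hv.sub ha hw) hHZ c hα hτ
    fun ξ hξ => by
      have i1 := MemLp.integrable_inner_real hv.memLp_grad (hξ.memLp_sgrad ha 2)
      have i2 := MemLp.integrable_inner_real hw.memLp_grad (hξ.memLp_sgrad ha 2)
      have e1 := hp.integral_inner_radial_mul ha hψ hψc hξ
      have e2 := hpeq _ (hξ.radial_mul hψ)
      have e3 : ∫ x', -(α * rexp α (bdryPt x') * b x')
            * (radial ψ (bdryPt x') * ξ (bdryPt x')) = -∫ x', b x' * ξ (bdryPt x') := by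
        rw [← integral_neg]
        apply integral_congr_ae
        filter_upwards [hbs] with x' hx'
        by_cases h0 : b x' = 0
        · simp [h0]
        · have h2 := h1 _ (hx' h0)
          rw [← norm_bdryPt] at h2
          have h3 : α * rexp α (bdryPt x') * radial ψ (bdryPt x') = 1 := h2
          linear_combination (-(b x' * ξ (bdryPt x'))) * h3
      have e4 : ∫ x, lamW τ α x ^ 2 * p x * (radial ψ x * ξ x) ∂ν = ∫ x, f₂ x * ξ x ∂ν := by
        congr 1
        ext x
        simp only [hf₂, hwdef]
        ring
      have j1 := MemLp.integrable_mul_real (hAv.add hH) (hξ.memLp ha 2)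
      have j2 := MemLp.integrable_mul_real hf₂L (hξ.memLp ha 2)
      have j3 := MemLp.integrable_mul_real hf₃L (hξ.memLp ha 2)
      have e5 := heq ξ hξ
      have e6 : ∫ x, -((c ^ 2 - τ ^ 2 * α ^ 2 * rexp (2 * α) x) * v x
          + 2 * τ * α * rexp α x * inner ℝ (P x) (rdir x) + τ * α ^ 2 * rexp α x * v x + H x) * ξ x ∂ν
          = -∫ x, (A v P x + H x) * ξ x ∂ν := by
        rw [← integral_neg]
        congr 1
        ext x
        simp only [hA]
        ring
      have e7 : ∫ x, inner ℝ (P x - W x) (sgrad ξ x) ∂ν = ∫ x, inner ℝ (P x) (sgrad ξ x) ∂ν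
          - ∫ x, inner ℝ (W x) (sgrad ξ x) ∂ν := by
        rw [← integral_sub i1 i2]
        congr 1
        ext x
        exact inner_sub_left _ _ _
      rw [e7, e5, e6, e1]
      rw [e3, e4] at e2
      have e8 := integral_lincomb₅ j1 j2 j3 j3 j3 (-1) 1 1 0 0
      refine Eq.trans ?_ (e8.symm.trans ?_)
      · simp only [Pi.add_apply]
        linarith
      · congr 1
        ext x
        simp only [hZ, hA, inner_sub_left, Pi.add_apply]
        ring
  set E := ∫ x, ‖Q x‖ ^ 2 ∂ν + ∫ x, (lamW τ α x * p x) ^ 2 ∂ν with hE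
  have iQ := hp.memLp_grad.norm.integrable_sq
  have il := hlp.integrable_sq
  have hE' : E = ∫ x, ((lamW τ α x * p x) ^ 2 + ‖Q x‖ ^ 2) ∂ν := by
    rw [integral_add il iQ, add_comm]
  have hE0 : 0 ≤ E := add_nonneg (integral_nonneg fun _ => sq_nonneg _)
    (integral_nonneg fun _ => sq_nonneg _)
  have hZE : ∫ x, Z x ^ 2 ∂ν ≤ 2 * K' ^ 2 * τ ^ 2 * E := by
    rw [hE', ← integral_const_mul]
    refine integral_mono hZL.integrable_sq ((il.add iQ).const_mul _) fun x => ?_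
    have h2 := pow_le_pow_left₀ (abs_nonneg _) (est x).1 2
    rw [sq_abs] at h2
    refine h2.trans ?_
    have h3 := sq_abs (lamW τ α x * p x)
    rw [← h3, ← hK', mul_pow, mul_pow]
    have h4 : (|lamW τ α x * p x| + ‖Q x‖) ^ 2 ≤ 2 * (|lamW τ α x * p x| ^ 2 + ‖Q x‖ ^ 2) := by
      nlinarith [sq_nonneg (|lamW τ α x * p x| - ‖Q x‖)]
    calc _ ≤ K' ^ 2 * τ ^ 2 * (2 * (|lamW τ α x * p x| ^ 2 + ‖Q x‖ ^ 2)) :=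
          mul_le_mul_of_nonneg_left h4 (by positivity)
      _ = _ := by ring
  have hHZE : ∫ x, (H x + Z x) ^ 2 ∂ν ≤ 2 * ∫ x, H x ^ 2 ∂ν + 2 * ∫ x, Z x ^ 2 ∂ν := by
    rw [← integral_const_mul, ← integral_const_mul,
      ← integral_add (hH.integrable_sq.const_mul 2) (hZL.integrable_sq.const_mul 2)]
    refine integral_mono hHZ.integrable_sq
      ((hH.integrable_sq.const_mul 2).add (hZL.integrable_sq.const_mul 2)) fun x => ?_
    simp only
    nlinarith [sq_nonneg (H x - Z x)]
  have iv := hsv'.integrable_rexp_mul_sq hv.memLp (3 * α)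
  have iw := hsw.integrable_rexp_mul_sq hw.memLp (3 * α)
  have ivw := (hsv'.sub hsw).integrable_rexp_mul_sq (hv.sub ha hw).memLp (3 * α)
  have jv := hsP'.integrable_rexp_mul_sq hv.memLp_grad α
  have jw := hsW.integrable_rexp_mul_sq hw.memLp_grad α
  have jvw := (hsP'.sub hsW).integrable_rexp_mul_sq (hv.sub ha hw).memLp_grad α
  simp only [Real.norm_eq_abs, sq_abs] at iv iw ivw
  have b1 : ∫ x, rexp (3 * α) x * v x ^ 2 ∂ν ≤ 2 * ∫ x, rexp (3 * α) x * (v x - w x) ^ 2 ∂ν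
      + 2 * ∫ x, rexp (3 * α) x * w x ^ 2 ∂ν := by
    rw [← integral_const_mul, ← integral_const_mul, ← integral_add (ivw.const_mul 2) (iw.const_mul 2)]
    refine integral_mono iv ((ivw.const_mul 2).add (iw.const_mul 2)) fun x => ?_
    have h2 : v x ^ 2 ≤ 2 * (v x - w x) ^ 2 + 2 * w x ^ 2 := by
      nlinarith [sq_nonneg (v x - 2 * w x)]
    have h3 := mul_le_mul_of_nonneg_left h2 (rexp_pos (3 * α) x).le
    simp only
    linarith
  have b2 : ∫ x, rexp α x * ‖P x‖ ^ 2 ∂ν ≤ 2 * ∫ x, rexp α x * ‖P x - W x‖ ^ 2 ∂ν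
      + 2 * ∫ x, rexp α x * ‖W x‖ ^ 2 ∂ν := by
    rw [← integral_const_mul, ← integral_const_mul, ← integral_add (jvw.const_mul 2) (jw.const_mul 2)]
    refine integral_mono jv ((jvw.const_mul 2).add (jw.const_mul 2)) fun x => ?_
    have h2 : ‖P x‖ ≤ ‖P x - W x‖ + ‖W x‖ := by
      simpa using norm_add_le (P x - W x) (W x)
    have h4 : ‖P x‖ ^ 2 ≤ 2 * ‖P x - W x‖ ^ 2 + 2 * ‖W x‖ ^ 2 := by
      nlinarith [sq_nonneg (‖P x - W x‖ - ‖W x‖), norm_nonneg (P x), norm_nonneg (W x),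
        norm_nonneg (P x - W x)]
    have h3 := mul_le_mul_of_nonneg_left h4 (rexp_pos α x).le
    simp only
    linarith
  have b3 : τ ^ 3 * ∫ x, rexp (3 * α) x * w x ^ 2 ∂ν ≤ K ^ 2 * τ ^ 2 * E := by
    have : τ ^ 3 * ∫ x, rexp (3 * α) x * w x ^ 2 ∂ν
        ≤ K ^ 2 * τ ^ 2 * ∫ x, (lamW τ α x * p x) ^ 2 ∂ν := by
      rw [← integral_const_mul, ← integral_const_mul]
      exact integral_mono (iw.const_mul _) (il.const_mul _) fun x => (est x).2.2.1
    refine this.trans (mul_le_mul_of_nonneg_left ?_ (by positivity))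
    exact le_add_of_nonneg_left (integral_nonneg fun _ => sq_nonneg _)
  have b4 : τ * ∫ x, rexp α x * ‖W x‖ ^ 2 ∂ν ≤ 2 * K ^ 2 * τ ^ 2 * E := by
    rw [hE', ← integral_const_mul, ← integral_const_mul]
    exact integral_mono (jw.const_mul _) ((il.add iQ).const_mul _) fun x => (est x).2.2.2
  -- The factor τ² lost in the correction meets the gain τ^{-(1-a)} from the trace inequality; with
  -- 1 - a = 2s this is the power τ^{2-2s}.
  have b5 : τ ^ 2 * E ≤ C₀ * α ^ 2 * (τ ^ (2 - (1 - a)) * B) := by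
    have h2 := hpE.trans (mul_le_mul_of_nonneg_left hbN hC₀.le)
    have h3 : τ ^ (2 - (1 - a)) = τ ^ 2 * τ ^ (-(1 - a)) := by
      rw [sub_eq_add_neg, Real.rpow_add hτ0, Real.rpow_two]
    rw [h3]
    calc τ ^ 2 * E ≤ τ ^ 2 * (C₀ * (α ^ 2 * τ ^ (-(1 - a)) * B)) :=
          mul_le_mul_of_nonneg_left h2 (by positivity)
      _ = _ := by ring
  have hH0 : 0 ≤ ∫ x, H x ^ 2 ∂ν := integral_nonneg fun _ => sq_nonneg _
  have hB0 : 0 ≤ τ ^ (2 - (1 - a)) * B :=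
    mul_nonneg (Real.rpow_nonneg hτ0.le _) (integral_nonneg fun _ => sq_nonneg _)
  have b1' := mul_le_mul_of_nonneg_left b1 (by positivity : 0 ≤ τ ^ 3)
  have b2' := mul_le_mul_of_nonneg_left b2 hτ0.le
  have hHZ' := mul_le_mul_of_nonneg_left (hHZE.trans (add_le_add_right
    (mul_le_mul_of_nonneg_left hZE (by norm_num)) _)) (by positivity : 0 ≤ 4 * α ^ 2)
  have hsum : τ ^ 3 * ∫ x, rexp (3 * α) x * v x ^ 2 ∂ν + τ * ∫ x, rexp α x * ‖P x‖ ^ 2 ∂ν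
      ≤ 16 * α ^ 2 * ∫ x, H x ^ 2 ∂ν + (32 * α ^ 2 * K' ^ 2 + 6 * K ^ 2) * (τ ^ 2 * E) := by
    linarith
  have hE2 : 0 ≤ τ ^ 2 * E := by positivity
  have b6 := mul_le_mul_of_nonneg_left b5 (by positivity : 0 ≤ 32 * α ^ 2 * K' ^ 2 + 8 * K ^ 2)
  have q1 : 0 ≤ 2 * K ^ 2 * (τ ^ 2 * E) := by positivity
  have q2 : 0 ≤ (32 * α ^ 2 * K' ^ 2 + 8 * K ^ 2) * (C₀ * α ^ 2) * ∫ x, H x ^ 2 ∂ν := by positivity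
  have q3 : 0 ≤ 16 * α ^ 2 * (τ ^ (2 - (1 - a)) * B) := by positivity
  linarith

end FluxCarlemanEstimate

/-! ### Conjugation with the Carleman weight -/

section RealCarleman

open Filter Topology

variable {n : ℕ} {a : ℝ}

theorem norm_eq_rexp {x : Eu n} (hx : x ≠ 0) : ‖x‖ = rexp 1 x := by
  rw [rexp, one_mul, Real.exp_log (norm_pos_iff.2 hx)]

/-- Writing the density as a square fixes the conjugating power c = (n-1+a)/2: Lebesgue integrals
with x_{n+1}^a equal invariant ones once |x|^c has been put into the function and |x| into the
gradient. -/
theorem coneWeight_eq {x : Eu n} (hx : x ∈ upperHalf n) : coneWeight n a x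
    = (x (Fin.last n) ^ (a / 2) / (rexp ((n - 1 + a) / 2) x * ‖x‖)) ^ 2 := by
  have h0 := norm_pos_iff.2 (ne_zero_of_mem_upperHalf hx)
  have hy : 0 < x (Fin.last n) := hx
  have h1 : (x (Fin.last n) ^ (a / 2)) ^ 2 = x (Fin.last n) ^ a := by
    rw [← Real.rpow_natCast, ← Real.rpow_mul hy.le]; congr 1; push_cast; ring
  have h2 : (rexp ((n - 1 + a) / 2) x * ‖x‖) ^ 2 = ‖x‖ ^ ((n : ℝ) + 1 + a) := by
    have h3 : rexp ((n - 1 + a) / 2) x * ‖x‖ = rexp ((n - 1 + a) / 2 + 1) x := by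
      rw [← rexp_mul, ← norm_eq_rexp (ne_zero_of_mem_upperHalf hx)]
    rw [h3, pow_two, rexp_mul, rexp, Real.rpow_def_of_pos h0, mul_comm]
    congr 1; ring
  rw [div_pow, h1, h2, coneWeight, Real.rpow_neg h0.le, div_eq_inv_mul]

theorem log_norm_mem_of_mem_annulus {R : ℝ} {x : Eu n} (hx : x ∈ annulus n 1 R) :
    Real.log ‖x‖ ∈ Set.Icc 0 (Real.log R) :=
  ⟨Real.log_nonneg hx.1, Real.log_le_log (by linarith [hx.1]) hx.2⟩

/-- The weak formulation after conjugation with the Carleman weight. -/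
theorem conjugated_equation (ha : -1 < a) {α τ T : ℝ} {u f : Eu n → ℝ} {G : Eu n → Eu n}
    {h : EuclideanSpace ℝ (Fin n) → ℝ}
    (hsh : ∀ᵐ x ∂(invMeasure n a), Real.log ‖x‖ ∉ Set.Icc 0 T → u x = 0 ∧ G x = 0)
    (heq : ∀ η : Eu n → ℝ, IsTest η →
      ∫ x, x (Fin.last n) ^ a * inner ℝ (gradient η x) (G x) ∂(halfMeasure n)
        = -(∫ x, η x * f x ∂(halfMeasure n)) - ∫ x', η (bdryPt x') * h x')
    {v H : Eu n → ℝ} {P : Eu n → Eu n} {c : ℝ} (hc : c = (n - 1 + a) / 2)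
    (hv : ∀ x, v x = Real.exp (τ * rexp α x) * rexp c x * u x)
    (hP : ∀ x, P x = (Real.exp (τ * rexp α x) * rexp c x) • (‖x‖ • G x)
      + ((τ * α * rexp α x + c) * v x) • rdir x)
    (hH : ∀ x, H x = Real.exp (τ * rexp α x) * rexp c x * ‖x‖ ^ 2
      * (x (Fin.last n) ^ (a / 2))⁻¹ ^ 2 * f x)
    (hvP : InEnergySpace a v P) (hHL : MemLp H 2 (invMeasure n a)) {ξ : Eu n → ℝ} (hξ : IsTest ξ) :
    ∫ x, inner ℝ (P x) (sgrad ξ x) ∂(invMeasure n a)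
        = ∫ x, -((c ^ 2 - τ ^ 2 * α ^ 2 * rexp (2 * α) x) * v x
          + 2 * τ * α * rexp α x * inner ℝ (P x) (rdir x) + τ * α ^ 2 * rexp α x * v x + H x) * ξ x
          ∂(invMeasure n a)
          - ∫ x', Real.exp (τ * rexp α (bdryPt x')) * rexp (-c) (bdryPt x') * h x'
            * ξ (bdryPt x') := by
  set ν := invMeasure n a with hν
  obtain ⟨χ, hχ, hχc, -, hχ1⟩ := exists_cutoff_one 0 T
  -- Without the cutoff, k₁ and k₂ are the logarithmic derivatives in t of e^{τ|x|^α}|x|^c and of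
  -- e^{τ|x|^α}|x|^{-c}, and k₃ is their product. The cutoff provides bounded multipliers and is
  -- invisible on the support of v.
  set k₁ : ℝ → ℝ := fun t => χ t * (τ * α * Real.exp (α * t) + c) with hk₁
  set k₂ : ℝ → ℝ := fun t => χ t * (τ * α * Real.exp (α * t) - c) with hk₂
  set k₃ : ℝ → ℝ := fun t => χ t * (τ ^ 2 * α ^ 2 * Real.exp (2 * α * t) - c ^ 2) with hk₃
  have s₁ : ContDiff ℝ ∞ k₁ := by fun_prop
  have s₂ : ContDiff ℝ ∞ k₂ := by fun_prop
  have s₃ : ContDiff ℝ ∞ k₃ := by fun_prop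
  obtain ⟨C₁, b₁, b₁', -⟩ := exists_bound_of_contDiff_compact s₁ hχc.mul_right
  obtain ⟨C₂, b₂, -, -⟩ := exists_bound_of_contDiff_compact s₂ hχc.mul_right
  obtain ⟨C₃, b₃, -, -⟩ := exists_bound_of_contDiff_compact s₃ hχc.mul_right
  have s₁' : Continuous (deriv k₁) := s₁.continuous_deriv (by simp)
  have hk₁' : ∀ t ∈ Set.Icc 0 T, deriv k₁ t = τ * α ^ 2 * Real.exp (α * t) := fun t ht => by
    have h4 : k₁ =ᶠ[𝓝 t] fun t => τ * α * Real.exp (α * t) + c := by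
      filter_upwards [hχ1 t ht] with s hs
      rw [hk₁]; simp only [hs, one_mul]
    have h5 := ((((hasDerivAt_id t).const_mul α).exp).const_mul (τ * α)).add_const c
    simp only [id, mul_one] at h5
    rw [h4.deriv_eq, h5.deriv]
    ring
  -- The original equation is tested with mξ. Its power -c, against +c in v, accounts for the factor
  -- |x|^{2c} between the two densities.
  set m : ℝ → ℝ := fun t => Real.exp (τ * Real.exp (α * t)) * Real.exp (-c * t) with hm
  have hms : ContDiff ℝ ∞ m := by fun_prop
  have hm' : ∀ t, deriv m t = (τ * α * Real.exp (α * t) - c) * m t := fun t => by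
    have h1 := ((((hasDerivAt_id t).const_mul α).exp).const_mul τ).exp
    have h2 := ((hasDerivAt_id t).const_mul (-c)).exp
    have h3 := h1.mul h2
    simp only [id, mul_one] at h3
    rw [hm]
    refine h3.deriv.trans ?_
    ring
  have e0 := heq _ (hξ.radial_mul hms)
  set g : Eu n → ℝ := fun x => inner ℝ (P x) (sgrad ξ x)
    - radial k₁ x * v x * inner ℝ (sgrad ξ x) (rdir x)
    + radial k₂ x * inner ℝ (P x) (rdir x) * ξ x - radial k₃ x * v x * ξ x with hg
  have e1 : ∫ x, x (Fin.last n) ^ a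
      * inner ℝ (gradient (fun x => radial m x * ξ x) x) (G x) ∂(halfMeasure n) = ∫ x, g x ∂ν := by
    rw [integral_invMeasure]
    apply integral_congr_ae
    filter_upwards [ae_mem_upperHalf, ae_invMeasure_iff.1 hsh] with x hx hs
    have hx0 := ne_zero_of_mem_upperHalf hx
    have hr := norm_pos_iff.2 hx0
    have hy : 0 < x (Fin.last n) := hx
    have hY : (x (Fin.last n) ^ (a / 2)) ^ 2 = x (Fin.last n) ^ a := by
      rw [← Real.rpow_natCast, ← Real.rpow_mul hy.le]; congr 1; push_cast; ring
    by_cases ht : Real.log ‖x‖ ∈ Set.Icc 0 T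
    · have c1 := (hχ1 _ ht).eq_of_nhds
      have q1 : radial k₁ x = τ * α * rexp α x + c := by
        simp only [radial, hk₁, c1, one_mul, rexp]
      have q2 : radial k₂ x = τ * α * rexp α x - c := by
        simp only [radial, hk₂, c1, one_mul, rexp]
      have q3 : radial k₃ x = (τ * α * rexp α x + c) * (τ * α * rexp α x - c) := by
        have : rexp (2 * α) x = rexp α x ^ 2 := by rw [pow_two, rexp_mul]; congr 1; ring
        have q : radial k₃ x = τ ^ 2 * α ^ 2 * rexp (2 * α) x - c ^ 2 := by
          simp only [radial, hk₃, c1, one_mul, rexp]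
        rw [q, this]; ring
      have g1 : gradient (fun x => radial m x * ξ x) x
          = ‖x‖⁻¹ • (radial m x • sgrad ξ x + (radial (deriv m) x * ξ x) • rdir x) := by
        rw [← sgrad_radial_mul (hms.differentiable (by simp)) hξ.differentiable, sgrad, smul_smul,
          inv_mul_cancel₀ hr.ne', one_smul]
      have q4 : radial (deriv m) x = (τ * α * rexp α x - c) * radial m x := hm' _
      have q5 : radial m x = Real.exp (τ * rexp α x) * (rexp c x)⁻¹ := by
        rw [rexp, rexp, ← Real.exp_neg, ← neg_mul]; rfl
      have hρ := rexp_pos c x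
      have q6 : inner ℝ (rdir x) (rdir x) = (1 : ℝ) := by
        rw [real_inner_self_eq_norm_sq, norm_rdir hx0, one_pow]
      simp only [hg, smul_eq_mul]
      rw [g1, q1, q2, q3, q4, q5, hP, coneWeight_eq hx, ← hc, ← hY]
      simp only [inner_add_left, real_inner_smul_left, q6, real_inner_comm (G x) (sgrad ξ x),
        real_inner_comm (G x) (rdir x), real_inner_comm (rdir x) (sgrad ξ x)]
      field_simp
      ring
    · obtain ⟨hu, hG⟩ := hs ht
      have hv0 : v x = 0 := by rw [hv, hu, mul_zero]
      have hP0 : P x = 0 := by rw [hP, hv0, hG]; simp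
      simp [hg, hG, hv0, hP0]
  have e2 : ∫ x, radial m x * ξ x * f x ∂(halfMeasure n) = ∫ x, H x * ξ x ∂ν := by
    rw [integral_invMeasure]
    apply integral_congr_ae
    filter_upwards [ae_mem_upperHalf] with x hx
    have hx0 := ne_zero_of_mem_upperHalf hx
    have hr := norm_pos_iff.2 hx0
    have hy : 0 < x (Fin.last n) := hx
    have hY : 0 < x (Fin.last n) ^ (a / 2) := Real.rpow_pos_of_pos hy _
    have q5 : radial m x = Real.exp (τ * rexp α x) * (rexp c x)⁻¹ := by
      rw [rexp, rexp, ← Real.exp_neg, ← neg_mul]; rfl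
    have hρ := rexp_pos c x
    rw [q5, hH, coneWeight_eq hx, ← hc, smul_eq_mul]
    field_simp
  have e3 : ∫ x', radial m (bdryPt x') * ξ (bdryPt x') * h x'
      = ∫ x', Real.exp (τ * rexp α (bdryPt x')) * rexp (-c) (bdryPt x') * h x' * ξ (bdryPt x') := by
    congr 1
    ext x'
    exact mul_right_comm _ _ _
  have hξ2 := hξ.memLp ha 2
  have mD := MemLp.inner_rdir hvP.memLp_grad
  have i1 := MemLp.integrable_inner_real hvP.memLp_grad (hξ.memLp_sgrad ha 2)
  have i2 := MemLp.integrable_mul_real (MemLp.radial_mul hvP.memLp s₁.continuous b₁)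
    (MemLp.inner_rdir (hξ.memLp_sgrad ha 2))
  have i3 := MemLp.integrable_mul_real (MemLp.radial_mul mD s₂.continuous b₂) hξ2
  have i4 := MemLp.integrable_mul_real (MemLp.radial_mul hvP.memLp s₃.continuous b₃) hξ2
  have i5 := MemLp.integrable_mul_real ((MemLp.radial_mul hvP.memLp s₁' b₁').add
    (MemLp.radial_mul mD s₁.continuous b₁)) hξ2
  have i6 := MemLp.integrable_mul_real hHL hξ2
  have e4 : ∫ x, g x ∂ν = ∫ x, inner ℝ (P x) (sgrad ξ x) ∂ν
      - ∫ x, radial k₁ x * v x * inner ℝ (sgrad ξ x) (rdir x) ∂ν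
      + ∫ x, radial k₂ x * inner ℝ (P x) (rdir x) * ξ x ∂ν
      - ∫ x, radial k₃ x * v x * ξ x ∂ν := by
    refine Eq.trans ?_ ((integral_lincomb₅ i1 i2 i3 i4 i4 1 (-1) 1 (-1) 0).trans (by ring))
    congr 1
    ext x
    simp only [hg]
    ring
  -- Moving the radial derivative from ξ onto k₁v produces the sum k₁ + k₂ in front of the radial
  -- derivative of v. There c cancels, leaving 2τα e^{αt}, and k₁' gives τα² e^{αt}.
  have e5 := hvP.integral_radial_mul_euler ha s₁ hχc.mul_right hξ
  have e6 : ∫ x, -((c ^ 2 - τ ^ 2 * α ^ 2 * rexp (2 * α) x) * v x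
          + 2 * τ * α * rexp α x * inner ℝ (P x) (rdir x) + τ * α ^ 2 * rexp α x * v x + H x) * ξ x ∂ν
      = -∫ x, (radial (deriv k₁) x * v x + radial k₁ x * inner ℝ (P x) (rdir x)) * ξ x ∂ν
        - ∫ x, radial k₂ x * inner ℝ (P x) (rdir x) * ξ x ∂ν
        + ∫ x, radial k₃ x * v x * ξ x ∂ν - ∫ x, H x * ξ x ∂ν := by
    refine Eq.trans ?_ ((integral_lincomb₅ i5 i3 i4 i6 i6 (-1) (-1) 1 (-1) 0).trans ?_)
    · apply integral_congr_ae
      filter_upwards [hsh] with x hs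
      by_cases ht : Real.log ‖x‖ ∈ Set.Icc 0 T
      · have c1 := (hχ1 _ ht).eq_of_nhds
        have q1 : radial k₁ x = τ * α * rexp α x + c := by
          simp only [radial, hk₁, c1, one_mul, rexp]
        have q2 : radial k₂ x = τ * α * rexp α x - c := by
          simp only [radial, hk₂, c1, one_mul, rexp]
        have q3 : radial k₃ x = τ ^ 2 * α ^ 2 * rexp (2 * α) x - c ^ 2 := by
          simp only [radial, hk₃, c1, one_mul, rexp]
        have q4 : radial (deriv k₁) x = τ * α ^ 2 * rexp α x := hk₁' _ ht
        simp only [Pi.add_apply]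
        rw [q1, q2, q3, q4]
        ring
      · obtain ⟨hu, hG⟩ := hs ht
        have hv0 : v x = 0 := by rw [hv, hu, mul_zero]
        have hP0 : P x = 0 := by rw [hP, hv0, hG]; simp
        simp [hv0, hP0]
    · simp only [Pi.add_apply]
      ring
  rw [e1, e2, e3, e4] at e0
  rw [e5] at e0
  rw [e6]
  linarith

end RealCarleman

/-! ### The estimate for real solutions -/

section RealCarlemanEstimate

open Filter Topology

variable {n : ℕ} {a : ℝ}

/-- The Carleman estimate for real solutions supported in an annulus. -/
theorem real_carleman (ha : -1 < a) (ha' : a < 1) {α : ℝ} (hα : 1 ≤ α) :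
    ∃ C : ℝ, 0 < C ∧ ∀ τ R : ℝ, Real.exp α ≤ τ → 1 ≤ R → ∀ (u f : Eu n → ℝ) (G : Eu n → Eu n)
      (h : EuclideanSpace ℝ (Fin n) → ℝ),
      MemLp (fun x => (x (Fin.last n) ^ (a / 2)) • u x) 2 (halfMeasure n) →
      MemLp (fun x => (x (Fin.last n) ^ (a / 2)) • G x) 2 (halfMeasure n) →
      (∀ᵐ x ∂(halfMeasure n), u x ≠ 0 → x ∈ annulus n 1 R) →
      (∀ᵐ x ∂(halfMeasure n), G x ≠ 0 → x ∈ annulus n 1 R) →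
      IsRealWeakGradient u G →
      MemLp (fun x => Real.exp (τ * rexp α x) * (x (Fin.last n) ^ (a / 2))⁻¹ * ‖x‖ * f x) 2
        (halfMeasure n) →
      MemLp (fun x' => Real.exp (τ * rexp α (bdryPt x'))
        * rexp (α * (1 - (1 - a) / 2) + (1 - a) / 2) (bdryPt x') * h x') 2 volume →
      (∀ᵐ x', h x' ≠ 0 → Real.log ‖x'‖ ∈ Set.Icc 0 (Real.log R)) →
      (∀ η : Eu n → ℝ, IsTest η →
        ∫ x, x (Fin.last n) ^ a * inner ℝ (gradient η x) (G x) ∂(halfMeasure n)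
          = -(∫ x, η x * f x ∂(halfMeasure n)) - ∫ x', η (bdryPt x') * h x') →
      τ ^ 3 * ∫ x, (Real.exp (τ * rexp α x) * rexp (3 * α / 2 - 1) x
            * x (Fin.last n) ^ (a / 2) * u x) ^ 2 ∂(halfMeasure n)
          + τ * ∫ x, (Real.exp (τ * rexp α x) * rexp (α / 2) x
            * x (Fin.last n) ^ (a / 2) * ‖G x‖) ^ 2 ∂(halfMeasure n)
        ≤ C * (∫ x, (Real.exp (τ * rexp α x) * (x (Fin.last n) ^ (a / 2))⁻¹ * ‖x‖ * f x) ^ 2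
            ∂(halfMeasure n) + τ ^ (2 - (1 - a)) * ∫ x', (Real.exp (τ * rexp α (bdryPt x'))
            * rexp (α * (1 - (1 - a) / 2) + (1 - a) / 2) (bdryPt x') * h x') ^ 2) := by
  set c : ℝ := (n - 1 + a) / 2 with hc
  obtain ⟨C, hC, key⟩ := flux_carleman (n := n) ha ha' hα c
  refine ⟨(2 + 2 * (α + |c|) ^ 2) * C, by positivity,
    fun τ R hτ hR u f G h hu hG hus hGs hw hf hh hhs heq => ?_⟩
  have hα0 : 0 ≤ α := by linarith
  have hτ1 : 1 ≤ τ := (Real.one_le_exp hα0).trans hτ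
  set T := Real.log R with hT
  have hT0 : 0 ≤ T := Real.log_nonneg hR
  set ν := invMeasure n a with hν
  have hsh : ∀ᵐ x ∂ν, Real.log ‖x‖ ∉ Set.Icc 0 T → u x = 0 ∧ G x = 0 := by
    rw [hν, ae_invMeasure_iff]
    filter_upwards [hus, hGs] with x h1 h2 ht
    exact ⟨by by_contra h0; exact ht (log_norm_mem_of_mem_annulus (h1 h0)),
      by by_contra h0; exact ht (log_norm_mem_of_mem_annulus (h2 h0))⟩
  have huG := inEnergySpace_of_weakGradient ha ha' one_pos hu hG hus hGs hw
  obtain ⟨χ, hχ, hχc, -, hχ1⟩ := exists_cutoff_one 0 T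
  set k : ℝ → ℝ := fun t => Real.exp (τ * Real.exp (α * t)) * Real.exp (c * t) with hk
  have hks : ContDiff ℝ ∞ (fun t => χ t * k t) := by fun_prop
  obtain ⟨M, hM, hM', -⟩ := exists_bound_of_contDiff_compact hks hχc.mul_right
  set v : Eu n → ℝ := fun x => Real.exp (τ * rexp α x) * rexp c x * u x with hv
  set P : Eu n → Eu n := fun x => (Real.exp (τ * rexp α x) * rexp c x) • (‖x‖ • G x)
      + ((τ * α * rexp α x + c) * v x) • rdir x with hP
  set H : Eu n → ℝ := fun x => Real.exp (τ * rexp α x) * rexp c x * ‖x‖ ^ 2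
      * (x (Fin.last n) ^ (a / 2))⁻¹ ^ 2 * f x with hH
  have hk' : ∀ t ∈ Set.Icc 0 T, deriv (fun t => χ t * k t) t
      = (τ * α * Real.exp (α * t) + c) * k t := fun t ht => by
    have h4 : (fun t => χ t * k t) =ᶠ[𝓝 t] k := by
      filter_upwards [hχ1 t ht] with s hs
      rw [hs, one_mul]
    have h1 := ((((hasDerivAt_id t).const_mul α).exp).const_mul τ).exp
    have h2 := ((hasDerivAt_id t).const_mul c).exp
    have h3 := h1.mul h2
    simp only [id, mul_one] at h3
    rw [h4.deriv_eq]
    refine h3.deriv.trans ?_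
    ring
  have hvP : InEnergySpace a v P := by
    refine (huG.radial_mul ha hks hM hM').congr ?_ ?_
    · filter_upwards [hsh] with x hs
      by_cases ht : Real.log ‖x‖ ∈ Set.Icc 0 T
      · have c1 := (hχ1 _ ht).eq_of_nhds
        simp only [radial, c1, one_mul, hk, hv, rexp]
      · simp [hv, (hs ht).1]
    · filter_upwards [hsh] with x hs
      by_cases ht : Real.log ‖x‖ ∈ Set.Icc 0 T
      · have c1 := (hχ1 _ ht).eq_of_nhds
        have q : radial (deriv fun t => χ t * k t) x
            = (τ * α * rexp α x + c) * k (Real.log ‖x‖) := hk' _ ht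
        rw [q]
        simp only [radial, c1, one_mul, hk, hv, hP, rexp]
        rw [mul_assoc (τ * α * Real.exp (α * Real.log ‖x‖) + c)]
      · simp [hv, hP, (hs ht).1, (hs ht).2]
  have hsv : SupportedInShell n a 0 T v := by
    filter_upwards [hsh] with x hs h0
    by_contra ht
    exact h0 (by simp [hv, (hs ht).1])
  have hsP : SupportedInShell n a 0 T P := by
    filter_upwards [hsh] with x hs h0
    by_contra ht
    exact h0 (by simp [hv, hP, (hs ht).1, (hs ht).2])
  have hHpt : ∀ᵐ x ∂(halfMeasure n), √(coneWeight n a x) * H x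
      = Real.exp (τ * rexp α x) * (x (Fin.last n) ^ (a / 2))⁻¹ * ‖x‖ * f x := by
    filter_upwards [ae_mem_upperHalf] with x hx
    have hr := norm_pos_iff.2 (ne_zero_of_mem_upperHalf hx)
    have hy : 0 < x (Fin.last n) := hx
    have hY : 0 < x (Fin.last n) ^ (a / 2) := Real.rpow_pos_of_pos hy _
    have hρ := rexp_pos c x
    rw [coneWeight_eq hx, ← hc, Real.sqrt_sq (by positivity)]
    simp only [hH]
    field_simp
  have hHL : MemLp H 2 ν := by
    rw [hν, memLp_invMeasure_iff]
    exact (memLp_congr_ae hHpt).2 hf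
  have hHI : ∫ x, H x ^ 2 ∂ν = ∫ x, (Real.exp (τ * rexp α x) * (x (Fin.last n) ^ (a / 2))⁻¹
      * ‖x‖ * f x) ^ 2 ∂(halfMeasure n) := by
    rw [hν, integral_invMeasure]
    apply integral_congr_ae
    filter_upwards [hHpt, ae_mem_upperHalf] with x hx hx'
    rw [← hx, mul_pow (√(coneWeight n a x)), Real.sq_sqrt (coneWeight_pos hx').le, smul_eq_mul]
  -- The conjugated flux carries |x|^{-c}, and n/2 - c = (1-a)/2; with (1-a)/2 = s the exponent
  -- becomes α(1-s) + s = α + (1-α)s.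
  have hbpt : ∀ x' : EuclideanSpace ℝ (Fin n), rexp (α * (1 - (1 - a) / 2) + n / 2) (bdryPt x')
      * (Real.exp (τ * rexp α (bdryPt x')) * rexp (-c) (bdryPt x') * h x')
      = Real.exp (τ * rexp α (bdryPt x'))
        * rexp (α * (1 - (1 - a) / 2) + (1 - a) / 2) (bdryPt x') * h x' := by
    intro x'
    have : rexp (α * (1 - (1 - a) / 2) + (1 - a) / 2) (bdryPt x')
        = rexp (α * (1 - (1 - a) / 2) + n / 2) (bdryPt x') * rexp (-c) (bdryPt x') := by
      rw [rexp_mul]; congr 1; rw [hc]; ring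
    rw [this]; ring
  have hfin := key τ T hτ hT0 v P H
    (fun x' => Real.exp (τ * rexp α (bdryPt x')) * rexp (-c) (bdryPt x') * h x') hvP hsv hsP hHL
    (by simpa only [hbpt] using hh)
    (by
      filter_upwards [hhs] with x' hx' h0
      exact hx' (right_ne_zero_of_mul h0))
    (fun ξ hξ => conjugated_equation ha hsh heq hc (fun _ => rfl) (fun _ => rfl) (fun _ => rfl)
      hvP hHL hξ)
  simp only [hbpt, hHI] at hfin
  set N := ∫ x, (Real.exp (τ * rexp α x) * (x (Fin.last n) ^ (a / 2))⁻¹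
      * ‖x‖ * f x) ^ 2 ∂(halfMeasure n) + τ ^ (2 - (1 - a)) * ∫ x', (Real.exp (τ * rexp α (bdryPt x'))
      * rexp (α * (1 - (1 - a) / 2) + (1 - a) / 2) (bdryPt x') * h x') ^ 2 with hN
  have iv := hsv.integrable_rexp_mul_sq hvP.memLp (3 * α)
  simp only [Real.norm_eq_abs, sq_abs] at iv
  have iP := hsP.integrable_rexp_mul_sq hvP.memLp_grad α
  set V := ∫ x, rexp (3 * α) x * v x ^ 2 ∂ν with hV
  set J := ∫ x, rexp α x * ‖P x‖ ^ 2 ∂ν with hJ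
  have hV0 : 0 ≤ V := integral_nonneg fun x => mul_nonneg (rexp_pos _ _).le (sq_nonneg _)
  have hJ0 : 0 ≤ J := integral_nonneg fun x => mul_nonneg (rexp_pos _ _).le (sq_nonneg _)
  have l1 : ∫ x, (Real.exp (τ * rexp α x) * rexp (3 * α / 2 - 1) x
            * x (Fin.last n) ^ (a / 2) * u x) ^ 2 ∂(halfMeasure n) = V := by
    rw [hV, hν, integral_invMeasure]
    apply integral_congr_ae
    filter_upwards [ae_mem_upperHalf] with x hx
    have hr := norm_pos_iff.2 (ne_zero_of_mem_upperHalf hx)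
    have hρ := rexp_pos c x
    have e1 : rexp (3 * α) x = (rexp (3 * α / 2 - 1) x * ‖x‖) ^ 2 := by
      have h3 : rexp (3 * α / 2 - 1) x * ‖x‖ = rexp (3 * α / 2) x := by
        rw [norm_eq_rexp (ne_zero_of_mem_upperHalf hx), rexp_mul, sub_add_cancel]
      rw [h3, pow_two, rexp_mul]; congr 1; ring
    rw [coneWeight_eq hx, ← hc, e1, smul_eq_mul]
    simp only [hv]
    field_simp
  have l2 : ∫ x, (Real.exp (τ * rexp α x) * rexp (α / 2) x
            * x (Fin.last n) ^ (a / 2) * ‖G x‖) ^ 2 ∂(halfMeasure n)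
      = ∫ x, rexp α x * ‖(Real.exp (τ * rexp α x) * rexp c x) • (‖x‖ • G x)‖ ^ 2 ∂ν := by
    rw [hν, integral_invMeasure]
    apply integral_congr_ae
    filter_upwards [ae_mem_upperHalf] with x hx
    have hr := norm_pos_iff.2 (ne_zero_of_mem_upperHalf hx)
    have hρ := rexp_pos c x
    have e1 : rexp α x = (rexp (α / 2) x) ^ 2 := by
      rw [pow_two, rexp_mul, add_halves]
    have e2 : ‖(Real.exp (τ * rexp α x) * rexp c x) • (‖x‖ • G x)‖
        = Real.exp (τ * rexp α x) * rexp c x * (‖x‖ * ‖G x‖) := by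
      rw [norm_smul, norm_smul, norm_norm, Real.norm_of_nonneg (by positivity)]
    rw [coneWeight_eq hx, ← hc, e2, smul_eq_mul]
    have e3 : (Real.exp (τ * rexp α x) * rexp (α / 2) x * x (Fin.last n) ^ (a / 2) * ‖G x‖) ^ 2
        = rexp α x * (Real.exp (τ * rexp α x) * x (Fin.last n) ^ (a / 2) * ‖G x‖) ^ 2 := by
      linear_combination
        -(Real.exp (τ * rexp α x) * x (Fin.last n) ^ (a / 2) * ‖G x‖) ^ 2 * e1
    rw [e3]
    field_simp
  -- Undoing the conjugation of the gradient costs (τα e^{αt} + c)v. Since τ e^{αt} ≥ 1 on the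
  -- shell, this is at most (α + |c|)τ e^{αt}|v|, whose weighted square goes into the zeroth order
  -- term.
  have l3 : ∫ x, rexp α x * ‖(Real.exp (τ * rexp α x) * rexp c x) • (‖x‖ • G x)‖ ^ 2 ∂ν
      ≤ 2 * J + 2 * (α + |c|) ^ 2 * τ ^ 2 * V := by
    rw [hJ, hV, ← integral_const_mul, ← integral_const_mul,
      ← integral_add (iP.const_mul _) (iv.const_mul _)]
    refine integral_mono_of_nonneg (Eventually.of_forall fun x =>
      mul_nonneg (rexp_pos _ _).le (sq_nonneg _)) ((iP.const_mul _).add (iv.const_mul _)) ?_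
    filter_upwards [hsh] with x hs
    by_cases ht : Real.log ‖x‖ ∈ Set.Icc 0 T
    · have he : 1 ≤ rexp α x := Real.one_le_exp (mul_nonneg hα0 ht.1)
      have e3 : rexp (3 * α) x = rexp α x * rexp α x ^ 2 := by
        rw [pow_two, rexp_mul, rexp_mul]; congr 1; ring
      have b1 : ‖(Real.exp (τ * rexp α x) * rexp c x) • (‖x‖ • G x)‖
          ≤ ‖P x‖ + (α + |c|) * τ * rexp α x * |v x| := by
        have e4 : (Real.exp (τ * rexp α x) * rexp c x) • (‖x‖ • G x)
            = P x - ((τ * α * rexp α x + c) * v x) • rdir x := by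
          simp only [hP, add_sub_cancel_right]
        rw [e4]
        refine (norm_sub_le _ _).trans (add_le_add le_rfl ?_)
        rw [norm_smul, norm_mul]
        refine (mul_le_of_le_one_right (by positivity) (norm_rdir_le x)).trans ?_
        refine mul_le_mul_of_nonneg_right ?_ (abs_nonneg _)
        refine (abs_add_le _ _).trans ?_
        rw [abs_of_nonneg (by positivity)]
        have : |c| ≤ |c| * (τ * rexp α x) := le_mul_of_one_le_right (abs_nonneg _)
          (one_le_mul_of_one_le_of_one_le hτ1 he)
        linarith
      have b2 := pow_le_pow_left₀ (norm_nonneg _) b1 2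
      have b3 : (‖P x‖ + (α + |c|) * τ * rexp α x * |v x|) ^ 2
          ≤ 2 * ‖P x‖ ^ 2 + 2 * ((α + |c|) * τ * rexp α x * |v x|) ^ 2 := by
        nlinarith [sq_nonneg (‖P x‖ - (α + |c|) * τ * rexp α x * |v x|)]
      have b4 := mul_le_mul_of_nonneg_left (b2.trans b3) (rexp_pos α x).le
      refine b4.trans (le_of_eq ?_)
      rw [e3, mul_pow _ |v x|, sq_abs]
      ring
    · rw [(hs ht).2]
      simp only [smul_zero, norm_zero, ne_eq, OfNat.ofNat_ne_zero, not_false_eq_true, zero_pow,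
        mul_zero]
      have := rexp_pos α x
      have := rexp_pos (3 * α) x
      positivity
  rw [l1, l2]
  have hτ0 : 0 < τ := by linarith
  have l4 := mul_le_mul_of_nonneg_left l3 hτ0.le
  have q1 : 0 ≤ τ * J := by positivity
  have q2 : 0 ≤ τ ^ 3 * V := by positivity
  have q3 : 0 ≤ 2 * (α + |c|) ^ 2 * (τ * J) := by positivity
  calc _ ≤ (2 + 2 * (α + |c|) ^ 2) * (τ ^ 3 * V + τ * J) := by linarith
    _ ≤ (2 + 2 * (α + |c|) ^ 2) * (C * N) := mul_le_mul_of_nonneg_left hfin (by positivity)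
    _ = _ := by ring

end RealCarlemanEstimate

/-! ### Local integrability, and supports of weak gradient and trace -/

section Reduction

open Filter Topology

variable {n : ℕ} {a : ℝ}

/-- Hölder's inequality with x_{n+1}^{-a/2}, which is square integrable on half-balls because a < 1.
-/
theorem integrableOn_of_memLp_weight (ha' : a < 1) {F : Type*} [NormedAddCommGroup F]
    [NormedSpace ℝ F] {f : Eu n → F}
    (hf : MemLp (fun x => (x (Fin.last n) ^ (a / 2)) • f x) 2 (halfMeasure n)) (ρ : ℝ) :
    IntegrableOn f (upperHalf n ∩ Metric.closedBall 0 ρ) := by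
  set S := upperHalf n ∩ Metric.closedBall (0 : Eu n) ρ with hS
  have hSm : MeasurableSet S := measurableSet_upperHalf.inter measurableSet_closedBall
  have h1 : MemLp (fun x => (x (Fin.last n) ^ (a / 2)) • f x) 2 (volume.restrict S) :=
    hf.mono_measure (Measure.restrict_mono Set.inter_subset_left le_rfl)
  have h2 : MemLp (fun x : Eu n => x (Fin.last n) ^ (-a / 2)) 2 (volume.restrict S) := by
    rw [memLp_two_iff_integrable_sq (measurable_last.pow_const _).aestronglyMeasurable]
    refine (integrableOn_rpow_last (n := n) (b := -a) (by linarith) ρ).congr ?_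
    filter_upwards [ae_restrict_mem hSm] with x hx
    have hy : 0 < x (Fin.last n) := hx.1
    rw [← Real.rpow_natCast, ← Real.rpow_mul hy.le]
    congr 1; push_cast; ring
  have h3 := memLp_one_iff_integrable.1 (h1.smul h2 (r := 1))
  refine h3.congr ?_
  filter_upwards [ae_restrict_mem hSm] with x hx
  have hy : 0 < x (Fin.last n) := hx.1
  simp only [Pi.smul_apply']
  rw [smul_smul, ← Real.rpow_add hy, neg_div, neg_add_cancel, Real.rpow_zero, one_smul]

theorem integrable_smul_of_memLp_weight (ha' : a < 1) {F : Type*} [NormedAddCommGroup F]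
    [NormedSpace ℝ F] {f : Eu n → F}
    (hf : MemLp (fun x => (x (Fin.last n) ^ (a / 2)) • f x) 2 (halfMeasure n)) {φ : Eu n → ℝ}
    (hφ : Continuous φ) (hc : HasCompactSupport φ) :
    Integrable (fun x => φ x • f x) (halfMeasure n) := by
  obtain ⟨ρ, hρ⟩ := hc.isCompact.isBounded.subset_closedBall 0
  obtain ⟨M, hM⟩ := hc.exists_bound_of_continuous hφ
  have h1 : IntegrableOn (fun x => φ x • f x) (upperHalf n ∩ Metric.closedBall 0 ρ) :=
    (integrableOn_of_memLp_weight ha' hf ρ).bdd_smul M hφ.aestronglyMeasurable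
      (Eventually.of_forall hM)
  refine h1.of_forall_sdiff_eq_zero measurableSet_upperHalf fun x hx => ?_
  have : φ x = 0 := image_eq_zero_of_notMem_tsupport fun h => hx.2 ⟨hx.1, hρ h⟩
  rw [this, zero_smul]

theorem isOpen_compl_annulus (r₁ r₂ : ℝ) : IsOpen (annulus n r₁ r₂)ᶜ :=
  ((isClosed_le continuous_const continuous_norm).inter
    (isClosed_le continuous_norm continuous_const)).isOpen_compl

theorem continuous_pderiv {m : ℕ} {η : EuclideanSpace ℝ (Fin m) → ℝ} (h : ContDiff ℝ ∞ η)
    (i : Fin m) : Continuous (pderiv i η) :=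
  (h.continuous_fderiv (by simp)).clm_apply continuous_const

theorem hasCompactSupport_pderiv {m : ℕ} {η : EuclideanSpace ℝ (Fin m) → ℝ}
    (h : HasCompactSupport η) (i : Fin m) : HasCompactSupport (pderiv i η) :=
  (h.fderiv ℝ).mono fun x hx h0 => hx (by simp [pderiv, h0])

theorem pderiv_eq_zero_of_notMem {m : ℕ} {η : EuclideanSpace ℝ (Fin m) → ℝ}
    {x : EuclideanSpace ℝ (Fin m)} (hx : x ∉ tsupport η) (i : Fin m) : pderiv i η x = 0 := by
  have : fderiv ℝ η x = 0 := by
    by_contra h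
    exact hx (support_fderiv_subset ℝ h)
  simp [pderiv, this]

/-- A weak gradient vanishes outside a closed annulus that carries the function. -/
theorem IsWeakGradient.ae_eq_zero (ha' : a < 1) {u : Eu n → ℂ}
    {G : Eu n → EuclideanSpace ℂ (Fin (n + 1))} (hw : IsWeakGradient u G)
    (hG : MemLp (fun x => (x (Fin.last n) ^ (a / 2)) • G x) 2 (halfMeasure n)) {r₁ r₂ : ℝ}
    (hu0 : ∀ᵐ x ∂(halfMeasure n), u x ≠ 0 → x ∈ annulus n r₁ r₂) :
    ∀ᵐ x ∂(halfMeasure n), G x ≠ 0 → x ∈ annulus n r₁ r₂ := by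
  have hU : IsOpen (upperHalf n ∩ (annulus n r₁ r₂)ᶜ) :=
    isOpen_upperHalf.inter (isOpen_compl_annulus _ _)
  -- The fundamental lemma of the calculus of variations on the open part of the half-space outside
  -- the annulus: test functions supported there see u = 0.
  have key : ∀ i, ∀ᵐ x, x ∈ upperHalf n ∩ (annulus n r₁ r₂)ᶜ → G x i = 0 := by
    intro i
    refine hU.ae_eq_zero_of_integral_contDiff_smul_eq_zero ?_ fun η h1 h2 h3 => ?_
    · intro x hx
      refine ⟨_, inter_mem (mem_nhdsWithin_of_mem_nhds
        (isOpen_upperHalf.mem_nhds hx.1)) (mem_nhdsWithin_of_mem_nhds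
          (Metric.closedBall_mem_nhds_of_mem
            (show x ∈ Metric.ball (0 : Eu n) (‖x‖ + 1) by simp))), ?_⟩
      exact (PiLp.proj (𝕜 := ℝ) 2 (fun _ : Fin (n + 1) => ℂ) i).integrable_comp
        (integrableOn_of_memLp_weight ha' hG _)
    · have h4 := hw η h1 h2 (h3.trans Set.inter_subset_left) i
      have h5 : ∫ x, pderiv i η x • u x ∂(halfMeasure n) = 0 := by
        rw [← integral_zero]
        apply integral_congr_ae
        filter_upwards [hu0] with x hx
        by_cases h0 : u x = 0
        · rw [h0, smul_zero]
        · rw [pderiv_eq_zero_of_notMem (fun h => (h3 h).2 (hx h0)), zero_smul]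
      rw [h5, eq_comm, neg_eq_zero, halfMeasure, setIntegral_eq_integral_of_forall_compl_eq_zero] at h4
      · exact h4
      · intro x hx
        rw [image_eq_zero_of_notMem_tsupport fun h => hx (h3 h).1, zero_smul]
  have key' : ∀ᵐ x ∂(halfMeasure n), ∀ i, x ∈ upperHalf n ∩ (annulus n r₁ r₂)ᶜ → G x i = 0 :=
    ae_restrict_of_ae (ae_all_iff.2 key)
  filter_upwards [key', ae_mem_upperHalf] with x hx hx' h0
  by_contra h
  refine h0 ?_
  ext i
  exact hx i ⟨hx', h⟩

/-- The projection of `ℝ^{n+1}` onto `ℝⁿ`. -/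
def initPt {n : ℕ} (x : Eu n) : EuclideanSpace ℝ (Fin n) := WithLp.toLp 2 fun i => x i.castSucc

theorem contDiff_initPt : ContDiff ℝ ∞ (initPt (n := n)) :=
  contDiff_euclidean.2 fun i => by
    change ContDiff ℝ ∞ fun x : Eu n => x i.castSucc
    fun_prop

theorem initPt_bdryPt (x' : EuclideanSpace ℝ (Fin n)) : initPt (bdryPt x') = x' := by
  ext i; simp [initPt, bdryPt]

theorem norm_sq_eq_initPt (x : Eu n) : ‖x‖ ^ 2 = ‖initPt x‖ ^ 2 + x (Fin.last n) ^ 2 := by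
  rw [EuclideanSpace.norm_sq_eq, EuclideanSpace.norm_sq_eq, Fin.sum_univ_castSucc]
  simp [initPt]

theorem norm_sub_bdryPt_initPt (x : Eu n) : ‖x - bdryPt (initPt x)‖ = |x (Fin.last n)| := by
  have h := norm_sq_eq_initPt (x - bdryPt (initPt x))
  have h1 : initPt (x - bdryPt (initPt x)) = 0 := by
    ext i; simp [initPt, bdryPt]
  have h2 : (x - bdryPt (initPt x)) (Fin.last n) = x (Fin.last n) := by simp [bdryPt]
  rw [h1, h2, norm_zero, zero_pow two_ne_zero, zero_add, ← sq_abs (x (Fin.last n))] at h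
  exact (pow_left_inj₀ (norm_nonneg _) (abs_nonneg _) two_ne_zero).1 h

/-- The trace vanishes outside a closed annulus that carries the function and its gradient. -/
theorem IsTrace.ae_eq_zero {u : Eu n → ℂ} {G : Eu n → EuclideanSpace ℂ (Fin (n + 1))}
    {g : EuclideanSpace ℝ (Fin n) → ℂ} (h : IsTrace u G g) {r₁ r₂ : ℝ}
    (hu0 : ∀ᵐ x ∂(halfMeasure n), u x ≠ 0 → x ∈ annulus n r₁ r₂)
    (hG0 : ∀ᵐ x ∂(halfMeasure n), G x ≠ 0 → x ∈ annulus n r₁ r₂) :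
    ∀ᵐ x', g x' ≠ 0 → r₁ ≤ ‖x'‖ ∧ ‖x'‖ ≤ r₂ := by
  have hU : IsOpen (bdryPt (n := n) ⁻¹' (annulus n r₁ r₂)ᶜ) :=
    (isOpen_compl_annulus _ _).preimage continuous_bdryPt
  have key := hU.ae_eq_zero_of_integral_contDiff_smul_eq_zero (h.locallyIntegrable.locallyIntegrableOn _)
    fun η h1 h2 h3 => by
      -- A boundary test function supported off the annulus is extended as η(x') b(x_{n+1}) into a
      -- collar so thin that it stays off the annulus. In Green's formula the bulk term is then
      -- zero, and so is the boundary term.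
      obtain ⟨δ, hδ, hK⟩ := (h2.isCompact.image (continuous_bdryPt (n := n))).exists_cthickening_subset_open
        (isOpen_compl_annulus r₁ r₂) (Set.image_subset_iff.2 h3)
      let b : ContDiffBump (0 : ℝ) := ⟨δ / 2, δ, by positivity, by linarith⟩
      set ζ : Eu n → ℝ := fun x => η (initPt x) * b (x (Fin.last n)) with hζ
      have hlast : ContDiff ℝ ∞ fun x : Eu n => x (Fin.last n) := by fun_prop
      have z1 : ContDiff ℝ ∞ ζ := (h1.comp contDiff_initPt).mul (b.contDiff.comp hlast)
      have zs : ∀ x, ζ x ≠ 0 → initPt x ∈ tsupport η ∧ |x (Fin.last n)| < δ := fun x hx => by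
        refine ⟨subset_tsupport _ (left_ne_zero_of_mul hx), ?_⟩
        have : x (Fin.last n) ∈ Function.support b := right_ne_zero_of_mul hx
        rw [b.support_eq, mem_ball_zero_iff] at this
        exact this
      obtain ⟨ρ, hρ⟩ := h2.isCompact.isBounded.subset_closedBall 0
      have z2 : HasCompactSupport ζ := by
        refine HasCompactSupport.of_support_subset_isCompact
          (isCompact_closedBall (0 : Eu n) (|ρ| + δ)) fun x hx => ?_
        obtain ⟨m1, m2⟩ := zs x hx
        have m3 : ‖initPt x‖ ≤ ρ := by simpa using hρ m1
        have m4 := norm_sub_bdryPt_initPt x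
        have m5 : ‖x‖ ≤ ‖bdryPt (initPt x)‖ + ‖x - bdryPt (initPt x)‖ := by
          simpa using norm_add_le (bdryPt (initPt x)) (x - bdryPt (initPt x))
        rw [norm_bdryPt] at m5
        rw [mem_closedBall_zero_iff]
        linarith [le_abs_self ρ]
      have z3 : tsupport ζ ⊆ (annulus n r₁ r₂)ᶜ := by
        refine (closure_minimal (fun x hx => ?_) Metric.isClosed_cthickening).trans hK
        obtain ⟨m1, m2⟩ := zs x hx
        refine Metric.mem_cthickening_of_dist_le x (bdryPt (initPt x)) δ _
          (Set.mem_image_of_mem _ m1) ?_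
        rw [dist_eq_norm, norm_sub_bdryPt_initPt]
        exact m2.le
      have h4 := h.green ζ z1 z2
      have h5 : ∫ x, (ζ x • G x (Fin.last n) + pderiv (Fin.last n) ζ x • u x) ∂(halfMeasure n) = 0 := by
        rw [← integral_zero]
        apply integral_congr_ae
        filter_upwards [hu0, hG0] with x hx hx'
        by_cases hA : x ∈ annulus n r₁ r₂
        · have hn : x ∉ tsupport ζ := fun h => z3 h hA
          rw [image_eq_zero_of_notMem_tsupport hn, pderiv_eq_zero_of_notMem hn, zero_smul,
            zero_smul, add_zero]
        · have e1 : u x = 0 := by by_contra h0; exact hA (hx h0)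
          have e2 : G x = 0 := by by_contra h0; exact hA (hx' h0)
          rw [e1, e2, smul_zero, add_zero]
          exact smul_zero _
      rw [h5, eq_comm, neg_eq_zero] at h4
      rw [← h4]
      congr 1
      ext x'
      have e1 : b ((bdryPt x') (Fin.last n)) = 1 := by
        have : (bdryPt x') (Fin.last n) = 0 := by simp [bdryPt]
        rw [this]
        exact b.one_of_mem_closedBall (Metric.mem_closedBall_self (by positivity))
      simp only [hζ, initPt_bdryPt, e1, mul_one]
  filter_upwards [key] with x' hx' h0
  by_contra hA
  refine h0 (hx' fun hx => hA ?_)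
  rw [← norm_bdryPt]
  exact hx

end Reduction

/-! ### Real and imaginary parts, and the estimate for complex solutions -/

section ComplexCarleman

open Filter Topology

variable {n : ℕ} {a : ℝ}

/-- A real linear functional on `ℂ`, applied to the coordinates of a vector. -/
noncomputable def mapEu (L : ℂ →L[ℝ] ℝ) (z : EuclideanSpace ℂ (Fin (n + 1))) : Eu n :=
  WithLp.toLp 2 fun i => L (z i)

theorem continuous_mapEu (L : ℂ →L[ℝ] ℝ) : Continuous (mapEu (n := n) L) :=
  (PiLp.continuous_toLp 2 _).comp (continuous_pi fun i =>
    L.continuous.comp (PiLp.continuous_apply 2 _ i))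

theorem mapEu_smul (L : ℂ →L[ℝ] ℝ) (c : ℝ) (z : EuclideanSpace ℂ (Fin (n + 1))) :
    mapEu L (c • z) = c • mapEu L z := by
  ext i
  change L (c • z i) = c * L (z i)
  rw [map_smul, smul_eq_mul]

theorem norm_mapEu_le {L : ℂ →L[ℝ] ℝ} (hL : ∀ z, |L z| ≤ ‖z‖)
    (z : EuclideanSpace ℂ (Fin (n + 1))) : ‖mapEu L z‖ ≤ ‖z‖ := by
  rw [EuclideanSpace.norm_eq, EuclideanSpace.norm_eq]
  refine Real.sqrt_le_sqrt (Finset.sum_le_sum fun i _ => ?_)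
  exact pow_le_pow_left₀ (norm_nonneg _) (hL (z i)) 2

theorem norm_sq_eq_mapEu (z : EuclideanSpace ℂ (Fin (n + 1))) :
    ‖z‖ ^ 2 = ‖mapEu Complex.reCLM z‖ ^ 2 + ‖mapEu Complex.imCLM z‖ ^ 2 := by
  rw [EuclideanSpace.norm_sq_eq, EuclideanSpace.norm_sq_eq, EuclideanSpace.norm_sq_eq,
    ← Finset.sum_add_distrib]
  refine Finset.sum_congr rfl fun i _ => ?_
  rw [Complex.sq_norm, Complex.normSq_apply]
  simp only [mapEu, Complex.reCLM_apply, Complex.imCLM_apply, Real.norm_eq_abs, sq_abs]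
  ring

theorem inner_gradient_mapEu (η : Eu n → ℝ) (x : Eu n) (L : ℂ →L[ℝ] ℝ)
    (z : EuclideanSpace ℂ (Fin (n + 1))) :
    inner ℝ (gradient η x) (mapEu L z) = L (∑ i, pderiv i η x • z i) := by
  have h : ∀ i, gradient η x i = pderiv i η x := fun i => by
    rw [pderiv, ← inner_gradient, EuclideanSpace.inner_single_right]
    simp
  rw [PiLp.inner_apply, map_sum]
  refine Finset.sum_congr rfl fun i _ => ?_
  rw [map_smul, h]
  simp only [mapEu, RCLike.inner_apply, conj_trivial, smul_eq_mul]
  ring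

theorem MemLp.clm_comp {X : Type*} [MeasurableSpace X] {μ : Measure X} {L : ℂ →L[ℝ] ℝ}
    (hL : ∀ z, |L z| ≤ ‖z‖) {f : X → ℂ} (hf : MemLp f 2 μ) : MemLp (fun x => L (f x)) 2 μ :=
  hf.of_le (L.continuous.comp_aestronglyMeasurable hf.1) (Eventually.of_forall fun x => hL (f x))

theorem MemLp.mapEu_comp {X : Type*} [MeasurableSpace X] {μ : Measure X} {L : ℂ →L[ℝ] ℝ}
    (hL : ∀ z, |L z| ≤ ‖z‖) {f : X → EuclideanSpace ℂ (Fin (n + 1))} (hf : MemLp f 2 μ) :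
    MemLp (fun x => mapEu L (f x)) 2 μ :=
  hf.of_le ((continuous_mapEu L).comp_aestronglyMeasurable hf.1)
    (Eventually.of_forall fun x => norm_mapEu_le hL (f x))

theorem abs_reCLM_le (z : ℂ) : |Complex.reCLM z| ≤ ‖z‖ := Complex.abs_re_le_norm z

theorem abs_imCLM_le (z : ℂ) : |Complex.imCLM z| ≤ ‖z‖ := Complex.abs_im_le_norm z

theorem integral_norm_sq_complex {X : Type*} [MeasurableSpace X] {μ : Measure X} {f : X → ℂ}
    (hf : MemLp f 2 μ) : ∫ x, ‖f x‖ ^ 2 ∂μ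
      = ∫ x, Complex.reCLM (f x) ^ 2 ∂μ + ∫ x, Complex.imCLM (f x) ^ 2 ∂μ := by
  rw [← integral_add (MemLp.clm_comp abs_reCLM_le hf).integrable_sq
    (MemLp.clm_comp abs_imCLM_le hf).integrable_sq]
  congr 1
  ext x
  rw [Complex.sq_norm, Complex.normSq_apply]
  simp only [Complex.reCLM_apply, Complex.imCLM_apply]
  ring

theorem integral_norm_sq_euclidean {X : Type*} [MeasurableSpace X] {μ : Measure X}
    {f : X → EuclideanSpace ℂ (Fin (n + 1))} (hf : MemLp f 2 μ) : ∫ x, ‖f x‖ ^ 2 ∂μ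
      = ∫ x, ‖mapEu Complex.reCLM (f x)‖ ^ 2 ∂μ + ∫ x, ‖mapEu Complex.imCLM (f x)‖ ^ 2 ∂μ := by
  rw [← integral_add (MemLp.mapEu_comp abs_reCLM_le hf).norm.integrable_sq
    (MemLp.mapEu_comp abs_imCLM_le hf).norm.integrable_sq]
  congr 1
  ext x
  exact norm_sq_eq_mapEu _

theorem eLpNorm_two_sq_eq_ofReal {X F : Type*} [MeasurableSpace X] {μ : Measure X}
    [NormedAddCommGroup F] {f : X → F} (hf : MemLp f 2 μ) :
    eLpNorm f 2 μ ^ 2 = ENNReal.ofReal (∫ x, ‖f x‖ ^ 2 ∂μ) := by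
  rw [eLpNorm_two_sq, ofReal_integral_eq_lintegral_ofReal hf.norm.integrable_sq
    (Eventually.of_forall fun x => sq_nonneg _)]
  congr 1
  ext x
  rw [ENNReal.ofReal_pow (norm_nonneg _), ofReal_norm]

theorem norm_rpow_eq_rexp {x : Eu n} (hx : x ≠ 0) (β : ℝ) : ‖x‖ ^ β = rexp β x := by
  rw [rexp, Real.rpow_def_of_pos (norm_pos_iff.2 hx), mul_comm]

/-- The Carleman weight is bounded on annuli. -/
theorem memLp_carleman_weight {F : Type*} [NormedAddCommGroup F] [NormedSpace ℝ F] {f : Eu n → F}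
    {R τ α : ℝ} (hτ : 0 ≤ τ) (hα : 0 ≤ α)
    (hf : MemLp (fun x => (x (Fin.last n) ^ (a / 2)) • f x) 2 (halfMeasure n))
    (hs : ∀ᵐ x ∂(halfMeasure n), f x ≠ 0 → x ∈ annulus n 1 R) (β : ℝ) :
    MemLp (fun x => (Real.exp (τ * ‖x‖ ^ α) * ‖x‖ ^ β * x (Fin.last n) ^ (a / 2)) • f x) 2
      (halfMeasure n) := by
  have hm : Measurable fun x : Eu n => Real.exp (τ * ‖x‖ ^ α) * ‖x‖ ^ β :=
    ((measurable_norm.pow_const α).const_mul τ).exp.mul (measurable_norm.pow_const β)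
  simp only [mul_smul _ (_ ^ (a / 2))]
  refine hf.of_le_mul (c := Real.exp (τ * R ^ α) * R ^ |β|) (hm.aestronglyMeasurable.smul hf.1) ?_
  filter_upwards [hs] with x hx
  by_cases h0 : f x = 0
  · simp [h0]
  · obtain ⟨h1, h2⟩ := hx h0
    rw [norm_smul, Real.norm_of_nonneg (by positivity)]
    refine mul_le_mul_of_nonneg_right ?_ (norm_nonneg _)
    have h3 : ‖x‖ ^ β ≤ R ^ |β| := (Real.rpow_le_rpow_of_exponent_le h1 (le_abs_self β)).trans
      (Real.rpow_le_rpow (by linarith) h2 (abs_nonneg β))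
    refine mul_le_mul (Real.exp_le_exp.2 (mul_le_mul_of_nonneg_left
      (Real.rpow_le_rpow (by linarith) h2 hα) hτ)) h3 (by positivity) (by positivity)

/-- The condition |x| > 1 is relaxed to the closed annulus, whose complement is open, so that the
support passes from u to its weak gradient and from both to the trace. -/
theorem IsAnnularSolution.grad_support {s R : ℝ} (hs0 : 0 < s) {u : Eu n → ℂ}
    {G : Eu n → EuclideanSpace ℂ (Fin (n + 1))} {g : EuclideanSpace ℝ (Fin n) → ℂ} {f : Eu n → ℂ}
    {V : EuclideanSpace ℝ (Fin n) → ℂ} (h : IsAnnularSolution s R u G g f V) :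
    (∀ᵐ x ∂(halfMeasure n), u x ≠ 0 → x ∈ annulus n 1 R) ∧
    (∀ᵐ x ∂(halfMeasure n), G x ≠ 0 → x ∈ annulus n 1 R) ∧
    ∀ᵐ x', V x' * g x' ≠ 0 → 1 ≤ ‖x'‖ ∧ ‖x'‖ ≤ R := by
  have h1 : ∀ᵐ x ∂(halfMeasure n), u x ≠ 0 → x ∈ annulus n 1 R := by
    filter_upwards [h.support] with x hx h0
    exact ⟨(hx h0).1.le, (hx h0).2⟩
  have h2 := h.weightedH1.weakGradient.ae_eq_zero (a := 1 - 2 * s) (by linarith)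
    h.weightedH1.memLp_grad h1
  refine ⟨h1, h2, ?_⟩
  filter_upwards [h.trace.ae_eq_zero h1 h2] with x' hx' h0
  exact hx' (right_ne_zero_of_mul h0)

/-- The real (or imaginary) part of the weak Neumann problem. -/
theorem IsAnnularSolution.real_equation {s R : ℝ} (hs1 : s < 1) {u : Eu n → ℂ}
    {G : Eu n → EuclideanSpace ℂ (Fin (n + 1))} {g : EuclideanSpace ℝ (Fin n) → ℂ} {f : Eu n → ℂ}
    {V : EuclideanSpace ℝ (Fin n) → ℂ} (h : IsAnnularSolution s R u G g f V) (L : ℂ →L[ℝ] ℝ)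
    {η : Eu n → ℝ} (h1 : ContDiff ℝ ∞ η) (h2 : HasCompactSupport η) :
    ∫ x, x (Fin.last n) ^ (1 - 2 * s) * inner ℝ (gradient η x) (mapEu L (G x)) ∂(halfMeasure n)
      = -(∫ x, η x * L (f x) ∂(halfMeasure n)) - ∫ x', η (bdryPt x') * L (V x' * g x') := by
  have e := congrArg L (h.equation η h1 h2)
  have hb : HasCompactSupport fun x' : EuclideanSpace ℝ (Fin n) => η (bdryPt x') := by
    obtain ⟨r, hr⟩ := h2.isCompact.isBounded.subset_closedBall 0
    refine HasCompactSupport.of_support_subset_isCompact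
      (isCompact_closedBall (0 : EuclideanSpace ℝ (Fin n)) r) fun x' hx' => ?_
    have := hr (subset_tsupport _ (show η (bdryPt x') ≠ 0 from hx'))
    simpa [norm_bdryPt] using this
  -- Commuting L with the integrals requires integrability. With a = 1 - 2s, the function x_{n+1}^a
  -- G is square integrable for the weight x_{n+1}^{-a}, and -a < 1 because s < 1.
  have i1 : Integrable (fun x => x (Fin.last n) ^ (1 - 2 * s) • ∑ i, pderiv i η x • G x i)
      (halfMeasure n) := by
    have hGi : ∀ i, Integrable (fun x => pderiv i η x • (x (Fin.last n) ^ (1 - 2 * s) • G x i))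
        (halfMeasure n) := fun i => by
      refine integrable_smul_of_memLp_weight (a := -(1 - 2 * s)) (by linarith) ?_
        (continuous_pderiv h1 i) (hasCompactSupport_pderiv h2 i)
      have := (PiLp.proj (𝕜 := ℝ) 2 (fun _ : Fin (n + 1) => ℂ) i).comp_memLp' h.weightedH1.memLp_grad
      refine (memLp_congr_ae ?_).1 this
      filter_upwards [ae_mem_upperHalf] with x hx
      have hy : 0 < x (Fin.last n) := hx
      simp only [Function.comp_apply, PiLp.proj_apply, PiLp.smul_apply]
      rw [smul_smul, ← Real.rpow_add hy]
      congr 2; ring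
    refine (integrable_finsetSum Finset.univ fun i _ => hGi i).congr
      (Eventually.of_forall fun x => ?_)
    simp only [Finset.smul_sum, smul_comm (pderiv _ η x)]
  have i2 : Integrable (fun x => η x • f x) (halfMeasure n) := by
    refine integrable_smul_of_memLp_weight (a := 2 * s - 1) (by linarith) h.rhs_memLp
      h1.continuous h2
  have i3 : Integrable fun x' => η (bdryPt x') • (V x' * g x') := by
    have := (h.trace.locallyIntegrable.integrable_smul_left_of_hasCompactSupport
      (h1.continuous.comp continuous_bdryPt) hb).mul_of_top_right h.potential
    refine this.congr (Eventually.of_forall fun x' => ?_)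
    simp only [Pi.mul_apply, Function.comp_apply]
    exact mul_smul_comm _ _ _
  rw [map_sub, map_neg, ← L.integral_comp_comm i1, ← L.integral_comp_comm i2,
    ← L.integral_comp_comm i3] at e
  simp only [map_smul, smul_eq_mul] at e
  simp only [inner_gradient_mapEu]
  exact e

/-- The test functions are real, so a real linear functional commutes with both sides once the
integrals are known to converge. -/
theorem IsWeakGradient.real_part (ha' : a < 1) {u : Eu n → ℂ}
    {G : Eu n → EuclideanSpace ℂ (Fin (n + 1))} (hw : IsWeakGradient u G)
    (hu : MemLp (fun x => (x (Fin.last n) ^ (a / 2)) • u x) 2 (halfMeasure n))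
    (hG : MemLp (fun x => (x (Fin.last n) ^ (a / 2)) • G x) 2 (halfMeasure n)) (L : ℂ →L[ℝ] ℝ) :
    IsRealWeakGradient (fun x => L (u x)) fun x => mapEu L (G x) := by
  intro η h1 h2 h3 i
  have e := congrArg L (hw η h1 h2 h3 i)
  have hGi : MemLp (fun x => (x (Fin.last n) ^ (a / 2)) • G x i) 2 (halfMeasure n) :=
    (PiLp.proj (𝕜 := ℝ) 2 (fun _ : Fin (n + 1) => ℂ) i).comp_memLp' hG
  rw [map_neg, ← L.integral_comp_comm (integrable_smul_of_memLp_weight ha' hu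
    (continuous_pderiv h1 i) (hasCompactSupport_pderiv h2 i)),
    ← L.integral_comp_comm (integrable_smul_of_memLp_weight ha' hGi h1.continuous h2)] at e
  simp only [map_smul, smul_eq_mul] at e
  exact e

/-- The Carleman estimate for the real or imaginary part. -/
theorem carleman_real_part {s α : ℝ} (hs0 : 0 < s) (hs1 : s < 1) (hα : 1 ≤ α) :
    ∃ C : ℝ, 0 < C ∧ ∀ τ R : ℝ, Real.exp α ≤ τ → 1 ≤ R → ∀ (u : Eu n → ℂ)
      (G : Eu n → EuclideanSpace ℂ (Fin (n + 1))) (g : EuclideanSpace ℝ (Fin n) → ℂ)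
      (f : Eu n → ℂ) (V : EuclideanSpace ℝ (Fin n) → ℂ), IsAnnularSolution s R u G g f V →
      MemLp (fun x => (Real.exp (τ * ‖x‖ ^ α) * x (Fin.last n) ^ ((2 * s - 1) / 2) * ‖x‖) • f x) 2
        (halfMeasure n) →
      MemLp (fun x' => (Real.exp (τ * ‖x'‖ ^ α) * ‖x'‖ ^ (α + (1 - α) * s)) • (V x' * g x')) 2
        volume →
      ∀ L : ℂ →L[ℝ] ℝ, (∀ z, |L z| ≤ ‖z‖) →
      τ ^ 3 * ∫ x, L ((Real.exp (τ * ‖x‖ ^ α) * ‖x‖ ^ (3 * α / 2 - 1)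
            * x (Fin.last n) ^ ((1 - 2 * s) / 2)) • u x) ^ 2 ∂(halfMeasure n)
          + τ * ∫ x, ‖mapEu L ((Real.exp (τ * ‖x‖ ^ α) * ‖x‖ ^ (α / 2)
            * x (Fin.last n) ^ ((1 - 2 * s) / 2)) • G x)‖ ^ 2 ∂(halfMeasure n)
        ≤ C * (∫ x, L ((Real.exp (τ * ‖x‖ ^ α) * x (Fin.last n) ^ ((2 * s - 1) / 2) * ‖x‖) • f x) ^ 2
            ∂(halfMeasure n) + τ ^ (2 - 2 * s) * ∫ x', L ((Real.exp (τ * ‖x'‖ ^ α)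
            * ‖x'‖ ^ (α + (1 - α) * s)) • (V x' * g x')) ^ 2) := by
  obtain ⟨C, hC, key⟩ := real_carleman (n := n) (a := 1 - 2 * s) (by linarith) (by linarith) hα
  refine ⟨C, hC, fun τ R hτ hR u G g f V h hf hh L hL => ?_⟩
  obtain ⟨hus, hGs, hhs⟩ := h.grad_support hs0
  have pf : ∀ᵐ x ∂(halfMeasure n), L ((Real.exp (τ * ‖x‖ ^ α)
      * x (Fin.last n) ^ ((2 * s - 1) / 2) * ‖x‖) • f x)
      = Real.exp (τ * rexp α x) * (x (Fin.last n) ^ ((1 - 2 * s) / 2))⁻¹ * ‖x‖ * L (f x) := by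
    filter_upwards [ae_mem_upperHalf] with x hx
    have hy : 0 < x (Fin.last n) := hx
    rw [map_smul, smul_eq_mul, norm_rpow_eq_rexp (ne_zero_of_mem_upperHalf hx), ← Real.rpow_neg hy.le]
    congr 4; ring
  have ph : ∀ᵐ x', L ((Real.exp (τ * ‖x'‖ ^ α) * ‖x'‖ ^ (α + (1 - α) * s)) • (V x' * g x'))
      = Real.exp (τ * rexp α (bdryPt x'))
        * rexp (α * (1 - (1 - (1 - 2 * s)) / 2) + (1 - (1 - 2 * s)) / 2) (bdryPt x')
        * L (V x' * g x') := by
    filter_upwards [hhs] with x' hx'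
    by_cases h0 : V x' * g x' = 0
    · simp [h0]
    · have h1 : bdryPt x' ≠ 0 := by
        rw [← norm_pos_iff, norm_bdryPt]
        linarith [(hx' h0).1]
      rw [map_smul, smul_eq_mul, ← norm_bdryPt, norm_rpow_eq_rexp h1, norm_rpow_eq_rexp h1]
      congr 3; ring
  have pu : ∀ᵐ x ∂(halfMeasure n), L ((Real.exp (τ * ‖x‖ ^ α) * ‖x‖ ^ (3 * α / 2 - 1)
      * x (Fin.last n) ^ ((1 - 2 * s) / 2)) • u x) = Real.exp (τ * rexp α x)
        * rexp (3 * α / 2 - 1) x * x (Fin.last n) ^ ((1 - 2 * s) / 2) * L (u x) := by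
    filter_upwards [ae_mem_upperHalf] with x hx
    have hx0 := ne_zero_of_mem_upperHalf hx
    rw [map_smul, smul_eq_mul, norm_rpow_eq_rexp hx0, norm_rpow_eq_rexp hx0]
  have pG : ∀ᵐ x ∂(halfMeasure n), ‖mapEu L ((Real.exp (τ * ‖x‖ ^ α) * ‖x‖ ^ (α / 2)
      * x (Fin.last n) ^ ((1 - 2 * s) / 2)) • G x)‖ = Real.exp (τ * rexp α x)
        * rexp (α / 2) x * x (Fin.last n) ^ ((1 - 2 * s) / 2) * ‖mapEu L (G x)‖ := by
    filter_upwards [ae_mem_upperHalf] with x hx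
    have hx0 := ne_zero_of_mem_upperHalf hx
    have hy : 0 < x (Fin.last n) := hx
    rw [mapEu_smul, norm_smul, norm_rpow_eq_rexp hx0, norm_rpow_eq_rexp hx0, Real.norm_of_nonneg]
    have := rexp_pos (α / 2) x
    positivity
  have hu := MemLp.clm_comp hL h.weightedH1.memLp
  have hG := MemLp.mapEu_comp hL h.weightedH1.memLp_grad
  simp only [map_smul] at hu
  simp only [mapEu_smul] at hG
  have fin := key τ R hτ hR (fun x => L (u x)) (fun x => L (f x)) (fun x => mapEu L (G x))
    (fun x' => L (V x' * g x')) hu hG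
    (by
      filter_upwards [hus] with x hx h0
      exact hx fun h1 => h0 (by rw [h1, map_zero]))
    (by
      filter_upwards [hGs] with x hx h0
      refine hx fun h1 => h0 ?_
      have := mapEu_smul (n := n) L 0 (G x)
      rw [zero_smul, zero_smul] at this
      rw [h1, this])
    (h.weightedH1.weakGradient.real_part (a := 1 - 2 * s) (by linarith) h.weightedH1.memLp
      h.weightedH1.memLp_grad L)
    ((memLp_congr_ae pf).1 (MemLp.clm_comp hL hf))
    ((memLp_congr_ae ph).1 (MemLp.clm_comp hL hh))
    (by
      filter_upwards [hhs] with x' hx' h0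
      obtain ⟨h1, h2⟩ := hx' fun h1 => h0 (by rw [h1, map_zero])
      exact ⟨Real.log_nonneg h1, Real.log_le_log (by linarith) h2⟩)
    (fun η hη => h.real_equation hs1 L hη.contDiff hη.compact)
  rw [integral_congr_ae (pu.mono fun x hx => congrArg (· ^ 2) hx),
    integral_congr_ae (pG.mono fun x hx => congrArg (· ^ 2) hx),
    integral_congr_ae (pf.mono fun x hx => congrArg (· ^ 2) hx),
    integral_congr_ae (ph.mono fun x hx => congrArg (· ^ 2) hx)]
  have e : (2 : ℝ) - (1 - (1 - 2 * s)) = 2 - 2 * s := by ring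
  rw [e] at fin
  exact fin

/-- The Carleman estimate with boundary weight `|x|^{α+(1-α)s}`. -/
theorem carleman_estimate {s α : ℝ} (hs0 : 0 < s) (hs1 : s < 1) (hα : 1 ≤ α) :
    ∃ C : ℝ, 1 < C ∧ ∀ τ R : ℝ, Real.exp α ≤ τ → 1 ≤ R → ∀ (u : Eu n → ℂ)
      (G : Eu n → EuclideanSpace ℂ (Fin (n + 1))) (g : EuclideanSpace ℝ (Fin n) → ℂ)
      (f : Eu n → ℂ) (V : EuclideanSpace ℝ (Fin n) → ℂ), IsAnnularSolution s R u G g f V →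
      carlemanLHS s α τ u G ≤ ENNReal.ofReal C * (carlemanBulk s α τ f
        + carlemanBdry s α τ (α + (1 - α) * s) V g) := by
  obtain ⟨C, hC, key⟩ := carleman_real_part (n := n) hs0 hs1 hα
  refine ⟨C + 1, by linarith, fun τ R hτ hR u G g f V h => ?_⟩
  have hτ0 : 0 < τ := (Real.exp_pos _).trans_le hτ
  obtain ⟨hus, hGs, hhs⟩ := h.grad_support hs0
  set f' : Eu n → ℂ := fun x =>
    (Real.exp (τ * ‖x‖ ^ α) * x (Fin.last n) ^ ((2 * s - 1) / 2) * ‖x‖) • f x with hf'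
  set h' : EuclideanSpace ℝ (Fin n) → ℂ := fun x' =>
    (Real.exp (τ * ‖x'‖ ^ α) * ‖x'‖ ^ (α + (1 - α) * s)) • (V x' * g x') with hh'
  have hfm : AEStronglyMeasurable f' (halfMeasure n) := by
    have hm : Measurable fun x : Eu n => Real.exp (τ * ‖x‖ ^ α) * ‖x‖ :=
      ((measurable_norm.pow_const α).const_mul τ).exp.mul measurable_norm
    refine (hm.aestronglyMeasurable.smul h.rhs_memLp.1).congr (Eventually.of_forall fun x => ?_)
    simp only [hf', Pi.smul_apply', smul_smul]
    congr 1; ring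
  have hhm : AEStronglyMeasurable h' volume := by
    have hm : Measurable fun x : EuclideanSpace ℝ (Fin n) =>
        Real.exp (τ * ‖x‖ ^ α) * ‖x‖ ^ (α + (1 - α) * s) :=
      ((measurable_norm.pow_const α).const_mul τ).exp.mul (measurable_norm.pow_const _)
    exact hm.aestronglyMeasurable.smul (h.potential.1.mul h.trace.locallyIntegrable.aestronglyMeasurable)
  have hC0 : ENNReal.ofReal (C + 1) ≠ 0 := (ENNReal.ofReal_pos.2 (by linarith)).ne'
  have hτ2 : ENNReal.ofReal (τ ^ (2 - 2 * s)) ≠ 0 :=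
    (ENNReal.ofReal_pos.2 (Real.rpow_pos_of_pos hτ0 _)).ne'
  -- If one of the norms on the right is infinite there is nothing to prove; otherwise all norms are
  -- square roots of real integrals.
  by_cases hft : eLpNorm f' 2 (halfMeasure n) = ⊤
  · have : carlemanBulk s α τ f = ⊤ := by
      change eLpNorm f' 2 (halfMeasure n) ^ 2 = ⊤
      rw [hft]; simp
    rw [this, top_add, ENNReal.mul_top hC0]
    exact le_top
  by_cases hht : eLpNorm h' 2 volume = ⊤
  · have : carlemanBdry s α τ (α + (1 - α) * s) V g = ⊤ := by
      change ENNReal.ofReal (τ ^ (2 - 2 * s)) * eLpNorm h' 2 volume ^ 2 = ⊤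
      rw [hht]; simp [ENNReal.mul_top hτ2]
    rw [this, add_top, ENNReal.mul_top hC0]
    exact le_top
  have hfL : MemLp f' 2 (halfMeasure n) := ⟨hfm, lt_top_iff_ne_top.2 hft⟩
  have hhL : MemLp h' 2 volume := ⟨hhm, lt_top_iff_ne_top.2 hht⟩
  have huL := memLp_carleman_weight (a := 1 - 2 * s) hτ0.le (by linarith : 0 ≤ α)
    h.weightedH1.memLp hus (3 * α / 2 - 1)
  have hGL := memLp_carleman_weight (a := 1 - 2 * s) hτ0.le (by linarith : 0 ≤ α)
    h.weightedH1.memLp_grad hGs (α / 2)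
  -- All terms are squared norms, so the estimates for real and imaginary parts add up to the
  -- complex one with the same constant.
  have r1 := key τ R hτ hR u G g f V h hfL hhL Complex.reCLM abs_reCLM_le
  have r2 := key τ R hτ hR u G g f V h hfL hhL Complex.imCLM abs_imCLM_le
  have eu := integral_norm_sq_complex huL
  have eG := integral_norm_sq_euclidean hGL
  have ef := integral_norm_sq_complex hfL
  have eh := integral_norm_sq_complex hhL
  have hτs := Real.rpow_nonneg hτ0.le (2 - 2 * s)
  have hfI : 0 ≤ ∫ x, ‖f' x‖ ^ 2 ∂(halfMeasure n) := integral_nonneg fun _ => sq_nonneg _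
  have hhI : 0 ≤ ∫ x, ‖h' x‖ ^ 2 := integral_nonneg fun _ => sq_nonneg _
  have e1 : carlemanBulk s α τ f + carlemanBdry s α τ (α + (1 - α) * s) V g
      = ENNReal.ofReal (∫ x, ‖f' x‖ ^ 2 ∂(halfMeasure n) + τ ^ (2 - 2 * s) * ∫ x, ‖h' x‖ ^ 2) := by
    change eLpNorm f' 2 (halfMeasure n) ^ 2
      + ENNReal.ofReal (τ ^ (2 - 2 * s)) * eLpNorm h' 2 volume ^ 2 = _
    rw [eLpNorm_two_sq_eq_ofReal hfL, eLpNorm_two_sq_eq_ofReal hhL, ← ENNReal.ofReal_mul hτs,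
      ← ENNReal.ofReal_add hfI (mul_nonneg hτs hhI)]
  rw [e1, carlemanLHS, eLpNorm_two_sq_eq_ofReal huL, eLpNorm_two_sq_eq_ofReal hGL,
    ← ENNReal.ofReal_mul (by positivity), ← ENNReal.ofReal_mul (by positivity),
    ← ENNReal.ofReal_add (mul_nonneg (by positivity) (integral_nonneg fun _ => sq_nonneg _))
      (mul_nonneg (by positivity) (integral_nonneg fun _ => sq_nonneg _)),
    ← ENNReal.ofReal_mul (by linarith)]
  refine ENNReal.ofReal_le_ofReal ?_
  have hN : 0 ≤ ∫ x, ‖f' x‖ ^ 2 ∂(halfMeasure n) + τ ^ (2 - 2 * s) * ∫ x, ‖h' x‖ ^ 2 :=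
    add_nonneg hfI (mul_nonneg hτs hhI)
  rw [add_mul, one_mul]
  refine le_trans ?_ (le_add_of_nonneg_right hN)
  rw [eu, eG, ef, eh]
  simp only [hf', hh']
  linear_combination r1 + r2

/-- Comparison of the two boundary weights. -/
theorem IsAnnularSolution.carlemanBdry_le {s R α τ : ℝ} (hs0 : 0 < s) (hα : 0 ≤ α)
    {u : Eu n → ℂ} {G : Eu n → EuclideanSpace ℂ (Fin (n + 1))} {g : EuclideanSpace ℝ (Fin n) → ℂ}
    {f : Eu n → ℂ} {V : EuclideanSpace ℝ (Fin n) → ℂ} (h : IsAnnularSolution s R u G g f V) (κ : ℝ) :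
    carlemanBdry s α τ (α + κ) V g ≤ ENNReal.ofReal (R ^ α) ^ 2 * carlemanBdry s α τ κ V g := by
  obtain ⟨-, -, hhs⟩ := h.grad_support hs0
  have key := eLpNorm_le_mul_eLpNorm_of_ae_le_mul (μ := volume) (c := R ^ α)
    (f := fun x' : EuclideanSpace ℝ (Fin n) => (Real.exp (τ * ‖x'‖ ^ α) * ‖x'‖ ^ (α + κ)) • (V x' * g x'))
    (g := fun x' : EuclideanSpace ℝ (Fin n) => (Real.exp (τ * ‖x'‖ ^ α) * ‖x'‖ ^ κ) • (V x' * g x')) (by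
      filter_upwards [hhs] with x' hx'
      by_cases h0 : V x' * g x' = 0
      · simp [h0]
      · obtain ⟨h1, h2⟩ := hx' h0
        have h3 : 0 < ‖x'‖ := by linarith
        rw [norm_smul, norm_smul, Real.norm_of_nonneg (by positivity),
          Real.norm_of_nonneg (by positivity), Real.rpow_add h3]
        calc Real.exp (τ * ‖x'‖ ^ α) * (‖x'‖ ^ α * ‖x'‖ ^ κ) * ‖V x' * g x'‖
            = ‖x'‖ ^ α * (Real.exp (τ * ‖x'‖ ^ α) * ‖x'‖ ^ κ * ‖V x' * g x'‖) := by ring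
          _ ≤ _ := mul_le_mul_of_nonneg_right (Real.rpow_le_rpow h3.le h2 hα) (by positivity)) 2
  rw [carlemanBdry, carlemanBdry, mul_left_comm, ← mul_pow]
  exact mul_le_mul_right (pow_le_pow_left' key 2) _

end ComplexCarleman

/-! ### Both estimates -/

theorem mainTheorem5 (n : ℕ) (hn : 1 ≤ n) (s : ℝ) (hs0 : 0 < s) (hs1 : s < 1)
    (α : ℝ) (hα : 1 ≤ α) :
    ∃ τ₀ : ℝ, 1 < τ₀ ∧
      -- the estimate with boundary weight `|x|^{(1-α)s}`, with a constant depending on `n, s, α, R`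
      (∀ R : ℝ, 1 < R → ∃ C : ℝ, 1 < C ∧
        ∀ (u : EuclideanSpace ℝ (Fin (n + 1)) → ℂ)
          (G : EuclideanSpace ℝ (Fin (n + 1)) → EuclideanSpace ℂ (Fin (n + 1)))
          (g : EuclideanSpace ℝ (Fin n) → ℂ) (f : EuclideanSpace ℝ (Fin (n + 1)) → ℂ)
          (V : EuclideanSpace ℝ (Fin n) → ℂ),
          IsAnnularSolution s R u G g f V → ∀ τ : ℝ, τ₀ ≤ τ →
            carlemanLHS s α τ u G ≤
              ENNReal.ofReal C * (carlemanBulk s α τ f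
                + carlemanBdry s α τ ((1 - α) * s) V g)) ∧
      -- the estimate with boundary weight `|x|^{α+(1-α)s}`, with a constant independent of `R`
      (∃ C : ℝ, 1 < C ∧ ∀ R : ℝ, 1 < R →
        ∀ (u : EuclideanSpace ℝ (Fin (n + 1)) → ℂ)
          (G : EuclideanSpace ℝ (Fin (n + 1)) → EuclideanSpace ℂ (Fin (n + 1)))
          (g : EuclideanSpace ℝ (Fin n) → ℂ) (f : EuclideanSpace ℝ (Fin (n + 1)) → ℂ)
          (V : EuclideanSpace ℝ (Fin n) → ℂ),
          IsAnnularSolution s R u G g f V → ∀ τ : ℝ, τ₀ ≤ τ →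
            carlemanLHS s α τ u G ≤
              ENNReal.ofReal C * (carlemanBulk s α τ f
                + carlemanBdry s α τ (α + (1 - α) * s) V g)) := by
  obtain ⟨C, hC, key⟩ := carleman_estimate (n := n) hs0 hs1 hα
  -- The threshold e^α is what absorbs the lower order terms on a shell beginning at t = -1; it
  -- depends on α only.
  refine ⟨Real.exp α, Real.one_lt_exp_iff.2 (by linarith), fun R hR => ?_, C, hC,
    fun R hR u G g f V h τ hτ => key τ R hτ hR.le u G g f V h⟩
  have hRα : 1 ≤ R ^ α := Real.one_le_rpow hR.le (by linarith)
  have hR2 : 1 ≤ (R ^ α) ^ 2 := one_le_pow₀ hRα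
  -- On the support |x|^α ≤ R^α, so passing to the smaller boundary weight costs (R^α)² in the
  -- squared norm.
  refine ⟨C * (R ^ α) ^ 2, by nlinarith, fun u G g f V h τ hτ => ?_⟩
  refine (key τ R hτ hR.le u G g f V h).trans ?_
  rw [ENNReal.ofReal_mul (by linarith), mul_assoc, ENNReal.ofReal_pow (by linarith)]
  refine mul_le_mul_right ?_ _
  rw [mul_add]
  refine add_le_add (le_mul_of_one_le_left zero_le ?_)
    (h.carlemanBdry_le hs0 (by linarith) _)
  rw [← ENNReal.ofReal_pow (by linarith)]
  exact ENNReal.one_le_ofReal.2 hR2
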